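/- Setting. Let $\mathcal M$ be a (nonempty) smooth complex curve with a smooth foliation $\mathcal F$ of real codimension one and let $\mathcal U$ be a transversal basis of $\mathcal F$: a family of transversal sections such that for every transversal section $U'$ and $p\in U'$ there is a holonomy embedding $h:U\hookrightarrow U'$ with $U\in\mathcal U$, $p\in h(U)$. Let $V=\coprod_{n\in\mathbb Z}V_{(n)}$ be a grading-restricted vertex algebra over $\mathbb C$ and $W=\coprod_{n\in\mathbb Z}W_{(n)}$ a $\mathbb Z$-graded $V$-module with $\dim W_{(n)}<\infty$, $W_{(n)}=0$ for $n\ll0$, on which $L_W(0)$ is the grading operator and $L_W(-1)$ has weight one. Put $W'=\coprod W_{(n)}^*$, $\overline W=\prod W_{(n)}$, $P_n:\overline W\to W_{(n)}$, $F_n\mathbb C=\{z\in\mathbb C^n: z_i\ne z_j\}$, and $Y^W_{WV}(w,z)v=e^{zL_W(-1)}Y_W(v,-z)w$. $R(\cdot)$ denotes the rational function extending a convergent series, and $E(\cdot)$ the $\overline V$- or $\overline W$-valued function whose matrix elements are these. Cochains. For $n\ge1$, $m\ge0$, $C^n_m(V,\mathcal W,\mathcal F)$ is the space of linear maps $\Phi$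 from $V^{\otimes n}$ to functions $F_n\mathbb C\to\overline W$ such that the matrix elements $\langle w',\Phi(v_1,z_1;\dots;v_n,z_n)\rangle$ are rational with poles at most at $z_i=z_j$; $\Phi$ has the $L(-1)$-derivative property ($\partial_{z_i}\langle w',\Phi\rangle=\langle w',\Phi(\dots;L_V(-1)v_i,z_i;\dots)\rangle$ and $\sum_i\partial_{z_i}\langle w',\Phi\rangle=\langle w',L_W(-1)\Phi\rangle$), the $L(0)$-conjugation property ($t^{L_W(0)}\Phi(v_1,z_1;\dots)=\Phi(t^{L(0)}v_1,tz_1;\dots)$, $t\neq 0$), its signed sums over inverses of $(s,n-s)$-shuffles vanish for $1\le s\le n-1$; and for every chain $U_1\hookrightarrow\dots\hookrightarrow U_m$ of holonomy embeddings between members of $\mathcal U$ and every $U_j$ in it, $\Phi$ is composable with $m$ vertex operators, the parameters $z$ being local coordinates $c(p)$ of points on the sections $U_i$ (vertex operators) and $U_j$ (arguments of $\Phi$; any member of $\mathcal U$ if $m=0$). Composability means that there are integers $N(u,v)$ depending only on pairs of vectors with: (1) for $l_1+\dots+l_n=m+n$, $l_i\ge1$, with $\Xi_i=E(Y_V(\cdot,\cdot-\zeta_i)\cdots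 Y_V(\cdot,\cdot-\zeta_i)\mathbf 1)$ the product over the $i$-th block of $l_i$ vectors and points, $\sum_{r_1,\dots,r_n}\langle w',\Phi(P_{r_1}\Xi_1,\zeta_1;\dots;P_{r_n}\Xi_n,\zeta_n)\rangle$ converges absolutely when $|z_a-\zeta_i|+|z_b-\zeta_j|<|\zeta_i-\zeta_j|$ for all $i\ne j$, $a$ in block $i$, $b$ in block $j$, to a rational function of $z$ independent of $\zeta$; (2) $\sum_q\langle w',E(Y_W(v_1,z_1)\cdots Y_W(v_m,z_m)P_q\Phi(v_{m+1},z_{m+1};\dots;v_{m+n},z_{m+n}))\rangle$ converges absolutely for distinct $z$'s with $|z_i|>|z_k|>0$ ($i\le m<k$) to a rational function; in both cases the only possible poles are at $z_a=z_b$, of order bounded in terms of $N(v_a,v_b),N(v_b,v_a)$. $C^2_{ex}(V,\mathcal W,\mathcal F)\subset C^2_0(V,\mathcal W,\mathcal F)$ consists of those $\Phi$ such that for all $v_1,v_2,v_3\in V$, $w'\in W'$, $\zeta\in\mathbb C$ the series $$G_1=\sum_{r}\Big(\langle w',e^{\zeta L_W(-1)}Y_W(v_1,z_1-\zeta)P_r\Phi(v_2,z_2-\zeta;v_3,z_3-\zeta)\rangle+\langle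 w',\Phi(v_1,z_1;P_rE(Y_V(v_2,z_2-\zeta)Y_V(v_3,z_3-\zeta)\mathbf 1),\zeta)\rangle\Big),$$ $$G_2=\sum_{r}\Big(\langle w',\Phi(P_rE(Y_V(v_1,z_1-\zeta)Y_V(v_2,z_2-\zeta)\mathbf 1),\zeta;v_3,z_3)\rangle+\langle w',e^{\zeta L_W(-1)}Y_W(v_3,z_3-\zeta)P_r\Phi(v_1,z_1-\zeta;v_2,z_2-\zeta)\rangle\Big)$$ converge absolutely for $|z_1-\zeta|>|z_2-\zeta|,|z_3-\zeta|>0$, respectively $|z_3-\zeta|>|z_1-\zeta|,|z_2-\zeta|>0$ (distinct $z_i$, local coordinates of points on any $U\in\mathcal U$), to rational functions of $(z_1,z_2,z_3)$, independent of $\zeta$, with poles at most at $z_i=z_j$. Put $$\langle w',\delta^2_{ex}\Phi\rangle=R(G_1)-R(G_2),$$ $$\langle w',\delta^1_2\chi\rangle=R\langle w',Y_W(v_1,z_1)\chi(v_2,z_2)\rangle-R\langle w',\chi(Y_V(v_1,z_1-z_2)v_2,z_2)\rangle+R\langle w',Y_W(v_2,z_2)\chi(v_1,z_1)\rangle,$$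 for $\chi\in C^1_2(V,\mathcal W,\mathcal F)$, and $H^2_{ex}(V,\mathcal W,\mathcal F)=\ker\delta^2_{ex}/\delta^1_2C^1_2(V,\mathcal W,\mathcal F)$. Extensions. A square-zero extension $(V_W,\gamma,\alpha)$ of $V$ by $W$ is a grading-restricted vertex algebra $V_W$ with a surjective homomorphism $\gamma:V_W\to V$ such that $Y(x,z)y=0$ for $x,y\in\ker\gamma$, and an injective homomorphism of $V$-modules $\alpha$ of $W$ onto $\ker\gamma$; equivalence is isomorphism compatible with $\alpha$ and $\gamma$. A realization of it on $V\oplus W$ is a grading-preserving linear section $\Gamma:V\to V_W$ of $\gamma$ with $\Gamma(\mathbf 1_V)=\mathbf 1$, such that the component $\omega_\Psi(u,z)v\in W((z))$ defined by $Y(\Gamma u,z)\Gamma v=\Gamma(Y_V(u,z)v)+\alpha(\omega_\Psi(u,z)v)$ satisfies $\omega_\Psi(u,z)\mathbf 1_V=0$. Only square-zero extensions that have a realization are considered. Statement. (1) For every square-zero extension with realization $\Gamma$ there is exactly one $\Phi\in\ker\delta^2_{ex}$ with $$\Phi(v_1,z_1;v_2,z_2)=E(\omega_\Psi(v_1,z_1)Y_V(v_2,z_2)\mathbf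 1_V)=E(\omega_\Psi(v_2,z_2)Y_V(v_1,z_1)\mathbf 1_V)=E(Y^W_{WV}(\omega_\Psi(v_1,z_1-z_2)v_2,z_2)\mathbf 1_V).$$ (2) For every $\Phi\in\ker\delta^2_{ex}$, with $\langle w',\omega_\Psi(v_1,z)v_2\rangle=\langle w',\Phi(v_1,z;v_2,0)\rangle$, the formula $$Y_Z((v_1,w_1),z)(v_2,w_2)=\big(Y_V(v_1,z)v_2,\;Y_W(v_1,z)w_2+Y^W_{WV}(w_1,z)v_2+\omega_\Psi(v_1,z)v_2\big)$$ makes the graded space $Z=V\oplus W$, with the projection $p_1$ to $V$ and the inclusion $i_2$ of $W$, a square-zero extension of $V$ by $W$ that has a realization. (3) There is a bijection from the set of equivalence classes of square-zero extensions of $V$ by $W$ (that have a realization) to $H^2_{ex}(V,\mathcal W,\mathcal F)$ that sends the class of the extension in (1) to $[\Phi]$ and the class of the extension $Z$ in (2) to $[\Phi]$. (4) Two elements of $\ker\delta^2_{ex}$ differ by an element of $\delta^1_2C^1_2(V,\mathcal W,\mathcal F)$ if and only if the corresponding square-zero extensions in (2) are equivalent. -/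

import Mathlib

open scoped Manifold ContDiff Topology

universe u v

noncomputable section

/-! ### Codimension one foliations on complex curves -/

/-- A smooth foliation of real codimension one on a complex curve `M` (a real surface), given by
foliated charts `M ⇀ ℝ × ℝ`; the first coordinate runs along the plaques, the second one is
transverse. -/
structure CurveFoliation (M : Type*) [TopologicalSpace M] [ChartedSpace ℂ M] where
  /-- the foliated charts -/
  charts : Set (OpenPartialHomeomorph M (ℝ × ℝ))
  cover : ∀ p : M, ∃ φ ∈ charts, p ∈ φ.source
  smooth : ∀ φ ∈ charts, ∀ e ∈ atlas ℂ M,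
    ContDiffOn ℝ ∞ (e.symm.trans φ) (e.symm.trans φ).source
  smooth_symm : ∀ φ ∈ charts, ∀ e ∈ atlas ℂ M,
    ContDiffOn ℝ ∞ (φ.symm.trans e) (φ.symm.trans e).source
  /-- locally, two foliated charts have the same plaques -/
  compatible : ∀ φ ∈ charts, ∀ ψ ∈ charts, ∀ p ∈ φ.source ∩ ψ.source,
    ∃ O ∈ 𝓝 p, O ⊆ φ.source ∩ ψ.source ∧
      ∀ q ∈ O, ∀ r ∈ O, (φ q).2 = (φ r).2 ↔ (ψ q).2 = (ψ r).2

namespace CurveFoliation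

variable {M : Type*} [TopologicalSpace M] [ChartedSpace ℂ M]

/-- A path that stays inside one leaf: its transverse coordinates are locally constant. -/
def IsLeafwise (F : CurveFoliation M) (c : unitInterval → M) : Prop :=
  Continuous c ∧ ∀ φ ∈ F.charts, ∀ t, c t ∈ φ.source →
    ∀ᶠ s in 𝓝 t, (φ (c s)).2 = (φ (c t)).2

/-- A transversal section: an embedded one-dimensional submanifold everywhere transverse to the
leaves, i.e. locally the graph of a smooth function of the transverse coordinate. -/
def IsTransversal (F : CurveFoliation M) (U : Set M) : Prop :=
  ∀ p ∈ U, ∃ φ ∈ F.charts, ∃ O : Set M, IsOpen O ∧ p ∈ O ∧ O ⊆ φ.source ∧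
    ∃ (I : Set ℝ) (g : ℝ → ℝ), IsOpen I ∧ ContDiffOn ℝ ∞ g I ∧
      φ '' (U ∩ O) = (fun t => (g t, t)) '' I

/-- A holonomy embedding `h : U → U'`: an embedding obtained by transporting the points of `U`
along paths in the leaves that depend continuously on the point. -/
def IsHolonomyEmbedding (F : CurveFoliation M) (U U' : Set M) (h : U → U') : Prop :=
  Topology.IsEmbedding h ∧ ∃ H : unitInterval × U → M, Continuous H ∧
    (∀ x, H (0, x) = x) ∧ (∀ x, H (1, x) = h x) ∧ ∀ x, F.IsLeafwise (fun t => H (t, x))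

/-- A transversal basis: a family of transversal sections such that each transversal section `U'`
through a point `p` receives a holonomy embedding, with `p` in its image, from a member. -/
def IsTransversalBasis (F : CurveFoliation M) (𝒰 : Set (Set M)) : Prop :=
  (∀ U ∈ 𝒰, F.IsTransversal U) ∧
  ∀ U', F.IsTransversal U' → ∀ p ∈ U', ∃ U ∈ 𝒰, ∃ h : U → U',
    F.IsHolonomyEmbedding U U' h ∧ ∃ x, (h x : M) = p

end CurveFoliation

/-- The values `c(p)` of the local holomorphic coordinates `c` of `M` at the points `p` of `S`. -/
def coordValues {M : Type*} [TopologicalSpace M] [ChartedSpace ℂ M] (S : Set M) : Set ℂ :=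
  {z | ∃ p ∈ S, ∃ c ∈ IsManifold.maximalAtlas 𝓘(ℂ, ℂ) ω M, p ∈ c.source ∧ c p = z}

/-! ### Graded spaces, graded duals, completions -/

/-- A `ℤ`-grading with finite-dimensional pieces that vanish in sufficiently negative degrees. -/
structure Grading (W : Type*) [AddCommGroup W] [Module ℂ W] where
  /-- the homogeneous subspaces -/
  gr : ℤ → Submodule ℂ W
  internal : DirectSum.IsInternal gr
  finite : ∀ n, FiniteDimensional ℂ (gr n)
  bounded : ∃ N : ℤ, ∀ n < N, gr n = ⊥

namespace Grading

variable {W : Type*} [AddCommGroup W] [Module ℂ W]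

/-- The grading operator `L(0)`: multiplication by `n` on the subspace of degree `n`. -/
def L0 (G : Grading W) : W →ₗ[ℂ] W :=
  DirectSum.toModule ℂ ℤ W (fun n => (n : ℂ) • (G.gr n).subtype) ∘ₗ
    (LinearEquiv.ofBijective (DirectSum.coeLinearMap G.gr) G.internal).symm.toLinearMap

/-- The graded dual `W' = ∐ W_(n)^*`: functionals that vanish on almost all `W_(n)`. -/
def gradedDual (G : Grading W) : Set (Module.Dual ℂ W) :=
  {w' | {n : ℤ | ∃ w ∈ G.gr n, w' w ≠ 0}.Finite}

/-- The algebraic completion `∏ W_(n)`; the projection `P_n` is evaluation at `n`. -/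
abbrev Completion (G : Grading W) : Type _ := ∀ n : ℤ, G.gr n

/-- The pairing of `W'` with the completion (a finite sum for `w'` in the graded dual). -/
def pairing (G : Grading W) (w' : Module.Dual ℂ W) (x : G.Completion) : ℂ :=
  ∑ᶠ n, w' (x n : W)

end Grading

/-! ### Grading-restricted vertex algebras and their modules -/

/-- The three series `∑ S₁ m n z₁^{-m-1} z₂^{-n-1}`, `∑ S₂ m n z₁^{-m-1} z₂^{-n-1}` and
`∑ S₃ m n (z₁-z₂)^{-m-1} z₂^{-n-1}` converge absolutely for `|z₁|>|z₂|>0`, `|z₂|>|z₁|>0` and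
`|z₂|>|z₁-z₂|>0` to a common rational function, with poles at most at `z₁=0`, `z₂=0`, `z₁=z₂`. -/
def CommonRational (S₁ S₂ S₃ : ℤ → ℤ → ℂ) : Prop :=
  ∃ (P : MvPolynomial (Fin 2) ℂ) (a b c : ℕ), ∀ z₁ z₂ : ℂ,
    (‖z₂‖ < ‖z₁‖ → 0 < ‖z₂‖ →
      HasSum (fun p : ℤ × ℤ => S₁ p.1 p.2 * z₁ ^ (-p.1 - 1) * z₂ ^ (-p.2 - 1))
        (MvPolynomial.eval ![z₁, z₂] P / (z₁ ^ a * z₂ ^ b * (z₁ - z₂) ^ c))) ∧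
    (‖z₁‖ < ‖z₂‖ → 0 < ‖z₁‖ →
      HasSum (fun p : ℤ × ℤ => S₂ p.1 p.2 * z₁ ^ (-p.1 - 1) * z₂ ^ (-p.2 - 1))
        (MvPolynomial.eval ![z₁, z₂] P / (z₁ ^ a * z₂ ^ b * (z₁ - z₂) ^ c))) ∧
    (‖z₁ - z₂‖ < ‖z₂‖ → 0 < ‖z₁ - z₂‖ →
      HasSum (fun p : ℤ × ℤ => S₃ p.1 p.2 * (z₁ - z₂) ^ (-p.1 - 1) * z₂ ^ (-p.2 - 1))
        (MvPolynomial.eval ![z₁, z₂] P / (z₁ ^ a * z₂ ^ b * (z₁ - z₂) ^ c)))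

/-- A grading-restricted vertex algebra; `mode n u v` is `u(n)v`, the coefficient of `z^{-n-1}`
in `Y(u, z)v`. -/
structure GRVertexAlgebra (V : Type*) [AddCommGroup V] [Module ℂ V] extends Grading V where
  /-- the components of the vertex operators -/
  mode : ℤ → V →ₗ[ℂ] V →ₗ[ℂ] V
  /-- the vacuum -/
  one : V
  lower_truncation : ∀ u v, ∃ N : ℤ, ∀ n ≥ N, mode n u v = 0
  identity : ∀ n v, mode n one v = if n = -1 then v else 0
  creation : ∀ u, (∀ n ≥ 0, mode n u one = 0) ∧ mode (-1) u one = u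
  duality : ∀ u₁ u₂ v, ∀ v' ∈ toGrading.gradedDual,
    CommonRational (fun m n => v' (mode m u₁ (mode n u₂ v)))
      (fun m n => v' (mode n u₂ (mode m u₁ v))) (fun m n => v' (mode n (mode m u₁ u₂) v))
  L0_bracket : ∀ n u v, toGrading.L0 (mode n u v) - mode n u (toGrading.L0 v) =
    mode n (toGrading.L0 u) v + (-(n : ℂ) - 1) • mode n u v
  /-- `Y(L(-1)u, z) = (d/dz) Y(u, z)`, with `L(-1)u = u(-2)1` -/
  Lm1_derivative : ∀ n u v, mode n (mode (-2) u one) v = (-(n : ℂ)) • mode (n - 1) u v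
  /-- `[L(-1), Y(u, z)] = (d/dz) Y(u, z)` -/
  Lm1_bracket : ∀ n u v, mode (-2) (mode n u v) one - mode n u (mode (-2) v one) =
    (-(n : ℂ)) • mode (n - 1) u v

namespace GRVertexAlgebra

variable {V : Type*} [AddCommGroup V] [Module ℂ V]

/-- `L(-1)v = Res_z z^{-2} Y(v, z)1 = v(-2)1`. -/
def Lm1 (A : GRVertexAlgebra V) : V →ₗ[ℂ] V := (A.mode (-2)).flip A.one

/-- Homomorphisms of grading-restricted vertex algebras. -/
structure IsHom {V' : Type*} [AddCommGroup V'] [Module ℂ V'] (A : GRVertexAlgebra V)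
    (B : GRVertexAlgebra V') (f : V →ₗ[ℂ] V') : Prop where
  map_gr : ∀ n, ∀ x ∈ A.gr n, f x ∈ B.gr n
  map_one : f A.one = B.one
  map_mode : ∀ n x y, f (A.mode n x y) = B.mode n (f x) (f y)

end GRVertexAlgebra

/-- A `ℤ`-graded grading-restricted module on which `L_W(0)` is the grading operator. -/
structure GRModule {V : Type*} [AddCommGroup V] [Module ℂ V] (A : GRVertexAlgebra V)
    (W : Type*) [AddCommGroup W] [Module ℂ W] extends Grading W where
  /-- the components of the vertex operators: `mode n u w` is the coefficient of `z^{-n-1}` in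
  `Y_W(u, z)w` -/
  mode : ℤ → V →ₗ[ℂ] W →ₗ[ℂ] W
  /-- the operator `L_W(-1)` -/
  Lm1 : W →ₗ[ℂ] W
  Lm1_weight : ∀ n, ∀ w ∈ gr n, Lm1 w ∈ gr (n + 1)
  lower_truncation : ∀ u w, ∃ N : ℤ, ∀ n ≥ N, mode n u w = 0
  identity : ∀ n w, mode n A.one w = if n = -1 then w else 0
  duality : ∀ u₁ u₂ w, ∀ w' ∈ toGrading.gradedDual,
    CommonRational (fun m n => w' (mode m u₁ (mode n u₂ w)))
      (fun m n => w' (mode n u₂ (mode m u₁ w))) (fun m n => w' (mode n (A.mode m u₁ u₂) w))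
  L0_bracket : ∀ n u w, toGrading.L0 (mode n u w) - mode n u (toGrading.L0 w) =
    mode n (A.L0 u) w + (-(n : ℂ) - 1) • mode n u w
  Lm1_derivative : ∀ n u w, mode n (A.Lm1 u) w = (-(n : ℂ)) • mode (n - 1) u w
  Lm1_bracket : ∀ n u w, Lm1 (mode n u w) - mode n u (Lm1 w) = (-(n : ℂ)) • mode (n - 1) u w

/-! ### Rational extensions and the elements `E(Y(v₁,z₁)⋯Y(v_l,z_l)w)` -/

/-- The value at `z` of the rational function that extends `f` from the region `D`
(`0` if there is no such rational function regular at `z`). -/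
def ratExt {ι : Type*} (D : Set (ι → ℂ)) (f : (ι → ℂ) → ℂ) (z : ι → ℂ) : ℂ :=
  open Classical in
  if h : ∃ c : ℂ, ∃ P Q : MvPolynomial ι ℂ, MvPolynomial.eval z Q ≠ 0 ∧
      c = MvPolynomial.eval z P / MvPolynomial.eval z Q ∧
      ∀ x ∈ D, MvPolynomial.eval x Q * f x = MvPolynomial.eval x P
  then h.choose else 0

section Elements

variable {V : Type*} [AddCommGroup V] [Module ℂ V] {W : Type*} [AddCommGroup W] [Module ℂ W]

/-- `v₁(k₁) ⋯ v_l(k_l) w`. -/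
def iterMode (mode : ℤ → V →ₗ[ℂ] W →ₗ[ℂ] W) : (l : ℕ) → (Fin l → V) → (Fin l → ℤ) → W → W
  | 0, _, _, w => w
  | l + 1, v, k, w =>
    mode (k 0) (v 0) (iterMode mode l (fun i => v i.succ) (fun i => k i.succ) w)

/-- The series `⟨w', Y(v₁, z₁) ⋯ Y(v_l, z_l) w⟩`. -/
def productSeries (mode : ℤ → V →ₗ[ℂ] W →ₗ[ℂ] W) (w' : Module.Dual ℂ W) (l : ℕ)
    (v : Fin l → V) (w : W) (z : Fin l → ℂ) : ℂ :=
  ∑' k : Fin l → ℤ, w' (iterMode mode l v k w) * ∏ i, z i ^ (-k i - 1)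

/-- The region `|z₁| > ⋯ > |z_l| > 0`. -/
def radialRegion (l : ℕ) : Set (Fin l → ℂ) :=
  {z | (∀ i, z i ≠ 0) ∧ ∀ i j, i < j → ‖z j‖ < ‖z i‖}

/-- The element `E(Y(v₁, z₁) ⋯ Y(v_l, z_l) w)` of the completion: its matrix coefficients are the
values of the rational functions that extend `⟨w', Y(v₁, z₁) ⋯ Y(v_l, z_l) w⟩`. -/
def elementE (G : Grading W) (mode : ℤ → V →ₗ[ℂ] W →ₗ[ℂ] W) (l : ℕ) (v : Fin l → V) (w : W)
    (z : Fin l → ℂ) : G.Completion :=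
  open Classical in
  if h : ∃ x : G.Completion, ∀ w' ∈ G.gradedDual,
      G.pairing w' x = ratExt (radialRegion l) (productSeries mode w' l v w) z
  then h.choose else 0

end Elements

/-! ### Cochains -/

section Cochains

variable {V : Type*} [AddCommGroup V] [Module ℂ V] {A : GRVertexAlgebra V}
  {W : Type*} [AddCommGroup W] [Module ℂ W]

/-- Linear maps from `V^{⊗ n}` to the functions from the configuration space `F_n ℂ` to the
completion of `W`. -/
abbrev PreCochain (B : GRModule A W) (n : ℕ) : Type _ :=
  MultilinearMap ℂ (fun _ : Fin n => V)
    ({z : Fin n → ℂ // Function.Injective z} → B.toGrading.Completion)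

namespace PreCochain

variable {B : GRModule A W} {n : ℕ}

/-- The value `Φ(v₁, z₁; …; v_n, z_n)`, with the value `0` off `F_n ℂ`. -/
def val (Φ : PreCochain B n) (v : Fin n → V) (z : Fin n → ℂ) : B.toGrading.Completion :=
  open Classical in if h : Function.Injective z then Φ v ⟨z, h⟩ else 0

/-- The matrix element `⟨w', Φ(v₁, z₁; …; v_n, z_n)⟩`. -/
def matEl (Φ : PreCochain B n) (w' : Module.Dual ℂ W) (v : Fin n → V) (z : Fin n → ℂ) : ℂ :=
  B.pairing w' (Φ.val v z)

/-- The values are rational functions with poles at most at `z_i = z_j`. -/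
def IsRational (Φ : PreCochain B n) : Prop :=
  ∀ v, ∀ w' ∈ B.gradedDual, ∃ (P : MvPolynomial (Fin n) ℂ) (N : ℕ),
    ∀ z, Function.Injective z → Φ.matEl w' v z =
      MvPolynomial.eval z P / ∏ p ∈ (Finset.univ : Finset (Fin n)).offDiag, (z p.1 - z p.2) ^ N

/-- The `L(-1)`-derivative property; the action of `L_W(-1)` on the completion is degreewise. -/
def LDerivative (Φ : PreCochain B n) : Prop :=
  ∀ v, ∀ w' ∈ B.gradedDual, ∀ z, Function.Injective z →
    (∀ i, HasDerivAt (fun t => Φ.matEl w' v (Function.update z i t))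
      (Φ.matEl w' (Function.update v i (A.Lm1 (v i))) z) (z i)) ∧
    ∑ i, deriv (fun t => Φ.matEl w' v (Function.update z i t)) (z i) =
      ∑ᶠ r : ℤ, w' (B.Lm1 (Φ.val v z r : W))

/-- The `L(0)`-conjugation property `⟨w', t^{L(0)} Φ(v, z)⟩ = ⟨w', Φ(t^{L(0)} v, t z)⟩`, on
homogeneous vectors, where `t^{L(0)}` is multiplication by `t` to the degree. -/
def LConjugation (Φ : PreCochain B n) : Prop :=
  ∀ (k : Fin n → ℤ) (v : Fin n → V), (∀ i, v i ∈ A.gr (k i)) → ∀ w' ∈ B.gradedDual,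
    ∀ z, Function.Injective z → ∀ t : ℂ, t ≠ 0 →
      ∑ᶠ r : ℤ, w' (t ^ r • (Φ.val v z r : W)) =
        Φ.matEl w' (fun i => t ^ k i • v i) (fun i => t * z i)

/-- The signed sums over inverses of `(s, n-s)`-shuffles vanish, for `1 ≤ s ≤ n - 1`. -/
def ShuffleSymmetric (Φ : PreCochain B n) : Prop :=
  open Classical in
  ∀ s : ℕ, 1 ≤ s → s < n → ∀ v, ∀ z, Function.Injective z →
    ∑ σ : Equiv.Perm (Fin n) with
        (∀ i j : Fin n, i < j → (j.val < s ∨ s ≤ i.val) → σ⁻¹ i < σ⁻¹ j),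
      ((Equiv.Perm.sign σ : ℤ) : ℂ) • Φ.val (v ∘ σ) (z ∘ σ) = 0

/-- Composability with `m` vertex operators. The parameters of the vertex operators take values
in the sets `S i`, those of the cochain in the set `S₀`. The bounds `N` on the pole orders depend
only on pairs of vectors. -/
structure Composable (Φ : PreCochain B n) (m : ℕ) (S₀ : Set ℂ) (S : Fin m → Set ℂ) : Prop where
  inner : ∃ N : V → V → ℕ, ∀ l : Fin n → ℕ, (∀ i, 0 < l i) → ∑ i, l i = m + n →
    ∀ v : (Σ i, Fin (l i)) → V, ∀ w' ∈ B.gradedDual, ∃ P : MvPolynomial (Σ i, Fin (l i)) ℂ,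
    ∀ z : (Σ i, Fin (l i)) → ℂ, (∀ a, z a ∈ S₀ ∪ ⋃ i, S i) → Function.Injective z →
    ∀ ζ : Fin n → ℂ, Function.Injective ζ →
    (∀ i j, i ≠ j → ∀ p q, ‖z ⟨i, p⟩ - ζ i‖ + ‖z ⟨j, q⟩ - ζ j‖ < ‖ζ i - ζ j‖) →
    HasSum (fun r : Fin n → ℤ => Φ.matEl w'
        (fun i => (elementE A.toGrading A.mode (l i) (fun p => v ⟨i, p⟩) A.one
          (fun p => z ⟨i, p⟩ - ζ i) (r i) : V)) ζ)
      (MvPolynomial.eval z P /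
        ∏ p ∈ (Finset.univ : Finset (Σ i, Fin (l i))).offDiag,
          (z p.1 - z p.2) ^ N (v p.1) (v p.2))
  outer : ∃ N : V → V → ℕ, ∀ (v : Fin m ⊕ Fin n → V), ∀ w' ∈ B.gradedDual,
    ∃ P : MvPolynomial (Fin m ⊕ Fin n) ℂ, ∀ z : Fin m ⊕ Fin n → ℂ,
    (∀ i, z (Sum.inl i) ∈ S i) → (∀ k, z (Sum.inr k) ∈ S₀) → Function.Injective z →
    (∀ k, 0 < ‖z (Sum.inr k)‖) → (∀ i k, ‖z (Sum.inr k)‖ < ‖z (Sum.inl i)‖) →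
    HasSum (fun q : ℤ => B.pairing w'
        (elementE B.toGrading B.mode m (v ∘ Sum.inl)
          (Φ.val (v ∘ Sum.inr) (z ∘ Sum.inr) q : W) (z ∘ Sum.inl)))
      (MvPolynomial.eval z P /
        ∏ p ∈ (Finset.univ : Finset (Fin m ⊕ Fin n)).offDiag,
          (z p.1 - z p.2) ^ N (v p.1) (v p.2))

end PreCochain

/-- The matrix element of `Y_W(v, z)` applied to the vector `w` placed at the point `ζ`,
`⟨w', e^{ζ L(-1)} Y_W(v, z - ζ) w⟩` (a finite sum for `w'` in the graded dual). -/
def actAt (B : GRModule A W) (w' : Module.Dual ℂ W) (v : V) (z ζ : ℂ) (w : W) : ℂ :=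
  ∑' p : ℕ × ℤ, w' ((B.Lm1 ^ p.1) (B.mode p.2 v w)) * (ζ ^ p.1 / (p.1.factorial : ℂ)) *
    (z - ζ) ^ (-p.2 - 1)

variable {M : Type*} [TopologicalSpace M] [ChartedSpace ℂ M]

/-- The space `C^n_m(V, 𝒲, 𝓕)` for `n ≥ 1`: the maps with values in the rational `𝒲`-valued forms
that are composable with `m` vertex operators for all chains `U₁ ↪ ⋯ ↪ U_m` of holonomy
embeddings between sections of the transversal basis `𝒰`, the parameters being local coordinates
of points on the sections `U_i` for the vertex operators, and on one section `U_j` of the chain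
for the arguments of the cochain (on any section of `𝒰` if `m = 0`). -/
def cochains (F : CurveFoliation M) (𝒰 : Set (Set M)) (B : GRModule A W) (n m : ℕ) :
    Set (PreCochain B n) :=
  {Φ | Φ.IsRational ∧ Φ.LDerivative ∧ Φ.LConjugation ∧ Φ.ShuffleSymmetric ∧
    ∀ U : Fin m → Set M, (∀ i, U i ∈ 𝒰) →
      (∀ i j : Fin m, i.val + 1 = j.val → ∃ h, F.IsHolonomyEmbedding (U i) (U j) h) →
      ∀ U₀ ∈ 𝒰, (0 < m → ∃ j, U₀ = U j) →
        Φ.Composable m (coordValues U₀) (fun i => coordValues (U i))}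

/-- `Θ = δ¹χ`: on matrix elements,
`Y_W(v₁, z₁)χ(v₂, z₂) - χ(Y_V(v₁, z₁ - z₂)v₂, z₂) + Y_W(v₂, z₂)χ(v₁, z₁)`, each term being the
rational extension of the corresponding series. -/
def IsDeltaOne {B : GRModule A W} (χ : PreCochain B 1) (Θ : PreCochain B 2) : Prop :=
  ∀ v₁ v₂ : V, ∀ w' ∈ B.gradedDual, ∀ z : Fin 2 → ℂ, Function.Injective z →
    Θ.matEl w' ![v₁, v₂] z =
      ratExt {x | 0 < ‖x 1‖ ∧ ‖x 1‖ < ‖x 0‖}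
        (fun x => ∑' q : ℤ, actAt B w' v₁ (x 0) 0 (χ.val ![v₂] ![x 1] q : W)) z
      - ratExt {x | x 0 ≠ x 1}
        (fun x => ∑' n : ℤ, χ.matEl w' ![A.mode n v₁ v₂] ![x 1] * (x 0 - x 1) ^ (-n - 1)) z
      + ratExt {x | 0 < ‖x 0‖ ∧ ‖x 0‖ < ‖x 1‖}
        (fun x => ∑' q : ℤ, actAt B w' v₂ (x 1) 0 (χ.val ![v₁] ![x 0] q : W)) z

/-- The degree `r` term of
`⟨w', Y_W(v₁, z₁) Φ(v₂, z₂; v₃, z₃)⟩ + ⟨w', Φ(v₁, z₁; Y_V(v₂, z₂ - ζ) Y_V(v₃, z₃ - ζ) 1, ζ)⟩`,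
expanded around `ζ`. -/
def firstTerm {B : GRModule A W} (Φ : PreCochain B 2) (w' : Module.Dual ℂ W) (v₁ v₂ v₃ : V)
    (z : Fin 3 → ℂ) (ζ : ℂ) (r : ℤ) : ℂ :=
  actAt B w' v₁ (z 0) ζ (Φ.val ![v₂, v₃] ![z 1 - ζ, z 2 - ζ] r : W) +
  Φ.matEl w' ![v₁, (elementE A.toGrading A.mode 2 ![v₂, v₃] A.one ![z 1 - ζ, z 2 - ζ] r : V)]
    ![z 0, ζ]

/-- The degree `r` term of
`⟨w', Φ(Y_V(v₁, z₁ - ζ) Y_V(v₂, z₂ - ζ) 1, ζ; v₃, z₃)⟩ + ⟨w', Y_W(v₃, z₃) Φ(v₁, z₁; v₂, z₂)⟩`,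
expanded around `ζ`. -/
def secondTerm {B : GRModule A W} (Φ : PreCochain B 2) (w' : Module.Dual ℂ W) (v₁ v₂ v₃ : V)
    (z : Fin 3 → ℂ) (ζ : ℂ) (r : ℤ) : ℂ :=
  Φ.matEl w' ![(elementE A.toGrading A.mode 2 ![v₁, v₂] A.one ![z 0 - ζ, z 1 - ζ] r : V), v₃]
    ![ζ, z 2] +
  actAt B w' v₃ (z 2) ζ (Φ.val ![v₁, v₂] ![z 0 - ζ, z 1 - ζ] r : W)

/-- The region for the first sum around `ζ`. -/
def firstRegion (ζ : ℂ) : Set (Fin 3 → ℂ) :=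
  {z | Function.Injective z ∧ 0 < ‖z 1 - ζ‖ ∧ ‖z 1 - ζ‖ < ‖z 0 - ζ‖ ∧
    0 < ‖z 2 - ζ‖ ∧ ‖z 2 - ζ‖ < ‖z 0 - ζ‖}

/-- The region for the second sum around `ζ`. -/
def secondRegion (ζ : ℂ) : Set (Fin 3 → ℂ) :=
  {z | Function.Injective z ∧ 0 < ‖z 0 - ζ‖ ∧ ‖z 0 - ζ‖ < ‖z 2 - ζ‖ ∧
    0 < ‖z 1 - ζ‖ ∧ ‖z 1 - ζ‖ < ‖z 2 - ζ‖}

/-- The exceptional space `C²_ex(V, 𝒲, 𝓕) ⊆ C²_0(V, 𝒲, 𝓕)`: both sums converge absolutely in their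
regions to rational functions, independent of `ζ`, with poles at most at `z_i = z_j`. -/
def exCochains (F : CurveFoliation M) (𝒰 : Set (Set M)) (B : GRModule A W) :
    Set (PreCochain B 2) :=
  {Φ | Φ ∈ cochains F 𝒰 B 2 0 ∧ ∀ U ∈ 𝒰, ∀ v₁ v₂ v₃ : V, ∀ w' ∈ B.gradedDual,
    (∃ (P : MvPolynomial (Fin 3) ℂ) (N : ℕ), ∀ z : Fin 3 → ℂ, (∀ i, z i ∈ coordValues U) →
      ∀ ζ, z ∈ firstRegion ζ → HasSum (firstTerm Φ w' v₁ v₂ v₃ z ζ)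
        (MvPolynomial.eval z P /
          ∏ p ∈ (Finset.univ : Finset (Fin 3)).offDiag, (z p.1 - z p.2) ^ N)) ∧
    (∃ (P : MvPolynomial (Fin 3) ℂ) (N : ℕ), ∀ z : Fin 3 → ℂ, (∀ i, z i ∈ coordValues U) →
      ∀ ζ, z ∈ secondRegion ζ → HasSum (secondTerm Φ w' v₁ v₂ v₃ z ζ)
        (MvPolynomial.eval z P /
          ∏ p ∈ (Finset.univ : Finset (Fin 3)).offDiag, (z p.1 - z p.2) ^ N))}

/-- The matrix element of `δ²_ex Φ`:
`Y_W(v₁)Φ(v₂; v₃) - Φ(Y_V(v₁)v₂; v₃) + Φ(v₁; Y_V(v₂)v₃) - Y_W(v₃)Φ(v₁; v₂)`. The rational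
extensions do not depend on `ζ`, and the expansion around `ζ = 0` is used. -/
def deltaEx {B : GRModule A W} (Φ : PreCochain B 2) (w' : Module.Dual ℂ W) (v₁ v₂ v₃ : V)
    (z : Fin 3 → ℂ) : ℂ :=
  ratExt (firstRegion 0) (fun x => ∑' r : ℤ, firstTerm Φ w' v₁ v₂ v₃ x 0 r) z -
  ratExt (secondRegion 0) (fun x => ∑' r : ℤ, secondTerm Φ w' v₁ v₂ v₃ x 0 r) z

/-- The kernel of `δ²_ex` on `C²_ex(V, 𝒲, 𝓕)`. -/
def exCocycles (F : CurveFoliation M) (𝒰 : Set (Set M)) (B : GRModule A W) :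
    Set (PreCochain B 2) :=
  {Φ | Φ ∈ exCochains F 𝒰 B ∧ ∀ v₁ v₂ v₃ : V, ∀ w' ∈ B.gradedDual, ∀ z : Fin 3 → ℂ,
    Function.Injective z → deltaEx Φ w' v₁ v₂ v₃ z = 0}

/-- `Φ₁ - Φ₂` lies in `δ¹_2 C¹_2(V, 𝒲, 𝓕)`. -/
def Cohomologous (F : CurveFoliation M) (𝒰 : Set (Set M)) (B : GRModule A W)
    (Φ₁ Φ₂ : PreCochain B 2) : Prop :=
  ∃ χ ∈ cochains F 𝒰 B 1 2, IsDeltaOne χ (Φ₁ - Φ₂)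

/-- The exceptional second cohomology `H²_ex(V, 𝒲, 𝓕) = ker δ²_ex / im δ¹_2`. -/
def ExCohomology (F : CurveFoliation M) (𝒰 : Set (Set M)) (B : GRModule A W) : Type _ :=
  Quot (fun Φ₁ Φ₂ : exCocycles F 𝒰 B => Cohomologous F 𝒰 B Φ₁.1 Φ₂.1)

end Cochains

/-! ### Square-zero extensions -/

section Extensions

variable {V : Type u} [AddCommGroup V] [Module ℂ V] {A : GRVertexAlgebra V}
  {W : Type v} [AddCommGroup W] [Module ℂ W]

/-- `γ : E → V` and `α : W → E` make `E` a square-zero extension of `V` by `W`. The `V`-module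
structure of the square-zero ideal `ker γ` is `v ↦ Y_E(e, z)` for any `e` with `γ e = v`. -/
structure IsSquareZeroExtension (B : GRModule A W) {E : Type*} [AddCommGroup E] [Module ℂ E]
    (C : GRVertexAlgebra E) (γ : E →ₗ[ℂ] V) (α : W →ₗ[ℂ] E) : Prop where
  hom : C.IsHom A γ
  surjective : Function.Surjective γ
  square_zero : ∀ n x y, γ x = 0 → γ y = 0 → C.mode n x y = 0
  injective : Function.Injective α
  range_eq : LinearMap.range α = LinearMap.ker γ
  map_gr : ∀ n, ∀ w ∈ B.gr n, α w ∈ C.gr n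
  map_mode : ∀ n e w, α (B.mode n (γ e) w) = C.mode n e (α w)
  map_Lm1 : ∀ w, α (B.Lm1 w) = C.Lm1 (α w)

/-- A square-zero extension `(E, γ, α)` of `V` by `W`. -/
structure SquareZeroExtension (B : GRModule A W) where
  /-- the underlying space -/
  E : Type (max u v)
  [group : AddCommGroup E]
  [module : Module ℂ E]
  /-- the vertex algebra -/
  alg : GRVertexAlgebra E
  /-- the projection to `V` -/
  γ : E →ₗ[ℂ] V
  /-- the inclusion of `W` -/
  α : W →ₗ[ℂ] E
  isExt : IsSquareZeroExtension B alg γ α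

attribute [instance] SquareZeroExtension.group SquareZeroExtension.module

namespace SquareZeroExtension

variable {B : GRModule A W}

/-- Equivalence of square-zero extensions. -/
def Equivalent (X₁ X₂ : SquareZeroExtension B) : Prop :=
  ∃ h : X₁.E ≃ₗ[ℂ] X₂.E, X₁.alg.IsHom X₂.alg h.toLinearMap ∧
    (∀ w, h (X₁.α w) = X₂.α w) ∧ ∀ x, X₂.γ (h x) = X₁.γ x

/-- A realization of the extension on `V ⊕ W`, given by a grading-preserving linear section
`Γ : V → E`: the vacuum becomes `(1, 0)`, and the component `Ψ` of the vertex operators defined by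
`Y_E(Γ u, z)Γ v = Γ(Y_V(u, z)v) + α(Ψ(u, z)v)` satisfies `Ψ(u, z)1 = 0`. -/
structure IsRealization (X : SquareZeroExtension B) (Γ : V →ₗ[ℂ] X.E) : Prop where
  isSection : ∀ v, X.γ (Γ v) = v
  map_gr : ∀ n, ∀ v ∈ A.gr n, Γ v ∈ X.alg.gr n
  map_one : Γ A.one = X.alg.one
  psi_one : ∀ n v, X.alg.mode n (Γ v) (Γ A.one) = Γ (A.mode n v A.one)

/-- The extension has a realization on `V ⊕ W`. -/
def Realizable (X : SquareZeroExtension B) : Prop := ∃ Γ, X.IsRealization Γ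

/-- `Φ` is the map built from the component `Ψ` of the vertex operators of the extension realized
by `Γ`: `Φ(v₁, z₁; v₂, z₂)` is the common rational extension of `Ψ(v₁, z₁)Y_V(v₂, z₂)1`,
`Ψ(v₂, z₂)Y_V(v₁, z₁)1` and `Y_{WV}^W(Ψ(v₁, z₁ - z₂)v₂, z₂)1 = e^{z₂ L(-1)} Ψ(v₁, z₁ - z₂)v₂`. -/
def IsInvariant (X : SquareZeroExtension B) (Γ : V →ₗ[ℂ] X.E) (Φ : PreCochain B 2) : Prop :=
  ∃ ψ : ℤ → V → V → W,
    (∀ n u v, X.alg.mode n (Γ u) (Γ v) = Γ (A.mode n u v) + X.α (ψ n u v)) ∧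
    ∀ v₁ v₂ : V, ∀ w' ∈ B.gradedDual, ∀ z₁ z₂ : ℂ,
      (0 < ‖z₂‖ → ‖z₂‖ < ‖z₁‖ → HasSum (fun p : ℤ × ℤ =>
        w' (ψ p.1 v₁ (A.mode p.2 v₂ A.one)) * z₁ ^ (-p.1 - 1) * z₂ ^ (-p.2 - 1))
          (Φ.matEl w' ![v₁, v₂] ![z₁, z₂])) ∧
      (0 < ‖z₁‖ → ‖z₁‖ < ‖z₂‖ → HasSum (fun p : ℤ × ℤ =>
        w' (ψ p.1 v₂ (A.mode p.2 v₁ A.one)) * z₂ ^ (-p.1 - 1) * z₁ ^ (-p.2 - 1))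
          (Φ.matEl w' ![v₁, v₂] ![z₁, z₂])) ∧
      (0 < ‖z₁ - z₂‖ → ‖z₁ - z₂‖ < ‖z₂‖ → HasSum (fun p : ℕ × ℤ =>
        w' ((B.Lm1 ^ p.1) (ψ p.2 v₁ v₂)) * (z₂ ^ p.1 / (p.1.factorial : ℂ)) *
          (z₁ - z₂) ^ (-p.2 - 1))
          (Φ.matEl w' ![v₁, v₂] ![z₁, z₂]))

end SquareZeroExtension

/-- The equivalence classes of (realizable) square-zero extensions of `V` by `W`. -/
def ExtensionClasses (B : GRModule A W) : Type _ :=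
  Quot (fun X₁ X₂ : {X : SquareZeroExtension B // X.Realizable} => X₁.1.Equivalent X₂.1)

/-- The coefficient of `z^{-n-1}` in the intertwining operator
`Y_{WV}^W(w, z)v = e^{z L(-1)} Y_W(v, -z)w`. -/
def intertwiningMode (B : GRModule A W) (n : ℤ) (w : W) (v : V) : W :=
  ∑ᶠ k : ℕ, ((-1 : ℂ) ^ (n + k + 1) / (k.factorial : ℂ)) • (B.Lm1 ^ k) (B.mode (n + k) v w)

/-- The vertex algebra `C` on `V ⊕ W` is the one defined by `Φ`: it is the direct sum as a graded
space, and
`Y((v₁,w₁), z)(v₂,w₂) = (Y_V(v₁,z)v₂, Y_W(v₁,z)w₂ + Y_{WV}^W(w₁,z)v₂ + Ψ(v₁,z)v₂)` with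
`⟨w', Ψ(v₁, z)v₂⟩ = ⟨w', Φ(v₁, z; v₂, 0)⟩`. -/
def IsExtensionOf {B : GRModule A W} (Φ : PreCochain B 2) (C : GRVertexAlgebra (V × W)) : Prop :=
  (∀ n, C.gr n = (A.gr n).prod (B.gr n)) ∧
  ∃ ψ : ℤ → V → V → W,
    (∀ v₁ v₂ : V, ∀ w' ∈ B.gradedDual, ∀ z : ℂ, z ≠ 0 →
      HasSum (fun n : ℤ => w' (ψ n v₁ v₂) * z ^ (-n - 1)) (Φ.matEl w' ![v₁, v₂] ![z, 0])) ∧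
    ∀ n v₁ w₁ v₂ w₂, C.mode n (v₁, w₁) (v₂, w₂) =
      (A.mode n v₁ v₂, B.mode n v₁ w₂ + intertwiningMode B n w₁ v₂ + ψ n v₁ v₂)

/-- The square-zero extension `(V ⊕ W, p₁, i₂)`. -/
def SquareZeroExtension.ofSum {B : GRModule A W} (C : GRVertexAlgebra (V × W))
    (h : IsSquareZeroExtension B C (LinearMap.fst ℂ V W) (LinearMap.inr ℂ V W)) :
    SquareZeroExtension B :=
  ⟨V × W, C, LinearMap.fst ℂ V W, LinearMap.inr ℂ V W, h⟩

end Extensions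

end

noncomputable section

/-! ### Local coordinates -/

/-! Everything is reduced to bilinear fields `ψ(u, z)v = ∑ ψ_n(u, v) z^{-n-1}` from `V × V` to `W`,
compatible with degrees and with `L(-1)` (`FieldMap`). Rationality, the `L(-1)`-derivative property
and `L(0)`-conjugation force a two-cochain to be `Φ(v₁, z₁; v₂, z₂) = e^{z₂L(-1)} ψ(v₁, z₁ - z₂)v₂`
(`PreCochain.eq_cochain_psi`). The shuffle condition becomes symmetry of this expression, and
composability with no vertex operators is then automatic. The foliation plays almost no role: some
member of the transversal basis is nonempty, and the coordinates of a point, being adjustable by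
translations, take every complex value.

From extensions to cocycles: let `Γ` realize the extension `E`, and let `ψ` be the `W`-component of
`Y_E(Γu, z)Γv`. Splitting a homogeneous component of `Y_E(Γv₂)Γv₃` into its `V`- and `W`-parts shows
that `G₁` is an expansion of the three-point function `⟨w', Y_E(Γv₁, z₁)Y_E(Γv₂, z₂)Γv₃⟩` with third
point `z₃`, paired through the retraction `E → W`. This function is symmetric in the three pairs
`(v_i, z_i)`. By symmetry of `Φ`, the sum `G₂` for `(v₁, v₂, v₃)` is `G₁` for `(v₃, v₁, v₂)`; hence
both extend to the same rational function and `δ²_ex Φ = 0` (`hasSum_firstTerm`, `secondTerm_eq`).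

From cocycles to extensions: the rational extension `T` of `G₁` is invariant under exchange of its
last two arguments because `Φ` and the products in `V` are, and under cyclic rotation because of the
cocycle equation; so it is fully symmetric (`FieldMap.HasTriple`). The `ψ`-part of the duality axiom
on `V ⊕ W` says that three expansions of this one function `T` agree. The remaining parts of duality
come from `V`, from `W`, and from the three-point functions of `W` rewritten through skew-symmetry.
The field `ψ(1, z)` is a constant operator `s`, which need not vanish: the vacuum of `V ⊕ W` is `(1,
-s(1))` and a realization is `v ↦ (v, -s(v))`.

Classification: a one-cochain is `e^{zL(-1)} f(v)` with `f : V → W` graded and commuting with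
`L(-1)`, and its coboundary belongs to the field `Y_W(u)f(v) - f(Y_V(u)v) + Y_{WV}^W(f(u))v`. An
equivalence between two extensions on `V ⊕ W` fixes the projection and the inclusion, so it is `(v,
w) ↦ (v, w + f(v))`, and compatibility with the vertex operators is exactly the coboundary equation
(`FieldMap.cohomologous_iff`, `FieldMap.HasTriple.equivalent_iff`). Every realizable extension is
equivalent to the model of its cocycle through `(v, w) ↦ Γv + αw`.

The analysis rests on rational functions with known poles. Their form gives absolute convergence,
while the coefficients are identified by iterated one-variable expansions (`dps_coeff`). Sums over
degrees are homogeneous in the relative positions: scaling the positions turns them into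
one-variable power series, which enlarges regions of convergence (`hasSum_tri_antidiagonal`) and
reaches the boundary case of coinciding points (`hasSum_on_axis`). -/

lemma coordValues_eq_univ {M : Type*} [TopologicalSpace M] [ChartedSpace ℂ M]
    [IsManifold 𝓘(ℂ, ℂ) ω M] {S : Set M} (hS : S.Nonempty) : coordValues S = Set.univ := by
  obtain ⟨p, hp⟩ := hS
  refine Set.eq_univ_of_forall fun z => ⟨p, hp, ?_⟩
  -- Composing a chart at `p` with a translation of `ℂ` stays in the maximal holomorphic atlas, and
  -- the translation can send the coordinate of `p` to any prescribed `z`.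
  let t : OpenPartialHomeomorph ℂ ℂ :=
    (Homeomorph.addRight (z - chartAt ℂ p p)).toOpenPartialHomeomorph
  have ht : t ∈ contDiffGroupoid ω 𝓘(ℂ, ℂ) := by
    rw [contDiffGroupoid, mem_groupoid_of_pregroupoid]
    constructor
    · have : ContDiff ℂ ω (fun x : ℂ => x + (z - chartAt ℂ p p)) := by fun_prop
      simpa [contDiffPregroupoid, t, Function.comp_def] using this.contDiffOn
    · have : ContDiff ℂ ω (fun x : ℂ => x - (z - chartAt ℂ p p)) := by fun_prop
      have h2 : ⇑(Homeomorph.addRight (z - chartAt ℂ p p)).symm =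
          fun x : ℂ => x - (z - chartAt ℂ p p) := by
        ext x
        rw [sub_eq_add_neg x]
        rfl
      simpa [contDiffPregroupoid, t, Function.comp_def, h2] using this.contDiffOn
  refine ⟨(chartAt ℂ p).trans t, ?_, ?_, ?_⟩
  · rw [IsManifold.maximalAtlas, mem_maximalAtlas_iff]
    intro e he
    have h1 := StructureGroupoid.compatible_of_mem_maximalAtlas
      (IsManifold.chart_mem_maximalAtlas (I := 𝓘(ℂ, ℂ)) (n := ω) p)
      (IsManifold.subset_maximalAtlas (I := 𝓘(ℂ, ℂ)) (n := ω) he)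
    have h2 := StructureGroupoid.compatible_of_mem_maximalAtlas
      (IsManifold.subset_maximalAtlas (I := 𝓘(ℂ, ℂ)) (n := ω) he)
      (IsManifold.chart_mem_maximalAtlas (I := 𝓘(ℂ, ℂ)) (n := ω) p)
    constructor
    · rw [OpenPartialHomeomorph.trans_symm_eq_symm_trans_symm, OpenPartialHomeomorph.trans_assoc]
      exact StructureGroupoid.trans _ (StructureGroupoid.symm _ ht) h1
    · rw [← OpenPartialHomeomorph.trans_assoc]
      exact StructureGroupoid.trans _ h2 ht
  · simp [t]
  · simp [t]

/-- The slice of a foliated chart on which the leaf coordinate is constant is a transversal section,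
and the basis must reach a point of it from some member. Without a nonempty member the convergence
conditions on exceptional cochains would carry no information. -/
lemma CurveFoliation.IsTransversalBasis.exists_nonempty {M : Type*} [TopologicalSpace M]
    [ChartedSpace ℂ M] [Nonempty M] {F : CurveFoliation M} {𝒰 : Set (Set M)}
    (h : F.IsTransversalBasis 𝒰) : ∃ U ∈ 𝒰, U.Nonempty := by
  obtain ⟨p⟩ := ‹Nonempty M›
  obtain ⟨φ, hφ, hp⟩ := F.cover p
  have hU : F.IsTransversal {q | q ∈ φ.source ∧ (φ q).1 = (φ p).1} := by
    intro q hq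
    refine ⟨φ, hφ, φ.source, φ.open_source, hq.1, subset_rfl,
      (fun t => ((φ p).1, t)) ⁻¹' φ.target, fun _ => (φ p).1,
      φ.open_target.preimage (by fun_prop), contDiffOn_const, ?_⟩
    ext ⟨a, b⟩
    simp only [Set.mem_image, Set.mem_inter_iff, Set.mem_ofPred_eq, Set.mem_preimage, Prod.mk.injEq]
    constructor
    · rintro ⟨x, ⟨⟨hx, hx1⟩, -⟩, hxe⟩
      refine ⟨b, ?_, by rw [← hx1, hxe], rfl⟩
      have : ((φ p).1, b) = φ x := by rw [← hx1, hxe]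
      rw [this]
      exact φ.map_source hx
    · rintro ⟨t, ht, rfl, rfl⟩
      exact ⟨φ.symm ((φ p).1, t), ⟨⟨φ.map_target ht, by rw [φ.right_inv ht]⟩, φ.map_target ht⟩,
        φ.right_inv ht⟩
  obtain ⟨U, hU', e, -, x, -⟩ := h.2 _ hU p ⟨hp, rfl⟩
  exact ⟨U, hU', x, x.2⟩

/-! ### Graded spaces -/

namespace Grading

variable {W : Type*} [AddCommGroup W] [Module ℂ W] (G : Grading W)

/-- The homogeneous component of degree `n`, as an element of `gr n`. -/
def component (n : ℤ) : W →ₗ[ℂ] G.gr n :=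
  DirectSum.component ℂ ℤ (fun n => G.gr n) n ∘ₗ
    (LinearEquiv.ofBijective (DirectSum.coeLinearMap G.gr) G.internal).symm.toLinearMap

/-- The projection to the homogeneous component of degree `n`. -/
def proj (n : ℤ) : W →ₗ[ℂ] W := (G.gr n).subtype ∘ₗ G.component n

lemma symm_of_mem {n : ℤ} {x : W} (hx : x ∈ G.gr n) :
    (LinearEquiv.ofBijective (DirectSum.coeLinearMap G.gr) G.internal).symm x =
      DirectSum.lof ℂ ℤ (fun n => G.gr n) n ⟨x, hx⟩ := by
  rw [LinearEquiv.symm_apply_eq]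
  exact (DirectSum.coeLinearMap_lof G.gr n ⟨x, hx⟩).symm

lemma component_of_mem {n : ℤ} {x : W} (hx : x ∈ G.gr n) : G.component n x = ⟨x, hx⟩ := by
  simp only [component, LinearMap.comp_apply, LinearEquiv.coe_coe]
  rw [G.symm_of_mem hx]
  simp [DirectSum.component.lof_self]

lemma component_of_mem_ne {n m : ℤ} {x : W} (hx : x ∈ G.gr m) (h : m ≠ n) :
    G.component n x = 0 := by
  simp only [component, LinearMap.comp_apply, LinearEquiv.coe_coe]
  rw [G.symm_of_mem hx]
  simp [DirectSum.component.of, h]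

lemma proj_of_mem {n : ℤ} {x : W} (hx : x ∈ G.gr n) : G.proj n x = x := by
  simp [proj, G.component_of_mem hx]

lemma proj_of_mem_ne {n m : ℤ} {x : W} (hx : x ∈ G.gr m) (h : m ≠ n) : G.proj n x = 0 := by
  simp [proj, G.component_of_mem_ne hx h]

lemma proj_mem (n : ℤ) (x : W) : G.proj n x ∈ G.gr n := (G.component n x).2

variable {G} in
lemma induction {p : W → Prop} (hom : ∀ n, ∀ x ∈ G.gr n, p x)
    (add : ∀ x y, p x → p y → p (x + y)) (x : W) : p x := by
  have hx : x ∈ ⨆ n, G.gr n := by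
    rw [G.internal.submodule_iSup_eq_top]; trivial
  exact Submodule.iSup_induction G.gr (motive := p) hx hom (hom 0 0 (zero_mem _)) add

lemma eq_zero_of_proj {x : W} (h : ∀ n, G.proj n x = 0) : x = 0 := by
  have : (LinearEquiv.ofBijective (DirectSum.coeLinearMap G.gr) G.internal).symm x = 0 := by
    refine DFinsupp.ext fun n => ?_
    have := h n
    exact Subtype.ext this
  simpa using this

lemma L0_of_mem {n : ℤ} {x : W} (hx : x ∈ G.gr n) : G.L0 x = (n : ℂ) • x := by
  simp only [L0, LinearMap.comp_apply, LinearEquiv.coe_coe]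
  rw [G.symm_of_mem hx]
  simp

lemma proj_L0 (n : ℤ) (x : W) : G.proj n (G.L0 x) = (n : ℂ) • G.proj n x := by
  induction x using G.induction with
  | hom m x hx =>
    rw [G.L0_of_mem hx, map_smul]
    by_cases h : m = n
    · rw [h]
    · rw [G.proj_of_mem_ne hx h]; simp
  | add x y hx hy => simp [hx, hy]

/-- Distinct integers are distinct eigenvalues over `ℂ`, so every component in a degree other than
`n` is killed. This is how the `L(0)`-bracket axioms are converted into statements about degrees. -/
lemma mem_gr_of_L0 {n : ℤ} {x : W} (h : G.L0 x = (n : ℂ) • x) : x ∈ G.gr n := by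
  have : x - G.proj n x = 0 := by
    refine G.eq_zero_of_proj fun m => ?_
    rw [map_sub]
    by_cases hm : n = m
    · subst hm
      rw [G.proj_of_mem (G.proj_mem n x), sub_self]
    · rw [G.proj_of_mem_ne (G.proj_mem n x) hm, sub_zero]
      have h1 := G.proj_L0 m x
      rw [h, map_smul, ← sub_eq_zero, ← sub_smul] at h1
      refine (smul_eq_zero.mp h1).resolve_left ?_
      refine sub_ne_zero.mpr ?_
      exact_mod_cast hm
  rw [sub_eq_zero] at this
  rw [this]
  exact G.proj_mem n x

lemma exists_lower : ∃ N : ℤ, ∀ n < N, ∀ x ∈ G.gr n, x = 0 := by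
  obtain ⟨N, hN⟩ := G.bounded
  exact ⟨N, fun n hn x hx => by simpa [hN n hn] using hx⟩

/-- Functionals in the graded dual are those that vanish in large degrees. -/
lemma mem_gradedDual_iff {w' : Module.Dual ℂ W} :
    w' ∈ G.gradedDual ↔ ∃ N : ℤ, ∀ n ≥ N, ∀ x ∈ G.gr n, w' x = 0 := by
  constructor
  · intro h
    obtain ⟨N, hN⟩ := h.bddAbove
    refine ⟨N + 1, fun n hn x hx => ?_⟩
    by_contra hne
    have : n ≤ N := hN ⟨x, hx, hne⟩
    lia
  · rintro ⟨N, hN⟩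
    obtain ⟨N₀, hN₀⟩ := G.exists_lower
    refine (Set.finite_Ico N₀ N).subset ?_
    rintro n ⟨x, hx, hne⟩
    refine ⟨?_, ?_⟩
    · by_contra h
      exact hne (by rw [hN₀ n (not_le.mp h) x hx, map_zero])
    · by_contra h
      exact hne (hN n (not_lt.mp h) x hx)

lemma add_mem_gradedDual {a b : Module.Dual ℂ W} (ha : a ∈ G.gradedDual)
    (hb : b ∈ G.gradedDual) : a + b ∈ G.gradedDual := by
  rw [mem_gradedDual_iff] at *
  obtain ⟨N, hN⟩ := ha
  obtain ⟨N', hN'⟩ := hb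
  exact ⟨max N N', fun n hn x hx => by
    simp [hN n (le_trans (le_max_left _ _) hn) x hx, hN' n (le_trans (le_max_right _ _) hn) x hx]⟩

lemma smul_mem_gradedDual {a : Module.Dual ℂ W} (c : ℂ) (ha : a ∈ G.gradedDual) :
    c • a ∈ G.gradedDual := by
  rw [mem_gradedDual_iff] at *
  obtain ⟨N, hN⟩ := ha
  exact ⟨N, fun n hn x hx => by simp [hN n hn x hx]⟩

lemma zero_mem_gradedDual : (0 : Module.Dual ℂ W) ∈ G.gradedDual :=
  G.mem_gradedDual_iff.mpr ⟨0, fun _ _ _ _ => rfl⟩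

lemma sum_mem_gradedDual {ι : Type*} (s : Finset ι) (a : ι → Module.Dual ℂ W)
    (h : ∀ i ∈ s, a i ∈ G.gradedDual) : ∑ i ∈ s, a i ∈ G.gradedDual := by
  classical
  induction s using Finset.induction_on with
  | empty => simpa using G.zero_mem_gradedDual
  | insert i s hi ih =>
    rw [Finset.sum_insert hi]
    exact G.add_mem_gradedDual (h i (by simp)) (ih fun j hj => h j (by simp [hj]))

variable {G} in
lemma comp_mem_gradedDual {X : Type*} [AddCommGroup X] [Module ℂ X] {H : Grading X}
    {w' : Module.Dual ℂ W} (hw : w' ∈ G.gradedDual) (f : X →ₗ[ℂ] W) (d : ℤ)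
    (hf : ∀ n, ∀ x ∈ H.gr n, f x ∈ G.gr (n + d)) : w'.comp f ∈ H.gradedDual := by
  rw [mem_gradedDual_iff] at *
  obtain ⟨N, hN⟩ := hw
  exact ⟨N - d, fun n hn x hx => hN (n + d) (by lia) _ (hf n x hx)⟩

lemma comp_proj_mem_gradedDual (φ : Module.Dual ℂ W) (n : ℤ) :
    φ.comp (G.proj n) ∈ G.gradedDual := by
  rw [mem_gradedDual_iff]
  exact ⟨n + 1, fun m hm x hx => by
    simp [G.proj_of_mem_ne hx (show m ≠ n by lia)]⟩

/-- The graded dual separates points. -/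
lemma ext_gradedDual {x y : W} (h : ∀ w' ∈ G.gradedDual, w' x = w' y) : x = y := by
  rw [← sub_eq_zero]
  refine G.eq_zero_of_proj fun n => ?_
  rw [← Module.forall_dual_apply_eq_zero_iff ℂ]
  intro φ
  have := h _ (G.comp_proj_mem_gradedDual φ n)
  simpa [sub_eq_zero] using this

lemma pairing_support {w' : Module.Dual ℂ W} (hw : w' ∈ G.gradedDual) :
    ∃ s : Finset ℤ, (∀ n ∉ s, ∀ x ∈ G.gr n, w' x = 0) ∧
      ∀ x : G.Completion, G.pairing w' x = ∑ n ∈ s, w' (x n) := by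
  refine ⟨Set.Finite.toFinset hw, fun n hn x hx => ?_, fun x => ?_⟩
  · by_contra hne
    exact hn ((Set.Finite.mem_toFinset hw).mpr ⟨x, hx, hne⟩)
  · refine finsum_eq_sum_of_support_subset _ fun n hn => ?_
    exact (Set.Finite.mem_toFinset hw).mpr ⟨x n, (x n).2, hn⟩

lemma hasSum_pairing {w' : Module.Dual ℂ W} (hw : w' ∈ G.gradedDual) (x : G.Completion) :
    HasSum (fun n => w' (x n)) (G.pairing w' x) := by
  obtain ⟨s, hs, h⟩ := G.pairing_support hw
  rw [h]
  exact hasSum_sum_of_ne_finset_zero fun n hn => hs n hn _ (x n).2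

lemma pairing_add {w' : Module.Dual ℂ W} (hw : w' ∈ G.gradedDual) (x y : G.Completion) :
    G.pairing w' (x + y) = G.pairing w' x + G.pairing w' y :=
  (G.hasSum_pairing hw _).unique (by
    simpa using (G.hasSum_pairing hw x).add (G.hasSum_pairing hw y))

lemma pairing_smul {w' : Module.Dual ℂ W} (hw : w' ∈ G.gradedDual) (c : ℂ) (x : G.Completion) :
    G.pairing w' (c • x) = c * G.pairing w' x :=
  (G.hasSum_pairing hw _).unique (by simpa using (G.hasSum_pairing hw x).mul_left c)

lemma pairing_sub {w' : Module.Dual ℂ W} (hw : w' ∈ G.gradedDual) (x y : G.Completion) :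
    G.pairing w' (x - y) = G.pairing w' x - G.pairing w' y :=
  (G.hasSum_pairing hw _).unique (by
    simpa using (G.hasSum_pairing hw x).sub (G.hasSum_pairing hw y))

lemma pairing_comp_proj (φ : Module.Dual ℂ W) (n : ℤ) (x : G.Completion) :
    G.pairing (φ.comp (G.proj n)) x = φ (x n) := by
  refine (G.hasSum_pairing (G.comp_proj_mem_gradedDual φ n) x).unique ?_
  have := hasSum_single (f := fun m => (φ.comp (G.proj n)) (x m : W)) n (fun m hm => by
    simp [G.proj_of_mem_ne (x m).2 hm])
  simpa [G.proj_of_mem (x n).2] using this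

lemma completion_ext {x y : G.Completion}
    (h : ∀ w' ∈ G.gradedDual, G.pairing w' x = G.pairing w' y) : x = y := by
  funext n
  refine Subtype.ext ?_
  rw [← sub_eq_zero, ← Module.forall_dual_apply_eq_zero_iff ℂ]
  intro φ
  have := h _ (G.comp_proj_mem_gradedDual φ n)
  rw [pairing_comp_proj, pairing_comp_proj] at this
  rw [map_sub, this, sub_self]

lemma eq_sum_comp_proj {w' : Module.Dual ℂ W} {s : Finset ℤ}
    (hs : ∀ n ∉ s, ∀ x ∈ G.gr n, w' x = 0) : w' = ∑ n ∈ s, w'.comp (G.proj n) := by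
  ext x
  induction x using G.induction with
  | hom m x hx =>
    simp only [LinearMap.sum_apply, LinearMap.comp_apply]
    by_cases hm : m ∈ s
    · rw [Finset.sum_eq_single m, G.proj_of_mem hx]
      · intro b _ hb; rw [G.proj_of_mem_ne hx hb.symm, map_zero]
      · exact fun h => absurd hm h
    · rw [hs m hm x hx, Finset.sum_eq_zero]
      intro b hb
      rw [G.proj_of_mem_ne hx (by rintro rfl; exact hm hb), map_zero]
  | add x y hx hy => simp only [map_add, hx, hy]

variable {G} in
-- A functional in the graded dual is a finite sum of functionals supported in a single degree.
-- Against such a functional the multi-index mode series of homogeneous vectors lose one free index.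
lemma gradedDual_induction {p : Module.Dual ℂ W → Prop}
    (hom : ∀ n φ, (∀ m ≠ n, ∀ x ∈ G.gr m, φ x = 0) → p φ)
    (add : ∀ a b, a ∈ G.gradedDual → b ∈ G.gradedDual → p a → p b → p (a + b))
    {w' : Module.Dual ℂ W} (hw : w' ∈ G.gradedDual) : p w' := by
  classical
  obtain ⟨s, hs, -⟩ := G.pairing_support hw
  rw [G.eq_sum_comp_proj hs]
  suffices h : ∀ t : Finset ℤ, (∑ n ∈ t, w'.comp (G.proj n)) ∈ G.gradedDual ∧
      p (∑ n ∈ t, w'.comp (G.proj n)) from (h s).2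
  intro t
  induction t using Finset.induction_on with
  | empty => simpa using ⟨G.zero_mem_gradedDual, hom 0 0 (by simp)⟩
  | insert i t hi ih =>
    rw [Finset.sum_insert hi]
    have h1 := G.comp_proj_mem_gradedDual w' i
    refine ⟨G.add_mem_gradedDual h1 ih.1, add _ _ h1 ih.1 (hom i _ ?_) ih.2⟩
    intro m hm x hx
    simp [G.proj_of_mem_ne hx hm]

lemma mem_gradedDual_of_hom {n : ℤ} {φ : Module.Dual ℂ W}
    (h : ∀ m ≠ n, ∀ x ∈ G.gr m, φ x = 0) : φ ∈ G.gradedDual :=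
  G.mem_gradedDual_iff.mpr ⟨n + 1, fun m hm x hx => h m (by lia) x hx⟩

/-- A linear functional on the graded dual is given by an element of the completion. -/
lemma exists_completion (l : Module.Dual ℂ W → ℂ)
    (add : ∀ a ∈ G.gradedDual, ∀ b ∈ G.gradedDual, l (a + b) = l a + l b)
    (smul : ∀ (c : ℂ), ∀ a ∈ G.gradedDual, l (c • a) = c * l a) :
    ∃ x : G.Completion, ∀ w' ∈ G.gradedDual, G.pairing w' x = l w' := by
  have hmem (n : ℤ) (φ : Module.Dual ℂ (G.gr n)) : φ.comp (G.component n) ∈ G.gradedDual :=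
    G.mem_gradedDual_of_hom (n := n) fun m hm x hx => by
      simp [G.component_of_mem_ne hx hm]
  let ev (n : ℤ) : Module.Dual ℂ (Module.Dual ℂ (G.gr n)) :=
    { toFun := fun φ => l (φ.comp (G.component n))
      map_add' := fun a b => by
        rw [LinearMap.add_comp, add _ (hmem n a) _ (hmem n b)]
      map_smul' := fun c a => by
        rw [LinearMap.smul_comp, smul _ _ (hmem n a)]; rfl }
  have fin (n : ℤ) : FiniteDimensional ℂ (G.gr n) := G.finite n
  -- Finite-dimensionality enters here: an element of the double dual of `gr n` is evaluation at a
  -- vector.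
  let x : G.Completion := fun n => (Module.evalEquiv ℂ (G.gr n)).symm (ev n)
  have hx (n : ℤ) (φ : Module.Dual ℂ (G.gr n)) : φ (x n) = l (φ.comp (G.component n)) := by
    have : Module.evalEquiv ℂ (G.gr n) (x n) φ = ev n φ := by simp [x]
    exact this
  refine ⟨x, fun w' hw => ?_⟩
  obtain ⟨s, hs, h⟩ := G.pairing_support hw
  rw [h]
  have hsum : ∀ t : Finset ℤ, l (∑ n ∈ t, w'.comp (G.proj n)) = ∑ n ∈ t, w' (x n) := by
    classical
    intro t
    induction t using Finset.induction_on with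
    | empty =>
      have := smul 0 0 G.zero_mem_gradedDual
      simpa using this
    | insert i t hi ih =>
      rw [Finset.sum_insert hi, Finset.sum_insert hi, add _ (G.comp_proj_mem_gradedDual w' i) _
        (G.sum_mem_gradedDual _ _ fun n _ => G.comp_proj_mem_gradedDual w' n), ih]
      congr 1
      exact (hx i (w'.comp (G.gr i).subtype)).symm
  rw [← hsum s, ← G.eq_sum_comp_proj hs]

/-- The element of the completion with prescribed matrix elements (`0` if there is none). -/
def ofFunctional (l : Module.Dual ℂ W → ℂ) : G.Completion :=
  open Classical in
  if h : ∃ x : G.Completion, ∀ w' ∈ G.gradedDual, G.pairing w' x = l w' then h.choose else 0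

lemma pairing_ofFunctional (l : Module.Dual ℂ W → ℂ)
    (add : ∀ a ∈ G.gradedDual, ∀ b ∈ G.gradedDual, l (a + b) = l a + l b)
    (smul : ∀ (c : ℂ), ∀ a ∈ G.gradedDual, l (c • a) = c * l a)
    {w' : Module.Dual ℂ W} (hw : w' ∈ G.gradedDual) : G.pairing w' (G.ofFunctional l) = l w' := by
  have h := G.exists_completion l add smul
  rw [ofFunctional, dif_pos h]
  exact h.choose_spec w' hw

end Grading

/-- `elementE` is a choice with default value `0`. Since the graded dual separates points of the
completion, any candidate with the right matrix elements is the chosen one. -/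
lemma elementE_eq {V : Type*} [AddCommGroup V] [Module ℂ V] {W : Type*} [AddCommGroup W]
    [Module ℂ W] {G : Grading W} {mode : ℤ → V →ₗ[ℂ] W →ₗ[ℂ] W} {l : ℕ} {v : Fin l → V} {w : W}
    {z : Fin l → ℂ} {x : G.Completion} (h : ∀ w' ∈ G.gradedDual,
      G.pairing w' x = ratExt (radialRegion l) (productSeries mode w' l v w) z) :
    elementE G mode l v w z = x := by
  have h' : ∃ x : G.Completion, ∀ w' ∈ G.gradedDual,
      G.pairing w' x = ratExt (radialRegion l) (productSeries mode w' l v w) z := ⟨x, h⟩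
  rw [elementE, dif_pos h']
  exact G.completion_ext fun w' hw => by rw [h'.choose_spec w' hw, h w' hw]

/-! ### Rational functions with prescribed poles -/

section Rational

open MvPolynomial

variable {ι : Type*}

lemma MvPolynomial.eq_of_eventually [Finite ι] {P Q : MvPolynomial ι ℂ} {z₀ : ι → ℂ}
    (h : ∀ᶠ z in 𝓝 z₀, eval z P = eval z Q) : P = Q := by
  cases nonempty_fintype ι
  obtain ⟨ε, hε, h⟩ := Metric.eventually_nhds_iff_ball.mp h
  refine funext_set (fun i => Metric.ball (z₀ i) ε)
    (fun i => infinite_of_mem_nhds (z₀ i) (Metric.ball_mem_nhds _ hε)) fun x hx => h x ?_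
  rw [Metric.mem_ball, dist_pi_lt_iff hε]
  exact fun i => hx i trivial

lemma MvPolynomial.continuous_eval' (P : MvPolynomial ι ℂ) :
    Continuous fun z : ι → ℂ => eval z P := P.continuous_eval

/-- Two fractions that represent `f` on `D` have equal cross products near the interior point `z₀`,
hence identically; so the chosen value at `z` does not depend on the fraction. -/
lemma ratExt_eq [Finite ι] {D : Set (ι → ℂ)} {f : (ι → ℂ) → ℂ} {P Q : MvPolynomial ι ℂ}
    {z z₀ : ι → ℂ} (hD : D ∈ 𝓝 z₀) (hz : eval z Q ≠ 0)
    (h : ∀ x ∈ D, eval x Q * f x = eval x P) : ratExt D f z = eval z P / eval z Q := by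
  have hex : ∃ c : ℂ, ∃ P Q : MvPolynomial ι ℂ, MvPolynomial.eval z Q ≠ 0 ∧
      c = MvPolynomial.eval z P / MvPolynomial.eval z Q ∧
      ∀ x ∈ D, MvPolynomial.eval x Q * f x = MvPolynomial.eval x P := ⟨_, P, Q, hz, rfl, h⟩
  rw [ratExt, dif_pos hex]
  obtain ⟨P', Q', hz', hc, h'⟩ := hex.choose_spec
  rw [hc]
  have key : P' * Q = P * Q' := by
    refine MvPolynomial.eq_of_eventually (z₀ := z₀) ?_
    filter_upwards [hD] with x hx
    rw [map_mul, map_mul, ← h x hx, ← h' x hx]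
    ring
  rw [div_eq_div_iff hz' hz, ← map_mul, key, map_mul]

/-- The function `f` agrees where `Δ ≠ 0` with a rational function whose denominator is a power
of `Δ`. -/
def RatOn (Δ : MvPolynomial ι ℂ) (f : (ι → ℂ) → ℂ) : Prop :=
  ∃ (P : MvPolynomial ι ℂ) (N : ℕ), ∀ z, eval z Δ ≠ 0 → f z = eval z P / eval z Δ ^ N

namespace RatOn

variable {Δ : MvPolynomial ι ℂ} {f g : (ι → ℂ) → ℂ}

lemma congr (hf : RatOn Δ f) (h : ∀ z, eval z Δ ≠ 0 → g z = f z) : RatOn Δ g := by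
  obtain ⟨P, N, hP⟩ := hf
  exact ⟨P, N, fun z hz => (h z hz).trans (hP z hz)⟩

lemma polynomial (P : MvPolynomial ι ℂ) : RatOn Δ fun z => eval z P := ⟨P, 0, fun z _ => by simp⟩

lemma const (c : ℂ) : RatOn Δ fun _ => c := (polynomial (C c)).congr (by simp)

lemma coord (i : ι) : RatOn Δ fun z => z i := (polynomial (X i)).congr (by simp)

lemma add (hf : RatOn Δ f) (hg : RatOn Δ g) : RatOn Δ fun z => f z + g z := by
  obtain ⟨P, N, hP⟩ := hf
  obtain ⟨Q, M, hQ⟩ := hg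
  refine ⟨P * Δ ^ M + Q * Δ ^ N, N + M, fun z hz => ?_⟩
  beta_reduce
  rw [hP z hz, hQ z hz]
  simp only [map_add, map_mul, map_pow]
  rw [pow_add]
  field_simp

lemma mul (hf : RatOn Δ f) (hg : RatOn Δ g) : RatOn Δ fun z => f z * g z := by
  obtain ⟨P, N, hP⟩ := hf
  obtain ⟨Q, M, hQ⟩ := hg
  refine ⟨P * Q, N + M, fun z hz => ?_⟩
  beta_reduce
  rw [hP z hz, hQ z hz]
  simp only [map_mul]
  rw [pow_add]
  field_simp

lemma pow (hf : RatOn Δ f) (n : ℕ) : RatOn Δ fun z => f z ^ n := by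
  induction n with
  | zero => simpa using const 1
  | succ n ih => exact (ih.mul hf).congr fun z _ => pow_succ _ _

lemma sum {κ : Type*} (s : Finset κ) {f : κ → (ι → ℂ) → ℂ} (hf : ∀ k ∈ s, RatOn Δ (f k)) :
    RatOn Δ fun z => ∑ k ∈ s, f k z := by
  classical
  induction s using Finset.induction_on with
  | empty => simpa using const 0
  | insert k s hk ih =>
    refine ((hf k (by simp)).add (ih fun j hj => hf j (by simp [hj]))).congr fun z _ => ?_
    rw [Finset.sum_insert hk]

lemma inv_of_dvd {A : MvPolynomial ι ℂ} (h : A ∣ Δ) : RatOn Δ fun z => (eval z A)⁻¹ := by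
  obtain ⟨B, rfl⟩ := h
  refine ⟨B, 1, fun z hz => ?_⟩
  rw [map_mul] at hz ⊢
  have := left_ne_zero_of_mul hz
  have := right_ne_zero_of_mul hz
  field_simp

lemma zpow_of_dvd {A : MvPolynomial ι ℂ} (h : A ∣ Δ) (n : ℤ) :
    RatOn Δ fun z => eval z A ^ n := by
  cases n with
  | ofNat n => simpa using (polynomial A).pow n
  | negSucc n => simpa [zpow_negSucc] using (inv_of_dvd h).pow (n + 1)

lemma mono (hf : RatOn Δ f) {Δ' : MvPolynomial ι ℂ} (h : Δ ∣ Δ') : RatOn Δ' f := by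
  obtain ⟨P, N, hP⟩ := hf
  refine ((polynomial P).mul ((inv_of_dvd h).pow N)).congr fun z hz => ?_
  have : eval z Δ ≠ 0 := by
    obtain ⟨B, rfl⟩ := h
    rw [map_mul] at hz
    exact left_ne_zero_of_mul hz
  rw [hP z this, inv_pow, div_eq_mul_inv]

lemma comp {κ : Type*} (hf : RatOn Δ f) (φ : ι → MvPolynomial κ ℂ) :
    RatOn (bind₁ φ Δ) fun z => f fun i => eval z (φ i) := by
  obtain ⟨P, N, hP⟩ := hf
  have h (z : κ → ℂ) (Q : MvPolynomial ι ℂ) :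
      eval z (bind₁ φ Q) = eval (fun i => eval z (φ i)) Q := by
    change eval₂Hom (RingHom.id ℂ) z (bind₁ φ Q) = _
    rw [eval₂Hom_bind₁]
    rfl
  refine ⟨bind₁ φ P, N, fun z hz => ?_⟩
  rw [h] at hz ⊢
  refine (hP _ hz).trans ?_
  rw [h]

lemma eq_of_eventually [Finite ι] (hf : RatOn Δ f) (hg : RatOn Δ g) {z₀ : ι → ℂ}
    (h : ∀ᶠ z in 𝓝 z₀, f z = g z) {z : ι → ℂ} (hz : eval z Δ ≠ 0) : f z = g z := by
  obtain ⟨P, N, hP⟩ := hf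
  obtain ⟨Q, M, hQ⟩ := hg
  -- The extra factor `Δ` makes the identity trivial on the zero locus of `Δ`, where `f` and `g` are
  -- not controlled; it is cancelled afterwards.
  have key : Δ * (P * Δ ^ M) = Δ * (Q * Δ ^ N) := by
    refine MvPolynomial.eq_of_eventually (z₀ := z₀) ?_
    filter_upwards [h] with x hx
    simp only [map_mul, map_pow]
    by_cases h0 : eval x Δ = 0
    · simp [h0]
    · rw [hP x h0, hQ x h0, div_eq_div_iff (pow_ne_zero _ h0) (pow_ne_zero _ h0)] at hx
      rw [hx]
  have hΔ : Δ ≠ 0 := by rintro rfl; simp at hz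
  have key' := mul_left_cancel₀ hΔ key
  rw [hP z hz, hQ z hz, div_eq_div_iff (pow_ne_zero _ hz) (pow_ne_zero _ hz), ← map_pow, ← map_pow,
    ← map_mul, ← map_mul, key']

lemma ratExt_eq [Finite ι] (hf : RatOn Δ f) {D : Set (ι → ℂ)} {z₀ : ι → ℂ} (hD : D ∈ 𝓝 z₀)
    (h : ∀ x ∈ D, eval x Δ ≠ 0 ∧ g x = f x) {z : ι → ℂ} (hz : eval z Δ ≠ 0) :
    ratExt D g z = f z := by
  obtain ⟨P, N, hP⟩ := hf
  rw [_root_.ratExt_eq (P := P) (Q := Δ ^ N) hD (by simpa using fun h => absurd h hz), hP z hz,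
    map_pow]
  intro x hx
  rw [(h x hx).2, hP x (h x hx).1, map_pow]
  have := (h x hx).1
  field_simp

lemma hasDerivAt_eval [Fintype ι] (P : MvPolynomial ι ℂ) (z d : ι → ℂ) :
    HasDerivAt (fun t : ℂ => eval (fun i => z i + t * d i) P)
      (eval z (∑ i, C (d i) * pderiv i P)) 0 := by
  classical
  induction P using MvPolynomial.induction_on with
  | C a => simpa using hasDerivAt_const (0 : ℂ) a
  | add p q hp hq =>
    simpa [mul_add, Finset.sum_add_distrib] using hp.fun_add hq
  | mul_X p j hp =>
    have hj : HasDerivAt (fun t : ℂ => z j + t * d j) (d j) 0 := by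
      simpa using ((hasDerivAt_id (0 : ℂ)).mul_const (d j)).const_add (z j)
    have := hp.fun_mul hj
    refine (this.congr_deriv ?_).congr_of_eventuallyEq (by simp)
    have h1 : ∀ i, C (d i) * pderiv i (p * X j) =
        C (d i) * pderiv i p * X j + p * (C (d i) * (Pi.single i 1 : ι → MvPolynomial ι ℂ) j) := by
      intro i
      rw [Derivation.leibniz, pderiv_X, smul_eq_mul, smul_eq_mul]
      ring
    have h2 : ∑ i, C (d i) * (Pi.single i 1 : ι → MvPolynomial ι ℂ) j = C (d j) := by
      rw [Finset.sum_eq_single j (fun b _ hb => by simp [hb.symm]) (by simp)]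
      simp
    rw [Finset.sum_congr rfl fun i _ => h1 i, Finset.sum_add_distrib, ← Finset.sum_mul,
      ← Finset.mul_sum, h2]
    simp

lemma exists_hasDerivAt [Fintype ι] (hf : RatOn Δ f) (d : ι → ℂ) :
    ∃ f', RatOn Δ f' ∧ ∀ z, eval z Δ ≠ 0 →
      HasDerivAt (fun t : ℂ => f fun i => z i + t * d i) (f' z) 0 := by
  obtain ⟨P, N, hP⟩ := hf
  set D := fun Q : MvPolynomial ι ℂ => ∑ i, C (d i) * pderiv i Q with hD
  refine ⟨fun z => eval z (D P * Δ ^ N - P * D (Δ ^ N)) / eval z Δ ^ (N * 2),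
    ⟨_, _, fun z _ => rfl⟩, fun z hz => ?_⟩
  have h1 := hasDerivAt_eval P z d
  have h2 := hasDerivAt_eval (Δ ^ N) z d
  have h3 := h1.fun_div h2 (by simpa using fun h => absurd h hz)
  have hne : ∀ᶠ t in 𝓝 (0 : ℂ), eval (fun i => z i + t * d i) Δ ≠ 0 := by
    have hc : Continuous fun t : ℂ => eval (fun i => z i + t * d i) Δ :=
      Δ.continuous_eval.comp (by fun_prop)
    exact hc.continuousAt.eventually_ne (by simpa using hz)
  refine (h3.congr_deriv ?_).congr_of_eventuallyEq ?_
  · simp [hD, pow_mul]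
  · filter_upwards [hne] with t ht
    rw [hP _ ht, map_pow]

end RatOn

end Rational

/-! ### Power series in one variable -/

section PowerSeries

/-- The hypothesis says nothing at `0`, where the functions used below carry a default value or a
cancelled pole; the value there is therefore replaced by the constant coefficient. -/
lemma hasFPowerSeriesAt_update {a : ℕ → ℂ} {f : ℂ → ℂ}
    (ha : ∀ᶠ t in 𝓝[≠] (0 : ℂ), HasSum (fun j => a j * t ^ j) (f t)) :
    HasFPowerSeriesAt (Function.update f 0 (a 0)) (FormalMultilinearSeries.ofScalars ℂ a) 0 := by
  rw [hasFPowerSeriesAt_iff]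
  rw [eventually_nhdsWithin_iff] at ha
  filter_upwards [ha] with t ht
  simp only [FormalMultilinearSeries.coeff_ofScalars, smul_eq_mul, zero_add]
  by_cases h0 : t = 0
  · subst h0
    have := hasSum_single (f := fun j => (0 : ℂ) ^ j * a j) 0 (fun j hj => by simp [hj])
    simpa using this
  · rw [Function.update_of_ne h0]
    simpa [mul_comm] using ht h0

lemma eq_coeff_zero {a : ℕ → ℂ} {f : ℂ → ℂ}
    (ha : ∀ᶠ t in 𝓝[≠] (0 : ℂ), HasSum (fun j => a j * t ^ j) (f t)) (hf : ContinuousAt f 0) :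
    f 0 = a 0 := by
  have h1 := (hasFPowerSeriesAt_update ha).continuousAt
  have h2 : f =ᶠ[𝓝[≠] 0] Function.update f 0 (a 0) := by
    filter_upwards [self_mem_nhdsWithin] with t ht
    rw [Function.update_of_ne ht]
  have := ((hf.eventuallyEq_nhds_iff_eventuallyEq_nhdsNE h1).mp h2).self_of_nhds
  simpa using this

lemma hasSum_pow_unique {a b : ℕ → ℂ} {f : ℂ → ℂ}
    (ha : ∀ᶠ t in 𝓝[≠] (0 : ℂ), HasSum (fun j => a j * t ^ j) (f t))
    (hb : ∀ᶠ t in 𝓝[≠] (0 : ℂ), HasSum (fun j => b j * t ^ j) (f t)) : a = b := by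
  have h1 := hasFPowerSeriesAt_update ha
  have h2 := hasFPowerSeriesAt_update hb
  have h3 : Function.update f 0 (a 0) =ᶠ[𝓝[≠] 0] Function.update f 0 (b 0) := by
    filter_upwards [self_mem_nhdsWithin] with t ht
    rw [Function.update_of_ne ht, Function.update_of_ne ht]
  have h4 := h1.eq_formalMultilinearSeries_of_eventually h2
    ((h1.continuousAt.eventuallyEq_nhds_iff_eventuallyEq_nhdsNE h2.continuousAt).mp h3)
  funext n
  rw [← FormalMultilinearSeries.coeff_ofScalars (p := a), h4,
    FormalMultilinearSeries.coeff_ofScalars]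

/-- The iterated derivatives of the holomorphic function `h 0` at the origin are the `h k 0`. In the
applications `h k` is a matrix element with `L(-1)^k` inserted, so the lemma sums the exponential
`e^{sL(-1)}` in a whole disc without rearranging series. -/
lemma hasSum_taylor {h : ℕ → ℂ → ℂ} {R : ℝ}
    (H : ∀ k, ∀ s, ‖s‖ < R → HasDerivAt (h k) (h (k + 1) s) s) {s : ℂ} (hs : ‖s‖ < R) :
    HasSum (fun k : ℕ => s ^ k / (k.factorial : ℂ) * h k 0) (h 0 s) := by
  have hmem {x : ℂ} : x ∈ Metric.ball (0 : ℂ) R ↔ ‖x‖ < R := by simp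
  have hit : ∀ k j, ∀ x ∈ Metric.ball (0 : ℂ) R, iteratedDeriv k (h j) x = h (j + k) x := by
    intro k
    induction k with
    | zero => intro j x _; simp
    | succ k ih =>
      intro j x hx
      rw [iteratedDeriv_succ']
      have : deriv (h j) =ᶠ[𝓝 x] h (j + 1) := by
        filter_upwards [Metric.isOpen_ball.mem_nhds hx] with y hy
        exact (H j y (hmem.mp hy)).deriv
      rw [this.iteratedDeriv_eq k, ih (j + 1) x hx]
      congr 1
      lia
  have hd : DifferentiableOn ℂ (h 0) (Metric.ball 0 R) := fun x hx =>
    (H 0 x (hmem.mp hx)).differentiableAt.differentiableWithinAt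
  have := Complex.hasSum_taylorSeries_on_ball hd (hmem.mpr hs)
  refine this.congr_fun fun k => ?_
  rw [hit k 0 0 (by simpa using (norm_nonneg s).trans_lt hs), zero_add, sub_zero, smul_eq_mul,
    smul_eq_mul]
  ring

/-- The Taylor series of `f` converges in the disc of radius `R > 1`, and uniqueness near `0`
identifies its coefficients with `p`; hence `t = 1` is allowed. An expansion known only for small
scaling parameter is thereby carried to the unscaled point. -/
lemma hasSum_of_small {p : ℕ → ℂ} {f : ℂ → ℂ} {R : ℝ} (hR : 1 < R)
    (hf : DifferentiableOn ℂ f (Metric.ball 0 R))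
    (h : ∀ᶠ t in 𝓝[≠] (0 : ℂ), HasSum (fun i => p i * t ^ i) (f t)) : HasSum p (f 1) := by
  have ht : ∀ t ∈ Metric.ball (0 : ℂ) R,
      HasSum (fun n : ℕ => (iteratedDeriv n f 0 / (n.factorial : ℂ)) * t ^ n) (f t) := by
    intro t ht
    refine (Complex.hasSum_taylorSeries_on_ball hf ht).congr_fun fun n => ?_
    rw [sub_zero, smul_eq_mul, smul_eq_mul]
    ring
  have := hasSum_pow_unique h (eventually_nhdsWithin_of_eventually_nhds (by
    filter_upwards [Metric.ball_mem_nhds (0 : ℂ) (zero_lt_one.trans hR)] with t h1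
    exact ht t h1))
  have h1 := ht 1 (by simpa using hR)
  rw [this]
  simpa using h1

end PowerSeries

/-! ### Absolutely convergent double power series -/

section DoublePowerSeries

lemma hasSum_fiberwise {α β : Type*} {f : α → ℂ} {a : ℂ} (h : HasSum f a) (s : α → β) :
    HasSum (fun b => ∑' x : {x // s x = b}, f x) a := by
  rw [← (Equiv.sigmaFiberEquiv s).hasSum_iff] at h
  exact h.sigma fun b => (h.summable.sigma_factor b).hasSum

/-- `K` is given on `D` by an absolutely convergent double power series. -/
def HasDPS (D : Set (ℂ × ℂ)) (K : ℂ × ℂ → ℂ) : Prop :=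
  ∃ c : ℕ × ℕ → ℂ, ∀ p ∈ D, HasSum (fun i : ℕ × ℕ => c i * (p.1 ^ i.1 * p.2 ^ i.2)) (K p)

namespace HasDPS

variable {D : Set (ℂ × ℂ)} {K L : ℂ × ℂ → ℂ}

lemma congr (hK : HasDPS D K) (h : ∀ p ∈ D, L p = K p) : HasDPS D L := by
  obtain ⟨c, hc⟩ := hK
  exact ⟨c, fun p hp => h p hp ▸ hc p hp⟩

lemma monomial (i : ℕ × ℕ) : HasDPS D fun p => p.1 ^ i.1 * p.2 ^ i.2 := by
  classical
  refine ⟨Pi.single i 1, fun p _ => ?_⟩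
  have := hasSum_single (f := fun j : ℕ × ℕ =>
    (Pi.single i 1 : ℕ × ℕ → ℂ) j * (p.1 ^ j.1 * p.2 ^ j.2)) i (fun j hj => by simp [hj])
  simpa using this

lemma const (a : ℂ) : HasDPS D fun _ => a := by
  obtain ⟨c, hc⟩ := monomial (D := D) (0, 0)
  exact ⟨fun i => a * c i, fun p hp => by simpa [mul_assoc] using (hc p hp).mul_left a⟩

lemma fst : HasDPS D fun p => p.1 := (monomial (1, 0)).congr (by simp)

lemma snd : HasDPS D fun p => p.2 := (monomial (0, 1)).congr (by simp)

lemma add (hK : HasDPS D K) (hL : HasDPS D L) : HasDPS D fun p => K p + L p := by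
  obtain ⟨c, hc⟩ := hK
  obtain ⟨d, hd⟩ := hL
  exact ⟨c + d, fun p hp => by simpa [add_mul] using (hc p hp).add (hd p hp)⟩

lemma mul (hK : HasDPS D K) (hL : HasDPS D L) : HasDPS D fun p => K p * L p := by
  obtain ⟨c, hc⟩ := hK
  obtain ⟨d, hd⟩ := hL
  refine ⟨fun n => ∑' x : {x : (ℕ × ℕ) × (ℕ × ℕ) // x.1 + x.2 = n}, c x.1.1 * d x.1.2,
    fun p hp => ?_⟩
  have h0 : Summable fun x : (ℕ × ℕ) × (ℕ × ℕ) =>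
      (c x.1 * (p.1 ^ x.1.1 * p.2 ^ x.1.2)) * (d x.2 * (p.1 ^ x.2.1 * p.2 ^ x.2.2)) :=
    summable_mul_of_summable_norm (R := ℂ)
      (f := fun i : ℕ × ℕ => c i * (p.1 ^ i.1 * p.2 ^ i.2))
      (g := fun i : ℕ × ℕ => d i * (p.1 ^ i.1 * p.2 ^ i.2))
      (by exact (hc p hp).summable.norm) (by exact (hd p hp).summable.norm)
  have h1 := HasSum.mul (hc p hp) (hd p hp) h0
  refine (hasSum_fiberwise h1 fun x => x.1 + x.2).congr_fun fun n => ?_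
  rw [← tsum_mul_right]
  refine tsum_congr fun x => ?_
  obtain ⟨x, rfl⟩ := x
  simp only [Prod.fst_add, Prod.snd_add, pow_add]
  ring

lemma sub (hK : HasDPS D K) (hL : HasDPS D L) : HasDPS D fun p => K p - L p :=
  (hK.add ((const (-1)).mul hL)).congr fun p _ => by ring

lemma pow (hK : HasDPS D K) (n : ℕ) : HasDPS D fun p => K p ^ n := by
  induction n with
  | zero => simpa using const 1
  | succ n ih => exact (ih.mul hK).congr fun p _ => pow_succ _ _

lemma eval {ι : Type*} {φ : ι → ℂ × ℂ → ℂ} (hφ : ∀ i, HasDPS D (φ i)) (P : MvPolynomial ι ℂ) :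
    HasDPS D fun p => MvPolynomial.eval (fun i => φ i p) P := by
  induction P using MvPolynomial.induction_on with
  | C a => simpa using const a
  | add p q hp hq => simpa using hp.add hq
  | mul_X p j hp => simpa using hp.mul (hφ j)

lemma inv_one_sub_mul (h : ∀ p ∈ D, ‖p.1 * p.2‖ < 1) : HasDPS D fun p => (1 - p.1 * p.2)⁻¹ := by
  refine ⟨fun i => if i.1 = i.2 then 1 else 0, fun p hp => ?_⟩
  have h1 := hasSum_geometric_of_norm_lt_one (h p hp)
  have hinj : Function.Injective fun n : ℕ => (n, n) := fun a b h => by simpa using h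
  rw [← hinj.hasSum_iff]
  · simpa [Function.comp_def, mul_pow] using h1
  · rintro ⟨i, j⟩ hij
    have : i ≠ j := fun h => hij ⟨i, by simp [h]⟩
    simp [this]

/-- The geometric series in `a x + b y` is expanded by the binomial theorem; the same computation
with norms gives `(‖a x‖ + ‖b y‖)^n` in each total degree and hence absolute convergence. -/
lemma inv_one_sub_add (a b : ℂ) (h : ∀ p ∈ D, ‖a * p.1‖ + ‖b * p.2‖ < 1) :
    HasDPS D fun p => (1 - (a * p.1 + b * p.2))⁻¹ := by
  refine ⟨fun i => (i.1 + i.2).choose i.1 * (a ^ i.1 * b ^ i.2), fun p hp => ?_⟩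
  have hbin (x y : ℂ) (n : ℕ) : ∑ i ∈ Finset.HasAntidiagonal.antidiagonal n, ((i.1 + i.2).choose i.1 : ℂ) *
      (x ^ i.1 * y ^ i.2) = (x + y) ^ n := by
    rw [(Commute.all x y).add_pow']
    refine Finset.sum_congr rfl fun i hi => ?_
    rw [Finset.HasAntidiagonal.mem_antidiagonal.mp hi, nsmul_eq_mul]
  have hbin' (x y : ℝ) (n : ℕ) : ∑ i ∈ Finset.HasAntidiagonal.antidiagonal n, ((i.1 + i.2).choose i.1 : ℝ) *
      (x ^ i.1 * y ^ i.2) = (x + y) ^ n := by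
    rw [(Commute.all x y).add_pow']
    refine Finset.sum_congr rfl fun i hi => ?_
    rw [Finset.HasAntidiagonal.mem_antidiagonal.mp hi, nsmul_eq_mul]
  set x := a * p.1 with hx
  set y := b * p.2 with hy
  have hsum : Summable fun i : ℕ × ℕ => ((i.1 + i.2).choose i.1 : ℂ) * (x ^ i.1 * y ^ i.2) := by
    refine Summable.of_norm ?_
    have : (fun i : ℕ × ℕ => ‖((i.1 + i.2).choose i.1 : ℂ) * (x ^ i.1 * y ^ i.2)‖) =
        fun i : ℕ × ℕ => ((i.1 + i.2).choose i.1 : ℝ) * (‖x‖ ^ i.1 * ‖y‖ ^ i.2) := by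
      funext i; simp
    rw [this, ← Finset.HasAntidiagonal.sigmaAntidiagonalEquivProd.summable_iff,
      summable_sigma_of_nonneg (fun _ => by simp; positivity)]
    refine ⟨fun n => Summable.of_finite, ?_⟩
    have h2 : (fun n => ∑' y_1 : ↥(Finset.HasAntidiagonal.antidiagonal n),
        ((fun i : ℕ × ℕ => ((i.1 + i.2).choose i.1 : ℝ) * (‖x‖ ^ i.1 * ‖y‖ ^ i.2)) ∘
          Finset.HasAntidiagonal.sigmaAntidiagonalEquivProd) ⟨n, y_1⟩) =
        fun n : ℕ => (‖x‖ + ‖y‖) ^ n := by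
      funext n
      rw [tsum_fintype, ← hbin', ← Finset.sum_coe_sort (Finset.HasAntidiagonal.antidiagonal n)]
      rfl
    rw [h2]
    exact summable_geometric_of_lt_one (by positivity) (h p hp)
  have hlt : ‖x + y‖ < 1 := (norm_add_le _ _).trans_lt (h p hp)
  have h3 := hsum.hasSum
  rw [← Finset.HasAntidiagonal.sigmaAntidiagonalEquivProd.hasSum_iff] at h3
  have h4 := h3.sigma (g := fun n : ℕ => (x + y) ^ n) (fun n => by
    rw [← hbin, ← Finset.sum_coe_sort]
    exact hasSum_fintype _)
  rw [h4.unique (hasSum_geometric_of_norm_lt_one hlt)] at h3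
  rw [← Finset.HasAntidiagonal.sigmaAntidiagonalEquivProd.hasSum_iff]
  refine h3.congr_fun fun i => ?_
  simp only [hx, hy, Function.comp_apply, mul_pow]
  ring

end HasDPS

lemma hasSum_antidiagonal {f : ℕ × ℕ → ℂ} {s : ℂ} (h : HasSum f s) :
    HasSum (fun n => ∑ i ∈ Finset.HasAntidiagonal.antidiagonal n, f i) s := by
  rw [← Finset.HasAntidiagonal.sigmaAntidiagonalEquivProd.hasSum_iff] at h
  refine h.sigma fun n => ?_
  rw [← Finset.sum_coe_sort]
  exact hasSum_fintype _

/-- An absolutely convergent double series may be summed first over one index, so its coefficients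
are those of the iterated expansion in `d` and then in `s`. Convergence, read off from a rational
formula, and coefficients, read off from modes, can thus be established separately. -/
lemma dps_coeff {c : ℕ × ℕ → ℂ} {K : ℂ × ℂ → ℂ} {ε : ℝ} (hε : 0 < ε)
    (hc : ∀ s d, ‖s‖ < ε → ‖d‖ < ε → HasSum (fun i : ℕ × ℕ => c i * (s ^ i.1 * d ^ i.2)) (K (s, d)))
    {κ : ℕ → ℕ → ℂ} {k : ℕ → ℂ → ℂ}
    (h1 : ∀ᶠ s in 𝓝[≠] (0 : ℂ), ∀ᶠ d in 𝓝[≠] (0 : ℂ), HasSum (fun j => k j s * d ^ j) (K (s, d)))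
    (h2 : ∀ j, ∀ᶠ s in 𝓝[≠] (0 : ℂ), HasSum (fun i => κ i j * s ^ i) (k j s)) (i j : ℕ) :
    c (i, j) = κ i j := by
  have hball : ∀ᶠ s in 𝓝[≠] (0 : ℂ), ‖s‖ < ε := eventually_nhdsWithin_of_eventually_nhds (by
    filter_upwards [Metric.ball_mem_nhds (0 : ℂ) hε] with t ht
    simpa using ht)
  -- Evaluating the double series at one fixed nonzero `d`, here `ε / 2`, and dividing by `d ^ j`
  -- shows that each row converges.
  have hrow : ∀ s, ‖s‖ < ε → ∀ j, Summable fun i => c (i, j) * s ^ i := by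
    intro s hs j
    have hd : ‖((ε / 2 : ℝ) : ℂ)‖ < ε := by
      rw [Complex.norm_real, Real.norm_of_nonneg (by positivity)]; linarith
    have hne : ((ε / 2 : ℝ) : ℂ) ≠ 0 := by
      rw [Complex.ofReal_ne_zero]; positivity
    have := (hc s _ hs hd).summable.comp_injective (i := fun i : ℕ => (i, j))
      (fun a b h => by simpa using h)
    refine (this.mul_right ((((ε / 2 : ℝ) : ℂ) ^ j)⁻¹)).congr fun i => ?_
    simp only [Function.comp_apply]
    field_simp
  have hk : ∀ j, ∀ᶠ s in 𝓝[≠] (0 : ℂ), HasSum (fun i => c (i, j) * s ^ i) (k j s) := by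
    intro j
    filter_upwards [h1, hball] with s hs1 hs2
    have : (fun j => ∑' i, c (i, j) * s ^ i) = fun j => k j s := by
      refine hasSum_pow_unique ?_ hs1
      filter_upwards [hball] with d hd
      have h3 := hc s d hs2 hd
      rw [← (Equiv.prodComm ℕ ℕ).hasSum_iff] at h3
      refine h3.prod_fiberwise fun j => ?_
      refine ((hrow s hs2 j).hasSum.mul_right (d ^ j)).congr_fun fun i => ?_
      simp only [Function.comp_apply, Equiv.prodComm_apply, Prod.swap_prod_mk]
      ring
    rw [← congrFun this j]
    exact (hrow s hs2 j).hasSum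
  exact congrFun (hasSum_pow_unique (hk j) (h2 j)) i

/-- A sum of homogeneous functions that converges to a double power series away from the axis
`y = 0` and the diagonal also converges on the axis. -/
lemma hasSum_on_axis {K : ℂ × ℂ → ℂ} {ρ : ℝ}
    (hK : HasDPS {p | ‖p.1‖ < ρ ∧ ‖p.2‖ < ρ} K) {p : ℕ → ℂ × ℂ → ℂ}
    (hp : ∀ i (t x y : ℂ), p i (t * x, t * y) = t ^ i * p i (x, y))
    (hcont : ∀ i, Continuous (p i))
    (h : ∀ x y, 0 < ‖x‖ → ‖x‖ < ρ → 0 < ‖y‖ → ‖y‖ < ρ → x ≠ y →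
      HasSum (fun i => p i (x, y)) (K (x, y))) {x : ℂ} (hx : 0 < ‖x‖) (hxρ : ‖x‖ < ρ) :
    HasSum (fun i => p i (x, 0)) (K (x, 0)) := by
  obtain ⟨c, hc⟩ := hK
  have hρ : 0 < ρ := hx.trans hxρ
  -- Grouping the double series by total degree gives forms `q n`. Scaling `(x, y)` by `t` turns
  -- both expansions into power series in `t`, so `p` and `q` agree off the axis and the diagonal;
  -- continuity in `y` then reaches `y = 0`.
  let q : ℕ → ℂ × ℂ → ℂ := fun n z => ∑ i ∈ Finset.HasAntidiagonal.antidiagonal n, c i * (z.1 ^ i.1 * z.2 ^ i.2)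
  have hq : ∀ i (t x y : ℂ), q i (t * x, t * y) = t ^ i * q i (x, y) := by
    intro n t x y
    simp only [q, Finset.mul_sum]
    refine Finset.sum_congr rfl fun i hi => ?_
    rw [← Finset.HasAntidiagonal.mem_antidiagonal.mp hi, pow_add, mul_pow, mul_pow]
    ring
  have hq1 : ∀ a b : ℂ, ‖a‖ < ρ → ‖b‖ < ρ → HasSum (fun i => q i (a, b)) (K (a, b)) :=
    fun a b ha hb => hasSum_antidiagonal (hc (a, b) ⟨ha, hb⟩)
  have hpq : ∀ y, 0 < ‖y‖ → ‖y‖ < ρ → x ≠ y → (fun i => p i (x, y)) = fun i => q i (x, y) := by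
    intro y hy hyρ hxy
    have hball : ∀ᶠ t in 𝓝[≠] (0 : ℂ), 0 < ‖t‖ ∧ ‖t‖ < 1 := by
      filter_upwards [self_mem_nhdsWithin, nhdsWithin_le_nhds (Metric.ball_mem_nhds (0 : ℂ)
        zero_lt_one)] with t h1 h2
      exact ⟨norm_pos_iff.mpr h1, by simpa using h2⟩
    have hlt : ∀ {t a : ℂ}, ‖t‖ < 1 → ‖a‖ < ρ → ‖t * a‖ < ρ := by
      intro t a ht ha
      rw [norm_mul]
      nlinarith [norm_nonneg t, norm_nonneg a]
    refine hasSum_pow_unique (f := fun t => K (t * x, t * y)) ?_ ?_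
    · filter_upwards [hball] with t ht
      have := h (t * x) (t * y) (by rw [norm_mul]; exact mul_pos ht.1 hx) (hlt ht.2 hxρ)
        (by rw [norm_mul]; exact mul_pos ht.1 hy) (hlt ht.2 hyρ)
        (fun h => hxy (mul_left_cancel₀ (norm_pos_iff.mp ht.1) h))
      exact this.congr_fun fun i => by rw [hp, mul_comm]
    · filter_upwards [hball] with t ht
      have := hq1 (t * x) (t * y) (hlt ht.2 hxρ) (hlt ht.2 hyρ)
      exact this.congr_fun fun i => by rw [hq, mul_comm]
  have hfin : ∀ i, p i (x, 0) = q i (x, 0) := by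
    intro i
    have h1 : Continuous fun y : ℂ => p i (x, y) := (hcont i).comp (by fun_prop)
    have h2 : Continuous fun y : ℂ => q i (x, y) := by
      simp only [q]; fun_prop
    refine ((h1.continuousAt.eventuallyEq_nhds_iff_eventuallyEq_nhdsNE h2.continuousAt).mp
      ?_).self_of_nhds
    filter_upwards [self_mem_nhdsWithin, nhdsWithin_le_nhds (Metric.ball_mem_nhds (0 : ℂ) hx)]
      with y h3 h4
    have h4 : ‖y‖ < ‖x‖ := by simpa using h4
    exact congrFun (hpq y (norm_pos_iff.mpr h3) (h4.trans hxρ) (by rintro rfl; exact h4.false)) i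
  simp only [hfin]
  exact hq1 x 0 hxρ (by simpa using hρ)

end DoublePowerSeries

/-! ### Graded spaces with a translation operator -/

/-- A graded space with an operator `L = L(-1)` of weight one. -/
structure TGrading (W : Type*) [AddCommGroup W] [Module ℂ W] extends Grading W where
  /-- the operator `L(-1)` -/
  L : W →ₗ[ℂ] W
  L_mem : ∀ n, ∀ x ∈ gr n, L x ∈ gr (n + 1)

namespace TGrading

variable {W : Type*} [AddCommGroup W] [Module ℂ W] (G : TGrading W)

lemma pow_mem (k : ℕ) {n : ℤ} {x : W} (hx : x ∈ G.gr n) : (G.L ^ k) x ∈ G.gr (n + k) := by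
  induction k with
  | zero => simpa using hx
  | succ k ih =>
    rw [pow_succ', Module.End.mul_apply]
    have := G.L_mem _ _ ih
    rwa [show n + ((k + 1 : ℕ) : ℤ) = n + k + 1 by push_cast; ring]

lemma pow_succ_apply (k : ℕ) (x : W) : (G.L ^ (k + 1)) x = (G.L ^ k) (G.L x) := by
  rw [pow_succ, Module.End.mul_apply]

lemma pow_succ_apply' (k : ℕ) (x : W) : (G.L ^ (k + 1)) x = G.L ((G.L ^ k) x) := by
  rw [pow_succ', Module.End.mul_apply]

lemma comp_L_mem {w' : Module.Dual ℂ W} (hw : w' ∈ G.gradedDual) :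
    w'.comp G.L ∈ G.gradedDual := Grading.comp_mem_gradedDual hw G.L 1 G.L_mem

lemma comp_pow_mem {w' : Module.Dual ℂ W} (hw : w' ∈ G.gradedDual) (k : ℕ) :
    w'.comp (G.L ^ k) ∈ G.gradedDual :=
  Grading.comp_mem_gradedDual hw (G.L ^ k) k fun _ _ hx => G.pow_mem k hx

/-- `L` raises degrees by one, while the space vanishes in low degrees and `w'` in high degrees.
Hence `⟨w', e^{zL(-1)} x⟩` is a polynomial in `z` of degree bounded independently of `x`. -/
lemma exists_comp_pow_eq_zero {w' : Module.Dual ℂ W} (hw : w' ∈ G.gradedDual) :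
    ∃ K : ℕ, ∀ k ≥ K, w'.comp (G.L ^ k) = 0 := by
  obtain ⟨N, hN⟩ := G.mem_gradedDual_iff.mp hw
  obtain ⟨N₀, hN₀⟩ := G.exists_lower
  refine ⟨(N - N₀).toNat, fun k hk => ?_⟩
  ext x
  induction x using Grading.induction (G := G.toGrading) with
  | hom n x hx =>
    by_cases hn : n < N₀
    · rw [hN₀ n hn x hx, map_zero, map_zero]
    · exact hN (n + k) (by lia) _ (G.pow_mem k hx)
  | add x y hx hy => rw [map_add, hx, hy, map_add]

/-- The functional `w' ∘ e^{z L(-1)}`. -/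
def expDual (w' : Module.Dual ℂ W) (z : ℂ) : Module.Dual ℂ W :=
  ∑ᶠ k : ℕ, (z ^ k / (k.factorial : ℂ)) • w'.comp (G.L ^ k)

lemma expDual_eq_sum {w' : Module.Dual ℂ W} {K : ℕ} (hK : ∀ k ≥ K, w'.comp (G.L ^ k) = 0)
    (z : ℂ) : G.expDual w' z =
      ∑ k ∈ Finset.range K, (z ^ k / (k.factorial : ℂ)) • w'.comp (G.L ^ k) := by
  refine finsum_eq_sum_of_support_subset _ fun k hk => ?_
  simp only [Finset.coe_range, Set.mem_Iio]
  by_contra h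
  exact hk (by simp [hK k (not_lt.mp h)])

lemma hasSum_expDual {w' : Module.Dual ℂ W} (hw : w' ∈ G.gradedDual) (z : ℂ) (x : W) :
    HasSum (fun k : ℕ => z ^ k / (k.factorial : ℂ) * w' ((G.L ^ k) x)) (G.expDual w' z x) := by
  obtain ⟨K, hK⟩ := G.exists_comp_pow_eq_zero hw
  rw [G.expDual_eq_sum hK, LinearMap.sum_apply]
  refine hasSum_sum_of_ne_finset_zero (f := fun k : ℕ =>
    z ^ k / (k.factorial : ℂ) * w' ((G.L ^ k) x)) fun k hk => ?_
  have := LinearMap.congr_fun (hK k (by simpa using hk)) x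
  rw [LinearMap.comp_apply] at this
  rw [this]
  simp

lemma expDual_mem {w' : Module.Dual ℂ W} (hw : w' ∈ G.gradedDual) (z : ℂ) :
    G.expDual w' z ∈ G.gradedDual := by
  obtain ⟨K, hK⟩ := G.exists_comp_pow_eq_zero hw
  rw [G.expDual_eq_sum hK]
  exact G.sum_mem_gradedDual _ _ fun k _ => G.smul_mem_gradedDual _ (G.comp_pow_mem hw k)

lemma expDual_zero {w' : Module.Dual ℂ W} (hw : w' ∈ G.gradedDual) : G.expDual w' 0 = w' := by
  ext x
  refine (G.hasSum_expDual hw 0 x).unique ?_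
  have := hasSum_single (f := fun k : ℕ => (0 : ℂ) ^ k / (k.factorial : ℂ) * w' ((G.L ^ k) x)) 0
    (fun k hk => by simp [hk])
  simpa using this

lemma expDual_add_dual {a b : Module.Dual ℂ W} (ha : a ∈ G.gradedDual) (hb : b ∈ G.gradedDual)
    (z : ℂ) : G.expDual (a + b) z = G.expDual a z + G.expDual b z := by
  ext x
  refine (G.hasSum_expDual (G.add_mem_gradedDual ha hb) z x).unique ?_
  exact ((G.hasSum_expDual ha z x).add (G.hasSum_expDual hb z x)).congr_fun fun k => by
    simp [mul_add]

lemma expDual_smul_dual {a : Module.Dual ℂ W} (c : ℂ) (ha : a ∈ G.gradedDual) (z : ℂ) :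
    G.expDual (c • a) z = c • G.expDual a z := by
  ext x
  refine (G.hasSum_expDual (G.smul_mem_gradedDual c ha) z x).unique ?_
  exact ((G.hasSum_expDual ha z x).mul_left c).congr_fun fun k => by
    simp; ring

lemma expDual_comp_L {w' : Module.Dual ℂ W} (hw : w' ∈ G.gradedDual) (z : ℂ) (x : W) :
    G.expDual (w'.comp G.L) z x = G.expDual w' z (G.L x) := by
  refine (G.hasSum_expDual (G.comp_L_mem hw) z x).unique ?_
  refine (G.hasSum_expDual hw z (G.L x)).congr_fun fun k => ?_
  rw [← G.pow_succ_apply, G.pow_succ_apply', LinearMap.comp_apply]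

lemma expDual_comp_L' {w' : Module.Dual ℂ W} (hw : w' ∈ G.gradedDual) (z : ℂ) :
    G.expDual (w'.comp G.L) z = (G.expDual w' z).comp G.L := by
  ext x; exact G.expDual_comp_L hw z x

lemma hasDerivAt_expDual {w' : Module.Dual ℂ W} (hw : w' ∈ G.gradedDual) (z : ℂ) (x : W) :
    HasDerivAt (fun z => G.expDual w' z x) (G.expDual w' z (G.L x)) z := by
  obtain ⟨K, hK⟩ := G.exists_comp_pow_eq_zero hw
  have hval : ∀ z x, G.expDual w' z x =
      ∑ k ∈ Finset.range (K + 1), z ^ k / (k.factorial : ℂ) * w' ((G.L ^ k) x) := by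
    intro z x
    rw [G.expDual_eq_sum (K := K + 1) (fun k hk => hK k (by lia)), LinearMap.sum_apply]
    rfl
  simp only [hval]
  refine (HasDerivAt.fun_sum fun k _ =>
    (((hasDerivAt_pow k z).div_const (k.factorial : ℂ)).mul_const (w' ((G.L ^ k) x)))).congr_deriv ?_
  -- Differentiation kills the term `k = 0` and lowers the others by one index. The term `k = K` on
  -- the other side contains `L ^ (K + 1)` and vanishes, so the two ranges match.
  rw [Finset.sum_range_succ', Finset.sum_range_succ]
  have h0 : w' ((G.L ^ K) (G.L x)) = 0 := by
    rw [← G.pow_succ_apply]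
    exact LinearMap.congr_fun (hK (K + 1) (by lia)) x
  simp only [h0, Nat.cast_zero, zero_mul, zero_div, mul_zero, add_zero]
  refine Finset.sum_congr rfl fun k _ => ?_
  rw [← G.pow_succ_apply, Nat.factorial_succ, Nat.add_sub_cancel]
  have : (k.factorial : ℂ) ≠ 0 := by exact_mod_cast k.factorial_ne_zero
  have : ((k : ℂ) + 1) ≠ 0 := by exact_mod_cast k.succ_ne_zero
  push_cast
  field_simp

lemma expDual_expDual {w' : Module.Dual ℂ W} (hw : w' ∈ G.gradedDual) (a b : ℂ) :
    G.expDual (G.expDual w' a) b = G.expDual w' (a + b) := by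
  ext x
  refine (G.hasSum_expDual (G.expDual_mem hw a) b x).unique ?_
  have := hasSum_taylor (h := fun k s => G.expDual w' (a + s) ((G.L ^ k) x)) (R := ‖b‖ + 1)
    (fun k s _ => by
      rw [G.pow_succ_apply']
      exact (G.hasDerivAt_expDual hw (a + s) ((G.L ^ k) x)).comp_const_add a s)
    (s := b) (by linarith)
  simpa using this

/-- Matrix elements of `e^{z L(-1)}` transported along a map commuting with `L(-1)`. -/
lemma expDual_comp {X : Type*} [AddCommGroup X] [Module ℂ X] {H : TGrading X}
    {w' : Module.Dual ℂ W} (hw : w' ∈ G.gradedDual) (f : X →ₗ[ℂ] W)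
    (hf : ∀ n, ∀ x ∈ H.gr n, f x ∈ G.gr n) (hL : ∀ x, f (H.L x) = G.L (f x)) (z : ℂ) :
    (G.expDual w' z).comp f = H.expDual (w'.comp f) z := by
  have hmem : w'.comp f ∈ H.gradedDual :=
    Grading.comp_mem_gradedDual hw f 0 (by simpa using hf)
  ext x
  refine (G.hasSum_expDual hw z (f x)).unique ?_
  refine (H.hasSum_expDual hmem z x).congr_fun fun k => ?_
  congr 1
  rw [LinearMap.comp_apply]
  congr 1
  induction k generalizing x with
  | zero => rfl
  | succ k ih => rw [G.pow_succ_apply, H.pow_succ_apply, ← ih, hL]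

end TGrading

/-! ### Vertex operator maps -/

section FieldMap

variable {U : Type*} [AddCommGroup U] [Module ℂ U] {X : Type*} [AddCommGroup X] [Module ℂ X]
  {W : Type*} [AddCommGroup W] [Module ℂ W]

/-- A map `Y(u, z)x = ∑ mode n u x z^{-n-1}` compatible with the gradings and with `L(-1)`. -/
structure FieldMap (G₁ : TGrading U) (G₂ : TGrading X) (G₃ : TGrading W) where
  /-- the components -/
  mode : ℤ → U →ₗ[ℂ] X →ₗ[ℂ] W
  weight : ∀ n k l u x, u ∈ G₁.gr k → x ∈ G₂.gr l → mode n u x ∈ G₃.gr (k + l - n - 1)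
  deriv_left : ∀ n u x, mode n (G₁.L u) x = (-(n : ℂ)) • mode (n - 1) u x
  bracket : ∀ n u x, G₃.L (mode n u x) - mode n u (G₂.L x) = (-(n : ℂ)) • mode (n - 1) u x

namespace FieldMap

variable {G₁ : TGrading U} {G₂ : TGrading X} {G₃ : TGrading W} (Y : FieldMap G₁ G₂ G₃)

/-- Truncation is not part of the structure: for homogeneous arguments the degree of `mode n u x`
drops below the lower bound of the grading. The bound is a natural number because it serves as a
pole order. -/
lemma exists_trunc (u : U) (x : X) : ∃ N : ℕ, ∀ n : ℤ, N ≤ n → Y.mode n u x = 0 := by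
  obtain ⟨N₀, hN₀⟩ := G₃.exists_lower
  induction u using Grading.induction (G := G₁.toGrading) with
  | hom k u hu =>
    induction x using Grading.induction (G := G₂.toGrading) with
    | hom l x hx =>
      exact ⟨(k + l - N₀).toNat, fun n hn => hN₀ _ (by lia) _ (Y.weight n k l u x hu hx)⟩
    | add x y hx hy =>
      obtain ⟨N, hN⟩ := hx
      obtain ⟨M, hM⟩ := hy
      exact ⟨max N M, fun n hn => by rw [map_add, hN n (by lia), hM n (by lia), add_zero]⟩
  | add x y hx hy =>
    obtain ⟨N, hN⟩ := hx
    obtain ⟨M, hM⟩ := hy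
    exact ⟨max N M, fun n hn => by
      rw [map_add, LinearMap.add_apply, hN n (by lia), hM n (by lia), add_zero]⟩

lemma exists_lower {w' : Module.Dual ℂ W} (hw : w' ∈ G₃.gradedDual) (u : U) (x : X) :
    ∃ N : ℤ, ∀ n : ℤ, n ≤ N → w' (Y.mode n u x) = 0 := by
  obtain ⟨N₀, hN₀⟩ := G₃.mem_gradedDual_iff.mp hw
  induction u using Grading.induction (G := G₁.toGrading) with
  | hom k u hu =>
    induction x using Grading.induction (G := G₂.toGrading) with
    | hom l x hx =>
      exact ⟨k + l - 1 - N₀, fun n hn => hN₀ _ (by lia) _ (Y.weight n k l u x hu hx)⟩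
    | add x y hx hy =>
      obtain ⟨N, hN⟩ := hx
      obtain ⟨M, hM⟩ := hy
      exact ⟨min N M, fun n hn => by
        rw [map_add, map_add, hN n (by lia), hM n (by lia), add_zero]⟩
  | add x y hx hy =>
    obtain ⟨N, hN⟩ := hx
    obtain ⟨M, hM⟩ := hy
    exact ⟨min N M, fun n hn => by
      rw [map_add, LinearMap.add_apply, map_add, hN n (by lia), hM n (by lia), add_zero]⟩

/-- Large indices are excluded by truncation and very negative ones by the boundedness of `w'`;
matrix elements of a single field are therefore Laurent polynomials and all sums over modes are
finite. -/
lemma exists_support {w' : Module.Dual ℂ W} (hw : w' ∈ G₃.gradedDual) (u : U) (x : X) :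
    ∃ s : Finset ℤ, ∀ n ∉ s, w' (Y.mode n u x) = 0 := by
  obtain ⟨N, hN⟩ := Y.exists_trunc u x
  obtain ⟨M, hM⟩ := Y.exists_lower hw u x
  refine ⟨Finset.Ioo M N, fun n hn => ?_⟩
  simp only [Finset.mem_Ioo, not_and_or, not_lt] at hn
  rcases hn with h | h
  · exact hM n h
  · rw [hN n h, map_zero]

/-- The Laurent polynomial `⟨w', Y(u, z)x⟩`. -/
def lau (w' : Module.Dual ℂ W) (u : U) (x : X) (z : ℂ) : ℂ :=
  ∑' n : ℤ, w' (Y.mode n u x) * z ^ (-n - 1)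

lemma lau_eq_sum {w' : Module.Dual ℂ W}
    {u : U} {x : X} {s : Finset ℤ} (hs : ∀ n ∉ s, w' (Y.mode n u x) = 0) (z : ℂ) :
    Y.lau w' u x z = ∑ n ∈ s, w' (Y.mode n u x) * z ^ (-n - 1) :=
  tsum_eq_sum fun n hn => by rw [hs n hn, zero_mul]

lemma hasSum_lau {w' : Module.Dual ℂ W} (hw : w' ∈ G₃.gradedDual)
    (u : U) (x : X) (z : ℂ) :
    HasSum (fun n : ℤ => w' (Y.mode n u x) * z ^ (-n - 1)) (Y.lau w' u x z) := by
  obtain ⟨s, hs⟩ := Y.exists_support hw u x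
  rw [Y.lau_eq_sum hs]
  exact hasSum_sum_of_ne_finset_zero fun n hn => by rw [hs n hn, zero_mul]

lemma lau_add_left {w' : Module.Dual ℂ W} (hw : w' ∈ G₃.gradedDual)
    (u v : U) (x : X) (z : ℂ) :
    Y.lau w' (u + v) x z = Y.lau w' u x z + Y.lau w' v x z :=
  (Y.hasSum_lau hw _ _ _).unique
    (((Y.hasSum_lau hw u x z).add (Y.hasSum_lau hw v x z)).congr_fun fun n => by simp [add_mul])

lemma lau_smul_left {w' : Module.Dual ℂ W} (hw : w' ∈ G₃.gradedDual)
    (c : ℂ) (u : U) (x : X) (z : ℂ) :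
    Y.lau w' (c • u) x z = c * Y.lau w' u x z :=
  (Y.hasSum_lau hw _ _ _).unique
    (((Y.hasSum_lau hw u x z).mul_left c).congr_fun fun n => by simp [mul_assoc])

lemma lau_add_right {w' : Module.Dual ℂ W} (hw : w' ∈ G₃.gradedDual)
    (u : U) (x y : X) (z : ℂ) :
    Y.lau w' u (x + y) z = Y.lau w' u x z + Y.lau w' u y z :=
  (Y.hasSum_lau hw _ _ _).unique
    (((Y.hasSum_lau hw u x z).add (Y.hasSum_lau hw u y z)).congr_fun fun n => by simp [add_mul])

lemma lau_smul_right {w' : Module.Dual ℂ W} (hw : w' ∈ G₃.gradedDual)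
    (c : ℂ) (u : U) (x : X) (z : ℂ) :
    Y.lau w' u (c • x) z = c * Y.lau w' u x z :=
  (Y.hasSum_lau hw _ _ _).unique
    (((Y.hasSum_lau hw u x z).mul_left c).congr_fun fun n => by simp [mul_assoc])

lemma lau_sum_right {w' : Module.Dual ℂ W} (hw : w' ∈ G₃.gradedDual)
    {ι : Type*} (s : Finset ι) (u : U) (f : ι → X) (z : ℂ) :
    Y.lau w' u (∑ i ∈ s, f i) z = ∑ i ∈ s, Y.lau w' u (f i) z := by
  let φ : X →+ ℂ := AddMonoidHom.mk' (fun x => Y.lau w' u x z)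
    fun a b => Y.lau_add_right hw u a b z
  exact map_sum φ f s

lemma lau_add_dual {w' : Module.Dual ℂ W} (hw : w' ∈ G₃.gradedDual)
    {a : Module.Dual ℂ W} (ha : a ∈ G₃.gradedDual) (u : U) (x : X) (z : ℂ) :
    Y.lau (w' + a) u x z = Y.lau w' u x z + Y.lau a u x z :=
  (Y.hasSum_lau (G₃.add_mem_gradedDual hw ha) _ _ _).unique
    (((Y.hasSum_lau hw u x z).add (Y.hasSum_lau ha u x z)).congr_fun fun n => by simp [add_mul])

lemma lau_smul_dual {w' : Module.Dual ℂ W} (hw : w' ∈ G₃.gradedDual)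
    (c : ℂ) (u : U) (x : X) (z : ℂ) :
    Y.lau (c • w') u x z = c * Y.lau w' u x z :=
  (Y.hasSum_lau (G₃.smul_mem_gradedDual c hw) _ _ _).unique
    (((Y.hasSum_lau hw u x z).mul_left c).congr_fun fun n => by simp [mul_assoc])

lemma lau_comp_L {w' : Module.Dual ℂ W} (hw : w' ∈ G₃.gradedDual)
    (u : U) (x : X) (z : ℂ) :
    Y.lau (w'.comp G₃.L) u x z = Y.lau w' (G₁.L u) x z + Y.lau w' u (G₂.L x) z :=
  (Y.hasSum_lau (G₃.comp_L_mem hw) _ _ _).unique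
    (((Y.hasSum_lau hw (G₁.L u) x z).add (Y.hasSum_lau hw u (G₂.L x) z)).congr_fun fun n => by
      rw [LinearMap.comp_apply, ← add_mul, ← map_add, Y.deriv_left, ← Y.bracket, sub_add_cancel])

lemma hasDerivAt_lau {w' : Module.Dual ℂ W} (hw : w' ∈ G₃.gradedDual)
    (u : U) (x : X) {z : ℂ} (hz : z ≠ 0) :
    HasDerivAt (Y.lau w' u x) (Y.lau w' (G₁.L u) x z) z := by
  obtain ⟨s, hs⟩ := Y.exists_support hw u x
  have h1 : Y.lau w' u x = fun z => ∑ n ∈ s, w' (Y.mode n u x) * z ^ (-n - 1) :=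
    funext (Y.lau_eq_sum hs)
  rw [h1]
  refine (HasDerivAt.fun_sum fun n _ => (hasDerivAt_zpow (-n - 1) z (Or.inl hz)).const_mul
    (w' (Y.mode n u x))).congr_deriv ?_
  refine HasSum.unique ?_ (Y.hasSum_lau hw (G₁.L u) x z)
  rw [← (Equiv.addRight (1 : ℤ)).hasSum_iff]
  refine (hasSum_sum_of_ne_finset_zero (s := s) (f := fun n : ℤ => w' (Y.mode n u x) *
    (((-n - 1 : ℤ) : ℂ) * z ^ (-n - 1 - 1))) fun n hn => by rw [hs n hn, zero_mul]).congr_fun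
    fun n => ?_
  simp only [Function.comp_apply, Equiv.coe_addRight, Y.deriv_left, map_smul, smul_eq_mul,
    add_sub_cancel_right]
  rw [show -(n + 1) - 1 = -n - 1 - 1 by ring]
  push_cast
  ring

/-- The matrix element `⟨w', e^{z₂ L(-1)} Y(u, z₁ - z₂)x⟩`. -/
def e2 (w' : Module.Dual ℂ W) (u : U) (x : X) (z₁ z₂ : ℂ) : ℂ :=
  Y.lau (G₃.expDual w' z₂) u x (z₁ - z₂)

lemma e2_eq_sum {w' : Module.Dual ℂ W} (hw : w' ∈ G₃.gradedDual)
    {K : ℕ} (hK : ∀ k ≥ K, w'.comp (G₃.L ^ k) = 0) (u : U) (x : X) (z₁ z₂ : ℂ) :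
    Y.e2 w' u x z₁ z₂ = ∑ k ∈ Finset.range K, z₂ ^ k / (k.factorial : ℂ) *
      Y.lau (w'.comp (G₃.L ^ k)) u x (z₁ - z₂) := by
  rw [e2, G₃.expDual_eq_sum hK]
  have hmem := fun k : ℕ => G₃.smul_mem_gradedDual (z₂ ^ k / (k.factorial : ℂ))
    (G₃.comp_pow_mem hw k)
  generalize Finset.range K = s
  classical
  induction s using Finset.induction_on with
  | empty => simp [lau]
  | insert i s hi ih =>
    rw [Finset.sum_insert hi, Finset.sum_insert hi, Y.lau_add_dual (hmem i)
      (G₃.sum_mem_gradedDual _ _ fun k _ => hmem k), Y.lau_smul_dual (G₃.comp_pow_mem hw i), ih]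

lemma e2_zero {w' : Module.Dual ℂ W} (hw : w' ∈ G₃.gradedDual)
    (u : U) (x : X) (z : ℂ) : Y.e2 w' u x z 0 = Y.lau w' u x z := by
  rw [e2, G₃.expDual_zero hw, sub_zero]

/-- Translation covariance, by the group law of `e^{zL(-1)}`. Expansions around an arbitrary `ζ`
reduce to expansions around `0` for the functional `w' ∘ e^{ζL(-1)}`. -/
lemma e2_expDual {w' : Module.Dual ℂ W} (hw : w' ∈ G₃.gradedDual)
    (u : U) (x : X) (z₁ z₂ ζ : ℂ) :
    Y.e2 (G₃.expDual w' ζ) u x (z₁ - ζ) (z₂ - ζ) = Y.e2 w' u x z₁ z₂ := by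
  rw [e2, e2, G₃.expDual_expDual hw, add_sub_cancel, sub_sub_sub_cancel_right]

lemma e2_comp_L {w' : Module.Dual ℂ W} (hw : w' ∈ G₃.gradedDual)
    (u : U) (x : X) (z₁ z₂ : ℂ) :
    Y.e2 (w'.comp G₃.L) u x z₁ z₂ = Y.e2 w' (G₁.L u) x z₁ z₂ + Y.e2 w' u (G₂.L x) z₁ z₂ := by
  rw [e2, G₃.expDual_comp_L' hw, Y.lau_comp_L (G₃.expDual_mem hw _)]
  rfl

lemma e2_add_dual {w' : Module.Dual ℂ W} (hw : w' ∈ G₃.gradedDual)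
    {a : Module.Dual ℂ W} (ha : a ∈ G₃.gradedDual) (u : U) (x : X) (z₁ z₂ : ℂ) :
    Y.e2 (w' + a) u x z₁ z₂ = Y.e2 w' u x z₁ z₂ + Y.e2 a u x z₁ z₂ := by
  rw [e2, G₃.expDual_add_dual hw ha, Y.lau_add_dual (G₃.expDual_mem hw _) (G₃.expDual_mem ha _)]
  rfl

lemma e2_smul_dual {w' : Module.Dual ℂ W} (hw : w' ∈ G₃.gradedDual)
    (c : ℂ) (u : U) (x : X) (z₁ z₂ : ℂ) :
    Y.e2 (c • w') u x z₁ z₂ = c * Y.e2 w' u x z₁ z₂ := by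
  rw [e2, G₃.expDual_smul_dual c hw, Y.lau_smul_dual (G₃.expDual_mem hw _)]
  rfl

lemma hasDerivAt_e2_fst {w' : Module.Dual ℂ W} (hw : w' ∈ G₃.gradedDual)
    (u : U) (x : X) {z₁ z₂ : ℂ} (hz : z₁ ≠ z₂) :
    HasDerivAt (fun z => Y.e2 w' u x z z₂) (Y.e2 w' (G₁.L u) x z₁ z₂) z₁ :=
  (Y.hasDerivAt_lau (G₃.expDual_mem hw z₂) u x (sub_ne_zero.mpr hz)).comp_sub_const z₁ z₂

/-- The exponential contributes `L(-1)Y(u)x` and the argument `z₁ - z₂` contributes `-Y(L(-1)u)x`;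
by the bracket formula what remains is `Y(u)L(-1)x`. -/
lemma hasDerivAt_e2_snd {w' : Module.Dual ℂ W} (hw : w' ∈ G₃.gradedDual)
    (u : U) (x : X) {z₁ z₂ : ℂ} (hz : z₁ ≠ z₂) :
    HasDerivAt (fun z => Y.e2 w' u x z₁ z) (Y.e2 w' u (G₂.L x) z₁ z₂) z₂ := by
  obtain ⟨K, hK⟩ := G₃.exists_comp_pow_eq_zero hw
  have hK' : ∀ k ≥ K + 1, w'.comp (G₃.L ^ k) = 0 := fun k hk => hK k (by lia)
  have hfun : (fun z => Y.e2 w' u x z₁ z) = fun z => ∑ k ∈ Finset.range (K + 1),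
      z ^ k / (k.factorial : ℂ) * Y.lau (w'.comp (G₃.L ^ k)) u x (z₁ - z) :=
    funext fun z => Y.e2_eq_sum hw hK' u x z₁ z
  have hd : ∀ k, HasDerivAt (fun z => Y.lau (w'.comp (G₃.L ^ k)) u x (z₁ - z))
      (-Y.lau (w'.comp (G₃.L ^ k)) (G₁.L u) x (z₁ - z₂)) z₂ := by
    intro k
    exact (Y.hasDerivAt_lau (G₃.comp_pow_mem hw k) u x (sub_ne_zero.mpr hz)).comp_const_sub z₁ z₂
  rw [hfun]
  refine (HasDerivAt.fun_sum fun k _ =>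
    ((hasDerivAt_pow k z₂).div_const (k.factorial : ℂ)).fun_mul (hd k)).congr_deriv ?_
  rw [Finset.sum_add_distrib, Finset.sum_range_succ', Y.e2_eq_sum hw hK']
  have hstep : ∀ k, Y.lau (w'.comp (G₃.L ^ (k + 1))) u x (z₁ - z₂) =
      Y.lau (w'.comp (G₃.L ^ k)) (G₁.L u) x (z₁ - z₂) +
        Y.lau (w'.comp (G₃.L ^ k)) u (G₂.L x) (z₁ - z₂) := by
    intro k
    rw [← Y.lau_comp_L (G₃.comp_pow_mem hw k)]
    congr 1
  have hlast : Y.lau (w'.comp (G₃.L ^ (K + 1))) u x (z₁ - z₂) = 0 := by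
    rw [hK _ (by lia)]; simp [lau]
  have h1 : ∑ k ∈ Finset.range K, ((k + 1 : ℕ) : ℂ) * z₂ ^ (k + 1 - 1) /
      ((k + 1).factorial : ℂ) * Y.lau (w'.comp (G₃.L ^ (k + 1))) u x (z₁ - z₂) =
      ∑ k ∈ Finset.range (K + 1), z₂ ^ k / (k.factorial : ℂ) *
        Y.lau (w'.comp (G₃.L ^ (k + 1))) u x (z₁ - z₂) := by
    rw [Finset.sum_range_succ, hlast, mul_zero, add_zero]
    refine Finset.sum_congr rfl fun k _ => ?_
    rw [Nat.factorial_succ, Nat.add_sub_cancel]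
    have : (k.factorial : ℂ) ≠ 0 := by exact_mod_cast k.factorial_ne_zero
    have : ((k : ℂ) + 1) ≠ 0 := by exact_mod_cast k.succ_ne_zero
    push_cast
    field_simp
  rw [h1]
  simp only [Nat.cast_zero, zero_mul, zero_div, add_zero]
  rw [← Finset.sum_add_distrib]
  refine Finset.sum_congr rfl fun k _ => ?_
  rw [hstep]
  ring

/-- `Y(u, z) e^{s L(-1)} x = e^{s L(-1)} Y(u, z - s) x` for `|s| < |z|`. -/
lemma hasSum_lau_exp {w' : Module.Dual ℂ W} (hw : w' ∈ G₃.gradedDual)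
    (u : U) (x : X) {z s : ℂ} (h : ‖s‖ < ‖z‖) :
    HasSum (fun j : ℕ => s ^ j / (j.factorial : ℂ) * Y.lau w' u ((G₂.L ^ j) x) z)
      (Y.e2 w' u x z s) := by
  have := hasSum_taylor (h := fun k s => Y.e2 w' u ((G₂.L ^ k) x) z s) (R := ‖z‖)
    (fun k s hs => by
      rw [G₂.pow_succ_apply']
      exact Y.hasDerivAt_e2_snd hw u _ (by rintro rfl; exact hs.false)) h
  simpa [Y.e2_zero hw] using this

lemma hasSum_e2_fst {w' : Module.Dual ℂ W} (hw : w' ∈ G₃.gradedDual)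
    (u : U) (x : X) {z₁ z₂ a : ℂ} (h : ‖a‖ < ‖z₁ - z₂‖) :
    HasSum (fun j : ℕ => a ^ j / (j.factorial : ℂ) * Y.e2 w' ((G₁.L ^ j) u) x z₁ z₂)
      (Y.e2 w' u x (z₁ + a) z₂) := by
  have := hasSum_taylor (h := fun k s => Y.e2 w' ((G₁.L ^ k) u) x (z₁ + s) z₂) (R := ‖z₁ - z₂‖)
    (fun k s hs => by
      rw [G₁.pow_succ_apply']
      refine (Y.hasDerivAt_e2_fst hw _ x ?_).comp_const_add z₁ s
      intro h0
      rw [← h0] at hs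
      simp at hs) h
  simpa using this

lemma hasSum_e2_snd {w' : Module.Dual ℂ W} (hw : w' ∈ G₃.gradedDual)
    (u : U) (x : X) {z₁ z₂ a : ℂ} (h : ‖a‖ < ‖z₁ - z₂‖) :
    HasSum (fun j : ℕ => a ^ j / (j.factorial : ℂ) * Y.e2 w' u ((G₂.L ^ j) x) z₁ z₂)
      (Y.e2 w' u x z₁ (z₂ + a)) := by
  have := hasSum_taylor (h := fun k s => Y.e2 w' u ((G₂.L ^ k) x) z₁ (z₂ + s)) (R := ‖z₁ - z₂‖)
    (fun k s hs => by
      rw [G₂.pow_succ_apply']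
      refine (Y.hasDerivAt_e2_snd hw u _ ?_).comp_const_add z₂ s
      intro h0
      rw [h0] at hs
      simp at hs) h
  simpa using this

/-- The element `e^{z₂ L(-1)} Y(u, z₁ - z₂)x` of the completion. -/
def e2elt (u : U) (x : X) (z₁ z₂ : ℂ) : G₃.Completion :=
  G₃.ofFunctional fun w' => Y.e2 w' u x z₁ z₂

lemma pairing_e2elt {w' : Module.Dual ℂ W} (hw : w' ∈ G₃.gradedDual) (u : U) (x : X)
    (z₁ z₂ : ℂ) : G₃.pairing w' (Y.e2elt u x z₁ z₂) = Y.e2 w' u x z₁ z₂ :=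
  G₃.pairing_ofFunctional _ (fun _ ha _ hb => Y.e2_add_dual ha hb u x z₁ z₂)
    (fun c _ ha => Y.e2_smul_dual ha c u x z₁ z₂) hw

lemma e2elt_apply (φ : Module.Dual ℂ W) (r : ℤ) (u : U) (x : X) (z₁ z₂ : ℂ) :
    φ (Y.e2elt u x z₁ z₂ r) = Y.e2 (φ.comp (G₃.proj r)) u x z₁ z₂ := by
  rw [← G₃.pairing_comp_proj, Y.pairing_e2elt (G₃.comp_proj_mem_gradedDual φ r)]

lemma e2elt_add_left (u v : U) (x : X) (z₁ z₂ : ℂ) :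
    Y.e2elt (u + v) x z₁ z₂ = Y.e2elt u x z₁ z₂ + Y.e2elt v x z₁ z₂ :=
  G₃.completion_ext fun w' hw => by
    rw [G₃.pairing_add hw, Y.pairing_e2elt hw, Y.pairing_e2elt hw, Y.pairing_e2elt hw]
    exact Y.lau_add_left (G₃.expDual_mem hw _) _ _ _ _

lemma e2elt_smul_left (c : ℂ) (u : U) (x : X) (z₁ z₂ : ℂ) :
    Y.e2elt (c • u) x z₁ z₂ = c • Y.e2elt u x z₁ z₂ :=
  G₃.completion_ext fun w' hw => by
    rw [G₃.pairing_smul hw, Y.pairing_e2elt hw, Y.pairing_e2elt hw]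
    exact Y.lau_smul_left (G₃.expDual_mem hw _) _ _ _ _

lemma e2elt_add_right (u : U) (x y : X) (z₁ z₂ : ℂ) :
    Y.e2elt u (x + y) z₁ z₂ = Y.e2elt u x z₁ z₂ + Y.e2elt u y z₁ z₂ :=
  G₃.completion_ext fun w' hw => by
    rw [G₃.pairing_add hw, Y.pairing_e2elt hw, Y.pairing_e2elt hw, Y.pairing_e2elt hw]
    exact Y.lau_add_right (G₃.expDual_mem hw _) _ _ _ _

lemma e2elt_smul_right (c : ℂ) (u : U) (x : X) (z₁ z₂ : ℂ) :
    Y.e2elt u (c • x) z₁ z₂ = c • Y.e2elt u x z₁ z₂ :=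
  G₃.completion_ext fun w' hw => by
    rw [G₃.pairing_smul hw, Y.pairing_e2elt hw, Y.pairing_e2elt hw]
    exact Y.lau_smul_right (G₃.expDual_mem hw _) _ _ _ _

lemma expDual_comp_proj_apply (φ : Module.Dual ℂ W) (r : ℤ) {m : ℤ} {y : W} (hy : y ∈ G₃.gr m)
    (z : ℂ) (k : ℕ) (hk : m + k = r) :
    G₃.expDual (φ.comp (G₃.proj r)) z y = z ^ k / (k.factorial : ℂ) * φ ((G₃.L ^ k) y) := by
  refine (G₃.hasSum_expDual (G₃.comp_proj_mem_gradedDual φ r) z y).unique ?_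
  have := hasSum_single (f := fun j : ℕ => z ^ j / (j.factorial : ℂ) *
    (φ.comp (G₃.proj r)) ((G₃.L ^ j) y)) k (fun j hj => by
      rw [LinearMap.comp_apply, G₃.proj_of_mem_ne (G₃.pow_mem j hy) (by lia), map_zero, mul_zero])
  rwa [LinearMap.comp_apply, G₃.proj_of_mem (hk ▸ G₃.pow_mem k hy)] at this

lemma expDual_comp_proj_apply_of_lt (φ : Module.Dual ℂ W) (r : ℤ) {m : ℤ} {y : W}
    (hy : y ∈ G₃.gr m) (z : ℂ) (hk : r < m) : G₃.expDual (φ.comp (G₃.proj r)) z y = 0 := by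
  refine (G₃.hasSum_expDual (G₃.comp_proj_mem_gradedDual φ r) z y).unique ?_
  refine hasSum_zero.congr_fun fun j => ?_
  rw [LinearMap.comp_apply, G₃.proj_of_mem_ne (G₃.pow_mem j hy) (by lia), map_zero, mul_zero]

lemma e2elt_of_lt {u : U} {x : X} {k l : ℤ} (hu : u ∈ G₁.gr k) (hx : x ∈ G₂.gr l) {b : ℕ}
    (hb : ∀ n : ℤ, b ≤ n → Y.mode n u x = 0) (z₁ z₂ : ℂ) {r : ℤ} (hr : r < k + l - b) :
    (Y.e2elt u x z₁ z₂ r : W) = 0 := by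
  rw [← Module.forall_dual_apply_eq_zero_iff ℂ]
  intro φ
  rw [e2elt_apply]
  refine (Y.hasSum_lau (G₃.expDual_mem (G₃.comp_proj_mem_gradedDual φ r) _) u x _).unique ?_
  refine hasSum_zero.congr_fun fun n => ?_
  by_cases hn : b ≤ n
  · rw [hb n hn, map_zero, zero_mul]
  · rw [expDual_comp_proj_apply_of_lt φ r (Y.weight n k l u x hu hx) z₂ (by lia), zero_mul]

/-- The homogeneous components of `e^{z₂ L(-1)} Y(u, z₁ - z₂)x` for homogeneous `u` and `x`. -/
lemma e2elt_hom {u : U} {x : X} {k l : ℤ} (hu : u ∈ G₁.gr k) (hx : x ∈ G₂.gr l) {b : ℕ}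
    (hb : ∀ n : ℤ, b ≤ n → Y.mode n u x = 0) {z₁ z₂ : ℂ} (hz : z₁ ≠ z₂) (i : ℕ) :
    ((z₁ - z₂) ^ b) • (Y.e2elt u x z₁ z₂ (k + l - b + i) : W) =
      ∑ p ∈ Finset.HasAntidiagonal.antidiagonal i, (z₂ ^ p.1 / (p.1.factorial : ℂ) *
        (z₁ - z₂) ^ p.2) • (G₃.L ^ p.1) (Y.mode (b - 1 - p.2) u x) := by
  rw [← sub_eq_zero, ← Module.forall_dual_apply_eq_zero_iff ℂ]
  intro φ
  have hz' : z₁ - z₂ ≠ 0 := sub_ne_zero.mpr hz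
  rw [map_sub, map_smul, e2elt_apply, sub_eq_zero, e2]
  have h1 := Y.hasSum_lau (G₃.expDual_mem (G₃.comp_proj_mem_gradedDual φ (k + l - b + i)) z₂) u x
    (z₁ - z₂)
  -- Projection to one degree leaves only the pairs (power of `L(-1)`, mode) whose degrees add up
  -- correctly. With modes indexed as `b - 1 - j` these pairs form an antidiagonal.
  have h2 : HasSum (fun n : ℤ => G₃.expDual (φ.comp (G₃.proj (k + l - b + i))) z₂ (Y.mode n u x) *
      (z₁ - z₂) ^ (-n - 1)) (∑ p ∈ Finset.HasAntidiagonal.antidiagonal i,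
        z₂ ^ p.1 / (p.1.factorial : ℂ) * φ ((G₃.L ^ p.1) (Y.mode (b - 1 - p.2) u x)) *
          (z₁ - z₂) ^ ((p.2 : ℤ) - b)) := by
    have hinj : Function.Injective fun j : ℕ => (b : ℤ) - 1 - j := fun a c h => by
      simp only at h; lia
    rw [← hinj.hasSum_iff]
    · have hsum : ∑ p ∈ Finset.HasAntidiagonal.antidiagonal i, z₂ ^ p.1 / (p.1.factorial : ℂ) *
          φ ((G₃.L ^ p.1) (Y.mode (b - 1 - p.2) u x)) * (z₁ - z₂) ^ ((p.2 : ℤ) - b) =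
          ∑ j ∈ Finset.range (i + 1), ((fun n : ℤ =>
            G₃.expDual (φ.comp (G₃.proj (k + l - b + i))) z₂ (Y.mode n u x) *
              (z₁ - z₂) ^ (-n - 1)) ∘ fun j : ℕ => (b : ℤ) - 1 - j) j := by
        refine Finset.sum_nbij' (fun p => p.2) (fun j => (i - j, j)) ?_ ?_ ?_ ?_ ?_
        · intro p hp; simp at hp ⊢; lia
        · intro j hj; simp at hj ⊢; lia
        · intro p hp; simp at hp; ext <;> simp; lia
        · intro j hj; rfl
        · intro p hp
          simp only [Finset.HasAntidiagonal.mem_antidiagonal] at hp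
          simp only [Function.comp_apply]
          rw [expDual_comp_proj_apply φ _ (Y.weight (b - 1 - p.2) k l u x hu hx) z₂ p.1 (by lia)]
          congr 2
          ring
      rw [hsum]
      refine hasSum_sum_of_ne_finset_zero fun j hj => ?_
      simp only [Finset.mem_range, not_lt] at hj
      simp only [Function.comp_apply]
      rw [expDual_comp_proj_apply_of_lt φ _ (Y.weight (b - 1 - j) k l u x hu hx) z₂ (by lia),
        zero_mul]
    · intro n hn
      rw [hb n, map_zero, zero_mul]
      by_contra h
      exact hn ⟨((b : ℤ) - 1 - n).toNat, by simp only; lia⟩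
  rw [h1.unique h2, smul_eq_mul, Finset.mul_sum,
    map_sum]
  refine Finset.sum_congr rfl fun p _ => ?_
  rw [map_smul, smul_eq_mul, zpow_sub₀ hz', zpow_natCast, zpow_natCast]
  field_simp

end FieldMap

end FieldMap

/-! ### Bounds for the pole orders -/

section PoleOrders

open MvPolynomial

lemma hasSum_columns {α β : Type*} {F : α × β → ℂ} {s : ℂ} (h : HasSum F s) :
    HasSum (fun n => ∑' m, F (m, n)) s := by
  have h1 := (Equiv.prodComm β α).hasSum_iff.mpr h
  exact h1.prod_fiberwise fun n => (h1.summable.prod_factor n).hasSum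

lemma hasSum_rows {α β : Type*} {F : α × β → ℂ} {s : ℂ} (h : HasSum F s) :
    HasSum (fun m => ∑' n, F (m, n)) s :=
  h.prod_fiberwise fun n => (h.summable.prod_factor n).hasSum

lemma hasSum_nat_of_laurent {A : ℤ → ℂ} {b : ℕ} (hA : ∀ n : ℤ, b ≤ n → A n = 0) {y s : ℂ}
    (hy : y ≠ 0) (h : HasSum (fun n : ℤ => A n * y ^ (-n - 1)) s) :
    HasSum (fun j : ℕ => A (b - 1 - j) * y ^ j) (y ^ b * s) := by
  have hinj : Function.Injective fun j : ℕ => (b : ℤ) - 1 - j := fun a c h => by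
    simp only at h; lia
  rw [← hinj.hasSum_iff] at h
  · refine (h.mul_left (y ^ b)).congr_fun fun j => ?_
    simp only [Function.comp_apply]
    rw [show -((b : ℤ) - 1 - j) - 1 = j - b by ring, zpow_sub₀ hy, zpow_natCast, zpow_natCast]
    field_simp
  · intro n hn
    rw [hA n, zero_mul]
    by_contra h
    exact hn ⟨((b : ℤ) - 1 - n).toNat, by simp only; lia⟩

/-- Multiplication by `y^(b+1)` gives a power series for `f` whose constant coefficient is `A b`,
which vanishes by hypothesis. -/
lemma eq_zero_of_laurent {A : ℤ → ℂ} {f : ℂ → ℂ} {b : ℕ} {ε : ℝ} (hε : 0 < ε)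
    (hA : ∀ n : ℤ, b ≤ n → A n = 0)
    (h : ∀ y, 0 < ‖y‖ → ‖y‖ < ε → HasSum (fun n : ℤ => A n * y ^ (-n - 1)) (f y / y ^ (b + 1)))
    (hf : ContinuousAt f 0) : f 0 = 0 := by
  have key : ∀ᶠ y in 𝓝[≠] (0 : ℂ), HasSum (fun j : ℕ => A (((b + 1 : ℕ) : ℤ) - 1 - j) * y ^ j) (f y) := by
    filter_upwards [self_mem_nhdsWithin, nhdsWithin_le_nhds (Metric.ball_mem_nhds (0 : ℂ) hε)]
      with y h1 h2
    have := hasSum_nat_of_laurent (b := b + 1) (fun n hn => hA n (by lia)) h1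
      (h y (norm_pos_iff.mpr h1) (by simpa using h2))
    rwa [mul_div_cancel₀ _ (pow_ne_zero _ h1)] at this
  rw [eq_coeff_zero key hf]
  exact hA _ (by simp)

lemma MvPolynomial.dvd_sub_bind₁ {ι : Type*} (f : ι → MvPolynomial ι ℂ) {l : MvPolynomial ι ℂ}
    (h : ∀ i, l ∣ X i - f i) (P : MvPolynomial ι ℂ) : l ∣ P - bind₁ f P := by
  induction P using MvPolynomial.induction_on with
  | C a => simp
  | add p q hp hq =>
    rw [map_add, add_sub_add_comm]
    exact dvd_add hp hq
  | mul_X p i hp =>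
    rw [map_mul, bind₁_X_right, show p * X i - bind₁ f p * f i =
      (p - bind₁ f p) * X i + bind₁ f p * (X i - f i) by ring]
    exact dvd_add (hp.mul_right _) ((h i).mul_left _)

lemma MvPolynomial.eval_bind₁ {ι κ : Type*} (φ : ι → MvPolynomial κ ℂ) (z : κ → ℂ)
    (Q : MvPolynomial ι ℂ) : eval z (bind₁ φ Q) = eval (fun i => eval z (φ i)) Q := by
  change eval₂Hom (RingHom.id ℂ) z (bind₁ φ Q) = _
  rw [eval₂Hom_bind₁]
  rfl

/-- Modulo `l` the substitution `f` is the identity, so `P` is congruent to its restriction to the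
line `l = 0`, and that restriction vanishes on an open set. It is used for the lines `z₁ = 0`, `z₂ =
0` and `z₁ = z₂`. -/
lemma MvPolynomial.dvd_of_eval {f : Fin 2 → MvPolynomial (Fin 2) ℂ} {l : MvPolynomial (Fin 2) ℂ}
    (h : ∀ i, l ∣ X i - f i) {P : MvPolynomial (Fin 2) ℂ}
    (hP : ∀ z : Fin 2 → ℂ, z 0 ≠ 0 → z 1 ≠ 0 → eval (fun i => eval z (f i)) P = 0) : l ∣ P := by
  have h0 : bind₁ f P = 0 := by
    refine MvPolynomial.eq_of_eventually (z₀ := ![1, 1]) ?_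
    have h1 : ∀ᶠ z : Fin 2 → ℂ in 𝓝 ![1, 1], z 0 ≠ 0 :=
      (continuous_apply 0).continuousAt.eventually_ne (by simp)
    have h2 : ∀ᶠ z : Fin 2 → ℂ in 𝓝 ![1, 1], z 1 ≠ 0 :=
      (continuous_apply 1).continuousAt.eventually_ne (by simp)
    filter_upwards [h1, h2] with z hz1 hz2
    rw [eval_bind₁, hP z hz1 hz2, map_zero]
  simpa [h0] using dvd_sub_bind₁ f h P

/-- The three series converge to the rational function `P / (z₁^a z₂^b (z₁-z₂)^c)`. -/
def ConvergesTo (S₁ S₂ S₃ : ℤ → ℤ → ℂ) (R : ℂ → ℂ → ℂ) : Prop :=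
  ∀ z₁ z₂ : ℂ,
    (‖z₂‖ < ‖z₁‖ → 0 < ‖z₂‖ →
      HasSum (fun p : ℤ × ℤ => S₁ p.1 p.2 * z₁ ^ (-p.1 - 1) * z₂ ^ (-p.2 - 1)) (R z₁ z₂)) ∧
    (‖z₁‖ < ‖z₂‖ → 0 < ‖z₁‖ →
      HasSum (fun p : ℤ × ℤ => S₂ p.1 p.2 * z₁ ^ (-p.1 - 1) * z₂ ^ (-p.2 - 1)) (R z₁ z₂)) ∧
    (‖z₁ - z₂‖ < ‖z₂‖ → 0 < ‖z₁ - z₂‖ →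
      HasSum (fun p : ℤ × ℤ => S₃ p.1 p.2 * (z₁ - z₂) ^ (-p.1 - 1) * z₂ ^ (-p.2 - 1)) (R z₁ z₂))

lemma ConvergesTo.congr {S₁ S₂ S₃ : ℤ → ℤ → ℂ} {R R' : ℂ → ℂ → ℂ} (h : ConvergesTo S₁ S₂ S₃ R)
    (hR : ∀ z₁ z₂, z₁ ≠ 0 → z₂ ≠ 0 → z₁ ≠ z₂ → R z₁ z₂ = R' z₁ z₂) : ConvergesTo S₁ S₂ S₃ R' := by
  intro z₁ z₂
  obtain ⟨h1, h2, h3⟩ := h z₁ z₂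
  refine ⟨fun a b => ?_, fun a b => ?_, fun a b => ?_⟩
  · have hz1 : z₁ ≠ 0 := norm_pos_iff.mp (b.trans a)
    rw [← hR z₁ z₂ hz1 (norm_pos_iff.mp b) (by rintro rfl; exact a.false)]
    exact h1 a b
  · rw [← hR z₁ z₂ (norm_pos_iff.mp b) (norm_pos_iff.mp (b.trans a))
      (by rintro rfl; exact a.false)]
    exact h2 a b
  · rw [← hR z₁ z₂ (by rintro rfl; simp at a) (norm_pos_iff.mp (b.trans a))
      (sub_ne_zero.mp (norm_pos_iff.mp b))]
    exact h3 a b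

variable {S₁ S₂ S₃ : ℤ → ℤ → ℂ}

/-- For fixed `z₁`, summing over `m` in the region `|z₁| > |z₂|` gives a Laurent series in `z₂` with
pole order at most `b`. A denominator `z₂^(b+1)` then forces the numerator to vanish on `z₂ = 0`,
and one factor cancels. The two lemmas that follow use the other two regions in the same way for the
poles `z₁ = 0` and `z₁ = z₂`. -/
lemma ConvergesTo.lower_snd {P : MvPolynomial (Fin 2) ℂ} {a b c : ℕ}
    (h : ConvergesTo S₁ S₂ S₃ fun z₁ z₂ =>
      eval ![z₁, z₂] P / (z₁ ^ a * z₂ ^ (b + 1) * (z₁ - z₂) ^ c))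
    (hS : ∀ m n : ℤ, b ≤ n → S₁ m n = 0) : ∃ P', ConvergesTo S₁ S₂ S₃ fun z₁ z₂ =>
      eval ![z₁, z₂] P' / (z₁ ^ a * z₂ ^ b * (z₁ - z₂) ^ c) := by
  have hdvd : X 1 ∣ P := by
    refine MvPolynomial.dvd_of_eval (f := ![X 0, 0]) (by simp [Fin.forall_fin_two]) ?_
    intro z hz _
    set x := z 0
    have hfun : (fun i => eval z ((![X 0, 0] : Fin 2 → MvPolynomial (Fin 2) ℂ) i)) = ![x, 0] := by
      funext i; fin_cases i <;> simp [x]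
    rw [hfun]
    have hc : Continuous fun y : ℂ => eval ![x, y] P := P.continuous_eval.comp (by fun_prop)
    have := eq_zero_of_laurent (f := fun y => eval ![x, y] P / (x ^ a * (x - y) ^ c)) (b := b)
      (A := fun n => ∑' m, S₁ m n * x ^ (-m - 1)) (norm_pos_iff.mpr hz)
      (fun n hn => by simp [hS _ n hn]) (fun y hy1 hy2 => ?_) ?_
    · simpa [hz] using this
    · have h1 := hasSum_columns ((h x y).1 hy2 hy1)
      simp only [tsum_mul_right] at h1
      convert h1 using 1
      have : y ≠ 0 := norm_pos_iff.mp hy1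
      field_simp
    · refine hc.continuousAt.div (by fun_prop) ?_
      simp [hz]
  obtain ⟨P', rfl⟩ := hdvd
  refine ⟨P', h.congr fun z₁ z₂ h1 h2 h3 => ?_⟩
  simp only [map_mul, eval_X, Matrix.cons_val_one, Matrix.cons_val_fin_one, pow_succ]
  field_simp

lemma ConvergesTo.lower_fst {P : MvPolynomial (Fin 2) ℂ} {a b c : ℕ}
    (h : ConvergesTo S₁ S₂ S₃ fun z₁ z₂ =>
      eval ![z₁, z₂] P / (z₁ ^ (a + 1) * z₂ ^ b * (z₁ - z₂) ^ c))
    (hS : ∀ m n : ℤ, a ≤ m → S₂ m n = 0) : ∃ P', ConvergesTo S₁ S₂ S₃ fun z₁ z₂ =>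
      eval ![z₁, z₂] P' / (z₁ ^ a * z₂ ^ b * (z₁ - z₂) ^ c) := by
  have hdvd : X 0 ∣ P := by
    refine MvPolynomial.dvd_of_eval (f := ![0, X 1]) (by simp [Fin.forall_fin_two]) ?_
    intro z _ hz
    set x := z 1
    have hfun : (fun i => eval z ((![0, X 1] : Fin 2 → MvPolynomial (Fin 2) ℂ) i)) = ![0, x] := by
      funext i; fin_cases i <;> simp [x]
    rw [hfun]
    have hc : Continuous fun y : ℂ => eval ![y, x] P := P.continuous_eval.comp (by fun_prop)
    have := eq_zero_of_laurent (f := fun y => eval ![y, x] P / (x ^ b * (y - x) ^ c)) (b := a)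
      (A := fun m => ∑' n, S₂ m n * x ^ (-n - 1)) (norm_pos_iff.mpr hz)
      (fun n hn => by simp [hS n _ hn]) (fun y hy1 hy2 => ?_) ?_
    · simpa [hz] using this
    · have h1 := hasSum_rows ((h y x).2.1 hy2 hy1)
      convert h1 using 1
      · funext m
        rw [← tsum_mul_right]
        exact tsum_congr fun n => by ring
      have : y ≠ 0 := norm_pos_iff.mp hy1
      field_simp
    · refine hc.continuousAt.div (by fun_prop) ?_
      simp [hz]
  obtain ⟨P', rfl⟩ := hdvd
  refine ⟨P', h.congr fun z₁ z₂ h1 h2 h3 => ?_⟩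
  simp only [map_mul, eval_X, Matrix.cons_val_zero, pow_succ]
  field_simp

lemma ConvergesTo.lower_diag {P : MvPolynomial (Fin 2) ℂ} {a b c : ℕ}
    (h : ConvergesTo S₁ S₂ S₃ fun z₁ z₂ =>
      eval ![z₁, z₂] P / (z₁ ^ a * z₂ ^ b * (z₁ - z₂) ^ (c + 1)))
    (hS : ∀ m n : ℤ, c ≤ m → S₃ m n = 0) : ∃ P', ConvergesTo S₁ S₂ S₃ fun z₁ z₂ =>
      eval ![z₁, z₂] P' / (z₁ ^ a * z₂ ^ b * (z₁ - z₂) ^ c) := by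
  have hdvd : X 0 - X 1 ∣ P := by
    refine MvPolynomial.dvd_of_eval (f := ![X 1, X 1]) (by simp [Fin.forall_fin_two]) ?_
    intro z _ hz
    set x := z 1
    have hfun : (fun i => eval z ((![X 1, X 1] : Fin 2 → MvPolynomial (Fin 2) ℂ) i)) =
        ![x, x] := by
      funext i; fin_cases i <;> simp [x]
    rw [hfun]
    have hc : Continuous fun y : ℂ => eval ![x + y, x] P := P.continuous_eval.comp (by fun_prop)
    have := eq_zero_of_laurent (f := fun y => eval ![x + y, x] P / ((x + y) ^ a * x ^ b)) (b := c)
      (A := fun m => ∑' n, S₃ m n * x ^ (-n - 1)) (norm_pos_iff.mpr hz)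
      (fun n hn => by simp [hS n _ hn]) (fun y hy1 hy2 => ?_) ?_
    · simpa [hz] using this
    · have h1 := (h (x + y) x).2.2
      simp only [add_sub_cancel_left] at h1
      have h1 := hasSum_rows (h1 hy2 hy1)
      convert h1 using 1
      · funext m
        rw [← tsum_mul_right]
        exact tsum_congr fun n => by ring
      have : y ≠ 0 := norm_pos_iff.mp hy1
      field_simp
    · refine hc.continuousAt.div (by fun_prop) ?_
      simp [hz]
  obtain ⟨P', rfl⟩ := hdvd
  refine ⟨P', h.congr fun z₁ z₂ h1 h2 h3 => ?_⟩
  have : z₁ - z₂ ≠ 0 := sub_ne_zero.mpr h3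
  simp only [map_mul, map_sub, eval_X, Matrix.cons_val_zero, Matrix.cons_val_one,
    Matrix.cons_val_fin_one, pow_succ]
  field_simp

/-- The pole orders of the common rational function are bounded by the truncation orders. -/
lemma CommonRational.exists_bounded (h : CommonRational S₁ S₂ S₃) {a b c : ℕ}
    (h₂ : ∀ m n : ℤ, a ≤ m → S₂ m n = 0) (h₁ : ∀ m n : ℤ, b ≤ n → S₁ m n = 0)
    (h₃ : ∀ m n : ℤ, c ≤ m → S₃ m n = 0) : ∃ P : MvPolynomial (Fin 2) ℂ,
      ConvergesTo S₁ S₂ S₃ fun z₁ z₂ => eval ![z₁, z₂] P / (z₁ ^ a * z₂ ^ b * (z₁ - z₂) ^ c) := by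
  obtain ⟨P, a', b', c', hP⟩ := h
  have hP : ConvergesTo S₁ S₂ S₃ fun z₁ z₂ =>
    eval ![z₁, z₂] P / (z₁ ^ a' * z₂ ^ b' * (z₁ - z₂) ^ c') := hP
  have key : ∀ i j k : ℕ, ∀ P, (ConvergesTo S₁ S₂ S₃ fun z₁ z₂ =>
      eval ![z₁, z₂] P / (z₁ ^ (a + i) * z₂ ^ (b + j) * (z₁ - z₂) ^ (c + k))) →
      ∃ P : MvPolynomial (Fin 2) ℂ, ConvergesTo S₁ S₂ S₃ fun z₁ z₂ =>
        eval ![z₁, z₂] P / (z₁ ^ a * z₂ ^ b * (z₁ - z₂) ^ c) := by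
    intro i
    induction i with
    | succ i ih =>
      intro j k P hP
      obtain ⟨P', hP'⟩ := hP.lower_fst (a := a + i) fun m n hm => h₂ m n (by push_cast at hm; lia)
      exact ih j k P' hP'
    | zero =>
      intro j
      induction j with
      | succ j ih =>
        intro k P hP
        obtain ⟨P', hP'⟩ := hP.lower_snd (b := b + j) fun m n hm => h₁ m n (by push_cast at hm; lia)
        exact ih k P' hP'
      | zero =>
        intro k
        induction k with
        | succ k ih =>
          intro P hP
          obtain ⟨P', hP'⟩ :=
            hP.lower_diag (c := c + k) fun m n hm => h₃ m n (by push_cast at hm; lia)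
          exact ih P' hP'
        | zero => exact fun P hP => ⟨P, hP⟩
  -- The given exponents `a', b', c'` need not exceed `a, b, c`. Multiplying numerator and
  -- denominator by the powers `a, b, c` produces exponents `a + a'`, `b + b'`, `c + c'`, from which
  -- the surplus is removed one factor at a time.
  refine key a' b' c' (P * X 0 ^ a * X 1 ^ b * (X 0 - X 1) ^ c) (hP.congr ?_)
  intro z₁ z₂ h1 h2 h3
  have : z₁ - z₂ ≠ 0 := sub_ne_zero.mpr h3
  simp only [map_mul, map_pow, map_sub, eval_X, Matrix.cons_val_zero, Matrix.cons_val_one,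
    Matrix.cons_val_fin_one, pow_add]
  field_simp

end PoleOrders

/-! ### Vertex algebras and modules as fields -/

namespace GRVertexAlgebra

variable {V : Type*} [AddCommGroup V] [Module ℂ V] (A : GRVertexAlgebra V)

/-- In the `L(0)`-bracket for `1(-1)1` the left side vanishes because `Y(1, z)` is the identity, and
the right side is `L(0)1` by the creation property. -/
lemma one_mem : A.one ∈ A.gr 0 := by
  refine A.mem_gr_of_L0 ?_
  have h := A.L0_bracket (-1) A.one A.one
  simp only [A.identity, if_true] at h
  have h2 := (A.creation (A.L0 A.one)).2
  rw [h2] at h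
  simpa using h.symm

lemma mode_weight (n k l : ℤ) (u x : V) (hu : u ∈ A.gr k) (hx : x ∈ A.gr l) :
    A.mode n u x ∈ A.gr (k + l - n - 1) := by
  refine A.mem_gr_of_L0 ?_
  have h := A.L0_bracket n u x
  rw [A.L0_of_mem hx, A.L0_of_mem hu, sub_eq_iff_eq_add] at h
  rw [h]
  simp only [map_smul, LinearMap.smul_apply, ← add_smul]
  congr 1
  push_cast
  ring

lemma Lm1_mem (n : ℤ) (x : V) (hx : x ∈ A.gr n) : A.Lm1 x ∈ A.gr (n + 1) := by
  have := A.mode_weight (-2) n 0 x A.one hx A.one_mem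
  rwa [show n + 0 - (-2) - 1 = n + 1 by ring] at this

/-- The graded space of a vertex algebra with its operator `L(-1)`. -/
abbrev tg : TGrading V := { A.toGrading with L := A.Lm1, L_mem := A.Lm1_mem }

/-- The vertex operator map. -/
abbrev field : FieldMap A.tg A.tg A.tg where
  mode := A.mode
  weight := A.mode_weight
  deriv_left := A.Lm1_derivative
  bracket := A.Lm1_bracket

/-- A vertex algebra as a module over itself. -/
abbrev adjoint : GRModule A V :=
  { A.toGrading with
    mode := A.mode
    Lm1 := A.Lm1
    Lm1_weight := A.Lm1_mem
    lower_truncation := A.lower_truncation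
    identity := A.identity
    duality := A.duality
    L0_bracket := A.L0_bracket
    Lm1_derivative := A.Lm1_derivative
    Lm1_bracket := A.Lm1_bracket }

lemma Lm1_one : A.Lm1 A.one = 0 := by
  change A.mode (-2) A.one A.one = 0
  rw [A.identity]
  simp

/-- `u(-k-1)1 = L(-1)^k u / k!`. -/
lemma mode_one (u : V) (k : ℕ) :
    A.mode (-k - 1) u A.one = ((k.factorial : ℂ)⁻¹) • (A.Lm1 ^ k) u := by
  induction k generalizing u with
  | zero => simpa using (A.creation u).2
  | succ k ih =>
    have h := A.Lm1_derivative (-k - 1) u A.one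
    have h2 : A.mode (-2) u A.one = A.Lm1 u := rfl
    rw [h2, ih, show (-(k : ℤ) - 1 - 1) = -((k + 1 : ℕ) : ℤ) - 1 by push_cast; ring] at h
    have hk : ((k : ℂ) + 1) ≠ 0 := by exact_mod_cast k.succ_ne_zero
    have hk' : -((-(k : ℤ) - 1 : ℤ) : ℂ) = (k : ℂ) + 1 := by push_cast; ring
    rw [hk'] at h
    rw [pow_succ, Module.End.mul_apply, Nat.factorial_succ, Nat.cast_mul, mul_inv, mul_smul, h,
      smul_smul]
    push_cast
    rw [inv_mul_cancel₀ hk, one_smul]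

end GRVertexAlgebra

namespace GRModule

variable {V : Type*} [AddCommGroup V] [Module ℂ V] {A : GRVertexAlgebra V}
  {W : Type*} [AddCommGroup W] [Module ℂ W] (B : GRModule A W)

lemma mode_weight (n k l : ℤ) (u : V) (x : W) (hu : u ∈ A.gr k) (hx : x ∈ B.gr l) :
    B.mode n u x ∈ B.gr (k + l - n - 1) := by
  refine B.mem_gr_of_L0 ?_
  have h := B.L0_bracket n u x
  rw [B.L0_of_mem hx, A.L0_of_mem hu, sub_eq_iff_eq_add] at h
  rw [h]
  simp only [map_smul, LinearMap.smul_apply, ← add_smul]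
  congr 1
  push_cast
  ring

/-- The graded space of a module with its operator `L(-1)`. -/
abbrev tg : TGrading W := { B.toGrading with L := B.Lm1, L_mem := B.Lm1_weight }

/-- The vertex operator map of a module. -/
abbrev field : FieldMap A.tg B.tg B.tg where
  mode := B.mode
  weight := B.mode_weight
  deriv_left := B.Lm1_derivative
  bracket := B.Lm1_bracket

end GRModule

/-! ### Correlation functions of two vertex operators -/

section Auxiliary

open MvPolynomial

lemma RatOn.differentiableAt {ι : Type*} [Fintype ι] {Δ : MvPolynomial ι ℂ} {f : (ι → ℂ) → ℂ}
    (hf : RatOn Δ f) {z : ι → ℂ} (hz : eval z Δ ≠ 0) : DifferentiableAt ℂ f z := by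
  have hP : ∀ P : MvPolynomial ι ℂ, Differentiable ℂ fun z : ι → ℂ => eval z P := by
    intro P
    induction P using MvPolynomial.induction_on with
    | C a => simp
    | add p q hp hq => simpa using hp.fun_add hq
    | mul_X p i hp => simpa using hp.fun_mul (differentiable_apply i)
  obtain ⟨P, N, h⟩ := hf
  have h0 : eval z Δ ^ N ≠ 0 := pow_ne_zero _ hz
  have h1 : DifferentiableAt ℂ (fun z => eval z P / eval z Δ ^ N) z := by
    simp only [div_eq_mul_inv]
    exact (hP P z).fun_mul (((hP Δ z).fun_pow N).fun_inv h0)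
  refine h1.congr_of_eventuallyEq ?_
  filter_upwards [(MvPolynomial.continuous_eval' Δ).continuousAt.eventually_ne hz] with y hy
  exact h y hy

/-- After its value at `0` is corrected, `f` is holomorphic in the disc, so its series may be
differentiated term by term. The product `y f'(y)` is used because it keeps the exponents unshifted.
-/
lemma hasSum_pow_deriv {a : ℕ → ℂ} {f f' : ℂ → ℂ} {R : ℝ}
    (h : ∀ y, 0 < ‖y‖ → ‖y‖ < R → HasSum (fun j => a j * y ^ j) (f y))
    (hd : ∀ y, 0 < ‖y‖ → ‖y‖ < R → HasDerivAt f (f' y) y) {y : ℂ}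
    (hy : 0 < ‖y‖) (hyR : ‖y‖ < R) :
    HasSum (fun j : ℕ => (j : ℂ) * a j * y ^ j) (y * f' y) := by
  have hR : 0 < R := hy.trans hyR
  have hev : ∀ᶠ t in 𝓝[≠] (0 : ℂ), 0 < ‖t‖ ∧ ‖t‖ < R := by
    filter_upwards [self_mem_nhdsWithin, nhdsWithin_le_nhds (Metric.ball_mem_nhds (0 : ℂ) hR)]
      with t h1 h2
    exact ⟨norm_pos_iff.mpr h1, by simpa using h2⟩
  set F := Function.update f 0 (a 0) with hF
  have hFd : ∀ t : ℂ, t ≠ 0 → ‖t‖ < R → HasDerivAt F (f' t) t := fun t h1 h2 =>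
    (hd t (norm_pos_iff.mpr h1) h2).congr_of_eventuallyEq (by
      filter_upwards [eventually_ne_nhds h1] with s hs
      exact Function.update_of_ne hs _ _)
  have hD : DifferentiableOn ℂ F (Metric.ball 0 R) := by
    intro t ht
    rw [Metric.mem_ball, dist_zero_right] at ht
    by_cases h0 : t = 0
    · subst h0
      exact (hasFPowerSeriesAt_update (hev.mono fun t ht => h t ht.1 ht.2)).differentiableAt
        |>.differentiableWithinAt
    · exact (hFd t h0 ht).differentiableAt.differentiableWithinAt
  have hT := fun {t : ℂ} (ht : t ∈ Metric.ball (0 : ℂ) R) =>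
    Complex.hasSum_taylorSeries_on_ball hD ht
  have hT' := Complex.hasSum_taylorSeries_on_ball (hD.deriv Metric.isOpen_ball)
    (z := y) (by simpa using hyR)
  have hcoef : a = fun n => (n.factorial : ℂ)⁻¹ * iteratedDeriv n F 0 := by
    refine hasSum_pow_unique (f := F) ?_ ?_
    · filter_upwards [hev, self_mem_nhdsWithin] with t ht h0
      rw [hF, Function.update_of_ne h0]
      exact h t ht.1 ht.2
    · filter_upwards [hev] with t ht
      refine (hT (t := t) (by simpa using ht.2)).congr_fun fun n => ?_
      simp only [sub_zero, smul_eq_mul]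
      ring
  have hy0 : y ≠ 0 := norm_pos_iff.mp hy
  rw [(hFd y hy0 hyR).deriv] at hT'
  rw [← hasSum_nat_add_iff' 1]
  simp only [Finset.range_one, Finset.sum_singleton, Nat.cast_zero, zero_mul, sub_zero]
  refine (hT'.mul_left y).congr_fun fun n => ?_
  rw [congrFun hcoef (n + 1), ← iteratedDeriv_succ', Nat.factorial_succ]
  have : (n.factorial : ℂ) ≠ 0 := by exact_mod_cast n.factorial_ne_zero
  have : ((n : ℂ) + 1) ≠ 0 := by exact_mod_cast n.succ_ne_zero
  simp only [sub_zero, smul_eq_mul]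
  push_cast
  field_simp
  ring

lemma hasSum_laurent_deriv {A : ℤ → ℂ} {f f' : ℂ → ℂ} {b : ℕ} {R : ℝ}
    (hA : ∀ n : ℤ, b ≤ n → A n = 0)
    (h : ∀ y, 0 < ‖y‖ → ‖y‖ < R → HasSum (fun n : ℤ => A n * y ^ (-n - 1)) (f y))
    (hd : ∀ y, 0 < ‖y‖ → ‖y‖ < R → HasDerivAt f (f' y) y) {y : ℂ}
    (hy : 0 < ‖y‖) (hyR : ‖y‖ < R) :
    HasSum (fun n : ℤ => -(n : ℂ) * A (n - 1) * y ^ (-n - 1)) (f' y) := by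
  have hy0 : y ≠ 0 := norm_pos_iff.mp hy
  have h1 := hasSum_pow_deriv (f := fun y => y ^ b * f y)
    (fun y h1 h2 => hasSum_nat_of_laurent hA (norm_pos_iff.mp h1) (h y h1 h2))
    (fun y h1 h2 => (hasDerivAt_pow b y).fun_mul (hd y h1 h2)) hy hyR
  have h2 := hasSum_nat_of_laurent hA hy0 (h y hy hyR)
  have h3 := (h1.sub (h2.mul_left (b : ℂ))).mul_left ((y ^ (b + 1))⁻¹)
  have hinj : Function.Injective fun j : ℕ => (b : ℤ) - j := fun a c h => by
    simp only at h; lia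
  rw [← hinj.hasSum_iff]
  · have hval : f' y = (y ^ (b + 1))⁻¹ *
        (y * (b * y ^ (b - 1) * f y + y ^ b * f' y) - b * (y ^ b * f y)) := by
      rcases b with _ | b
      · simp
        field_simp
      · simp only [Nat.add_sub_cancel]
        field_simp
        ring
    rw [hval]
    refine h3.congr_fun fun j => ?_
    simp only [Function.comp_apply]
    rw [show -((b : ℤ) - j) - 1 = j - (b + 1 : ℕ) by push_cast; ring, zpow_sub₀ hy0,
      zpow_natCast, zpow_natCast, show (b : ℤ) - j - 1 = b - 1 - j by ring]
    push_cast
    field_simp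
    ring
  · intro n hn
    rw [hA (n - 1)]
    · simp
    · by_contra h
      exact hn ⟨((b : ℤ) - n).toNat, by simp only; lia⟩

end Auxiliary

namespace FieldMap

variable {U : Type*} [AddCommGroup U] [Module ℂ U] {X : Type*} [AddCommGroup X] [Module ℂ X]
  {W : Type*} [AddCommGroup W] [Module ℂ W]
  {G₁ : TGrading U} {G₂ : TGrading X} {G₃ : TGrading W} (Y : FieldMap G₁ G₂ G₃)

lemma lau_ratOn {w' : Module.Dual ℂ W} (hw : w' ∈ G₃.gradedDual) (u : U) (x : X) {ι : Type*}
    {Δ l : MvPolynomial ι ℂ} (hl : l ∣ Δ) :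
    RatOn Δ fun z => Y.lau w' u x (MvPolynomial.eval z l) := by
  obtain ⟨s, hs⟩ := Y.exists_support hw u x
  simp only [Y.lau_eq_sum hs]
  exact RatOn.sum _ fun n _ => (RatOn.const _).mul (RatOn.zpow_of_dvd hl _)

lemma e2_ratOn {w' : Module.Dual ℂ W} (hw : w' ∈ G₃.gradedDual) (u : U) (x : X) :
    RatOn (MvPolynomial.X 0 - MvPolynomial.X 1 : MvPolynomial (Fin 2) ℂ)
      fun z => Y.e2 w' u x (z 0) (z 1) := by
  obtain ⟨K, hK⟩ := G₃.exists_comp_pow_eq_zero hw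
  simp only [Y.e2_eq_sum hw hK]
  refine RatOn.sum _ fun k _ => ?_
  have := Y.lau_ratOn (G₃.comp_pow_mem hw k) u x
    (dvd_refl (MvPolynomial.X 0 - MvPolynomial.X 1 : MvPolynomial (Fin 2) ℂ))
  simp only [map_sub, MvPolynomial.eval_X] at this
  refine RatOn.mul ?_ this
  simp only [div_eq_mul_inv]
  exact ((RatOn.coord 1).pow k).mul (RatOn.const _)

end FieldMap

/-- The polynomial `x y (x - y)`. -/
def discTwo : MvPolynomial (Fin 2) ℂ :=
  MvPolynomial.X 0 * MvPolynomial.X 1 * (MvPolynomial.X 0 - MvPolynomial.X 1)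

lemma eval_discTwo_ne (z : Fin 2 → ℂ) :
    MvPolynomial.eval z discTwo ≠ 0 ↔ z 0 ≠ 0 ∧ z 1 ≠ 0 ∧ z 0 ≠ z 1 := by
  simp [discTwo, sub_eq_zero, and_assoc]

/-- The polynomial `(x - z) (y - z) (x - y)`. -/
def discThree : MvPolynomial (Fin 3) ℂ :=
  (MvPolynomial.X 0 - MvPolynomial.X 2) * (MvPolynomial.X 1 - MvPolynomial.X 2) *
    (MvPolynomial.X 0 - MvPolynomial.X 1)

lemma eval_discThree_ne (z : Fin 3 → ℂ) :
    MvPolynomial.eval z discThree ≠ 0 ↔ z 0 ≠ z 2 ∧ z 1 ≠ z 2 ∧ z 0 ≠ z 1 := by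
  simp [discThree, sub_eq_zero, and_assoc]

lemma eventually_norm_lt : ∀ᶠ z : Fin 2 → ℂ in 𝓝 ![2, 1], 0 < ‖z 1‖ ∧ ‖z 1‖ < ‖z 0‖ := by
  have h0 : Filter.Tendsto (fun z : Fin 2 → ℂ => ‖z 0‖) (𝓝 ![2, 1]) (𝓝 2) := by
    have := (continuous_apply (A := fun _ : Fin 2 => ℂ) 0).norm.tendsto ![2, 1]
    simpa using this
  have h1 : Filter.Tendsto (fun z : Fin 2 → ℂ => ‖z 1‖) (𝓝 ![2, 1]) (𝓝 1) := by
    have := (continuous_apply (A := fun _ : Fin 2 => ℂ) 1).norm.tendsto ![2, 1]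
    simpa using this
  exact (h1.eventually_const_lt one_pos).and (h1.eventually_lt h0 (by norm_num))

namespace GRModule

open MvPolynomial

variable {V : Type*} [AddCommGroup V] [Module ℂ V] {A : GRVertexAlgebra V}
  {W : Type*} [AddCommGroup W] [Module ℂ W] (B : GRModule A W)

/-- A rational function in two variables with poles at most at `x = 0`, `y = 0`, `x = y`. -/
def IsCorr (w' : Module.Dual ℂ W) (u₁ u₂ : V) (w : W) (R : ℂ → ℂ → ℂ) : Prop :=
  RatOn discTwo (fun z => R (z 0) (z 1)) ∧
  ConvergesTo (fun m n => w' (B.mode m u₁ (B.mode n u₂ w)))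
    (fun m n => w' (B.mode n u₂ (B.mode m u₁ w))) (fun m n => w' (B.mode n (A.mode m u₁ u₂) w)) R

lemma ratOn_of_poly {P : MvPolynomial (Fin 2) ℂ} {a b c : ℕ} :
    RatOn discTwo fun z => eval ![z 0, z 1] P / (z 0 ^ a * z 1 ^ b * (z 0 - z 1) ^ c) := by
  have h0 : (X 0 : MvPolynomial (Fin 2) ℂ) ∣ discTwo := ⟨X 1 * (X 0 - X 1), by
    rw [discTwo]; ring⟩
  have h1 : (X 1 : MvPolynomial (Fin 2) ℂ) ∣ discTwo := ⟨X 0 * (X 0 - X 1), by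
    rw [discTwo]; ring⟩
  have h2 : (X 0 - X 1 : MvPolynomial (Fin 2) ℂ) ∣ discTwo := ⟨X 0 * X 1, by
    rw [discTwo]; ring⟩
  refine ((RatOn.polynomial P).mul ((((RatOn.inv_of_dvd h0).pow a).mul
    ((RatOn.inv_of_dvd h1).pow b)).mul ((RatOn.inv_of_dvd h2).pow c))).congr fun z _ => ?_
  have : (![z 0, z 1] : Fin 2 → ℂ) = z := by funext i; fin_cases i <;> rfl
  rw [this]
  simp only [map_sub, eval_X, div_eq_mul_inv, mul_inv, inv_pow]

lemma exists_bounded {w' : Module.Dual ℂ W} (hw : w' ∈ B.gradedDual) {u₁ u₂ : V} {w : W}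
    {a b c : ℕ} (ha : ∀ n : ℤ, a ≤ n → B.mode n u₁ w = 0) (hb : ∀ n : ℤ, b ≤ n → B.mode n u₂ w = 0)
    (hc : ∀ n : ℤ, c ≤ n → A.mode n u₁ u₂ = 0) : ∃ P : MvPolynomial (Fin 2) ℂ,
      B.IsCorr w' u₁ u₂ w fun x y => eval ![x, y] P / (x ^ a * y ^ b * (x - y) ^ c) := by
  obtain ⟨P, hP⟩ := (B.duality u₁ u₂ w w' hw).exists_bounded (a := a) (b := b) (c := c)
    (fun m n h => by rw [ha m h, map_zero, map_zero])
    (fun m n h => by rw [hb n h, map_zero, map_zero])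
    (fun m n h => by rw [hc m h, map_zero, LinearMap.zero_apply, map_zero])
  exact ⟨P, ratOn_of_poly, hP⟩

lemma exists_isCorr {w' : Module.Dual ℂ W} (hw : w' ∈ B.gradedDual) (u₁ u₂ : V) (w : W) :
    ∃ R, B.IsCorr w' u₁ u₂ w R := by
  obtain ⟨a, ha⟩ := B.field.exists_trunc u₁ w
  obtain ⟨b, hb⟩ := B.field.exists_trunc u₂ w
  obtain ⟨c, hc⟩ := A.field.exists_trunc u₁ u₂
  obtain ⟨P, hP⟩ := B.exists_bounded hw ha hb hc
  exact ⟨_, hP⟩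

/-- The rational function that extends `⟨w', Y(u₁, x) Y(u₂, y) w⟩`. -/
def corr (w' : Module.Dual ℂ W) (u₁ u₂ : V) (w : W) : ℂ → ℂ → ℂ :=
  open Classical in if h : ∃ R, B.IsCorr w' u₁ u₂ w R then h.choose else 0

lemma isCorr_corr {w' : Module.Dual ℂ W} (hw : w' ∈ B.gradedDual) (u₁ u₂ : V) (w : W) :
    B.IsCorr w' u₁ u₂ w (B.corr w' u₁ u₂ w) := by
  rw [corr, dif_pos (B.exists_isCorr hw u₁ u₂ w)]
  exact (B.exists_isCorr hw u₁ u₂ w).choose_spec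

lemma eq_of_region {R R' : ℂ → ℂ → ℂ} (hR : RatOn discTwo fun z => R (z 0) (z 1))
    (hR' : RatOn discTwo fun z => R' (z 0) (z 1))
    (h : ∀ x y, 0 < ‖y‖ → ‖y‖ < ‖x‖ → R x y = R' x y) {x y : ℂ} (hx : x ≠ 0) (hy : y ≠ 0)
    (hxy : x ≠ y) : R x y = R' x y := by
  have := RatOn.eq_of_eventually hR hR' (z₀ := ![2, 1]) (z := ![x, y])
    (eventually_norm_lt.mono fun z hz => h _ _ hz.1 hz.2)
    ((eval_discTwo_ne _).mpr ⟨by simpa using hx, by simpa using hy, by simpa using hxy⟩)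
  simpa using this

/-- A rational function is determined by its expansion in one open region. Identities between
correlation functions are therefore checked on products of modes for `|x| > |y|` only. -/
lemma corr_eq {w' : Module.Dual ℂ W} (hw : w' ∈ B.gradedDual) {u₁ u₂ : V} {w : W}
    {R : ℂ → ℂ → ℂ} (hR : RatOn discTwo fun z => R (z 0) (z 1))
    (h : ∀ x y, 0 < ‖y‖ → ‖y‖ < ‖x‖ → HasSum (fun p : ℤ × ℤ =>
      w' (B.mode p.1 u₁ (B.mode p.2 u₂ w)) * x ^ (-p.1 - 1) * y ^ (-p.2 - 1)) (R x y)) {x y : ℂ}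
    (hx : x ≠ 0) (hy : y ≠ 0) (hxy : x ≠ y) : B.corr w' u₁ u₂ w x y = R x y := by
  have hc := B.isCorr_corr hw u₁ u₂ w
  exact eq_of_region hc.1 hR (fun x y h1 h2 => ((hc.2 x y).1 h2 h1).unique (h x y h1 h2)) hx hy hxy

lemma corr_poly {w' : Module.Dual ℂ W} (hw : w' ∈ B.gradedDual) {u₁ u₂ : V} {w : W}
    {a b c : ℕ} (ha : ∀ n : ℤ, a ≤ n → B.mode n u₁ w = 0) (hb : ∀ n : ℤ, b ≤ n → B.mode n u₂ w = 0)
    (hc : ∀ n : ℤ, c ≤ n → A.mode n u₁ u₂ = 0) : ∃ P : MvPolynomial (Fin 2) ℂ, ∀ x y : ℂ, x ≠ 0 →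
      y ≠ 0 → x ≠ y → B.corr w' u₁ u₂ w x y = eval ![x, y] P / (x ^ a * y ^ b * (x - y) ^ c) := by
  obtain ⟨P, hP⟩ := B.exists_bounded hw ha hb hc
  exact ⟨P, fun x y hx hy hxy => B.corr_eq hw hP.1 (fun x y h1 h2 => (hP.2 x y).1 h2 h1) hx hy hxy⟩

lemma hasSum_corr {w' : Module.Dual ℂ W} (hw : w' ∈ B.gradedDual) (u₁ u₂ : V) (w : W) {x y : ℂ}
    (h1 : 0 < ‖y‖) (h2 : ‖y‖ < ‖x‖) : HasSum (fun p : ℤ × ℤ =>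
      w' (B.mode p.1 u₁ (B.mode p.2 u₂ w)) * x ^ (-p.1 - 1) * y ^ (-p.2 - 1))
      (B.corr w' u₁ u₂ w x y) :=
  ((B.isCorr_corr hw u₁ u₂ w).2 x y).1 h2 h1

/-- The expansion of `⟨w', Y(u₁, x) Y(u₂, y) w⟩` in powers of `y`. -/
lemma hasSum_corr_snd {w' : Module.Dual ℂ W} (hw : w' ∈ B.gradedDual) (u₁ u₂ : V) (w : W) {x y : ℂ}
    (h1 : 0 < ‖y‖) (h2 : ‖y‖ < ‖x‖) : HasSum (fun n : ℤ =>
      B.field.lau w' u₁ (B.mode n u₂ w) x * y ^ (-n - 1)) (B.corr w' u₁ u₂ w x y) := by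
  refine (hasSum_columns (B.hasSum_corr hw u₁ u₂ w h1 h2)).congr_fun fun n => ?_
  rw [FieldMap.lau, ← tsum_mul_right]

lemma corr_add_dual {a b : Module.Dual ℂ W} (ha : a ∈ B.gradedDual) (hb : b ∈ B.gradedDual)
    (u₁ u₂ : V) (w : W) {x y : ℂ} (hx : x ≠ 0) (hy : y ≠ 0) (hxy : x ≠ y) :
    B.corr (a + b) u₁ u₂ w x y = B.corr a u₁ u₂ w x y + B.corr b u₁ u₂ w x y :=
  B.corr_eq (R := fun x y => B.corr a u₁ u₂ w x y + B.corr b u₁ u₂ w x y)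
    (B.add_mem_gradedDual ha hb) ((B.isCorr_corr ha u₁ u₂ w).1.add (B.isCorr_corr hb u₁ u₂ w).1)
    (fun _ _ h1 h2 => ((B.hasSum_corr ha u₁ u₂ w h1 h2).add
      (B.hasSum_corr hb u₁ u₂ w h1 h2)).congr_fun fun p => by
        simp only [LinearMap.add_apply]; ring) hx hy hxy

lemma corr_smul_dual {a : Module.Dual ℂ W} (ha : a ∈ B.gradedDual) (c : ℂ)
    (u₁ u₂ : V) (w : W) {x y : ℂ} (hx : x ≠ 0) (hy : y ≠ 0) (hxy : x ≠ y) :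
    B.corr (c • a) u₁ u₂ w x y = c * B.corr a u₁ u₂ w x y :=
  B.corr_eq (R := fun x y => c * B.corr a u₁ u₂ w x y)
    (B.smul_mem_gradedDual c ha) ((RatOn.const c).mul (B.isCorr_corr ha u₁ u₂ w).1)
    (fun _ _ h1 h2 => ((B.hasSum_corr ha u₁ u₂ w h1 h2).mul_left c).congr_fun fun p => by
        simp only [LinearMap.smul_apply, smul_eq_mul]; ring) hx hy hxy

lemma corr_sum_dual {ι : Type*} (s : Finset ι) (c : ι → ℂ) (a : ι → Module.Dual ℂ W)
    (ha : ∀ i, a i ∈ B.gradedDual) (u₁ u₂ : V) (w : W) {x y : ℂ} (hx : x ≠ 0) (hy : y ≠ 0)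
    (hxy : x ≠ y) :
    B.corr (∑ i ∈ s, c i • a i) u₁ u₂ w x y = ∑ i ∈ s, c i * B.corr (a i) u₁ u₂ w x y := by
  classical
  induction s using Finset.induction_on with
  | empty =>
    have := B.corr_smul_dual B.zero_mem_gradedDual 0 u₁ u₂ w hx hy hxy
    simpa using this
  | insert i s hi ih =>
    rw [Finset.sum_insert hi, Finset.sum_insert hi, B.corr_add_dual
      (B.smul_mem_gradedDual _ (ha i)) (B.sum_mem_gradedDual _ _ fun k _ =>
      B.smul_mem_gradedDual _ (ha k)) _ _ _ hx hy hxy, ih, B.corr_smul_dual (ha i) _ _ _ _ hx hy hxy]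

lemma corr_add_fst {w' : Module.Dual ℂ W} (hw : w' ∈ B.gradedDual)
    (u₁ v₁ u₂ : V) (w : W) {x y : ℂ} (hx : x ≠ 0) (hy : y ≠ 0) (hxy : x ≠ y) :
    B.corr w' (u₁ + v₁) u₂ w x y = B.corr w' u₁ u₂ w x y + B.corr w' v₁ u₂ w x y :=
  B.corr_eq (R := fun x y => B.corr w' u₁ u₂ w x y + B.corr w' v₁ u₂ w x y) hw
    ((B.isCorr_corr hw u₁ u₂ w).1.add (B.isCorr_corr hw v₁ u₂ w).1)
    (fun _ _ h1 h2 => ((B.hasSum_corr hw u₁ u₂ w h1 h2).add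
      (B.hasSum_corr hw v₁ u₂ w h1 h2)).congr_fun fun p => by
        simp only [LinearMap.add_apply, map_add]; ring) hx hy hxy

lemma corr_add_snd {w' : Module.Dual ℂ W} (hw : w' ∈ B.gradedDual)
    (u₁ u₂ v₂ : V) (w : W) {x y : ℂ} (hx : x ≠ 0) (hy : y ≠ 0) (hxy : x ≠ y) :
    B.corr w' u₁ (u₂ + v₂) w x y = B.corr w' u₁ u₂ w x y + B.corr w' u₁ v₂ w x y :=
  B.corr_eq (R := fun x y => B.corr w' u₁ u₂ w x y + B.corr w' u₁ v₂ w x y) hw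
    ((B.isCorr_corr hw u₁ u₂ w).1.add (B.isCorr_corr hw u₁ v₂ w).1)
    (fun _ _ h1 h2 => ((B.hasSum_corr hw u₁ u₂ w h1 h2).add
      (B.hasSum_corr hw u₁ v₂ w h1 h2)).congr_fun fun p => by
        simp only [LinearMap.add_apply, map_add]; ring) hx hy hxy

lemma corr_add_vec {w' : Module.Dual ℂ W} (hw : w' ∈ B.gradedDual)
    (u₁ u₂ : V) (w₁ w₂ : W) {x y : ℂ} (hx : x ≠ 0) (hy : y ≠ 0) (hxy : x ≠ y) :
    B.corr w' u₁ u₂ (w₁ + w₂) x y = B.corr w' u₁ u₂ w₁ x y + B.corr w' u₁ u₂ w₂ x y :=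
  B.corr_eq (R := fun x y => B.corr w' u₁ u₂ w₁ x y + B.corr w' u₁ u₂ w₂ x y) hw
    ((B.isCorr_corr hw u₁ u₂ w₁).1.add (B.isCorr_corr hw u₁ u₂ w₂).1)
    (fun _ _ h1 h2 => ((B.hasSum_corr hw u₁ u₂ w₁ h1 h2).add
      (B.hasSum_corr hw u₁ u₂ w₂ h1 h2)).congr_fun fun p => by
        simp only [map_add]; ring) hx hy hxy

lemma ratOn_swap {R : ℂ → ℂ → ℂ} (hR : RatOn discTwo fun z => R (z 0) (z 1)) :
    RatOn discTwo fun z => R (z 1) (z 0) := by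
  have h := hR.comp (κ := Fin 2) ![X 1, X 0]
  have h2 : bind₁ (![X 1, X 0] : Fin 2 → MvPolynomial (Fin 2) ℂ) discTwo ∣ discTwo := by
    refine ⟨-1, ?_⟩
    simp [discTwo]
    ring
  simpa using h.mono h2

/-- Commutativity: the expansion for `|y| > |x|` supplied by duality for `u₂, u₁` is the product
expansion for `u₁, u₂`. -/
lemma corr_symm {w' : Module.Dual ℂ W} (hw : w' ∈ B.gradedDual) (u₁ u₂ : V) (w : W) {x y : ℂ}
    (hx : x ≠ 0) (hy : y ≠ 0) (hxy : x ≠ y) :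
    B.corr w' u₁ u₂ w x y = B.corr w' u₂ u₁ w y x := by
  refine B.corr_eq (R := fun x y => B.corr w' u₂ u₁ w y x) hw
    (ratOn_swap (B.isCorr_corr hw u₂ u₁ w).1) (fun x y h1 h2 => ?_) hx hy hxy
  have h3 := ((B.isCorr_corr hw u₂ u₁ w).2 y x).2.1 h2 h1
  exact ((Equiv.prodComm ℤ ℤ).hasSum_iff.mpr h3).congr_fun fun p => by
    simp only [Function.comp_apply, Equiv.prodComm_apply, Prod.fst_swap, Prod.snd_swap]; ring

/-- The `L(-1)`-derivative property for the second vertex operator. -/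
lemma hasDerivAt_corr_snd {w' : Module.Dual ℂ W} (hw : w' ∈ B.gradedDual) (u₁ u₂ : V) (w : W)
    {x y : ℂ} (hx : x ≠ 0) (hy : y ≠ 0) (hxy : x ≠ y) :
    HasDerivAt (fun t => B.corr w' u₁ u₂ w x t) (B.corr w' u₁ (A.Lm1 u₂) w x y) y := by
  obtain ⟨f', hf', hd⟩ := (B.isCorr_corr hw u₁ u₂ w).1.exists_hasDerivAt ![0, 1]
  have hd' : ∀ x y : ℂ, x ≠ 0 → y ≠ 0 → x ≠ y →
      HasDerivAt (fun t => B.corr w' u₁ u₂ w x t) (f' ![x, y]) y := by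
    intro x y hx hy hxy
    have h := hd ![x, y] ((eval_discTwo_ne _).mpr ⟨by simpa using hx, by simpa using hy,
      by simpa using hxy⟩)
    have h' := HasDerivAt.comp_sub_const (f := fun t : ℂ =>
      B.corr w' u₁ u₂ w (x + t * 0) (y + t * 1)) y y (f' := f' ![x, y]) (by simpa using h)
    simpa using h'
  obtain ⟨b, hb⟩ := B.field.exists_trunc u₂ w
  have hf : RatOn discTwo fun z => f' ![z 0, z 1] := by
    have h3 : ∀ z : Fin 2 → ℂ, ![z 0, z 1] = z := fun z => by funext i; fin_cases i <;> rfl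
    simpa only [h3] using hf'
  -- The partial derivative `f'` is again rational. Differentiating the Laurent expansion in `y`
  -- term by term and using the derivative property of the modes identifies it with the correlation
  -- function of `L(-1)u₂`.
  have key := B.corr_eq (R := fun x y => f' ![x, y]) hw (u₁ := u₁) (u₂ := A.Lm1 u₂) (w := w) hf
    (fun x y h1 h2 => ?_) hx hy hxy
  · rw [key]
    exact hd' x y hx hy hxy
  · have hx0 : x ≠ 0 := norm_pos_iff.mp (h1.trans h2)
    have hs := hasSum_laurent_deriv (A := fun n => B.field.lau w' u₁ (B.mode n u₂ w) x) (b := b)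
      (f := fun y => B.corr w' u₁ u₂ w x y) (R := ‖x‖) (fun n hn => by
        have : B.mode n u₂ w = 0 := hb n hn
        simp only [this]; simp [FieldMap.lau])
      (f' := fun y => f' ![x, y]) (fun y h1 h2 => B.hasSum_corr_snd hw u₁ u₂ w h1 h2)
      (fun y h1 h2 => hd' x y hx0 (norm_pos_iff.mp h1) (by rintro rfl; exact h2.false)) h1 h2
    have hc := B.hasSum_corr_snd hw u₁ (A.Lm1 u₂) w h1 h2
    have : f' ![x, y] = B.corr w' u₁ (A.Lm1 u₂) w x y := by
      refine hs.unique (hc.congr_fun fun n => ?_)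
      rw [B.Lm1_derivative, B.field.lau_smul_right hw]
    rw [this]
    exact B.hasSum_corr hw u₁ (A.Lm1 u₂) w h1 h2

lemma hasDerivAt_corr_fst {w' : Module.Dual ℂ W} (hw : w' ∈ B.gradedDual) (u₁ u₂ : V) (w : W)
    {x y : ℂ} (hx : x ≠ 0) (hy : y ≠ 0) (hxy : x ≠ y) :
    HasDerivAt (fun t => B.corr w' u₁ u₂ w t y) (B.corr w' (A.Lm1 u₁) u₂ w x y) x := by
  rw [B.corr_symm hw _ _ _ hx hy hxy]
  refine (B.hasDerivAt_corr_snd hw u₂ u₁ w hy hx hxy.symm).congr_of_eventuallyEq ?_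
  filter_upwards [eventually_ne_nhds hx, eventually_ne_nhds hxy] with t h1 h2
  exact B.corr_symm hw _ _ _ h1 hy h2

/-- `L(-1)` is commuted through both vertex operators; each bracket is a derivative, that is,
`L(-1)` inserted in the corresponding argument. -/
lemma corr_comp_L {w' : Module.Dual ℂ W} (hw : w' ∈ B.gradedDual) (u₁ u₂ : V) (w : W) {x y : ℂ}
    (hx : x ≠ 0) (hy : y ≠ 0) (hxy : x ≠ y) :
    B.corr (w'.comp B.Lm1) u₁ u₂ w x y = B.corr w' (A.Lm1 u₁) u₂ w x y +
      B.corr w' u₁ (A.Lm1 u₂) w x y + B.corr w' u₁ u₂ (B.Lm1 w) x y := by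
  refine B.corr_eq (R := fun x y => B.corr w' (A.Lm1 u₁) u₂ w x y +
      B.corr w' u₁ (A.Lm1 u₂) w x y + B.corr w' u₁ u₂ (B.Lm1 w) x y) (B.tg.comp_L_mem hw)
    (((B.isCorr_corr hw _ _ _).1.add (B.isCorr_corr hw _ _ _).1).add (B.isCorr_corr hw _ _ _).1)
    (fun x y h1 h2 => ?_) hx hy hxy
  refine (((B.hasSum_corr hw _ _ _ h1 h2).add (B.hasSum_corr hw _ _ _ h1 h2)).add
    (B.hasSum_corr hw _ _ _ h1 h2)).congr_fun fun p => ?_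
  rw [LinearMap.comp_apply, ← add_mul, ← add_mul, ← add_mul, ← add_mul, ← map_add, ← map_add]
  congr 3
  have e1 := B.Lm1_bracket p.1 u₁ (B.mode p.2 u₂ w)
  have e2 := B.Lm1_bracket p.2 u₂ w
  rw [sub_eq_iff_eq_add] at e1 e2
  rw [e1, e2, B.Lm1_derivative, B.Lm1_derivative, map_add]
  abel

end GRModule

/-! ### Three-point functions: two vertex operators and a translated vector -/

namespace GRModule

open MvPolynomial

variable {V : Type*} [AddCommGroup V] [Module ℂ V] {A : GRVertexAlgebra V}
  {W : Type*} [AddCommGroup W] [Module ℂ W] (B : GRModule A W)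

/-- The rational function `⟨w', Y(u₁, z₁) Y(u₂, z₂) e^{z₃ L(-1)} w⟩`. -/
def tri (w' : Module.Dual ℂ W) (u₁ u₂ : V) (w : W) (z₁ z₂ z₃ : ℂ) : ℂ :=
  B.corr (B.tg.expDual w' z₃) u₁ u₂ w (z₁ - z₃) (z₂ - z₃)

lemma tri_eq_sum {w' : Module.Dual ℂ W} (hw : w' ∈ B.gradedDual) {K : ℕ}
    (hK : ∀ k ≥ K, w'.comp (B.Lm1 ^ k) = 0) (u₁ u₂ : V) (w : W) {z₁ z₂ z₃ : ℂ} (h₁ : z₁ ≠ z₃)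
    (h₂ : z₂ ≠ z₃) (h₁₂ : z₁ ≠ z₂) : B.tri w' u₁ u₂ w z₁ z₂ z₃ =
      ∑ k ∈ Finset.range K, z₃ ^ k / (k.factorial : ℂ) *
        B.corr (w'.comp (B.Lm1 ^ k)) u₁ u₂ w (z₁ - z₃) (z₂ - z₃) := by
  rw [tri, B.tg.expDual_eq_sum hK, B.corr_sum_dual _ _ _ (fun k => B.tg.comp_pow_mem hw k)]
  · exact sub_ne_zero.mpr h₁
  · exact sub_ne_zero.mpr h₂
  · simpa using h₁₂

/-- `e^{z₃L(-1)}` contributes finitely many functionals, and the pole bounds of the two-point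
functions depend only on `u₁, u₂, w`; so one denominator serves all summands. -/
lemma tri_poly {w' : Module.Dual ℂ W} (hw : w' ∈ B.gradedDual) {u₁ u₂ : V} {w : W}
    {a b c : ℕ} (ha : ∀ n : ℤ, a ≤ n → B.mode n u₁ w = 0) (hb : ∀ n : ℤ, b ≤ n → B.mode n u₂ w = 0)
    (hc : ∀ n : ℤ, c ≤ n → A.mode n u₁ u₂ = 0) : ∃ Q : MvPolynomial (Fin 3) ℂ, ∀ z₁ z₂ z₃ : ℂ,
      z₁ ≠ z₃ → z₂ ≠ z₃ → z₁ ≠ z₂ → B.tri w' u₁ u₂ w z₁ z₂ z₃ =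
        eval ![z₁, z₂, z₃] Q / ((z₁ - z₃) ^ a * (z₂ - z₃) ^ b * (z₁ - z₂) ^ c) := by
  obtain ⟨K, hK⟩ := B.tg.exists_comp_pow_eq_zero hw
  choose P hP using fun k => B.corr_poly (B.tg.comp_pow_mem hw k) ha hb hc
  refine ⟨∑ k ∈ Finset.range K, C ((k.factorial : ℂ)⁻¹) * X 2 ^ k *
    bind₁ ![X 0 - X 2, X 1 - X 2] (P k), fun z₁ z₂ z₃ h₁ h₂ h₁₂ => ?_⟩
  rw [B.tri_eq_sum hw hK _ _ _ h₁ h₂ h₁₂, map_sum, Finset.sum_div]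
  refine Finset.sum_congr rfl fun k _ => ?_
  rw [hP k _ _ (sub_ne_zero.mpr h₁) (sub_ne_zero.mpr h₂) (by simpa using h₁₂),
    map_mul, map_mul, map_pow, eval_C, eval_X, MvPolynomial.eval_bind₁]
  have : (fun i => eval ![z₁, z₂, z₃]
      ((![X 0 - X 2, X 1 - X 2] : Fin 2 → MvPolynomial (Fin 3) ℂ) i)) = ![z₁ - z₃, z₂ - z₃] := by
    funext i; fin_cases i <;> simp
  rw [this, sub_sub_sub_cancel_right]
  simp only [Matrix.cons_val]
  ring

lemma ratOn_of_poly_three {P : MvPolynomial (Fin 3) ℂ} {a b c : ℕ} :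
    RatOn discThree fun z => eval ![z 0, z 1, z 2] P /
      ((z 0 - z 2) ^ a * (z 1 - z 2) ^ b * (z 0 - z 1) ^ c) := by
  have h0 : (X 0 - X 2 : MvPolynomial (Fin 3) ℂ) ∣ discThree := ⟨(X 1 - X 2) * (X 0 - X 1), by
    rw [discThree]; ring⟩
  have h1 : (X 1 - X 2 : MvPolynomial (Fin 3) ℂ) ∣ discThree := ⟨(X 0 - X 2) * (X 0 - X 1), by
    rw [discThree]; ring⟩
  have h2 : (X 0 - X 1 : MvPolynomial (Fin 3) ℂ) ∣ discThree := ⟨(X 0 - X 2) * (X 1 - X 2), by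
    rw [discThree]; ring⟩
  refine ((RatOn.polynomial P).mul ((((RatOn.inv_of_dvd h0).pow a).mul
    ((RatOn.inv_of_dvd h1).pow b)).mul ((RatOn.inv_of_dvd h2).pow c))).congr fun z _ => ?_
  have : (![z 0, z 1, z 2] : Fin 3 → ℂ) = z := by funext i; fin_cases i <;> rfl
  rw [this]
  simp only [map_sub, eval_X, div_eq_mul_inv, mul_inv, inv_pow]

lemma tri_ratOn {w' : Module.Dual ℂ W} (hw : w' ∈ B.gradedDual) (u₁ u₂ : V) (w : W) :
    RatOn discThree fun z => B.tri w' u₁ u₂ w (z 0) (z 1) (z 2) := by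
  obtain ⟨a, ha⟩ := B.field.exists_trunc u₁ w
  obtain ⟨b, hb⟩ := B.field.exists_trunc u₂ w
  obtain ⟨c, hc⟩ := A.field.exists_trunc u₁ u₂
  obtain ⟨Q, hQ⟩ := B.tri_poly hw ha hb hc
  refine (ratOn_of_poly_three (P := Q) (a := a) (b := b) (c := c)).congr fun z hz => ?_
  obtain ⟨h1, h2, h3⟩ := (eval_discThree_ne z).mp hz
  exact hQ _ _ _ h1 h2 h3

lemma tri_expDual {w' : Module.Dual ℂ W} (hw : w' ∈ B.gradedDual) (u₁ u₂ : V) (w : W)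
    (z₁ z₂ z₃ ζ : ℂ) : B.tri (B.tg.expDual w' ζ) u₁ u₂ w (z₁ - ζ) (z₂ - ζ) (z₃ - ζ) =
      B.tri w' u₁ u₂ w z₁ z₂ z₃ := by
  rw [tri, tri, B.tg.expDual_expDual hw, add_sub_cancel, sub_sub_sub_cancel_right,
    sub_sub_sub_cancel_right]

lemma tri_zero {w' : Module.Dual ℂ W} (hw : w' ∈ B.gradedDual) (u₁ u₂ : V) (w : W) (z₁ z₂ : ℂ) :
    B.tri w' u₁ u₂ w z₁ z₂ 0 = B.corr w' u₁ u₂ w z₁ z₂ := by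
  rw [tri, B.tg.expDual_zero hw, sub_zero, sub_zero]

lemma tri_symm {w' : Module.Dual ℂ W} (hw : w' ∈ B.gradedDual) (u₁ u₂ : V) (w : W) {z₁ z₂ z₃ : ℂ}
    (h₁ : z₁ ≠ z₃) (h₂ : z₂ ≠ z₃) (h₁₂ : z₁ ≠ z₂) :
    B.tri w' u₁ u₂ w z₁ z₂ z₃ = B.tri w' u₂ u₁ w z₂ z₁ z₃ :=
  B.corr_symm (B.tg.expDual_mem hw z₃) u₁ u₂ w (sub_ne_zero.mpr h₁) (sub_ne_zero.mpr h₂)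
    (by simpa using h₁₂)

lemma tri_add_dual {a b : Module.Dual ℂ W} (ha : a ∈ B.gradedDual) (hb : b ∈ B.gradedDual)
    (u₁ u₂ : V) (w : W) {z₁ z₂ z₃ : ℂ} (h₁ : z₁ ≠ z₃) (h₂ : z₂ ≠ z₃) (h₁₂ : z₁ ≠ z₂) :
    B.tri (a + b) u₁ u₂ w z₁ z₂ z₃ = B.tri a u₁ u₂ w z₁ z₂ z₃ + B.tri b u₁ u₂ w z₁ z₂ z₃ := by
  rw [tri, B.tg.expDual_add_dual ha hb]
  exact B.corr_add_dual (B.tg.expDual_mem ha z₃) (B.tg.expDual_mem hb z₃) _ _ _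
    (sub_ne_zero.mpr h₁) (sub_ne_zero.mpr h₂) (by simpa using h₁₂)

lemma tri_smul_dual {a : Module.Dual ℂ W} (ha : a ∈ B.gradedDual) (c : ℂ)
    (u₁ u₂ : V) (w : W) {z₁ z₂ z₃ : ℂ} (h₁ : z₁ ≠ z₃) (h₂ : z₂ ≠ z₃) (h₁₂ : z₁ ≠ z₂) :
    B.tri (c • a) u₁ u₂ w z₁ z₂ z₃ = c * B.tri a u₁ u₂ w z₁ z₂ z₃ := by
  rw [tri, B.tg.expDual_smul_dual c ha]
  exact B.corr_smul_dual (B.tg.expDual_mem ha z₃) _ _ _ _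
    (sub_ne_zero.mpr h₁) (sub_ne_zero.mpr h₂) (by simpa using h₁₂)

lemma tri_add_fst {w' : Module.Dual ℂ W} (hw : w' ∈ B.gradedDual) (u₁ v₁ u₂ : V) (w : W)
    {z₁ z₂ z₃ : ℂ} (h₁ : z₁ ≠ z₃) (h₂ : z₂ ≠ z₃) (h₁₂ : z₁ ≠ z₂) :
    B.tri w' (u₁ + v₁) u₂ w z₁ z₂ z₃ = B.tri w' u₁ u₂ w z₁ z₂ z₃ + B.tri w' v₁ u₂ w z₁ z₂ z₃ :=
  B.corr_add_fst (B.tg.expDual_mem hw z₃) _ _ _ _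
    (sub_ne_zero.mpr h₁) (sub_ne_zero.mpr h₂) (by simpa using h₁₂)

lemma tri_add_snd {w' : Module.Dual ℂ W} (hw : w' ∈ B.gradedDual) (u₁ u₂ v₂ : V) (w : W)
    {z₁ z₂ z₃ : ℂ} (h₁ : z₁ ≠ z₃) (h₂ : z₂ ≠ z₃) (h₁₂ : z₁ ≠ z₂) :
    B.tri w' u₁ (u₂ + v₂) w z₁ z₂ z₃ = B.tri w' u₁ u₂ w z₁ z₂ z₃ + B.tri w' u₁ v₂ w z₁ z₂ z₃ :=
  B.corr_add_snd (B.tg.expDual_mem hw z₃) _ _ _ _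
    (sub_ne_zero.mpr h₁) (sub_ne_zero.mpr h₂) (by simpa using h₁₂)

lemma tri_add_vec {w' : Module.Dual ℂ W} (hw : w' ∈ B.gradedDual) (u₁ u₂ : V) (w x : W)
    {z₁ z₂ z₃ : ℂ} (h₁ : z₁ ≠ z₃) (h₂ : z₂ ≠ z₃) (h₁₂ : z₁ ≠ z₂) :
    B.tri w' u₁ u₂ (w + x) z₁ z₂ z₃ = B.tri w' u₁ u₂ w z₁ z₂ z₃ + B.tri w' u₁ u₂ x z₁ z₂ z₃ :=
  B.corr_add_vec (B.tg.expDual_mem hw z₃) _ _ _ _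
    (sub_ne_zero.mpr h₁) (sub_ne_zero.mpr h₂) (by simpa using h₁₂)

end GRModule

lemma HasDPS.inv_sub {D : Set (ℂ × ℂ)} {z : ℂ} (a b : ℂ) (hz : z ≠ 0)
    (h : ∀ p ∈ D, ‖a * p.1‖ + ‖b * p.2‖ < ‖z‖) :
    HasDPS D fun p => (z - (a * p.1 + b * p.2))⁻¹ := by
  have h1 := (HasDPS.const z⁻¹).mul (HasDPS.inv_one_sub_add (D := D) (z⁻¹ * a) (z⁻¹ * b)
    fun p hp => by
      rw [mul_assoc, mul_assoc, norm_mul z⁻¹, norm_mul z⁻¹, ← mul_add, norm_inv,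
        inv_mul_lt_iff₀ (norm_pos_iff.mpr hz), mul_one]
      exact h p hp)
  refine h1.congr fun p _ => ?_
  rw [← mul_inv]
  congr 1
  field_simp

namespace GRModule

open MvPolynomial

variable {V : Type*} [AddCommGroup V] [Module ℂ V] {A : GRVertexAlgebra V}
  {W : Type*} [AddCommGroup W] [Module ℂ W] (B : GRModule A W)

/-- The expansion of `⟨w', Y(u₁, z₁) e^{s L(-1)} Y(u₂, d) w⟩` in powers of `s` and `d`. -/
lemma hasSum_tri_small {w' : Module.Dual ℂ W} (hw : w' ∈ B.gradedDual) {u₁ u₂ : V} {w : W}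
    {b : ℕ} (hb : ∀ n : ℤ, b ≤ n → B.mode n u₂ w = 0) {z₁ s d : ℂ}
    (hd : d ≠ 0) (h : ‖s‖ + ‖d‖ < ‖z₁‖) :
    HasSum (fun i : ℕ × ℕ => B.field.lau w' u₁ ((B.Lm1 ^ i.1) (B.mode (b - 1 - i.2) u₂ w)) z₁ /
      (i.1.factorial : ℂ) * (s ^ i.1 * d ^ i.2)) (d ^ b * B.tri w' u₁ u₂ w z₁ (s + d) s) := by
  obtain ⟨a, ha⟩ := B.field.exists_trunc u₁ w
  obtain ⟨c, hc⟩ := A.field.exists_trunc u₁ u₂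
  obtain ⟨Q, hQ⟩ := B.tri_poly hw ha hb hc
  have hz₁ : z₁ ≠ 0 := norm_pos_iff.mp (lt_of_le_of_lt (by positivity) h)
  -- Once the pole `d^b` is cleared, what remains is a polynomial times inverse powers of `z₁ - s`
  -- and `z₁ - s - d`, which are absolutely expandable for `‖s‖ + ‖d‖ < ‖z₁‖`.
  set K : ℂ × ℂ → ℂ := fun p => eval ![z₁, p.1 + p.2, p.1] Q *
    ((z₁ - (1 * p.1 + 0 * p.2))⁻¹ ^ a * (z₁ - (1 * p.1 + 1 * p.2))⁻¹ ^ c) with hKdef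
  have hK : HasDPS {p : ℂ × ℂ | ‖p.1‖ + ‖p.2‖ < ‖z₁‖} K := by
    refine HasDPS.mul ?_ (HasDPS.mul (HasDPS.pow (HasDPS.inv_sub 1 0 hz₁ fun p hp => ?_) a)
      (HasDPS.pow (HasDPS.inv_sub 1 1 hz₁ fun p hp => ?_) c))
    · have := HasDPS.eval (D := {p : ℂ × ℂ | ‖p.1‖ + ‖p.2‖ < ‖z₁‖})
        (φ := fun i p => (![z₁, p.1 + p.2, p.1] : Fin 3 → ℂ) i) (fun i => by
          fin_cases i
          · exact HasDPS.const z₁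
          · exact HasDPS.fst.add HasDPS.snd
          · exact HasDPS.fst) Q
      exact this
    · have hp : ‖p.1‖ + ‖p.2‖ < ‖z₁‖ := hp
      have := norm_nonneg p.2
      simp
      linarith
    · have hp : ‖p.1‖ + ‖p.2‖ < ‖z₁‖ := hp
      simpa using hp
  have hval : ∀ s d : ℂ, d ≠ 0 → ‖s‖ + ‖d‖ < ‖z₁‖ →
      K (s, d) = d ^ b * B.tri w' u₁ u₂ w z₁ (s + d) s := by
    intro s d hd h
    have h1 : z₁ ≠ s := by rintro rfl; have := norm_nonneg d; linarith
    have h2 : z₁ ≠ s + d := by rintro rfl; exact (norm_add_le s d).not_gt h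
    rw [hQ _ _ _ h1 (by simpa using hd) h2, hKdef]
    have h1' := sub_ne_zero.mpr h1
    have h2' := sub_ne_zero.mpr h2
    simp only [one_mul, zero_mul, add_zero, add_sub_cancel_left, inv_pow]
    field_simp
  obtain ⟨κ, hκ⟩ := hK
  -- The coefficients come from the Laurent expansion in `d` of the translated two-point function,
  -- followed by the expansion of `e^{sL(-1)}` in `s`.
  have hcoef := dps_coeff (c := κ) (K := K) (ε := ‖z₁‖ / 2) (half_pos (norm_pos_iff.mpr hz₁))
    (fun s d h1 h2 => hκ (s, d) (by change ‖s‖ + ‖d‖ < ‖z₁‖; linarith))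
    (κ := fun i j => B.field.lau w' u₁ ((B.Lm1 ^ i) (B.mode (b - 1 - j) u₂ w)) z₁ /
      (i.factorial : ℂ)) (k := fun j s => B.field.e2 w' u₁ (B.mode (b - 1 - j) u₂ w) z₁ s) ?_ ?_
  · rw [← hval s d hd h]
    refine (hκ (s, d) h).congr_fun fun i => ?_
    rw [← hcoef]
  · have hev : ∀ᶠ s in 𝓝[≠] (0 : ℂ), ‖s‖ < ‖z₁‖ := by
      filter_upwards [nhdsWithin_le_nhds
        (Metric.ball_mem_nhds (0 : ℂ) (norm_pos_iff.mpr hz₁))] with s hs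
      simpa using hs
    filter_upwards [hev] with s hs
    filter_upwards [self_mem_nhdsWithin, nhdsWithin_le_nhds
      (Metric.ball_mem_nhds (0 : ℂ) (sub_pos.mpr hs))] with d hd0 hd1
    have hd1 : ‖d‖ < ‖z₁‖ - ‖s‖ := by simpa using hd1
    rw [hval s d hd0 (by linarith)]
    have h3 := B.hasSum_corr_snd (B.tg.expDual_mem hw s) u₁ u₂ w (x := z₁ - s)
      (norm_pos_iff.mpr hd0) (by have := norm_sub_norm_le z₁ s; linarith)
    have h4 := hasSum_nat_of_laurent (b := b) (fun n hn => by
      rw [hb n hn]; simp [FieldMap.lau]) hd0 h3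
    rw [tri, add_sub_cancel_left]
    exact h4
  · intro j
    filter_upwards [nhdsWithin_le_nhds
        (Metric.ball_mem_nhds (0 : ℂ) (norm_pos_iff.mpr hz₁))] with s hs
    refine (B.field.hasSum_lau_exp hw u₁ (B.mode (b - 1 - j) u₂ w) (z := z₁) (s := s)
      (by simpa using hs)).congr_fun fun i => ?_
    ring

/-- With `M = max ‖z₂‖ ‖z₃‖ < ‖z₁‖`, the number `R = 2‖z₁‖ / (‖z₁‖ + M)` satisfies `R > 1` and `R M
< ‖z₁‖`. -/
lemma exists_scale {z₁ z₂ z₃ : ℂ} (h₂ : ‖z₂‖ < ‖z₁‖) (h₃ : ‖z₃‖ < ‖z₁‖) :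
    ∃ R : ℝ, 1 < R ∧ R * ‖z₂‖ < ‖z₁‖ ∧ R * ‖z₃‖ < ‖z₁‖ := by
  set M := max ‖z₂‖ ‖z₃‖ with hM
  have hM1 : M < ‖z₁‖ := max_lt h₂ h₃
  have hM0 : 0 ≤ M := le_max_of_le_left (norm_nonneg _)
  have hpos : 0 < ‖z₁‖ + M := by linarith
  have hR : 2 * ‖z₁‖ / (‖z₁‖ + M) * M < ‖z₁‖ := by
    rw [div_mul_eq_mul_div, div_lt_iff₀ hpos]
    nlinarith
  have hR0 : 0 ≤ 2 * ‖z₁‖ / (‖z₁‖ + M) := by positivity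
  refine ⟨2 * ‖z₁‖ / (‖z₁‖ + M), ?_, ?_, ?_⟩
  · rw [lt_div_iff₀ hpos]; linarith
  · exact lt_of_le_of_lt (mul_le_mul_of_nonneg_left (le_max_left _ _) hR0) hR
  · exact lt_of_le_of_lt (mul_le_mul_of_nonneg_left (le_max_right _ _) hR0) hR

/-- Replacing `(z₂, z₃)` by `(t z₂, t z₃)` multiplies the `i`-th term by `t^i`. For small `t` the
sum is known from `hasSum_tri_small`, and the rational function is holomorphic in `t` on a disc of
radius larger than `1`; so `t = 1` is reached. The region improves from `‖z₃‖ + ‖z₂ - z₃‖ < ‖z₁‖` to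
the one in the definition of `G₁`. -/
lemma hasSum_tri_antidiagonal {w' : Module.Dual ℂ W} (hw : w' ∈ B.gradedDual) {u₁ u₂ : V} {w : W}
    {b : ℕ} (hb : ∀ n : ℤ, b ≤ n → B.mode n u₂ w = 0) {z₁ z₂ z₃ : ℂ} (h₂ : ‖z₂‖ < ‖z₁‖)
    (h₃ : ‖z₃‖ < ‖z₁‖) (h : z₂ ≠ z₃) :
    HasSum (fun i : ℕ => ∑ p ∈ Finset.HasAntidiagonal.antidiagonal i,
      B.field.lau w' u₁ ((B.Lm1 ^ p.1) (B.mode (b - 1 - p.2) u₂ w)) z₁ / (p.1.factorial : ℂ) *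
        (z₃ ^ p.1 * (z₂ - z₃) ^ p.2)) ((z₂ - z₃) ^ b * B.tri w' u₁ u₂ w z₁ z₂ z₃) := by
  obtain ⟨a, ha⟩ := B.field.exists_trunc u₁ w
  obtain ⟨c, hc⟩ := A.field.exists_trunc u₁ u₂
  obtain ⟨Q, hQ⟩ := B.tri_poly hw ha hb hc
  obtain ⟨R, hR1, hR2, hR3⟩ := exists_scale h₂ h₃
  have hz₁ : z₁ ≠ 0 := norm_pos_iff.mp (lt_of_le_of_lt (norm_nonneg _) h₂)
  have hz : z₂ - z₃ ≠ 0 := sub_ne_zero.mpr h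
  have hne : ∀ {t x : ℂ}, ‖t‖ < R → R * ‖x‖ < ‖z₁‖ → z₁ - t * x ≠ 0 := by
    intro t x ht hx h0
    rw [sub_eq_zero] at h0
    rw [h0, norm_mul] at hx
    exact hx.not_ge (mul_le_mul_of_nonneg_right ht.le (norm_nonneg _))
  have hval : ∀ t : ℂ, t ≠ 0 → ‖t‖ < R → eval ![z₁, t * z₂, t * z₃] Q /
      ((z₁ - t * z₃) ^ a * (z₁ - t * z₂) ^ c) =
      (t * (z₂ - z₃)) ^ b * B.tri w' u₁ u₂ w z₁ (t * z₂) (t * z₃) := by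
    intro t ht htR
    rw [hQ _ _ _ (sub_ne_zero.mp (hne htR hR3)) (by simpa [ht] using h)
      (sub_ne_zero.mp (hne htR hR2)), ← mul_sub]
    have h1 := hne htR hR3
    have h2 := hne htR hR2
    field_simp
  have key := hasSum_of_small (p := fun i : ℕ => ∑ p ∈ Finset.HasAntidiagonal.antidiagonal i,
      B.field.lau w' u₁ ((B.Lm1 ^ p.1) (B.mode (b - 1 - p.2) u₂ w)) z₁ / (p.1.factorial : ℂ) *
        (z₃ ^ p.1 * (z₂ - z₃) ^ p.2)) (f := fun t => eval ![z₁, t * z₂, t * z₃] Q /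
      ((z₁ - t * z₃) ^ a * (z₁ - t * z₂) ^ c)) hR1 ?_ ?_
  · beta_reduce at key
    rwa [hval 1 one_ne_zero (by simpa using hR1), one_mul, one_mul, one_mul] at key
  · intro t ht
    have ht : ‖t‖ < R := by simpa using ht
    have hdQ : ∀ Q : MvPolynomial (Fin 3) ℂ,
        Differentiable ℂ fun t : ℂ => eval ![z₁, t * z₂, t * z₃] Q := by
      intro Q
      induction Q using MvPolynomial.induction_on with
      | C a => simp
      | add p q hp hq => simpa using hp.fun_add hq
      | mul_X p i hp =>
        simp only [map_mul, eval_X]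
        refine hp.fun_mul ?_
        fin_cases i <;> simp
    refine DifferentiableAt.differentiableWithinAt (DifferentiableAt.fun_div (hdQ Q t)
      (by fun_prop) ?_)
    exact mul_ne_zero (pow_ne_zero _ (hne ht hR3)) (pow_ne_zero _ (hne ht hR2))
  · have hcont : ContinuousAt (fun t : ℂ => ‖t * z₃‖ + ‖t * (z₂ - z₃)‖) 0 := by fun_prop
    have hsmall : ∀ᶠ t in 𝓝[≠] (0 : ℂ), ‖t * z₃‖ + ‖t * (z₂ - z₃)‖ < ‖z₁‖ :=
      nhdsWithin_le_nhds (hcont.eventually_lt_const (by simpa using hz₁))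
    filter_upwards [self_mem_nhdsWithin, nhdsWithin_le_nhds
      (Metric.ball_mem_nhds (0 : ℂ) (zero_lt_one.trans hR1)), hsmall] with t ht0 htR hts
    have ht0 : t ≠ 0 := ht0
    rw [hval t ht0 (by simpa using htR)]
    have h5 := hasSum_antidiagonal (B.hasSum_tri_small hw hb (u₁ := u₁) (z₁ := z₁) (s := t * z₃)
      (d := t * (z₂ - z₃)) (mul_ne_zero ht0 hz) hts)
    rw [show t * z₃ + t * (z₂ - z₃) = t * z₂ by ring] at h5
    refine h5.congr_fun fun i => ?_
    rw [Finset.sum_mul]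
    refine Finset.sum_congr rfl fun p hp => ?_
    rw [← Finset.HasAntidiagonal.mem_antidiagonal.mp hp, pow_add, mul_pow, mul_pow]
    ring

/-- `∑_r ⟨w', Y(u₁, z₁) P_r(e^{z₃ L(-1)} Y(u₂, z₂ - z₃) w)⟩`. -/
lemma hasSum_tri_e2elt {w' : Module.Dual ℂ W} (hw : w' ∈ B.gradedDual) (u₁ u₂ : V) (w : W)
    {z₁ z₂ z₃ : ℂ} (h₂ : ‖z₂‖ < ‖z₁‖) (h₃ : ‖z₃‖ < ‖z₁‖) (h : z₂ ≠ z₃) :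
    HasSum (fun r : ℤ => B.field.lau w' u₁ (B.field.e2elt u₂ w z₂ z₃ r : W) z₁)
      (B.tri w' u₁ u₂ w z₁ z₂ z₃) := by
  have h₁ : z₁ ≠ z₃ := by rintro rfl; exact h₃.false
  have h₁₂ : z₁ ≠ z₂ := by rintro rfl; exact h₂.false
  induction u₂ using Grading.induction (G := A.toGrading) with
  | add x y hx hy =>
    rw [B.tri_add_snd hw _ _ _ _ h₁ h h₁₂]
    refine (hx.add hy).congr_fun fun r => ?_
    rw [B.field.e2elt_add_left, ← B.field.lau_add_right hw]
    rfl
  | hom k u₂ hu =>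
    induction w using Grading.induction (G := B.toGrading) with
    | add x y hx hy =>
      rw [B.tri_add_vec hw _ _ _ _ h₁ h h₁₂]
      refine (hx.add hy).congr_fun fun r => ?_
      rw [B.field.e2elt_add_right, ← B.field.lau_add_right hw]
      rfl
    | hom l w hw2 =>
      obtain ⟨b, hb⟩ := B.field.exists_trunc u₂ w
      have hz : z₂ - z₃ ≠ 0 := sub_ne_zero.mpr h
      -- Up to the factor `(z₂ - z₃)^(-b)`, the component of degree `k + l - b + i` is a form of
      -- degree `i` in `z₃` and `z₂ - z₃`, and lower components vanish; so the sum over degrees is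
      -- the sum over antidiagonals.
      have hinj : Function.Injective fun i : ℕ => k + l - (b : ℤ) + i := fun a c h => by
        simp only at h; lia
      rw [← hinj.hasSum_iff]
      · have h6 := (B.hasSum_tri_antidiagonal hw hb (u₁ := u₁) h₂ h₃ h).mul_left
          (((z₂ - z₃) ^ b)⁻¹)
        rw [inv_mul_cancel_left₀ (pow_ne_zero _ hz)] at h6
        refine h6.congr_fun fun i => ?_
        rw [eq_inv_mul_iff_mul_eq₀ (pow_ne_zero _ hz)]
        simp only [Function.comp_apply]
        rw [← B.field.lau_smul_right hw, B.field.e2elt_hom hu hw2 hb h, B.field.lau_sum_right hw]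
        refine Finset.sum_congr rfl fun p _ => ?_
        rw [B.field.lau_smul_right hw]
        ring
      · intro r hr
        rw [B.field.e2elt_of_lt hu hw2 hb]
        · simp [FieldMap.lau]
        · by_contra h0
          exact hr ⟨(r - (k + l - b)).toNat, by simp only; lia⟩

end GRModule

lemma HasSum.of_eq {α : Type*} {f g : α → ℂ} {a b : ℂ} (h : HasSum f a) (hf : ∀ x, g x = f x)
    (hb : b = a) : HasSum g b := by
  rw [hb]
  exact h.congr_fun hf

namespace GRModule

open MvPolynomial

variable {V : Type*} [AddCommGroup V] [Module ℂ V] {A : GRVertexAlgebra V}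
  {W : Type*} [AddCommGroup W] [Module ℂ W] (B : GRModule A W)

lemma hasDerivAt_corr_diag {w' : Module.Dual ℂ W} (hw : w' ∈ B.gradedDual) (u₁ u₂ : V) (w : W)
    {z₁ z₂ z₃ : ℂ} (h₁ : z₁ ≠ z₃) (h₂ : z₂ ≠ z₃) (h₁₂ : z₁ ≠ z₂) :
    HasDerivAt (fun t => B.corr w' u₁ u₂ w (z₁ - t) (z₂ - t))
      (-(B.corr w' (A.Lm1 u₁) u₂ w (z₁ - z₃) (z₂ - z₃) +
        B.corr w' u₁ (A.Lm1 u₂) w (z₁ - z₃) (z₂ - z₃))) z₃ := by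
  set x := z₁ - z₃ with hx
  set y := z₂ - z₃ with hy
  have hx0 : x ≠ 0 := sub_ne_zero.mpr h₁
  have hy0 : y ≠ 0 := sub_ne_zero.mpr h₂
  have hxy : x ≠ y := by simpa [hx, hy] using h₁₂
  have hf := ((B.isCorr_corr hw u₁ u₂ w).1.differentiableAt (z := ![x, y])
    ((eval_discTwo_ne _).mpr ⟨by simpa using hx0, by simpa using hy0,
      by simpa using hxy⟩)).hasFDerivAt
  set f := fun z : Fin 2 → ℂ => B.corr w' u₁ u₂ w (z 0) (z 1)
  set D := fderiv ℂ f ![x, y]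
  have e1 : D ![1, 0] = B.corr w' (A.Lm1 u₁) u₂ w x y := by
    have hγ : HasDerivAt (fun t : ℂ => (![t, y] : Fin 2 → ℂ)) ![1, 0] x := by
      rw [hasDerivAt_pi]
      intro i
      fin_cases i
      · exact hasDerivAt_id x
      · exact hasDerivAt_const x y
    exact (HasFDerivAt.comp_hasDerivAt (f := fun t : ℂ => (![t, y] : Fin 2 → ℂ)) x hf hγ).unique
      (B.hasDerivAt_corr_fst hw u₁ u₂ w hx0 hy0 hxy)
  have e2 : D ![0, 1] = B.corr w' u₁ (A.Lm1 u₂) w x y := by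
    have hγ : HasDerivAt (fun t : ℂ => (![x, t] : Fin 2 → ℂ)) ![0, 1] y := by
      rw [hasDerivAt_pi]
      intro i
      fin_cases i
      · exact hasDerivAt_const y x
      · exact hasDerivAt_id y
    exact (HasFDerivAt.comp_hasDerivAt (f := fun t : ℂ => (![x, t] : Fin 2 → ℂ)) y hf hγ).unique
      (B.hasDerivAt_corr_snd hw u₁ u₂ w hx0 hy0 hxy)
  have hγ : HasDerivAt (fun t : ℂ => (![z₁ - t, z₂ - t] : Fin 2 → ℂ)) ![-1, -1] z₃ := by
    rw [hasDerivAt_pi]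
    intro i
    fin_cases i
    · exact (hasDerivAt_id z₃).const_sub z₁
    · exact (hasDerivAt_id z₃).const_sub z₂
  have h := HasFDerivAt.comp_hasDerivAt (f := fun t : ℂ => (![z₁ - t, z₂ - t] : Fin 2 → ℂ)) z₃
    hf hγ
  refine h.congr_deriv ?_
  rw [← e1, ← e2, ← map_add, ← map_neg]
  congr 1
  funext i
  fin_cases i <;> simp

/-- Differentiating the exponential inserts `L(-1)` on the left. Moved to the right it produces
`L(-1)u₁` and `L(-1)u₂`, which cancel the derivatives of the shifted arguments `z₁ - z₃` and `z₂ -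
z₃`, and `L(-1)w` remains. -/
lemma hasDerivAt_tri {w' : Module.Dual ℂ W} (hw : w' ∈ B.gradedDual) (u₁ u₂ : V) (w : W)
    {z₁ z₂ z₃ : ℂ} (h₁ : z₁ ≠ z₃) (h₂ : z₂ ≠ z₃) (h₁₂ : z₁ ≠ z₂) :
    HasDerivAt (fun t => B.tri w' u₁ u₂ w z₁ z₂ t) (B.tri w' u₁ u₂ (B.Lm1 w) z₁ z₂ z₃) z₃ := by
  obtain ⟨K, hK⟩ := B.tg.exists_comp_pow_eq_zero hw
  have hK' : ∀ k ≥ K + 1, w'.comp (B.Lm1 ^ k) = 0 := fun k hk => hK k (by lia)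
  have hx0 : z₁ - z₃ ≠ 0 := sub_ne_zero.mpr h₁
  have hy0 : z₂ - z₃ ≠ 0 := sub_ne_zero.mpr h₂
  have hxy : z₁ - z₃ ≠ z₂ - z₃ := by simpa using h₁₂
  have hmem := fun k => B.tg.comp_pow_mem hw k
  have hfun : (fun t => B.tri w' u₁ u₂ w z₁ z₂ t) =ᶠ[𝓝 z₃] fun t =>
      ∑ k ∈ Finset.range (K + 1), t ^ k / (k.factorial : ℂ) *
        B.corr (w'.comp (B.Lm1 ^ k)) u₁ u₂ w (z₁ - t) (z₂ - t) := by
    filter_upwards [eventually_ne_nhds h₁.symm, eventually_ne_nhds h₂.symm] with t ht1 ht2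
    exact B.tri_eq_sum hw hK' u₁ u₂ w ht1.symm ht2.symm h₁₂
  refine HasDerivAt.congr_of_eventuallyEq ?_ hfun
  refine (HasDerivAt.fun_sum fun k _ => ((hasDerivAt_pow k z₃).div_const
    (k.factorial : ℂ)).fun_mul (B.hasDerivAt_corr_diag (hmem k) u₁ u₂ w h₁ h₂ h₁₂)).congr_deriv ?_
  rw [Finset.sum_add_distrib, Finset.sum_range_succ', B.tri_eq_sum hw hK' _ _ _ h₁ h₂ h₁₂]
  have hstep := fun k => B.corr_comp_L (hmem k) u₁ u₂ w hx0 hy0 hxy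
  have hpow : ∀ k, (w'.comp (B.Lm1 ^ k)).comp B.Lm1 = w'.comp (B.Lm1 ^ (k + 1)) := by
    intro k; ext x; rw [pow_succ]; rfl
  have hlast : B.corr (w'.comp (B.Lm1 ^ (K + 1))) u₁ u₂ w (z₁ - z₃) (z₂ - z₃) = 0 := by
    rw [hK _ (by lia)]
    have := B.corr_smul_dual B.zero_mem_gradedDual 0 u₁ u₂ w hx0 hy0 hxy
    simpa using this
  have h1 : ∑ k ∈ Finset.range K, ((k + 1 : ℕ) : ℂ) * z₃ ^ (k + 1 - 1) /
      ((k + 1).factorial : ℂ) * B.corr (w'.comp (B.Lm1 ^ (k + 1))) u₁ u₂ w (z₁ - z₃) (z₂ - z₃) =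
      ∑ k ∈ Finset.range (K + 1), z₃ ^ k / (k.factorial : ℂ) *
        B.corr (w'.comp (B.Lm1 ^ (k + 1))) u₁ u₂ w (z₁ - z₃) (z₂ - z₃) := by
    rw [Finset.sum_range_succ, hlast, mul_zero, add_zero]
    refine Finset.sum_congr rfl fun k _ => ?_
    rw [Nat.factorial_succ, Nat.add_sub_cancel]
    have : (k.factorial : ℂ) ≠ 0 := by exact_mod_cast k.factorial_ne_zero
    have : ((k : ℂ) + 1) ≠ 0 := by exact_mod_cast k.succ_ne_zero
    push_cast
    field_simp
  rw [h1]
  simp only [Nat.cast_zero, zero_mul, zero_div, add_zero]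
  rw [← Finset.sum_add_distrib]
  refine Finset.sum_congr rfl fun k _ => ?_
  rw [← hpow, hstep]
  ring

/-- `⟨w', Y(u₁, z₁) Y(u₂, z₂) e^{z₃ L(-1)} w⟩` as a power series in `z₃`. -/
lemma hasSum_tri_vec {w' : Module.Dual ℂ W} (hw : w' ∈ B.gradedDual) (u₁ u₂ : V) (w : W)
    {z₁ z₂ z₃ : ℂ} (h₁ : ‖z₃‖ < ‖z₁‖) (h₂ : ‖z₃‖ < ‖z₂‖) (h₁₂ : z₁ ≠ z₂) :
    HasSum (fun j : ℕ => z₃ ^ j / (j.factorial : ℂ) * B.corr w' u₁ u₂ ((B.Lm1 ^ j) w) z₁ z₂)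
      (B.tri w' u₁ u₂ w z₁ z₂ z₃) := by
  have := hasSum_taylor (h := fun k s => B.tri w' u₁ u₂ ((B.Lm1 ^ k) w) z₁ z₂ s)
    (R := min ‖z₁‖ ‖z₂‖) (fun k s hs => by
      have h := B.hasDerivAt_tri hw u₁ u₂ ((B.Lm1 ^ k) w) (z₁ := z₁) (z₂ := z₂) (z₃ := s)
        (by rintro rfl; exact (lt_min_iff.mp hs).1.false)
        (by rintro rfl; exact (lt_min_iff.mp hs).2.false) h₁₂
      rwa [← Module.End.mul_apply, ← pow_succ'] at h) (lt_min h₁ h₂)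
  simpa [B.tri_zero hw] using this

/-- By the bracket formula each application of `L(-1)` raises the pole order by at most one. -/
lemma mode_pow_eq_zero {u : V} {w : W} {b : ℕ} (hb : ∀ n : ℤ, b ≤ n → B.mode n u w = 0) (j : ℕ) :
    ∀ n : ℤ, (b + j : ℕ) ≤ n → B.mode n u ((B.Lm1 ^ j) w) = 0 := by
  induction j with
  | zero => simpa using hb
  | succ j ih =>
    intro n hn
    have h := B.Lm1_bracket n u ((B.Lm1 ^ j) w)
    rw [ih n (by lia), ih (n - 1) (by lia), map_zero, smul_zero, zero_sub, neg_eq_zero] at h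
    rwa [pow_succ', Module.End.mul_apply]

/-- The expansion of `⟨w', Y(u₁, z₁) Y(u₂, z₂) e^{z₃ L(-1)} w⟩` for `|z₁| > |z₂| > |z₃|`. -/
lemma hasSum_tri_double {w' : Module.Dual ℂ W} (hw : w' ∈ B.gradedDual) (u₁ : V) {u₂ : V} {w : W}
    {b : ℕ} (hb : ∀ n : ℤ, b ≤ n → B.mode n u₂ w = 0) {z₁ z₂ z₃ : ℂ} (h₁ : ‖z₂‖ < ‖z₁‖)
    (h₂ : ‖z₃‖ < ‖z₂‖) :
    HasSum (fun i : ℕ × ℕ => B.field.lau w' u₁ (B.mode (b + i.2 - 1 - i.1) u₂ ((B.Lm1 ^ i.2) w)) z₁ *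
      (z₂ ^ ((i.1 : ℤ) - b - i.2) * (z₃ ^ i.2 / (i.2.factorial : ℂ))))
      (B.tri w' u₁ u₂ w z₁ z₂ z₃) := by
  obtain ⟨a, ha⟩ := B.field.exists_trunc u₁ w
  obtain ⟨c, hc⟩ := A.field.exists_trunc u₁ u₂
  obtain ⟨Q, hQ⟩ := B.tri_poly hw ha hb hc
  have hz₂ : z₂ ≠ 0 := norm_pos_iff.mp (lt_of_le_of_lt (norm_nonneg _) h₂)
  have hz₁ : z₁ ≠ 0 := norm_pos_iff.mp (lt_of_le_of_lt (norm_nonneg _) h₁)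
  -- In the coordinates `x = z₂/z₁` and `y = z₃/z₂` the region is a bidisc, and `z₁ - z₃`, `z₂ -
  -- z₃`, `z₁ - z₂` become monomials times `1 - xy`, `1 - y`, `1 - x`.
  set D := {p : ℂ × ℂ | ‖p.1‖ < 1 ∧ ‖p.2‖ < 1} with hD
  set K : ℂ × ℂ → ℂ := fun p => eval ![z₁, z₁ * p.1, z₁ * (p.1 * p.2)] Q * (z₁ ^ (a + b + c))⁻¹ *
    ((1 - p.1 * p.2)⁻¹ ^ a * (1 - (0 * p.1 + 1 * p.2))⁻¹ ^ b * (1 - (1 * p.1 + 0 * p.2))⁻¹ ^ c)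
    with hKdef
  have hK : HasDPS D K := by
    refine HasDPS.mul (HasDPS.mul ?_ (HasDPS.const _)) (HasDPS.mul (HasDPS.mul
      (HasDPS.pow (HasDPS.inv_one_sub_mul fun p hp => ?_) a)
      (HasDPS.pow (HasDPS.inv_one_sub_add 0 1 fun p hp => ?_) b))
      (HasDPS.pow (HasDPS.inv_one_sub_add 1 0 fun p hp => ?_) c))
    · have := HasDPS.eval (D := D)
        (φ := fun i p => (![z₁, z₁ * p.1, z₁ * (p.1 * p.2)] : Fin 3 → ℂ) i) (fun i => by
          fin_cases i
          · exact HasDPS.const z₁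
          · exact (HasDPS.const z₁).mul HasDPS.fst
          · exact (HasDPS.const z₁).mul (HasDPS.fst.mul HasDPS.snd)) Q
      exact this
    · rw [norm_mul]
      exact mul_lt_one_of_nonneg_of_lt_one_left (norm_nonneg _) hp.1 hp.2.le
    · simpa using hp.2
    · simpa using hp.1
  have hne : ∀ {t : ℂ}, ‖t‖ < 1 → 1 - t ≠ 0 := by
    intro t ht h0
    rw [sub_eq_zero] at h0
    rw [← h0] at ht
    simp at ht
  have hval : ∀ x y : ℂ, x ≠ 0 → ‖x‖ < 1 → ‖y‖ < 1 →
      K (x, y) = x ^ b * B.tri w' u₁ u₂ w z₁ (z₁ * x) (z₁ * (x * y)) := by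
    intro x y hx h1 h2
    have e1 : 1 - x * y ≠ 0 := hne (by
      rw [norm_mul]; exact mul_lt_one_of_nonneg_of_lt_one_left (norm_nonneg _) h1 h2.le)
    have e2 := hne h2
    have e3 := hne h1
    have f1 : z₁ - z₁ * (x * y) = z₁ * (1 - x * y) := by ring
    have f2 : z₁ * x - z₁ * (x * y) = z₁ * x * (1 - y) := by ring
    have f3 : z₁ - z₁ * x = z₁ * (1 - x) := by ring
    rw [hQ, f1, f2, f3, hKdef]
    · simp only [zero_mul, zero_add, one_mul, add_zero, pow_add, mul_pow, inv_pow]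
      field_simp
    · rw [← sub_ne_zero, f1]; exact mul_ne_zero hz₁ e1
    · rw [← sub_ne_zero, f2]; exact mul_ne_zero (mul_ne_zero hz₁ hx) e2
    · rw [← sub_ne_zero, f3]; exact mul_ne_zero hz₁ e3
  obtain ⟨κ, hκ⟩ := hK
  have hcoef := dps_coeff (c := κ) (K := K) one_pos (fun s d h1 h2 => hκ (s, d) ⟨h1, h2⟩)
    (κ := fun i j => B.field.lau w' u₁ (B.mode (b + j - 1 - i) u₂ ((B.Lm1 ^ j) w)) z₁ *
      (z₁ ^ ((i : ℤ) - b) / (j.factorial : ℂ)))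
    (k := fun j x => x ^ b * ((z₁ * x) ^ j / (j.factorial : ℂ) *
      B.corr w' u₁ u₂ ((B.Lm1 ^ j) w) z₁ (z₁ * x))) ?_ ?_
  · set x := z₂ / z₁ with hx
    set y := z₃ / z₂ with hy
    have hx0 : x ≠ 0 := div_ne_zero hz₂ hz₁
    have hx1 : ‖x‖ < 1 := by rwa [hx, norm_div, div_lt_one (norm_pos_iff.mpr hz₁)]
    have hy1 : ‖y‖ < 1 := by rwa [hy, norm_div, div_lt_one (norm_pos_iff.mpr hz₂)]
    have h3 := (hκ (x, y) ⟨hx1, hy1⟩).mul_left ((x ^ b)⁻¹)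
    rw [hval x y hx0 hx1 hy1, inv_mul_cancel_left₀ (pow_ne_zero _ hx0),
      show z₁ * x = z₂ by rw [hx]; field_simp,
      show z₁ * (x * y) = z₃ by rw [hx, hy]; field_simp] at h3
    refine h3.congr_fun fun i => ?_
    rw [hcoef, hx, hy]
    simp only [zpow_sub₀ hz₁, zpow_sub₀ hz₂, zpow_natCast, div_pow]
    field_simp
  · have hev : ∀ᶠ s in 𝓝[≠] (0 : ℂ), ‖s‖ < 1 := by
      filter_upwards [nhdsWithin_le_nhds (Metric.ball_mem_nhds (0 : ℂ) one_pos)] with s hs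
      simpa using hs
    filter_upwards [hev, self_mem_nhdsWithin] with x hx1 hx0
    have hx0 : x ≠ 0 := hx0
    have hnx : 0 < ‖x‖ := norm_pos_iff.mpr hx0
    have hnz : 0 < ‖z₁‖ := norm_pos_iff.mpr hz₁
    filter_upwards [hev] with y hy1
    rw [hval x y hx0 hx1 hy1]
    have h4 := (B.hasSum_tri_vec hw u₁ u₂ w (z₁ := z₁) (z₂ := z₁ * x) (z₃ := z₁ * (x * y))
      (by rw [norm_mul, norm_mul]; nlinarith [mul_pos hnz hnx, norm_nonneg y])
      (by rw [norm_mul, norm_mul, norm_mul]; nlinarith [mul_pos hnz hnx]) (by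
        intro h; rw [← sub_eq_zero] at h
        exact mul_ne_zero hz₁ (hne hx1) (by linear_combination h))).mul_left (x ^ b)
    refine h4.congr_fun fun j => ?_
    rw [← mul_assoc z₁, mul_pow (z₁ * x)]
    ring
  · intro j
    filter_upwards [nhdsWithin_le_nhds (Metric.ball_mem_nhds (0 : ℂ) one_pos),
      self_mem_nhdsWithin] with x hx1 hx0
    have hx0 : x ≠ 0 := hx0
    have hx1 : ‖x‖ < 1 := by simpa using hx1
    have hnx : 0 < ‖x‖ := norm_pos_iff.mpr hx0
    have hnz : 0 < ‖z₁‖ := norm_pos_iff.mpr hz₁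
    have h5 := hasSum_nat_of_laurent (b := b + j) (fun n hn => by
      rw [B.mode_pow_eq_zero hb j n hn]; simp [FieldMap.lau]) (mul_ne_zero hz₁ hx0)
      (B.hasSum_corr_snd hw u₁ u₂ ((B.Lm1 ^ j) w) (x := z₁) (y := z₁ * x)
        (by rw [norm_mul]; positivity) (by rw [norm_mul]; nlinarith))
    have h6 := h5.mul_left ((z₁ ^ b)⁻¹ * (j.factorial : ℂ)⁻¹)
    refine h6.of_eq (fun i => ?_) ?_
    · rw [zpow_sub₀ hz₁, zpow_natCast, zpow_natCast, mul_pow]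
      push_cast
      field_simp
    · rw [pow_add, mul_pow, mul_pow]
      field_simp

end GRModule

/-! ### Elements of the completion -/

lemma hasSum_int_of_nat {F : ℤ → ℂ} (hF : ∀ n, 0 ≤ n → F n = 0) {s : ℂ}
    (h : HasSum (fun j : ℕ => F (-j - 1)) s) : HasSum F s := by
  have hinj : Function.Injective fun j : ℕ => -(j : ℤ) - 1 := fun a c h => by
    simp only at h; lia
  rw [← hinj.hasSum_iff]
  · exact h
  · intro n hn
    refine hF n ?_
    by_contra h
    exact hn ⟨(-n - 1).toNat, by simp only; lia⟩

namespace TGrading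

variable {W : Type*} [AddCommGroup W] [Module ℂ W] (G : TGrading W)

/-- The element `e^{z L(-1)} x` of the completion. -/
def expElt (x : W) (z : ℂ) : G.Completion := G.ofFunctional fun w' => G.expDual w' z x

lemma pairing_expElt {w' : Module.Dual ℂ W} (hw : w' ∈ G.gradedDual) (x : W) (z : ℂ) :
    G.pairing w' (G.expElt x z) = G.expDual w' z x :=
  G.pairing_ofFunctional _ (fun _ ha _ hb => by rw [G.expDual_add_dual ha hb]; rfl)
    (fun c _ ha => by rw [G.expDual_smul_dual c ha]; rfl) hw

lemma expElt_apply (φ : Module.Dual ℂ W) (r : ℤ) (x : W) (z : ℂ) :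
    φ (G.expElt x z r) = G.expDual (φ.comp (G.proj r)) z x := by
  rw [← G.pairing_comp_proj, G.pairing_expElt (G.comp_proj_mem_gradedDual φ r)]

lemma expElt_add (x y : W) (z : ℂ) : G.expElt (x + y) z = G.expElt x z + G.expElt y z :=
  G.completion_ext fun w' hw => by
    rw [G.pairing_add hw, G.pairing_expElt hw, G.pairing_expElt hw, G.pairing_expElt hw, map_add]

lemma expElt_smul (c : ℂ) (x : W) (z : ℂ) : G.expElt (c • x) z = c • G.expElt x z :=
  G.completion_ext fun w' hw => by
    rw [G.pairing_smul hw, G.pairing_expElt hw, G.pairing_expElt hw, map_smul, smul_eq_mul]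

lemma expElt_hom {x : W} {m : ℤ} (hx : x ∈ G.gr m) (z : ℂ) (k : ℕ) :
    (G.expElt x z (m + k) : W) = (z ^ k / (k.factorial : ℂ)) • (G.L ^ k) x := by
  rw [← sub_eq_zero, ← Module.forall_dual_apply_eq_zero_iff ℂ]
  intro φ
  rw [map_sub, expElt_apply, FieldMap.expDual_comp_proj_apply φ _ hx z k rfl, map_smul,
    smul_eq_mul, sub_self]

lemma expElt_of_lt {x : W} {m : ℤ} (hx : x ∈ G.gr m) (z : ℂ) {r : ℤ} (hr : r < m) :
    (G.expElt x z r : W) = 0 := by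
  rw [← Module.forall_dual_apply_eq_zero_iff ℂ]
  intro φ
  rw [expElt_apply, FieldMap.expDual_comp_proj_apply_of_lt φ _ hx z hr]

/-- Sums over the homogeneous components of `e^{z L(-1)} x`. -/
lemma hasSum_expElt {φ : W → ℂ} (hadd : ∀ x y, φ (x + y) = φ x + φ y)
    (hsmul : ∀ (c : ℂ) x, φ (c • x) = c * φ x) {x : W} {z : ℂ} {Q : W → ℂ}
    (hQ : ∀ x y, Q (x + y) = Q x + Q y)
    (h : ∀ x, HasSum (fun k : ℕ => z ^ k / (k.factorial : ℂ) * φ ((G.L ^ k) x)) (Q x)) :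
    HasSum (fun r => φ (G.expElt x z r)) (Q x) := by
  have h0 : φ 0 = 0 := by simpa using hsmul 0 0
  induction x using Grading.induction (G := G.toGrading) with
  | add x y hx hy =>
    rw [hQ]
    refine (hx.add hy).congr_fun fun r => ?_
    rw [G.expElt_add, ← hadd]
    rfl
  | hom m x hx =>
    have hinj : Function.Injective fun k : ℕ => m + (k : ℤ) := fun a c h => by
      simp only at h; lia
    rw [← hinj.hasSum_iff]
    · refine (h x).congr_fun fun k => ?_
      simp only [Function.comp_apply]
      rw [G.expElt_hom hx, hsmul]
    · intro r hr
      rw [G.expElt_of_lt hx, h0]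
      by_contra h1
      exact hr ⟨(r - m).toNat, by simp only; lia⟩

end TGrading

lemma exists_radialRegion_mem_nhds (l : ℕ) : ∃ z₀ : Fin l → ℂ, radialRegion l ∈ 𝓝 z₀ := by
  have ho : IsOpen (radialRegion l) := by
    have : radialRegion l = (⋂ i, {z : Fin l → ℂ | z i ≠ 0}) ∩
        ⋂ i, ⋂ j, {z : Fin l → ℂ | i < j → ‖z j‖ < ‖z i‖} := by
      ext z
      simp [radialRegion]
    rw [this]
    refine IsOpen.inter (isOpen_iInter_of_finite fun i => ?_)
      (isOpen_iInter_of_finite fun i => isOpen_iInter_of_finite fun j => ?_)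
    · exact isOpen_ne_fun (continuous_apply i) continuous_const
    · by_cases h : i < j
      · simpa [h] using isOpen_lt (continuous_apply (A := fun _ : Fin l => ℂ) j).norm
          (continuous_apply i).norm
      · simp [h]
  -- The base point is `(l, l - 1, …, 1)`.
  refine ⟨fun i => (((l : ℝ) - i : ℝ) : ℂ), ho.mem_nhds ⟨fun i => ?_, fun i j hij => ?_⟩⟩
  · have : (i : ℝ) < l := by exact_mod_cast i.2
    exact Complex.ofReal_ne_zero.mpr (sub_pos.mpr this).ne'
  · have hi : (i : ℝ) < l := by exact_mod_cast i.2
    have hj : (j : ℝ) < l := by exact_mod_cast j.2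
    have hij : (i : ℝ) < j := by exact_mod_cast hij
    rw [Complex.norm_real, Complex.norm_real, Real.norm_of_nonneg (by linarith),
      Real.norm_of_nonneg (by linarith)]
    linarith

/-- The elements `E(⋯)` are computed by exhibiting, for every functional, a rational function with a
common denominator `Δ` that has the right expansion in the radial region. -/
lemma elementE_pairing {V : Type*} [AddCommGroup V] [Module ℂ V] {W : Type*} [AddCommGroup W]
    [Module ℂ W] {G : Grading W} {mode : ℤ → V →ₗ[ℂ] W →ₗ[ℂ] W} {l : ℕ} {v : Fin l → V} {w : W}
    {z : Fin l → ℂ} {Δ : MvPolynomial (Fin l) ℂ} {f : Module.Dual ℂ W → (Fin l → ℂ) → ℂ}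
    {x : G.Completion} (hx : ∀ w' ∈ G.gradedDual, G.pairing w' x = f w' z)
    (hf : ∀ w' ∈ G.gradedDual, RatOn Δ (f w')) (hΔ : ∀ y ∈ radialRegion l, MvPolynomial.eval y Δ ≠ 0)
    (h : ∀ w' ∈ G.gradedDual, ∀ y ∈ radialRegion l, HasSum (fun k : Fin l → ℤ =>
      w' (iterMode mode l v k w) * ∏ i, y i ^ (-k i - 1)) (f w' y))
    (hz : MvPolynomial.eval z Δ ≠ 0) : elementE G mode l v w z = x := by
  obtain ⟨z₀, hz₀⟩ := exists_radialRegion_mem_nhds l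
  refine elementE_eq fun w' hw => ?_
  rw [hx w' hw]
  exact ((hf w' hw).ratExt_eq (g := productSeries mode w' l v w) hz₀
    (fun y hy => ⟨hΔ y hy, (h w' hw y hy).tsum_eq⟩) hz).symm

/-! ### Skew-symmetry and products applied to the vacuum -/

namespace GRVertexAlgebra

open MvPolynomial

variable {V : Type*} [AddCommGroup V] [Module ℂ V] (A : GRVertexAlgebra V)

/-- The creation property in the form `Y(u, y)1 = e^{yL(-1)}u`, under a homogeneous scalar function
`φ`. -/
lemma hasSum_mode_one {φ : V → ℂ} (hsmul : ∀ (c : ℂ) x, φ (c • x) = c * φ x) {u : V} {y s : ℂ}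
    (h : HasSum (fun j : ℕ => y ^ j / (j.factorial : ℂ) * φ ((A.Lm1 ^ j) u)) s) :
    HasSum (fun n : ℤ => φ (A.mode n u A.one) * y ^ (-n - 1)) s := by
  have h0 : φ 0 = 0 := by simpa using hsmul 0 0
  refine hasSum_int_of_nat (fun n hn => by rw [(A.creation u).1 n hn, h0, zero_mul])
    (h.congr_fun fun j => ?_)
  rw [A.mode_one, hsmul, show -(-(j : ℤ) - 1) - 1 = j by ring, zpow_natCast]
  ring

/-- `Y(u, x)Y(v, y)1 = Y(u, x)e^{yL(-1)}v = e^{yL(-1)}Y(u, x - y)v` for `|x| > |y|`; elsewhere the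
equality follows by rationality. -/
lemma corr_one {v' : Module.Dual ℂ V} (hv : v' ∈ A.gradedDual) (u v : V) {x y : ℂ} (hx : x ≠ 0)
    (hy : y ≠ 0) (hxy : x ≠ y) : A.adjoint.corr v' u v A.one x y = A.field.e2 v' u v x y := by
  refine GRModule.eq_of_region (R' := fun x y => A.field.e2 v' u v x y)
    (A.adjoint.isCorr_corr hv u v A.one).1
    ((A.field.e2_ratOn hv u v).mono ⟨X 0 * X 1, by rw [discTwo]; ring⟩) (fun x y h1 h2 => ?_)
    hx hy hxy
  refine (A.adjoint.hasSum_corr_snd hv u v A.one h1 h2).unique ?_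
  exact A.hasSum_mode_one (φ := fun t => A.field.lau v' u t x)
    (fun c t => A.field.lau_smul_right hv c u t x) (A.field.hasSum_lau_exp hv u v h2)

/-- Skew-symmetry `Y(u, z)v = e^{zL(-1)}Y(v, -z)u`, obtained from commutativity of the two operators
applied to the vacuum. -/
lemma e2_symm {v' : Module.Dual ℂ V} (hv : v' ∈ A.gradedDual) (u v : V) {z₁ z₂ : ℂ}
    (h : z₁ ≠ z₂) : A.field.e2 v' u v z₁ z₂ = A.field.e2 v' v u z₂ z₁ := by
  have hr : RatOn (X 0 - X 1 : MvPolynomial (Fin 2) ℂ) fun z => A.field.e2 v' v u (z 1) (z 0) := by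
    have h1 := (A.field.e2_ratOn hv v u).comp (κ := Fin 2) ![X 1, X 0]
    have h2 : bind₁ (![X 1, X 0] : Fin 2 → MvPolynomial (Fin 2) ℂ) (X 0 - X 1) ∣ X 0 - X 1 :=
      ⟨-1, by simp⟩
    simpa using h1.mono h2
  have := RatOn.eq_of_eventually (A.field.e2_ratOn hv u v) hr (z₀ := ![2, 1]) (z := ![z₁, z₂])
    (eventually_norm_lt.mono fun z hz => ?_) (by simpa [sub_eq_zero] using h)
  · simpa using this
  · have h1 : z 1 ≠ 0 := norm_pos_iff.mp hz.1
    have h0 : z 0 ≠ 0 := norm_pos_iff.mp (hz.1.trans hz.2)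
    have h01 : z 0 ≠ z 1 := fun h => by rw [h] at hz; exact hz.2.false
    rw [← A.corr_one hv u v h0 h1 h01, ← A.corr_one hv v u h1 h0 h01.symm,
      A.adjoint.corr_symm hv u v A.one h0 h1 h01]

lemma e2elt_symm (u v : V) {z₁ z₂ : ℂ} (h : z₁ ≠ z₂) :
    A.field.e2elt u v z₁ z₂ = A.field.e2elt v u z₂ z₁ :=
  A.completion_ext fun v' hv => by
    rw [A.field.pairing_e2elt hv, A.field.pairing_e2elt hv, A.e2_symm hv u v h]

lemma eventually_norm_lt_three : ∀ᶠ z : Fin 3 → ℂ in 𝓝 ![3, 2, 1],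
    ‖z 1‖ < ‖z 0‖ ∧ ‖z 2‖ < ‖z 1‖ := by
  have h : ∀ i, Filter.Tendsto (fun z : Fin 3 → ℂ => ‖z i‖) (𝓝 ![3, 2, 1])
      (𝓝 ‖(![3, 2, 1] : Fin 3 → ℂ) i‖) := fun i =>
    (continuous_apply (A := fun _ : Fin 3 => ℂ) i).norm.tendsto ![3, 2, 1]
  exact ((h 1).eventually_lt (h 0) (by norm_num)).and ((h 2).eventually_lt (h 1) (by simp))

/-- For `|z₁| > |z₂| > |z₃|` both sides are `Y(u₁, z₁)` summed over the components of one element,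
which is symmetric in `(u₂, z₂)` and `(u₃, z₃)` by skew-symmetry. Together with `tri_symm` this
generates all permutations. -/
lemma tri_symm_right {v' : Module.Dual ℂ V} (hv : v' ∈ A.gradedDual) (u₁ u₂ u₃ : V)
    {z₁ z₂ z₃ : ℂ} (h₁ : z₁ ≠ z₃) (h₂ : z₂ ≠ z₃) (h₁₂ : z₁ ≠ z₂) :
    A.adjoint.tri v' u₁ u₂ u₃ z₁ z₂ z₃ = A.adjoint.tri v' u₁ u₃ u₂ z₁ z₃ z₂ := by
  have hr : RatOn discThree fun z => A.adjoint.tri v' u₁ u₃ u₂ (z 0) (z 2) (z 1) := by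
    have h1 := (A.adjoint.tri_ratOn hv u₁ u₃ u₂).comp (κ := Fin 3) ![X 0, X 2, X 1]
    have h2 : bind₁ (![X 0, X 2, X 1] : Fin 3 → MvPolynomial (Fin 3) ℂ) discThree ∣ discThree :=
      ⟨-1, by simp [discThree]; ring⟩
    simpa using h1.mono h2
  have := RatOn.eq_of_eventually (A.adjoint.tri_ratOn hv u₁ u₂ u₃) hr (z₀ := ![3, 2, 1])
    (z := ![z₁, z₂, z₃]) (eventually_norm_lt_three.mono fun z hz => ?_)
    ((eval_discThree_ne _).mpr (by simpa using ⟨h₁, h₂, h₁₂⟩))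
  · simpa using this
  · have h12 : z 1 ≠ z 2 := fun h => by rw [h] at hz; exact hz.2.false
    refine (A.adjoint.hasSum_tri_e2elt hv u₁ u₂ u₃ hz.1 (hz.2.trans hz.1) h12).unique ?_
    refine (A.adjoint.hasSum_tri_e2elt hv u₁ u₃ u₂ (hz.2.trans hz.1) hz.1 h12.symm).congr_fun
      fun r => ?_
    exact congrArg (fun t : A.Completion => A.adjoint.field.lau v' u₁ (t r : V) (z 0))
      (A.e2elt_symm u₂ u₃ h12)

/-- The expansion of `⟨v', Y(u₁, z₁) Y(u₂, z₂) Y(u₃, z₃) 1⟩`. -/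
lemma hasSum_product_three {v' : Module.Dual ℂ V} (hv : v' ∈ A.gradedDual) (u₁ u₂ u₃ : V)
    {z₁ z₂ z₃ : ℂ} (h₁ : ‖z₂‖ < ‖z₁‖) (h₂ : ‖z₃‖ < ‖z₂‖) (h₃ : z₃ ≠ 0) :
    HasSum (fun k : Fin 3 → ℤ =>
      v' (A.mode (k 0) u₁ (A.mode (k 1) u₂ (A.mode (k 2) u₃ A.one))) *
        (z₁ ^ (-k 0 - 1) * z₂ ^ (-k 1 - 1) * z₃ ^ (-k 2 - 1)))
      (A.adjoint.tri v' u₁ u₂ u₃ z₁ z₂ z₃) := by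
  have hz₂ : z₂ ≠ 0 := norm_pos_iff.mp (lt_of_le_of_lt (norm_nonneg _) h₂)
  have d13 : z₁ ≠ z₃ := by rintro rfl; exact (h₁.trans h₂).false
  have d23 : z₂ ≠ z₃ := by rintro rfl; exact h₂.false
  have d12 : z₁ ≠ z₂ := by rintro rfl; exact h₁.false
  refine Grading.gradedDual_induction (G := A.toGrading) (p := fun v' => HasSum
    (fun k : Fin 3 → ℤ => v' (A.mode (k 0) u₁ (A.mode (k 1) u₂ (A.mode (k 2) u₃ A.one))) *
      (z₁ ^ (-k 0 - 1) * z₂ ^ (-k 1 - 1) * z₃ ^ (-k 2 - 1)))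
    (A.adjoint.tri v' u₁ u₂ u₃ z₁ z₂ z₃)) (fun D v' hD => ?_) (fun a b ha hb iha ihb => ?_) hv
  swap
  · rw [A.adjoint.tri_add_dual ha hb _ _ _ d13 d23 d12]
    exact (iha.add ihb).congr_fun fun k => by simp only [LinearMap.add_apply]; ring
  have hv := A.mem_gradedDual_of_hom hD
  induction u₁ using Grading.induction (G := A.toGrading) with
  | add x y hx hy =>
    rw [A.adjoint.tri_add_fst hv _ _ _ _ d13 d23 d12]
    exact (hx.add hy).congr_fun fun k => by simp only [LinearMap.add_apply, map_add]; ring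
  | hom p u₁ hu₁ =>
  induction u₂ using Grading.induction (G := A.toGrading) with
  | add x y hx hy =>
    rw [A.adjoint.tri_add_snd hv _ _ _ _ d13 d23 d12]
    exact (hx.add hy).congr_fun fun k => by simp only [LinearMap.add_apply, map_add]; ring
  | hom q u₂ hu₂ =>
  induction u₃ using Grading.induction (G := A.toGrading) with
  | add x y hx hy =>
    rw [A.adjoint.tri_add_vec hv _ _ _ _ d13 d23 d12]
    exact (hx.add hy).congr_fun fun k => by simp only [LinearMap.add_apply, map_add]; ring
  | hom r u₃ hu₃ =>
  obtain ⟨b, hb⟩ := A.field.exists_trunc u₂ u₃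
  have hw : ∀ (j : ℕ) (n : ℤ), A.mode n u₂ ((A.Lm1 ^ j) u₃) ∈ A.gr (q + (r + j) - n - 1) :=
    fun j n => A.mode_weight n q (r + j) u₂ _ hu₂ (A.tg.pow_mem j hu₃)
  have hz : ∀ (j : ℕ) (m n : ℤ), m ≠ p + q + r + j - n - 2 - D →
      v' (A.mode m u₁ (A.mode n u₂ ((A.Lm1 ^ j) u₃))) = 0 := fun j m n hm =>
    hD _ (by lia) _ (A.mode_weight m p _ u₁ _ hu₁ (hw j n))
  -- For homogeneous vectors and a functional of degree `D`, the first index is determined by the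
  -- other two, and the third is `-j - 1` by the creation property. The triple series is therefore
  -- the double series of `hasSum_tri_double`.
  have hinj : Function.Injective fun i : ℕ × ℕ => (![p + q + r + i.2 - (b + i.2 - 1 - i.1) - 2 - D,
      b + i.2 - 1 - i.1, -i.2 - 1] : Fin 3 → ℤ) := by
    intro i i' h
    have e1 := congrFun h 1
    have e2 := congrFun h 2
    simp only [Matrix.cons_val] at e1 e2
    ext <;> lia
  rw [← hinj.hasSum_iff]
  · refine (A.adjoint.hasSum_tri_double hv u₁ hb h₁ h₂).congr_fun fun i => ?_
    simp only [Function.comp_apply, Matrix.cons_val]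
    have hlau : A.adjoint.field.lau v' u₁ (A.mode (b + i.2 - 1 - i.1) u₂ ((A.Lm1 ^ i.2) u₃)) z₁ = _ :=
      tsum_eq_single (p + q + r + i.2 - (b + i.2 - 1 - i.1) - 2 - D) fun m hm => by
        rw [hz _ _ _ hm, zero_mul]
    rw [hlau, A.mode_one, map_smul, map_smul, map_smul, smul_eq_mul,
      show -(-(i.2 : ℤ) - 1) - 1 = i.2 by ring, zpow_natCast,
      show -((b : ℤ) + i.2 - 1 - i.1) - 1 = i.1 - b - i.2 by ring]
    ring
  · intro k hk
    by_cases h2 : 0 ≤ k 2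
    · rw [(A.creation u₃).1 _ h2, map_zero, map_zero, map_zero, zero_mul]
    obtain ⟨j, hj⟩ : ∃ j : ℕ, k 2 = -j - 1 := ⟨(-k 2 - 1).toNat, by lia⟩
    rw [hj, A.mode_one, map_smul, map_smul, map_smul]
    by_cases h1 : (b + j : ℕ) ≤ k 1
    · rw [A.adjoint.mode_pow_eq_zero hb j _ h1, map_zero, map_zero, smul_zero, zero_mul]
    · rw [hz j _ _ ?_, smul_zero, zero_mul]
      intro h0
      refine hk ⟨((b + j - 1 - k 1).toNat, j), ?_⟩
      have hc : (((b + j - 1 - k 1).toNat : ℕ) : ℤ) = b + j - 1 - k 1 := by lia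
      funext t
      fin_cases t
      · simp only [Fin.zero_eta, Matrix.cons_val, hc]; lia
      · simp only [Fin.mk_one, Matrix.cons_val, hc]; lia
      · simp only [Matrix.cons_val, Fin.reduceFinMk]; lia

lemma elementE_one (v : Fin 1 → V) (z : Fin 1 → ℂ) :
    elementE A.toGrading A.mode 1 v A.one z = A.tg.expElt (v 0) (z 0) := by
  refine elementE_pairing (Δ := 1) (f := fun v' z => A.tg.expDual v' (z 0) (v 0))
    (fun v' hv => A.tg.pairing_expElt hv _ _) (fun v' hv => ?_) (by simp) (fun v' hv y hy => ?_)
    (by simp)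
  · obtain ⟨K, hK⟩ := A.tg.exists_comp_pow_eq_zero hv
    simp only [A.tg.expDual_eq_sum hK, LinearMap.sum_apply, LinearMap.smul_apply, smul_eq_mul,
      div_eq_mul_inv]
    exact RatOn.sum _ fun k _ => (((RatOn.coord 0).pow k).mul (RatOn.const _)).mul (RatOn.const _)
  · rw [← (Equiv.funUnique (Fin 1) ℤ).symm.hasSum_iff]
    refine (A.hasSum_mode_one (φ := v') (fun c x => by simp)
      (A.tg.hasSum_expDual hv (y 0) (v 0))).congr_fun fun n => ?_
    simp [iterMode]

lemma elementE_two (v : Fin 2 → V) {z : Fin 2 → ℂ} (hz : z 0 ≠ z 1) :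
    elementE A.toGrading A.mode 2 v A.one z = A.field.e2elt (v 0) (v 1) (z 0) (z 1) := by
  refine elementE_pairing (Δ := X 0 - X 1) (f := fun v' z => A.field.e2 v' (v 0) (v 1) (z 0) (z 1))
    (fun v' hv => A.field.pairing_e2elt hv _ _ _ _) (fun v' hv => A.field.e2_ratOn hv _ _)
    (fun y hy h => ?_) (fun v' hv y hy => ?_) (by simpa [sub_eq_zero] using hz)
  · have h1 := hy.2 0 1 (by simp)
    simp only [map_sub, eval_X, sub_eq_zero] at h
    rw [h] at h1
    exact h1.false
  · have h1 := hy.2 0 1 (by simp)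
    have h01 : y 0 ≠ y 1 := fun h => by rw [h] at h1; exact h1.false
    rw [← A.corr_one hv _ _ (hy.1 0) (hy.1 1) h01, ← (finTwoArrowEquiv ℤ).symm.hasSum_iff]
    refine (A.adjoint.hasSum_corr hv (v 0) (v 1) A.one (norm_pos_iff.mpr (hy.1 1)) h1).congr_fun
      fun p => ?_
    simp [iterMode, mul_assoc]

lemma pairing_elementE_three (v : Fin 3 → V) {z : Fin 3 → ℂ} (h02 : z 0 ≠ z 2) (h12 : z 1 ≠ z 2)
    (h01 : z 0 ≠ z 1) {v' : Module.Dual ℂ V} (hv : v' ∈ A.gradedDual) :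
    A.pairing v' (elementE A.toGrading A.mode 3 v A.one z) =
      A.adjoint.tri v' (v 0) (v 1) (v 2) (z 0) (z 1) (z 2) := by
  have hx : ∀ w' ∈ A.gradedDual, A.pairing w' (A.ofFunctional fun v' =>
      A.adjoint.tri v' (v 0) (v 1) (v 2) (z 0) (z 1) (z 2)) =
      A.adjoint.tri w' (v 0) (v 1) (v 2) (z 0) (z 1) (z 2) := fun w' hw =>
    A.pairing_ofFunctional _ (fun a ha b hb => A.adjoint.tri_add_dual ha hb _ _ _ h02 h12 h01)
      (fun c a ha => A.adjoint.tri_smul_dual ha c _ _ _ h02 h12 h01) hw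
  rw [elementE_pairing (Δ := discThree)
    (f := fun v' z => A.adjoint.tri v' (v 0) (v 1) (v 2) (z 0) (z 1) (z 2)) hx
    (fun w' hw => A.adjoint.tri_ratOn hw _ _ _) (fun y hy => ?_) (fun w' hw y hy => ?_)
    ((eval_discThree_ne _).mpr ⟨h02, h12, h01⟩), hx v' hv]
  · have h1 := hy.2 0 1 (by simp)
    have h2 := hy.2 1 2 (by simp)
    refine (eval_discThree_ne _).mpr ⟨fun h => ?_, fun h => ?_, fun h => ?_⟩
    · rw [h] at h1; exact (h1.trans h2).false
    · rw [h] at h2; exact h2.false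
    · rw [h] at h1; exact h1.false
  · refine (A.hasSum_product_three hw (v 0) (v 1) (v 2) (hy.2 0 1 (by simp)) (hy.2 1 2 (by simp))
      (hy.1 2)).congr_fun fun k => ?_
    rw [Fin.prod_univ_three]
    rfl

end GRVertexAlgebra

namespace GRModule

variable {V : Type*} [AddCommGroup V] [Module ℂ V] {A : GRVertexAlgebra V}
  {W : Type*} [AddCommGroup W] [Module ℂ W] (B : GRModule A W)

lemma pairing_elementE_two (v : Fin 2 → V) (w : W) {z : Fin 2 → ℂ} (h0 : z 0 ≠ 0) (h1 : z 1 ≠ 0)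
    (h01 : z 0 ≠ z 1) {w' : Module.Dual ℂ W} (hw : w' ∈ B.gradedDual) :
    B.pairing w' (elementE B.toGrading B.mode 2 v w z) =
      B.corr w' (v 0) (v 1) w (z 0) (z 1) := by
  have hx : ∀ w' ∈ B.gradedDual, B.pairing w' (B.ofFunctional fun w' =>
      B.corr w' (v 0) (v 1) w (z 0) (z 1)) = B.corr w' (v 0) (v 1) w (z 0) (z 1) := fun w' hw =>
    B.pairing_ofFunctional _ (fun a ha b hb => B.corr_add_dual ha hb _ _ _ h0 h1 h01)
      (fun c a ha => B.corr_smul_dual ha c _ _ _ h0 h1 h01) hw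
  rw [elementE_pairing (Δ := discTwo) (f := fun w' z => B.corr w' (v 0) (v 1) w (z 0) (z 1)) hx
    (fun w' hw => (B.isCorr_corr hw _ _ _).1) (fun y hy => ?_) (fun w' hw y hy => ?_)
    ((eval_discTwo_ne _).mpr ⟨h0, h1, h01⟩), hx w' hw]
  · have h1 := hy.2 0 1 (by simp)
    exact (eval_discTwo_ne _).mpr ⟨hy.1 0, hy.1 1, fun h => by rw [h] at h1; exact h1.false⟩
  · rw [← (finTwoArrowEquiv ℤ).symm.hasSum_iff]
    refine (B.hasSum_corr hw (v 0) (v 1) w (norm_pos_iff.mpr (hy.1 1))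
      (hy.2 0 1 (by simp))).congr_fun fun p => ?_
    simp [iterMode, mul_assoc]

end GRModule

/-! ### Poles along the diagonals -/

section Poles

open MvPolynomial

/-- The product of all differences of distinct variables. -/
def discAll (ι : Type*) [Fintype ι] [DecidableEq ι] : MvPolynomial ι ℂ :=
  ∏ p ∈ (Finset.univ : Finset ι).offDiag, (X p.1 - X p.2)

variable {ι : Type*} [Fintype ι] [DecidableEq ι]

lemma eval_discAll_ne {z : ι → ℂ} (hz : Function.Injective z) : eval z (discAll ι) ≠ 0 := by
  rw [discAll, map_prod, Finset.prod_ne_zero_iff]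
  intro p hp
  simp only [Finset.mem_offDiag] at hp
  simp only [map_sub, eval_X]
  exact sub_ne_zero.mpr fun h => hp.2.2 (hz h)

lemma RatOn.exists_offDiag {f : (ι → ℂ) → ℂ} (hf : RatOn (discAll ι) f) :
    ∃ (P : MvPolynomial ι ℂ) (N : ℕ), ∀ z, Function.Injective z →
      f z = eval z P / ∏ p ∈ (Finset.univ : Finset ι).offDiag, (z p.1 - z p.2) ^ N := by
  obtain ⟨P, N, h⟩ := hf
  refine ⟨P, N, fun z hz => ?_⟩
  rw [h z (eval_discAll_ne hz), discAll, map_prod, Finset.prod_pow]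
  simp

lemma ratOn_offDiag (P : MvPolynomial ι ℂ) (N : ℕ) : RatOn (discAll ι) fun z =>
    eval z P / ∏ p ∈ (Finset.univ : Finset ι).offDiag, (z p.1 - z p.2) ^ N := by
  refine ⟨P, N, fun z _ => ?_⟩
  simp [discAll, map_prod, Finset.prod_pow]

/-- Natural denominators contain some differences only and with smaller exponents; this brings them
to the shape required by composability, a product over all ordered pairs. -/
lemma exists_offDiag_poles (P : MvPolynomial ι ℂ) {S : Finset (ι × ι)}
    (hS : S ⊆ (Finset.univ : Finset ι).offDiag) {M N : ι × ι → ℕ} (hMN : ∀ p ∈ S, M p ≤ N p) :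
    ∃ P' : MvPolynomial ι ℂ, ∀ z, Function.Injective z →
      eval z P / ∏ p ∈ S, (z p.1 - z p.2) ^ M p =
        eval z P' / ∏ p ∈ (Finset.univ : Finset ι).offDiag, (z p.1 - z p.2) ^ N p := by
  refine ⟨P * ((∏ p ∈ S, (X p.1 - X p.2) ^ (N p - M p)) *
    ∏ p ∈ (Finset.univ : Finset ι).offDiag \ S, (X p.1 - X p.2) ^ N p), fun z hz => ?_⟩
  have hne : ∀ p ∈ (Finset.univ : Finset ι).offDiag, z p.1 - z p.2 ≠ 0 := fun p hp =>
    sub_ne_zero.mpr fun h => (Finset.mem_offDiag.mp hp).2.2 (hz h)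
  have h1 : ∏ p ∈ S, (z p.1 - z p.2) ^ M p ≠ 0 :=
    Finset.prod_ne_zero_iff.mpr fun p hp => pow_ne_zero _ (hne p (hS hp))
  have h2 : ∏ p ∈ (Finset.univ : Finset ι).offDiag, (z p.1 - z p.2) ^ N p ≠ 0 :=
    Finset.prod_ne_zero_iff.mpr fun p hp => pow_ne_zero _ (hne p hp)
  rw [div_eq_div_iff h1 h2, map_mul, map_mul, map_prod, map_prod, ← Finset.prod_sdiff hS]
  simp only [map_pow, map_sub, eval_X]
  have : ∏ p ∈ S, (z p.1 - z p.2) ^ (N p - M p) * (z p.1 - z p.2) ^ M p =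
      ∏ p ∈ S, (z p.1 - z p.2) ^ N p := Finset.prod_congr rfl fun p hp => by rw [← pow_add, Nat.sub_add_cancel (hMN p hp)]
  rw [← this, Finset.prod_mul_distrib]
  ring

lemma sub_dvd_discAll {i j : ι} (h : i ≠ j) : (X i - X j : MvPolynomial ι ℂ) ∣ discAll ι :=
  Finset.dvd_prod_of_mem (fun p : ι × ι => (X p.1 - X p.2 : MvPolynomial ι ℂ)) (a := (i, j))
    (by simpa using h)

lemma discThree_dvd_discAll : discThree ∣ discAll (Fin 3) := by
  have h := Finset.prod_dvd_prod_of_subset ({(0, 2), (1, 2), (0, 1)} : Finset (Fin 3 × Fin 3))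
    (Finset.univ : Finset (Fin 3)).offDiag
    (fun p : Fin 3 × Fin 3 => (X p.1 - X p.2 : MvPolynomial (Fin 3) ℂ)) (by decide)
  rw [Finset.prod_insert (by decide), Finset.prod_insert (by decide), Finset.prod_singleton] at h
  rw [discThree, mul_assoc]
  exact h

end Poles

/-! ### Pole orders, scaling and Taylor expansion of translated fields -/

namespace FieldMap

variable {U : Type*} [AddCommGroup U] [Module ℂ U] {X : Type*} [AddCommGroup X] [Module ℂ X]
  {W : Type*} [AddCommGroup W] [Module ℂ W]
  {G₁ : TGrading U} {G₂ : TGrading X} {G₃ : TGrading W} (Y : FieldMap G₁ G₂ G₃)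

lemma hasSum_e2 {w' : Module.Dual ℂ W} (hw : w' ∈ G₃.gradedDual) (u : U) (x : X) (z₁ z₂ : ℂ) :
    HasSum (fun p : ℕ × ℤ => w' ((G₃.L ^ p.1) (Y.mode p.2 u x)) *
      (z₂ ^ p.1 / (p.1.factorial : ℂ)) * (z₁ - z₂) ^ (-p.2 - 1)) (Y.e2 w' u x z₁ z₂) := by
  obtain ⟨K, hK⟩ := G₃.exists_comp_pow_eq_zero hw
  choose s hs using fun k => Y.exists_support (G₃.comp_pow_mem hw k) u x
  have hs' : ∀ k < K, ∀ n ∉ (Finset.range K).biUnion s,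
      (w'.comp (G₃.L ^ k)) (Y.mode n u x) = 0 := by
    intro k hk n hn
    refine hs k n fun h => hn ?_
    simp only [Finset.mem_biUnion, Finset.mem_range]
    exact ⟨k, hk, h⟩
  rw [Y.e2_eq_sum hw hK]
  have h1 : ∑ k ∈ Finset.range K, z₂ ^ k / (k.factorial : ℂ) *
      Y.lau (w'.comp (G₃.L ^ k)) u x (z₁ - z₂) =
      ∑ p ∈ Finset.range K ×ˢ (Finset.range K).biUnion s, w' ((G₃.L ^ p.1) (Y.mode p.2 u x)) *
      (z₂ ^ p.1 / (p.1.factorial : ℂ)) * (z₁ - z₂) ^ (-p.2 - 1) := by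
    rw [Finset.sum_product]
    refine Finset.sum_congr rfl fun k hk => ?_
    rw [Y.lau_eq_sum (hs' k (Finset.mem_range.mp hk)), Finset.mul_sum]
    refine Finset.sum_congr rfl fun n _ => ?_
    rw [LinearMap.comp_apply]
    ring
  rw [h1]
  refine hasSum_sum_of_ne_finset_zero fun p hp => ?_
  have : w' ((G₃.L ^ p.1) (Y.mode p.2 u x)) = 0 := by
    by_cases hk : p.1 < K
    · refine hs' p.1 hk p.2 fun h => hp ?_
      exact Finset.mem_product.mpr ⟨Finset.mem_range.mpr hk, h⟩
    · exact LinearMap.congr_fun (hK p.1 (not_lt.mp hk)) _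
  rw [this, zero_mul, zero_mul]

lemma lau_poly {w' : Module.Dual ℂ W} (hw : w' ∈ G₃.gradedDual) {u : U} {x : X} {c : ℕ}
    (hc : ∀ n : ℤ, c ≤ n → Y.mode n u x = 0) :
    ∃ p : Polynomial ℂ, ∀ z : ℂ, z ≠ 0 → Y.lau w' u x z = p.eval z / z ^ c := by
  obtain ⟨s, hs⟩ := Y.exists_support hw u x
  refine ⟨∑ n ∈ s, Polynomial.C (w' (Y.mode n u x)) * Polynomial.X ^ (c - 1 - n).toNat,
    fun z hz => ?_⟩
  rw [Y.lau_eq_sum hs, Polynomial.eval_finsetSum, Finset.sum_div]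
  refine Finset.sum_congr rfl fun n _ => ?_
  by_cases hn : (c : ℤ) ≤ n
  · simp [hc n hn]
  · simp only [Polynomial.eval_mul, Polynomial.eval_C, Polynomial.eval_pow, Polynomial.eval_X]
    rw [mul_div_assoc]
    congr 1
    rw [eq_div_iff (pow_ne_zero _ hz), ← zpow_natCast, ← zpow_natCast, ← zpow_add₀ hz]
    congr 1
    lia

lemma e2_poly {w' : Module.Dual ℂ W} (hw : w' ∈ G₃.gradedDual) {u : U} {x : X} {c : ℕ}
    (hc : ∀ n : ℤ, c ≤ n → Y.mode n u x = 0) :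
    ∃ P : MvPolynomial (Fin 2) ℂ, ∀ z₁ z₂ : ℂ, z₁ ≠ z₂ →
      Y.e2 w' u x z₁ z₂ = MvPolynomial.eval ![z₁, z₂] P / (z₁ - z₂) ^ c := by
  obtain ⟨K, hK⟩ := G₃.exists_comp_pow_eq_zero hw
  choose p hp using fun k => Y.lau_poly (G₃.comp_pow_mem hw k) hc
  refine ⟨∑ k ∈ Finset.range K, MvPolynomial.C ((k.factorial : ℂ)⁻¹) * MvPolynomial.X 1 ^ k *
    Polynomial.aeval (MvPolynomial.X 0 - MvPolynomial.X 1 : MvPolynomial (Fin 2) ℂ) (p k),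
    fun z₁ z₂ h => ?_⟩
  rw [Y.e2_eq_sum hw hK, map_sum, Finset.sum_div]
  refine Finset.sum_congr rfl fun k _ => ?_
  rw [hp k _ (sub_ne_zero.mpr h), map_mul, map_mul, map_pow, MvPolynomial.eval_C,
    MvPolynomial.eval_X]
  have h1 : ∀ q : Polynomial ℂ, MvPolynomial.eval ![z₁, z₂] (Polynomial.aeval
      (MvPolynomial.X 0 - MvPolynomial.X 1 : MvPolynomial (Fin 2) ℂ) q) = q.eval (z₁ - z₂) := by
    intro q
    induction q using Polynomial.induction_on' with
    | add p q hp hq => rw [map_add, map_add, hp, hq, Polynomial.eval_add]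
    | monomial n a => simp [Polynomial.aeval_monomial, MvPolynomial.algebraMap_eq]
  rw [h1]
  simp only [Matrix.cons_val]
  ring

/-- The component of degree `r` is homogeneous of degree `r - k - l` in `(z₁, z₂)`, since the power
of `L(-1)` and the mode contribute complementary degrees. This is the source of `L(0)`-conjugation.
-/
lemma e2elt_scale {u : U} {x : X} {k l : ℤ} (hu : u ∈ G₁.gr k) (hx : x ∈ G₂.gr l) {t : ℂ}
    (ht : t ≠ 0) (z₁ z₂ : ℂ) (r : ℤ) :
    (t ^ (k + l)) • (Y.e2elt u x (t * z₁) (t * z₂) r : W) = (t ^ r) • (Y.e2elt u x z₁ z₂ r : W) := by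
  rw [← sub_eq_zero, ← Module.forall_dual_apply_eq_zero_iff ℂ]
  intro φ
  have hmem := G₃.comp_proj_mem_gradedDual φ r
  rw [map_sub, map_smul, map_smul, e2elt_apply, e2elt_apply, sub_eq_zero, smul_eq_mul, smul_eq_mul,
    e2, e2, ← mul_sub]
  refine ((Y.hasSum_lau (G₃.expDual_mem hmem _) u x _).mul_left _).unique
    (((Y.hasSum_lau (G₃.expDual_mem hmem _) u x _).mul_left _).congr_fun fun n => ?_)
  have hy := Y.weight n k l u x hu hx
  by_cases hr : r < k + l - n - 1
  · rw [expDual_comp_proj_apply_of_lt φ r hy _ hr, expDual_comp_proj_apply_of_lt φ r hy _ hr]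
    simp
  · obtain ⟨j, hj⟩ : ∃ j : ℕ, k + l - n - 1 + j = r := ⟨(r - (k + l - n - 1)).toNat, by lia⟩
    rw [expDual_comp_proj_apply φ r hy _ j hj, expDual_comp_proj_apply φ r hy _ j hj, ← hj,
      mul_zpow, mul_pow, show k + l - n - 1 + (j : ℤ) = k + l + (j + (-n - 1)) by ring,
      zpow_add₀ ht (k + l), zpow_add₀ ht j, zpow_natCast]
    ring

/-- Absolute convergence of the Taylor expansion of `⟨w', e^{z₂ L(-1)} Y(u, z₁ - z₂)x⟩` in both
variables. -/
lemma hasSum_e2_both {w' : Module.Dual ℂ W} (hw : w' ∈ G₃.gradedDual) (u : U) (x : X)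
    {z₁ z₂ a b : ℂ} (h : ‖a‖ + ‖b‖ < ‖z₁ - z₂‖) :
    HasSum (fun i : ℕ × ℕ => Y.e2 w' ((G₁.L ^ i.1) u) ((G₂.L ^ i.2) x) z₁ z₂ /
      ((i.1.factorial : ℂ) * (i.2.factorial : ℂ)) * (a ^ i.1 * b ^ i.2))
      (Y.e2 w' u x (z₁ + a) (z₂ + b)) := by
  obtain ⟨c, hc⟩ := Y.exists_trunc u x
  obtain ⟨P, hP⟩ := Y.e2_poly hw hc
  have hz : z₁ - z₂ ≠ 0 := norm_pos_iff.mp (lt_of_le_of_lt (by positivity) h)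
  set K : ℂ × ℂ → ℂ := fun p => MvPolynomial.eval ![z₁ + p.1, z₂ + p.2] P *
    (z₁ - z₂ - (-1 * p.1 + 1 * p.2))⁻¹ ^ c with hKdef
  have hK : HasDPS {p : ℂ × ℂ | ‖p.1‖ + ‖p.2‖ < ‖z₁ - z₂‖} K := by
    refine HasDPS.mul ?_ (HasDPS.pow (HasDPS.inv_sub (-1) 1 hz fun p hp => ?_) c)
    · have := HasDPS.eval (D := {p : ℂ × ℂ | ‖p.1‖ + ‖p.2‖ < ‖z₁ - z₂‖})
        (φ := fun i p => (![z₁ + p.1, z₂ + p.2] : Fin 2 → ℂ) i) (fun i => by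
          fin_cases i
          · exact (HasDPS.const z₁).add HasDPS.fst
          · exact (HasDPS.const z₂).add HasDPS.snd) P
      exact this
    · have hp : ‖p.1‖ + ‖p.2‖ < ‖z₁ - z₂‖ := hp
      simpa using hp
  have hval : ∀ a b : ℂ, ‖a‖ + ‖b‖ < ‖z₁ - z₂‖ → K (a, b) = Y.e2 w' u x (z₁ + a) (z₂ + b) := by
    intro a b h
    have h1 : z₁ + a ≠ z₂ + b := by
      intro h0
      have : z₁ - z₂ = b - a := by linear_combination h0
      rw [this] at h
      have := norm_sub_le b a
      linarith
    rw [hP _ _ h1, hKdef, div_eq_mul_inv]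
    simp only [inv_pow]
    congr 3
    ring
  obtain ⟨κ, hκ⟩ := hK
  have hpos : 0 < ‖z₁ - z₂‖ := norm_pos_iff.mpr hz
  have hev : ∀ ε : ℝ, 0 < ε → ∀ᶠ s in 𝓝[≠] (0 : ℂ), ‖s‖ < ε := fun ε hε => by
    filter_upwards [nhdsWithin_le_nhds (Metric.ball_mem_nhds (0 : ℂ) hε)] with s hs
    simpa using hs
  have hcoef := dps_coeff (c := κ) (K := K) (half_pos hpos)
    (fun s d h1 h2 => hκ (s, d) (by change ‖s‖ + ‖d‖ < ‖z₁ - z₂‖; linarith))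
    (κ := fun i j => Y.e2 w' ((G₁.L ^ i) u) ((G₂.L ^ j) x) z₁ z₂ /
      ((i.factorial : ℂ) * (j.factorial : ℂ)))
    (k := fun j s => Y.e2 w' u ((G₂.L ^ j) x) (z₁ + s) z₂ / (j.factorial : ℂ)) ?_ ?_
  · rw [← hval a b h]
    exact (hκ (a, b) h).congr_fun fun i => by rw [← hcoef]
  · filter_upwards [hev _ (half_pos hpos)] with s hs
    filter_upwards [hev _ (half_pos hpos)] with d hd
    rw [hval s d (by linarith)]
    refine (Y.hasSum_e2_snd hw u x (z₁ := z₁ + s) (z₂ := z₂) (a := d) ?_).congr_fun fun j => by ring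
    have := norm_sub_le (z₁ + s - z₂) s
    rw [show z₁ + s - z₂ - s = z₁ - z₂ by ring] at this
    linarith
  · intro j
    filter_upwards [hev _ hpos] with s hs
    refine ((Y.hasSum_e2_fst hw u ((G₂.L ^ j) x) (z₁ := z₁) (z₂ := z₂) (a := s) hs).mul_left
      ((j.factorial : ℂ)⁻¹)).of_eq (fun i => ?_) (by ring)
    rw [div_eq_mul_inv, mul_inv]
    ring

end FieldMap

/-! ### The cochain of a symmetric field -/

lemma Grading.pairing_elementE_zero {V : Type*} [AddCommGroup V] [Module ℂ V] {W : Type*}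
    [AddCommGroup W] [Module ℂ W] {G : Grading W} {mode : ℤ → V →ₗ[ℂ] W →ₗ[ℂ] W} (v : Fin 0 → V)
    (w : W) (z : Fin 0 → ℂ) {w' : Module.Dual ℂ W} (hw : w' ∈ G.gradedDual) :
    G.pairing w' (elementE G mode 0 v w z) = w' w := by
  have hx : ∀ w' ∈ G.gradedDual, G.pairing w' (G.ofFunctional fun w' => w' w) = w' w :=
    fun w' hw => G.pairing_ofFunctional _ (fun _ _ _ _ => rfl) (fun _ _ _ => rfl) hw
  rw [elementE_pairing (Δ := 1) (f := fun w' _ => w' w) hx (fun w' _ => RatOn.const _) (by simp)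
    (fun w' hw y hy => ?_) (by simp), hx w' hw]
  have := hasSum_unique fun k : Fin 0 → ℤ => w' (iterMode mode 0 v k w) * ∏ i, y i ^ (-k i - 1)
  simp [iterMode] at this ⊢

namespace PreCochain

variable {V : Type*} [AddCommGroup V] [Module ℂ V] {A : GRVertexAlgebra V}
  {W : Type*} [AddCommGroup W] [Module ℂ W] {B : GRModule A W}

lemma val_of_injective {n : ℕ} (Φ : PreCochain B n) (v : Fin n → V) {z : Fin n → ℂ}
    (hz : Function.Injective z) : Φ.val v z = Φ v ⟨z, hz⟩ := dif_pos hz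

lemma ext_matEl {n : ℕ} {Φ Φ' : PreCochain B n} (h : ∀ v, ∀ w' ∈ B.gradedDual, ∀ z,
    Function.Injective z → Φ.matEl w' v z = Φ'.matEl w' v z) : Φ = Φ' := by
  ext1 v
  funext z
  refine B.completion_ext fun w' hw => ?_
  have := h v w' hw z.1 z.2
  rwa [matEl, matEl, val_of_injective _ _ z.2, val_of_injective _ _ z.2] at this

lemma matEl_sub {n : ℕ} (Φ Φ' : PreCochain B n) {w' : Module.Dual ℂ W} (hw : w' ∈ B.gradedDual)
    (v : Fin n → V) {z : Fin n → ℂ} (hz : Function.Injective z) :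
    (Φ - Φ').matEl w' v z = Φ.matEl w' v z - Φ'.matEl w' v z := by
  rw [matEl, matEl, matEl, val_of_injective _ _ hz, val_of_injective _ _ hz,
    val_of_injective _ _ hz, ← B.pairing_sub hw]
  rfl

lemma isRational_iff {n : ℕ} {Φ : PreCochain B n} : Φ.IsRational ↔ ∀ v, ∀ w' ∈ B.gradedDual,
    ∃ f, RatOn (discAll (Fin n)) f ∧ ∀ z, Function.Injective z → Φ.matEl w' v z = f z := by
  constructor
  · intro h v w' hw
    obtain ⟨P, N, hP⟩ := h v w' hw
    exact ⟨_, ratOn_offDiag P N, hP⟩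
  · intro h v w' hw
    obtain ⟨f, hf, h2⟩ := h v w' hw
    obtain ⟨P, N, hP⟩ := hf.exists_offDiag
    exact ⟨P, N, fun z hz => (h2 z hz).trans (hP z hz)⟩

end PreCochain

lemma injective_two {z : Fin 2 → ℂ} : Function.Injective z ↔ z 0 ≠ z 1 := by
  constructor
  · intro h h0; exact absurd (h h0) (by simp)
  · intro h i j hij
    fin_cases i <;> fin_cases j <;> first | rfl | exact absurd hij h | exact absurd hij.symm h

lemma injective_three {z : Fin 3 → ℂ} :
    Function.Injective z ↔ z 0 ≠ z 2 ∧ z 1 ≠ z 2 ∧ z 0 ≠ z 1 := by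
  constructor
  · intro h
    exact ⟨fun h0 => absurd (h h0) (by simp), fun h0 => absurd (h h0) (by simp),
      fun h0 => absurd (h h0) (by simp)⟩
  · rintro ⟨h1, h2, h3⟩ i j hij
    fin_cases i <;> fin_cases j <;> first
      | rfl | exact absurd hij h1 | exact absurd hij.symm h1 | exact absurd hij h2
      | exact absurd hij.symm h2 | exact absurd hij h3 | exact absurd hij.symm h3

lemma comp_swap_two {α : Type*} (f : Fin 2 → α) :
    f ∘ Equiv.swap (0 : Fin 2) 1 = ![f 1, f 0] := by
  funext i
  fin_cases i <;> simp

/-- For `n = 2` and `s = 1` the shuffle condition on a permutation is vacuous, so the signed sum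
runs over both permutations. -/
lemma PreCochain.shuffleSymmetric_two {V : Type*} [AddCommGroup V] [Module ℂ V]
    {A : GRVertexAlgebra V} {W : Type*} [AddCommGroup W] [Module ℂ W] {B : GRModule A W}
    {Φ : PreCochain B 2} : Φ.ShuffleSymmetric ↔ ∀ v z, Function.Injective z →
      Φ.val v z = Φ.val ![v 1, v 0] ![z 1, z 0] := by
  classical
  have hfilter : ∀ s : ℕ, 1 ≤ s → s < 2 → (Finset.univ.filter fun σ : Equiv.Perm (Fin 2) =>
      ∀ i j : Fin 2, i < j → (j.val < s ∨ s ≤ i.val) → σ⁻¹ i < σ⁻¹ j) = Finset.univ := by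
    refine fun s h1 h2 => Finset.filter_true_of_mem fun σ _ i j hij h => ?_
    lia
  have huniv : (Finset.univ : Finset (Equiv.Perm (Fin 2))) = {1, Equiv.swap 0 1} := by decide
  have hsum : ∀ v z, ∑ σ : Equiv.Perm (Fin 2), ((Equiv.Perm.sign σ : ℤ) : ℂ) •
      Φ.val (v ∘ σ) (z ∘ σ) = Φ.val v z - Φ.val ![v 1, v 0] ![z 1, z 0] := fun v z => by
    rw [huniv, Finset.sum_pair (by decide), Equiv.Perm.sign_swap (show (0 : Fin 2) ≠ 1 by simp),
      ← comp_swap_two, ← comp_swap_two, sub_eq_add_neg]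
    simp
  constructor
  · intro h v z hz
    have h1 := h 1 le_rfl (by norm_num) v z hz
    refine sub_eq_zero.1 ((hsum v z).symm.trans (Eq.trans ?_ h1))
    exact Finset.sum_congr (by convert (hfilter 1 le_rfl (by norm_num)).symm) fun _ _ => rfl
  · intro h s h1 h2 v z hz
    refine Eq.trans ?_ (sub_eq_zero.2 (h v z hz))
    rw [← hsum v z]
    exact Finset.sum_congr (by convert hfilter s h1 h2) fun _ _ => rfl

namespace FieldMap

variable {V : Type*} [AddCommGroup V] [Module ℂ V] {A : GRVertexAlgebra V}
  {W : Type*} [AddCommGroup W] [Module ℂ W] {B : GRModule A W} (ψ : FieldMap A.tg A.tg B.tg)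

/-- The map `(v₁, z₁; v₂, z₂) ↦ e^{z₂ L(-1)} ψ(v₁, z₁ - z₂)v₂`. -/
def cochain : PreCochain B 2 where
  toFun v z := ψ.e2elt (v 0) (v 1) (z.1 0) (z.1 1)
  map_update_add' v i x y := by
    funext z
    fin_cases i
    · simpa [Function.update] using ψ.e2elt_add_left x y (v 1) (z.1 0) (z.1 1)
    · simpa [Function.update] using ψ.e2elt_add_right (v 0) x y (z.1 0) (z.1 1)
  map_update_smul' v i c x := by
    funext z
    fin_cases i
    · simpa [Function.update] using ψ.e2elt_smul_left c x (v 1) (z.1 0) (z.1 1)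
    · simpa [Function.update] using ψ.e2elt_smul_right c (v 0) x (z.1 0) (z.1 1)

lemma cochain_val (v : Fin 2 → V) {z : Fin 2 → ℂ} (hz : z 0 ≠ z 1) :
    ψ.cochain.val v z = ψ.e2elt (v 0) (v 1) (z 0) (z 1) :=
  PreCochain.val_of_injective _ _ (injective_two.mpr hz)

lemma cochain_matEl {w' : Module.Dual ℂ W} (hw : w' ∈ B.gradedDual) (v : Fin 2 → V)
    {z : Fin 2 → ℂ} (hz : z 0 ≠ z 1) :
    ψ.cochain.matEl w' v z = ψ.e2 w' (v 0) (v 1) (z 0) (z 1) := by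
  rw [PreCochain.matEl, ψ.cochain_val v hz]
  exact ψ.pairing_e2elt hw _ _ _ _

/-- Invariance of `e^{z₂ L(-1)} ψ(v₁, z₁ - z₂)v₂` under the exchange of both arguments. -/
def IsSymmetric : Prop :=
  ∀ w' ∈ B.gradedDual, ∀ u v z₁ z₂, z₁ ≠ z₂ → ψ.e2 w' u v z₁ z₂ = ψ.e2 w' v u z₂ z₁

variable {ψ}

lemma IsSymmetric.e2elt (hψ : ψ.IsSymmetric) (u v : V) {z₁ z₂ : ℂ} (h : z₁ ≠ z₂) :
    ψ.e2elt u v z₁ z₂ = ψ.e2elt v u z₂ z₁ :=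
  B.completion_ext fun w' hw =>
    (ψ.pairing_e2elt hw u v z₁ z₂).trans ((hψ w' hw u v z₁ z₂ h).trans
      (ψ.pairing_e2elt hw v u z₂ z₁).symm)

variable (ψ)

lemma cochain_isRational : ψ.cochain.IsRational := by
  rw [PreCochain.isRational_iff]
  intro v w' hw
  exact ⟨_, (ψ.e2_ratOn hw (v 0) (v 1)).mono (sub_dvd_discAll (by simp)),
    fun z hz => ψ.cochain_matEl hw v (injective_two.mp hz)⟩

lemma cochain_lDerivative : ψ.cochain.LDerivative := by
  intro v w' hw z hz
  have hz := injective_two.mp hz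
  have h0 : HasDerivAt (fun t => ψ.cochain.matEl w' v (Function.update z 0 t))
      (ψ.e2 w' (A.Lm1 (v 0)) (v 1) (z 0) (z 1)) (z 0) := by
    refine (ψ.hasDerivAt_e2_fst hw (v 0) (v 1) hz).congr_of_eventuallyEq ?_
    filter_upwards [eventually_ne_nhds hz] with t ht
    rw [ψ.cochain_matEl hw v (by simpa [Function.update] using ht)]
    simp [Function.update]
  have h1 : HasDerivAt (fun t => ψ.cochain.matEl w' v (Function.update z 1 t))
      (ψ.e2 w' (v 0) (A.Lm1 (v 1)) (z 0) (z 1)) (z 1) := by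
    refine (ψ.hasDerivAt_e2_snd hw (v 0) (v 1) hz).congr_of_eventuallyEq ?_
    filter_upwards [eventually_ne_nhds hz.symm] with t ht
    rw [ψ.cochain_matEl hw v (by simpa [Function.update] using ht.symm)]
    simp [Function.update]
  refine ⟨fun i => ?_, ?_⟩
  · rw [ψ.cochain_matEl hw _ hz]
    fin_cases i
    · simpa [Function.update] using h0
    · simpa [Function.update] using h1
  · rw [Fin.sum_univ_two, h0.deriv, h1.deriv]
    have h2 : ∑ᶠ r : ℤ, w' (B.Lm1 (ψ.cochain.val v z r : W)) =
        ψ.e2 (w'.comp B.Lm1) (v 0) (v 1) (z 0) (z 1) := by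
      rw [← ψ.cochain_matEl (B.tg.comp_L_mem hw) v hz]
      rfl
    rw [h2]
    exact (ψ.e2_comp_L hw _ _ _ _).symm

lemma cochain_lConjugation : ψ.cochain.LConjugation := by
  intro k v hv w' hw z hz t ht
  have hz := injective_two.mp hz
  have ht' : t * z 0 ≠ t * z 1 := by simpa [ht] using hz
  rw [PreCochain.matEl, ψ.cochain_val _ hz, ψ.cochain_val _ ht', Grading.pairing]
  refine finsum_congr fun r => ?_
  rw [← ψ.e2elt_scale (hv 0) (hv 1) ht, ψ.e2elt_smul_left, ψ.e2elt_smul_right, smul_smul,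
    ← zpow_add₀ ht]
  rfl

variable {ψ}

lemma IsSymmetric.cochain_shuffle (hψ : ψ.IsSymmetric) : ψ.cochain.ShuffleSymmetric := by
  refine PreCochain.shuffleSymmetric_two.2 fun v z hz => ?_
  have hz := injective_two.mp hz
  rw [ψ.cochain_val _ hz, ψ.cochain_val _ (by simpa using hz.symm)]
  exact hψ.e2elt (v 0) (v 1) hz

/-- A bound for the pole orders that depends only on pairs of vectors. -/
def truncBound (ψ : FieldMap A.tg A.tg B.tg) (u v : V) : ℕ := (ψ.exists_trunc u v).choose

lemma mode_truncBound (ψ : FieldMap A.tg A.tg B.tg) (u v : V) :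
    ∀ n : ℤ, ψ.truncBound u v ≤ n → ψ.mode n u v = 0 := (ψ.exists_trunc u v).choose_spec

lemma hasSum_cochain_expElt (ψ : FieldMap A.tg A.tg B.tg) {w' : Module.Dual ℂ W}
    (hw : w' ∈ B.gradedDual) (u v : V) {z₁ z₂ a b : ℂ} (h : ‖a‖ + ‖b‖ < ‖z₁ - z₂‖) :
    HasSum (fun r : ℤ × ℤ => ψ.e2 w' (A.tg.expElt u a r.1 : V) (A.tg.expElt v b r.2 : V) z₁ z₂)
      (ψ.e2 w' u v (z₁ + a) (z₂ + b)) := by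
  have hE : ∀ z, B.tg.expDual w' z ∈ B.gradedDual := fun z => B.tg.expDual_mem hw z
  induction u using Grading.induction (G := A.toGrading) with
  | add x y hx hy =>
    rw [FieldMap.e2, ψ.lau_add_left (hE _)]
    refine (hx.add hy).congr_fun fun r => ?_
    rw [FieldMap.e2, FieldMap.e2, FieldMap.e2, ← ψ.lau_add_left (hE _), A.tg.expElt_add]
    rfl
  | hom k u hu =>
  induction v using Grading.induction (G := A.toGrading) with
  | add x y hx hy =>
    rw [FieldMap.e2, ψ.lau_add_right (hE _)]
    refine (hx.add hy).congr_fun fun r => ?_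
    rw [FieldMap.e2, FieldMap.e2, FieldMap.e2, ← ψ.lau_add_right (hE _), A.tg.expElt_add]
    rfl
  | hom l v hv =>
    have hinj : Function.Injective fun i : ℕ × ℕ => (k + (i.1 : ℤ), l + (i.2 : ℤ)) := by
      intro i j h
      simp only [Prod.mk.injEq] at h
      ext <;> lia
    rw [← hinj.hasSum_iff]
    · refine (ψ.hasSum_e2_both hw u v h).congr_fun fun i => ?_
      simp only [Function.comp_apply]
      rw [A.tg.expElt_hom hu, A.tg.expElt_hom hv, FieldMap.e2, ψ.lau_smul_left (hE _),
        ψ.lau_smul_right (hE _), FieldMap.e2, div_eq_mul_inv _ ((i.1.factorial : ℂ) * _), mul_inv]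
      ring
    · intro r hr
      by_cases h1 : r.1 < k
      · rw [A.tg.expElt_of_lt hu a h1]; simp [FieldMap.e2, FieldMap.lau]
      by_cases h2 : r.2 < l
      · rw [A.tg.expElt_of_lt hv b h2]; simp [FieldMap.e2, FieldMap.lau]
      refine absurd ⟨((r.1 - k).toNat, (r.2 - l).toNat), ?_⟩ hr
      ext
      · simp only; lia
      · simp only; lia

/-- Without vertex operators every block contains one vector, and `Ξ_i = e^{(z_i - ζ_i)L(-1)} v_i`.
The inner condition is then the Taylor expansion around `(ζ₁, ζ₂)`, and the outer one is the finite
pairing itself. The pole order is the truncation order of `ψ(u, z)v`, a function of the pair `(u,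
v)`. -/
lemma cochain_composable (ψ : FieldMap A.tg A.tg B.tg) (S₀ : Set ℂ) (S : Fin 0 → Set ℂ) :
    ψ.cochain.Composable 0 S₀ S where
  inner := by
    refine ⟨ψ.truncBound, fun l hl hsum v w' hw => ?_⟩
    obtain rfl : l = fun _ => 1 := by
      rw [Fin.sum_univ_two] at hsum
      have h0 := hl 0
      have h1 := hl 1
      funext i
      fin_cases i
      · simp only [Fin.zero_eta]; lia
      · simp only [Fin.mk_one]; lia
    obtain ⟨P, hP⟩ := ψ.e2_poly hw (ψ.mode_truncBound (v ⟨0, 0⟩) (v ⟨1, 0⟩))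
    obtain ⟨P', hP'⟩ := exists_offDiag_poles (ι := Σ _ : Fin 2, Fin 1)
      (MvPolynomial.rename (fun i : Fin 2 => (⟨i, 0⟩ : Σ _ : Fin 2, Fin 1)) P)
      (S := {(⟨0, 0⟩, ⟨1, 0⟩)}) (by decide)
      (M := fun p => ψ.truncBound (v p.1) (v p.2)) (N := fun p => ψ.truncBound (v p.1) (v p.2))
      (fun _ _ => le_rfl)
    refine ⟨P', fun z _ hz ζ hζ hζz => ?_⟩
    have hz01 : z ⟨0, 0⟩ ≠ z ⟨1, 0⟩ := fun h => by simpa using hz h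
    rw [← hP' z hz, Finset.prod_singleton, MvPolynomial.eval_rename]
    have hcomp : z ∘ (fun i : Fin 2 => (⟨i, 0⟩ : Σ _ : Fin 2, Fin 1)) =
        ![z ⟨0, 0⟩, z ⟨1, 0⟩] := by funext i; fin_cases i <;> rfl
    rw [hcomp, ← hP _ _ hz01]
    have h := ψ.hasSum_cochain_expElt hw (v ⟨0, 0⟩) (v ⟨1, 0⟩) (hζz 0 1 (by simp) 0 0)
    rw [add_sub_cancel, add_sub_cancel] at h
    rw [← (finTwoArrowEquiv ℤ).symm.hasSum_iff]
    refine h.congr_fun fun r => ?_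
    simp only [Function.comp_apply]
    rw [ψ.cochain_matEl hw _ (injective_two.mp hζ), A.elementE_one, A.elementE_one]
    rfl
  outer := by
    refine ⟨ψ.truncBound, fun v w' hw => ?_⟩
    obtain ⟨P, hP⟩ := ψ.e2_poly hw (ψ.mode_truncBound (v (Sum.inr 0)) (v (Sum.inr 1)))
    obtain ⟨P', hP'⟩ := exists_offDiag_poles (ι := Fin 0 ⊕ Fin 2)
      (MvPolynomial.rename (fun i : Fin 2 => (Sum.inr i : Fin 0 ⊕ Fin 2)) P)
      (S := {(Sum.inr 0, Sum.inr 1)}) (by decide)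
      (M := fun p => ψ.truncBound (v p.1) (v p.2)) (N := fun p => ψ.truncBound (v p.1) (v p.2))
      (fun _ _ => le_rfl)
    refine ⟨P', fun z _ _ hz _ _ => ?_⟩
    have hz01 : z (Sum.inr 0) ≠ z (Sum.inr 1) := fun h => by simpa using hz h
    rw [← hP' z hz, Finset.prod_singleton, MvPolynomial.eval_rename]
    have hcomp : z ∘ (fun i : Fin 2 => (Sum.inr i : Fin 0 ⊕ Fin 2)) =
        ![z (Sum.inr 0), z (Sum.inr 1)] := by funext i; fin_cases i <;> rfl
    rw [hcomp, ← hP _ _ hz01, ← hcomp]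
    have h := B.hasSum_pairing hw (ψ.cochain.val (v ∘ Sum.inr) (z ∘ Sum.inr))
    have h2 := ψ.cochain_matEl hw (v ∘ Sum.inr) (z := z ∘ Sum.inr) hz01
    rw [PreCochain.matEl] at h2
    rw [h2] at h
    exact h.congr_fun fun q => Grading.pairing_elementE_zero _ _ _ hw

lemma IsSymmetric.cochain_mem {M : Type*} [TopologicalSpace M] [ChartedSpace ℂ M]
    (F : CurveFoliation M) (𝒰 : Set (Set M)) (hψ : ψ.IsSymmetric) :
    ψ.cochain ∈ cochains F 𝒰 B 2 0 :=
  ⟨ψ.cochain_isRational, ψ.cochain_lDerivative, ψ.cochain_lConjugation, hψ.cochain_shuffle,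
    fun _ _ _ _ _ _ => ψ.cochain_composable _ _⟩

end FieldMap

/-! ### The cocycle of a square-zero extension -/

section ActAt

variable {V : Type*} [AddCommGroup V] [Module ℂ V] {A : GRVertexAlgebra V}
  {W : Type*} [AddCommGroup W] [Module ℂ W] (B : GRModule A W)

lemma actAt_eq {w' : Module.Dual ℂ W} (hw : w' ∈ B.gradedDual) (v : V) (z ζ : ℂ) (w : W) :
    actAt B w' v z ζ w = B.field.e2 w' v w z ζ :=
  (B.field.hasSum_e2 hw v w z ζ).tsum_eq

variable {B}

lemma firstTerm_cochain (ψ : FieldMap A.tg A.tg B.tg) {w' : Module.Dual ℂ W}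
    (hw : w' ∈ B.gradedDual) (v₁ v₂ v₃ : V) {z : Fin 3 → ℂ} {ζ : ℂ} (hz : z ∈ firstRegion ζ)
    (r : ℤ) : firstTerm ψ.cochain w' v₁ v₂ v₃ z ζ r =
      B.field.e2 w' v₁ (ψ.e2elt v₂ v₃ (z 1 - ζ) (z 2 - ζ) r : W) (z 0) ζ +
      ψ.e2 w' v₁ (A.field.e2elt v₂ v₃ (z 1 - ζ) (z 2 - ζ) r : V) (z 0) ζ := by
  have h12 : z 1 - ζ ≠ z 2 - ζ := by simpa using (injective_three.mp hz.1).2.1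
  have h0 : z 0 ≠ ζ := by
    rintro h
    have := hz.2.1.trans hz.2.2.1
    simp [h] at this
  rw [firstTerm, actAt_eq B hw, ψ.cochain_val _ (by simpa using h12),
    ψ.cochain_matEl hw _ (by simpa using h0), A.elementE_two _ (by simpa using h12)]
  rfl

/-- Symmetry of the cochain identifies `G₂` with `G₁` for cyclically permuted arguments, so only
`G₁` needs analysis and the cocycle equation becomes invariance under rotation. -/
lemma secondTerm_eq (ψ : FieldMap A.tg A.tg B.tg) (hψ : ψ.IsSymmetric) {w' : Module.Dual ℂ W}
    (hw : w' ∈ B.gradedDual) (v₁ v₂ v₃ : V) {z : Fin 3 → ℂ} {ζ : ℂ} (hz : z ∈ secondRegion ζ)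
    (r : ℤ) : secondTerm ψ.cochain w' v₁ v₂ v₃ z ζ r =
      firstTerm ψ.cochain w' v₃ v₁ v₂ ![z 2, z 0, z 1] ζ r := by
  have h0 : ζ ≠ z 2 := by
    rintro h
    have := hz.2.1.trans hz.2.2.1
    simp [h] at this
  rw [secondTerm, firstTerm, ψ.cochain_matEl hw _ (by simpa using h0),
    ψ.cochain_matEl hw _ (by simpa using h0.symm), add_comm]
  congr 1
  exact hψ w' hw _ _ _ _ h0

lemma mem_firstRegion_of_second {z : Fin 3 → ℂ} {ζ : ℂ} (hz : z ∈ secondRegion ζ) :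
    ![z 2, z 0, z 1] ∈ firstRegion ζ := by
  obtain ⟨h1, h2, h3, h4, h5⟩ := hz
  obtain ⟨h02, h12, h01⟩ := injective_three.mp h1
  exact ⟨injective_three.mpr ⟨h12.symm, h01, h02.symm⟩, h2, h3, h4, h5⟩

lemma firstRegion_mem_nhds : firstRegion 0 ∈ 𝓝 (![3, 2, 1] : Fin 3 → ℂ) := by
  have h2 : ∀ᶠ z : Fin 3 → ℂ in 𝓝 ![3, 2, 1], z 2 ≠ 0 :=
    (continuous_apply 2).continuousAt.eventually_ne (by simp)
  filter_upwards [GRVertexAlgebra.eventually_norm_lt_three, h2] with z hz h2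
  have h2' := norm_pos_iff.mpr h2
  refine ⟨injective_three.mpr ⟨fun h => ?_, fun h => ?_, fun h => ?_⟩, ?_⟩
  · rw [h] at hz; exact (hz.1.trans hz.2).false
  · rw [h] at hz; exact hz.2.false
  · rw [h] at hz; exact hz.1.false
  · simp only [sub_zero]
    exact ⟨h2'.trans hz.2, hz.1, h2', hz.2.trans hz.1⟩

lemma secondRegion_mem_nhds : secondRegion 0 ∈ 𝓝 (![2, 1, 3] : Fin 3 → ℂ) := by
  have hc : Continuous fun z : Fin 3 → ℂ => (![z 2, z 0, z 1] : Fin 3 → ℂ) := by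
    refine continuous_pi fun i => ?_
    fin_cases i
    · exact continuous_apply 2
    · exact continuous_apply 0
    · exact continuous_apply 1
  have h := hc.continuousAt.preimage_mem_nhds (x := ![2, 1, 3]) (t := firstRegion 0)
    (by simpa using firstRegion_mem_nhds)
  filter_upwards [h] with z hz
  obtain ⟨h1, h2, h3, h4, h5⟩ := hz
  obtain ⟨h12, h01, h02⟩ := injective_three.mp h1
  exact ⟨injective_three.mpr ⟨h02.symm, h12.symm, h01⟩, h2, h3, h4, h5⟩

/-- A symmetric field whose sum `G₁` extends to a rational function `R`, invariant under cyclic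
permutations of the arguments, gives a cocycle. -/
lemma cochain_mem_exCocycles {M : Type*} [TopologicalSpace M] [ChartedSpace ℂ M]
    (F : CurveFoliation M) (𝒰 : Set (Set M)) {ψ : FieldMap A.tg A.tg B.tg} (hψ : ψ.IsSymmetric)
    (R : Module.Dual ℂ W → V → V → V → (Fin 3 → ℂ) → ℂ)
    (hR : ∀ w' ∈ B.gradedDual, ∀ v₁ v₂ v₃, RatOn (discAll (Fin 3)) (R w' v₁ v₂ v₃))
    (hsum : ∀ w' ∈ B.gradedDual, ∀ v₁ v₂ v₃ z ζ, z ∈ firstRegion ζ →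
      HasSum (firstTerm ψ.cochain w' v₁ v₂ v₃ z ζ) (R w' v₁ v₂ v₃ z))
    (hsymm : ∀ w' ∈ B.gradedDual, ∀ v₁ v₂ v₃ z, Function.Injective z →
      R w' v₃ v₁ v₂ ![z 2, z 0, z 1] = R w' v₁ v₂ v₃ z) :
    ψ.cochain ∈ exCocycles F 𝒰 B := by
  have hsum2 : ∀ w' ∈ B.gradedDual, ∀ v₁ v₂ v₃ z ζ, z ∈ secondRegion ζ →
      HasSum (secondTerm ψ.cochain w' v₁ v₂ v₃ z ζ) (R w' v₁ v₂ v₃ z) := by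
    intro w' hw v₁ v₂ v₃ z ζ hz
    rw [← hsymm w' hw v₁ v₂ v₃ z hz.1]
    exact (hsum w' hw v₃ v₁ v₂ _ ζ (mem_firstRegion_of_second hz)).congr_fun fun r =>
      secondTerm_eq ψ hψ hw v₁ v₂ v₃ hz r
  refine ⟨⟨hψ.cochain_mem F 𝒰, fun U _ v₁ v₂ v₃ w' hw => ?_⟩, fun v₁ v₂ v₃ w' hw z hz => ?_⟩
  · obtain ⟨P, N, hP⟩ := (hR w' hw v₁ v₂ v₃).exists_offDiag
    refine ⟨⟨P, N, fun z _ ζ hz => ?_⟩, ⟨P, N, fun z _ ζ hz => ?_⟩⟩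
    · rw [← hP z hz.1]; exact hsum w' hw v₁ v₂ v₃ z ζ hz
    · rw [← hP z hz.1]; exact hsum2 w' hw v₁ v₂ v₃ z ζ hz
  · rw [deltaEx, (hR w' hw v₁ v₂ v₃).ratExt_eq firstRegion_mem_nhds
      (fun x hx => ⟨eval_discAll_ne hx.1, (hsum w' hw v₁ v₂ v₃ x 0 hx).tsum_eq⟩)
      (eval_discAll_ne hz), (hR w' hw v₁ v₂ v₃).ratExt_eq secondRegion_mem_nhds
      (fun x hx => ⟨eval_discAll_ne hx.1, (hsum2 w' hw v₁ v₂ v₃ x 0 hx).tsum_eq⟩)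
      (eval_discAll_ne hz), sub_self]

end ActAt

namespace SquareZeroExtension

variable {V : Type u} [AddCommGroup V] [Module ℂ V] {A : GRVertexAlgebra V}
  {W : Type v} [AddCommGroup W] [Module ℂ W] {B : GRModule A W}

namespace IsRealization

variable {X : SquareZeroExtension B} {Γ : V →ₗ[ℂ] X.E} (hΓ : X.IsRealization Γ)

lemma exists_retraction {X : SquareZeroExtension B} {Γ : V →ₗ[ℂ] X.E} (hΓ : X.IsRealization Γ) :
    ∃ π : X.E →ₗ[ℂ] W, ∀ e, e = Γ (X.γ e) + X.α (π e) := by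
  let α' := LinearEquiv.ofInjective X.α X.isExt.injective
  have hmem : ∀ e, e - Γ (X.γ e) ∈ LinearMap.range X.α := by
    intro e
    rw [X.isExt.range_eq, LinearMap.mem_ker, map_sub, hΓ.isSection, sub_self]
  refine ⟨α'.symm.toLinearMap ∘ₗ (LinearMap.id - Γ ∘ₗ X.γ).codRestrict _ hmem, fun e => ?_⟩
  have h : X.α (α'.symm ⟨e - Γ (X.γ e), hmem e⟩) = e - Γ (X.γ e) := by
    have := LinearEquiv.apply_symm_apply α' ⟨e - Γ (X.γ e), hmem e⟩
    exact congrArg Subtype.val this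
  change e = Γ (X.γ e) + X.α (α'.symm ⟨e - Γ (X.γ e), hmem e⟩)
  rw [h]
  abel

/-- The projection to `W`. -/
def ret : X.E →ₗ[ℂ] W := hΓ.exists_retraction.choose

lemma eq_add (e : X.E) : e = Γ (X.γ e) + X.α (hΓ.ret e) := hΓ.exists_retraction.choose_spec e

lemma gamma_alpha (X : SquareZeroExtension B) (w : W) : X.γ (X.α w) = 0 := by
  have : X.α w ∈ LinearMap.ker X.γ := by rw [← X.isExt.range_eq]; exact ⟨w, rfl⟩
  exact this

lemma ret_alpha (w : W) : hΓ.ret (X.α w) = w := by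
  have h := hΓ.eq_add (X.α w)
  rw [gamma_alpha, map_zero, zero_add] at h
  exact (X.isExt.injective h).symm

lemma ret_section (v : V) : hΓ.ret (Γ v) = 0 := by
  have h := hΓ.eq_add (Γ v)
  rw [hΓ.isSection, left_eq_add] at h
  exact X.isExt.injective (by rw [h, map_zero])

/-- An extension only records that `α` sends degree `n` into degree `n`. The converse holds because
`α` is injective and intertwines the grading operators. -/
lemma ret_mem {n : ℤ} {e : X.E} (he : e ∈ X.alg.gr n) : hΓ.ret e ∈ B.gr n := by
  have h1 : X.α (hΓ.ret e) ∈ X.alg.gr n := by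
    have h := hΓ.eq_add e
    rw [← sub_eq_iff_eq_add'] at h
    rw [← h]
    exact Submodule.sub_mem _ he (hΓ.map_gr n _ (X.isExt.hom.map_gr n _ he))
  refine B.mem_gr_of_L0 (X.isExt.injective ?_)
  have hL : ∀ w, X.α (B.L0 w) = X.alg.L0 (X.α w) := by
    intro w
    induction w using Grading.induction (G := B.toGrading) with
    | hom m w hw => rw [B.L0_of_mem hw, X.alg.L0_of_mem (X.isExt.map_gr m w hw), map_smul]
    | add x y hx hy => rw [map_add, map_add, hx, hy, map_add, map_add]
  rw [hL, X.alg.L0_of_mem h1, map_smul]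

/-- The normalization `ω_Ψ(u, z)1 = 0` at `n = -2`: it is what makes the section commute with
`L(-1)`, and hence `ω_Ψ` a field compatible with `L(-1)`. -/
lemma Lm1_section (hΓ : X.IsRealization Γ) (v : V) : X.alg.Lm1 (Γ v) = Γ (A.Lm1 v) := by
  have := hΓ.psi_one (-2) v
  rw [hΓ.map_one] at this
  exact this

lemma ret_Lm1 (e : X.E) : hΓ.ret (X.alg.Lm1 e) = B.Lm1 (hΓ.ret e) := by
  conv_lhs => rw [hΓ.eq_add e]
  rw [map_add, map_add, hΓ.Lm1_section, hΓ.ret_section, ← X.isExt.map_Lm1, hΓ.ret_alpha, zero_add]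

/-- The component `Ψ` of the vertex operators. -/
def psi : FieldMap A.tg A.tg B.tg where
  mode n := ((X.alg.mode n).compl₁₂ Γ Γ).compr₂ hΓ.ret
  weight n k l u x hu hx :=
    hΓ.ret_mem (X.alg.mode_weight n k l _ _ (hΓ.map_gr k u hu) (hΓ.map_gr l x hx))
  deriv_left n u x := by
    change hΓ.ret (X.alg.mode n (Γ (A.Lm1 u)) (Γ x)) =
      (-(n : ℂ)) • hΓ.ret (X.alg.mode (n - 1) (Γ u) (Γ x))
    rw [← hΓ.Lm1_section, ← map_smul]
    exact congrArg _ (X.alg.Lm1_derivative n (Γ u) (Γ x))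
  bracket n u x := by
    change B.Lm1 (hΓ.ret (X.alg.mode n (Γ u) (Γ x))) - hΓ.ret (X.alg.mode n (Γ u) (Γ (A.Lm1 x))) =
      (-(n : ℂ)) • hΓ.ret (X.alg.mode (n - 1) (Γ u) (Γ x))
    rw [← hΓ.Lm1_section, ← hΓ.ret_Lm1, ← map_smul, ← map_sub]
    exact congrArg _ (X.alg.Lm1_bracket n (Γ u) (Γ x))

lemma psi_mode (n : ℤ) (u v : V) : hΓ.psi.mode n u v = hΓ.ret (X.alg.mode n (Γ u) (Γ v)) := rfl

lemma mode_section (n : ℤ) (u v : V) :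
    X.alg.mode n (Γ u) (Γ v) = Γ (A.mode n u v) + X.α (hΓ.psi.mode n u v) := by
  conv_lhs => rw [hΓ.eq_add (X.alg.mode n (Γ u) (Γ v))]
  rw [X.isExt.hom.map_mode, hΓ.isSection, hΓ.isSection]
  rfl

lemma ret_dual {w' : Module.Dual ℂ W} (hw : w' ∈ B.gradedDual) :
    w'.comp hΓ.ret ∈ X.alg.gradedDual :=
  Grading.comp_mem_gradedDual hw hΓ.ret 0 fun n e he => by simpa using hΓ.ret_mem he

lemma expDual_ret {w' : Module.Dual ℂ W} (hw : w' ∈ B.gradedDual) (z : ℂ) :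
    X.alg.tg.expDual (w'.comp hΓ.ret) z = (B.tg.expDual w' z).comp hΓ.ret :=
  (B.tg.expDual_comp (H := X.alg.tg) hw hΓ.ret (fun _ _ he => hΓ.ret_mem he)
    (fun e => hΓ.ret_Lm1 e) z).symm

lemma e2_psi {w' : Module.Dual ℂ W} (hw : w' ∈ B.gradedDual) (u v : V) (z₁ z₂ : ℂ) :
    hΓ.psi.e2 w' u v z₁ z₂ = X.alg.field.e2 (w'.comp hΓ.ret) (Γ u) (Γ v) z₁ z₂ := by
  rw [FieldMap.e2, FieldMap.e2, hΓ.expDual_ret hw]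
  rfl

lemma isSymmetric_psi : hΓ.psi.IsSymmetric := fun w' hw u v z₁ z₂ h => by
  rw [hΓ.e2_psi hw, hΓ.e2_psi hw, X.alg.e2_symm (hΓ.ret_dual hw) _ _ h]

lemma ret_e2elt (u v : V) (z₁ z₂ : ℂ) (r : ℤ) :
    hΓ.ret (X.alg.field.e2elt (Γ u) (Γ v) z₁ z₂ r : X.E) = (hΓ.psi.e2elt u v z₁ z₂ r : W) := by
  rw [← sub_eq_zero, ← Module.forall_dual_apply_eq_zero_iff ℂ]
  intro φ
  have hc : (φ.comp hΓ.ret).comp (X.alg.proj r) = (φ.comp (B.proj r)).comp hΓ.ret := by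
    ext e
    simp only [LinearMap.comp_apply]
    congr 1
    induction e using Grading.induction (G := X.alg.toGrading) with
    | hom m e he =>
      by_cases h : m = r
      · subst h
        rw [X.alg.proj_of_mem he, B.proj_of_mem (hΓ.ret_mem he)]
      · rw [X.alg.proj_of_mem_ne he h, B.proj_of_mem_ne (hΓ.ret_mem he) h, map_zero]
    | add x y hx hy => rw [map_add, map_add, map_add, map_add, hx, hy]
  have h1 := X.alg.field.e2elt_apply (φ.comp hΓ.ret) r (Γ u) (Γ v) z₁ z₂
  rw [LinearMap.comp_apply] at h1
  rw [map_sub, h1, hΓ.psi.e2elt_apply φ r u v z₁ z₂,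
    hΓ.e2_psi (B.comp_proj_mem_gradedDual φ r), ← hc, sub_self]

lemma gamma_e2elt (hΓ : X.IsRealization Γ) (u v : V) (z₁ z₂ : ℂ) (r : ℤ) :
    X.γ (X.alg.field.e2elt (Γ u) (Γ v) z₁ z₂ r : X.E) = (A.field.e2elt u v z₁ z₂ r : V) := by
  rw [← sub_eq_zero, ← Module.forall_dual_apply_eq_zero_iff ℂ]
  intro φ
  have hγ := X.isExt.hom.map_gr
  have hL : ∀ e, X.γ (X.alg.Lm1 e) = A.Lm1 (X.γ e) := by
    intro e
    change X.γ (X.alg.mode (-2) e X.alg.one) = A.mode (-2) (X.γ e) A.one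
    rw [X.isExt.hom.map_mode, X.isExt.hom.map_one]
  have hc : (φ.comp X.γ).comp (X.alg.proj r) = (φ.comp (A.proj r)).comp X.γ := by
    ext e
    simp only [LinearMap.comp_apply]
    congr 1
    induction e using Grading.induction (G := X.alg.toGrading) with
    | hom m e he =>
      by_cases h : m = r
      · subst h
        rw [X.alg.proj_of_mem he, A.proj_of_mem (hγ _ _ he)]
      · rw [X.alg.proj_of_mem_ne he h, A.proj_of_mem_ne (hγ _ _ he) h, map_zero]
    | add x y hx hy => rw [map_add, map_add, map_add, map_add, hx, hy]
  have h1 := X.alg.field.e2elt_apply (φ.comp X.γ) r (Γ u) (Γ v) z₁ z₂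
  rw [LinearMap.comp_apply] at h1
  rw [map_sub, h1, A.field.e2elt_apply φ r u v z₁ z₂, hc, FieldMap.e2, FieldMap.e2,
    ← A.tg.expDual_comp (H := X.alg.tg) (A.comp_proj_mem_gradedDual φ r) X.γ hγ hL, sub_eq_zero]
  refine tsum_congr fun n => ?_
  have : X.γ (X.alg.mode n (Γ u) (Γ v)) = A.mode n u v := by
    rw [X.isExt.hom.map_mode, hΓ.isSection, hΓ.isSection]
  rw [← this]
  rfl

/-- A component `e` of `Y_E(Γv₂)Γv₃` splits as `Γ(γ e) + α(ret e)`. After applying `Y_E(Γv₁)` and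
retracting to `W`, the first part gives `ψ(v₁)` on a component of `Y_V(v₂)v₃`, and the second gives
`Y_W(v₁)` on a component of `ψ(v₂)v₃`: these are the two summands of `G₁`. Convergence is that of
the three-point function of `E`. -/
lemma hasSum_firstTerm {w' : Module.Dual ℂ W} (hw : w' ∈ B.gradedDual) (v₁ v₂ v₃ : V)
    {z : Fin 3 → ℂ} {ζ : ℂ} (hz : z ∈ firstRegion ζ) :
    HasSum (firstTerm hΓ.psi.cochain w' v₁ v₂ v₃ z ζ)
      (X.alg.adjoint.tri (w'.comp hΓ.ret) (Γ v₁) (Γ v₂) (Γ v₃) (z 0) (z 1) (z 2)) := by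
  obtain ⟨hinj, h1, h2, h3, h4⟩ := id hz
  have h12 : z 1 - ζ ≠ z 2 - ζ := by simpa using (injective_three.mp hinj).2.1
  have hr := hΓ.ret_dual hw
  have hE : B.tg.expDual w' ζ ∈ B.gradedDual := B.tg.expDual_mem hw ζ
  rw [← X.alg.adjoint.tri_expDual hr _ _ _ _ _ _ ζ]
  have h := X.alg.adjoint.hasSum_tri_e2elt (X.alg.tg.expDual_mem hr ζ) (Γ v₁) (Γ v₂) (Γ v₃) h2 h4 h12
  refine h.congr_fun fun r => ?_
  rw [firstTerm_cochain hΓ.psi hw v₁ v₂ v₃ hz r]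
  set e : X.E := (X.alg.field.e2elt (Γ v₂) (Γ v₃) (z 1 - ζ) (z 2 - ζ) r : X.E) with he
  have e1 : hΓ.ret e = _ := hΓ.ret_e2elt v₂ v₃ (z 1 - ζ) (z 2 - ζ) r
  have e2 : X.γ e = _ := hΓ.gamma_e2elt v₂ v₃ (z 1 - ζ) (z 2 - ζ) r
  change _ = X.alg.field.lau (X.alg.tg.expDual (w'.comp hΓ.ret) ζ) (Γ v₁) e (z 0 - ζ)
  rw [hΓ.eq_add e, e1, e2, X.alg.field.lau_add_right (X.alg.tg.expDual_mem hr ζ),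
    hΓ.expDual_ret hw, add_comm]
  congr 1
  refine tsum_congr fun n => ?_
  simp only [LinearMap.comp_apply]
  have h5 := X.isExt.map_mode n (Γ v₁) (hΓ.psi.e2elt v₂ v₃ (z 1 - ζ) (z 2 - ζ) r : W)
  rw [hΓ.isSection] at h5
  change _ = B.tg.expDual w' ζ (hΓ.ret (X.alg.mode n (Γ v₁) (X.α _))) * _
  rw [← h5, hΓ.ret_alpha]

lemma cochain_mem {M : Type*} [TopologicalSpace M] [ChartedSpace ℂ M]
    (F : CurveFoliation M) (𝒰 : Set (Set M)) : hΓ.psi.cochain ∈ exCocycles F 𝒰 B := by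
  refine cochain_mem_exCocycles F 𝒰 hΓ.isSymmetric_psi (fun w' v₁ v₂ v₃ z =>
    X.alg.adjoint.tri (w'.comp hΓ.ret) (Γ v₁) (Γ v₂) (Γ v₃) (z 0) (z 1) (z 2))
    (fun w' hw v₁ v₂ v₃ => (X.alg.adjoint.tri_ratOn (hΓ.ret_dual hw) _ _ _).mono
      discThree_dvd_discAll) (fun w' hw v₁ v₂ v₃ z ζ hz => hΓ.hasSum_firstTerm hw v₁ v₂ v₃ hz)
    (fun w' hw v₁ v₂ v₃ z hz => ?_)
  obtain ⟨h02, h12, h01⟩ := injective_three.mp hz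
  have hr := hΓ.ret_dual hw
  simp only [Matrix.cons_val]
  rw [X.alg.adjoint.tri_symm hr _ _ _ h12.symm h01 h02.symm,
    X.alg.tri_symm_right hr _ _ _ h01 h12.symm h02]

lemma isInvariant : X.IsInvariant Γ hΓ.psi.cochain := by
  refine ⟨fun n u v => hΓ.psi.mode n u v, hΓ.mode_section, fun v₁ v₂ w' hw z₁ z₂ => ?_⟩
  have hr := hΓ.ret_dual hw
  have key : ∀ (v₁ v₂ : V) (z₁ z₂ : ℂ), 0 < ‖z₂‖ → ‖z₂‖ < ‖z₁‖ → HasSum (fun p : ℤ × ℤ =>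
      w' (hΓ.psi.mode p.1 v₁ (A.mode p.2 v₂ A.one)) * z₁ ^ (-p.1 - 1) * z₂ ^ (-p.2 - 1))
      (hΓ.psi.e2 w' v₁ v₂ z₁ z₂) := by
    intro v₁ v₂ z₁ z₂ h1 h2
    rw [hΓ.e2_psi hw, ← X.alg.corr_one hr _ _ (norm_pos_iff.mp (h1.trans h2))
      (norm_pos_iff.mp h1) (by rintro rfl; exact h2.false)]
    refine (X.alg.adjoint.hasSum_corr hr (Γ v₁) (Γ v₂) X.alg.one h1 h2).congr_fun fun p => ?_
    rw [hΓ.psi_mode, ← hΓ.psi_one, hΓ.map_one]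
    rfl
  refine ⟨fun h1 h2 => ?_, fun h1 h2 => ?_, fun h1 h2 => ?_⟩
  · have h12 : z₁ ≠ z₂ := by rintro rfl; exact h2.false
    rw [hΓ.psi.cochain_matEl hw _ (by simpa using h12)]
    exact key v₁ v₂ z₁ z₂ h1 h2
  · have h12 : z₁ ≠ z₂ := by rintro rfl; exact h2.false
    rw [hΓ.psi.cochain_matEl hw _ (by simpa using h12)]
    change HasSum _ (hΓ.psi.e2 w' v₁ v₂ z₁ z₂)
    rw [hΓ.isSymmetric_psi w' hw v₁ v₂ z₁ z₂ h12]
    exact key v₂ v₁ z₂ z₁ h1 h2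
  · have h12 : z₁ ≠ z₂ := sub_ne_zero.mp (norm_pos_iff.mp h1)
    rw [hΓ.psi.cochain_matEl hw _ (by simpa using h12)]
    exact hΓ.psi.hasSum_e2 hw v₁ v₂ z₁ z₂

/-- The invariant is determined by the realization. -/
lemma eq_cochain {Φ : PreCochain B 2} (hrat : Φ.IsRational) (h : X.IsInvariant Γ Φ) :
    Φ = hΓ.psi.cochain := by
  obtain ⟨ψ, hψ, hsum⟩ := h
  have hψ' : ∀ n u v, ψ n u v = hΓ.psi.mode n u v := by
    intro n u v
    have := hψ n u v
    rw [hΓ.mode_section, add_right_inj] at this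
    exact (X.isExt.injective this).symm
  refine PreCochain.ext_matEl fun v w' hw z hz => ?_
  obtain ⟨f, hf, hfv⟩ := PreCochain.isRational_iff.mp hrat v w' hw
  obtain ⟨g, hg, hgv⟩ := PreCochain.isRational_iff.mp hΓ.psi.cochain_isRational v w' hw
  rw [hfv z hz, hgv z hz]
  -- Near `(3, 2)` one has `0 < |z₁ - z₂| < |z₂|`, where the third expansion determines both
  -- functions; rationality does the rest.
  refine RatOn.eq_of_eventually hf hg (z₀ := ![3, 2]) ?_ (eval_discAll_ne hz)
  have h0 : Filter.Tendsto (fun z : Fin 2 → ℂ => ‖z 0 - z 1‖) (𝓝 ![3, 2]) (𝓝 1) := by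
    have := ((continuous_apply (A := fun _ : Fin 2 => ℂ) 0).sub
      (continuous_apply (A := fun _ : Fin 2 => ℂ) 1)).norm.tendsto ![3, 2]
    norm_num at this
    exact this
  have h1 : Filter.Tendsto (fun z : Fin 2 → ℂ => ‖z 1‖) (𝓝 ![3, 2]) (𝓝 2) := by
    have := (continuous_apply (A := fun _ : Fin 2 => ℂ) 1).norm.tendsto ![3, 2]
    simpa using this
  filter_upwards [h0.eventually_const_lt one_pos, h0.eventually_lt h1 (by norm_num)] with z h1 h2
  have h12 : z 0 ≠ z 1 := sub_ne_zero.mp (norm_pos_iff.mp h1)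
  have hz := injective_two.mpr h12
  rw [← hfv z hz, ← hgv z hz, hΓ.psi.cochain_matEl hw _ h12]
  have h3 := (hsum (v 0) (v 1) w' hw (z 0) (z 1)).2.2 h1 h2
  have hv : ![v 0, v 1] = v := by funext i; fin_cases i <;> rfl
  have hz' : ![z 0, z 1] = z := by funext i; fin_cases i <;> rfl
  rw [hv, hz'] at h3
  refine h3.unique ((hΓ.psi.hasSum_e2 hw (v 0) (v 1) (z 0) (z 1)).congr_fun fun p => ?_)
  rw [hψ']

end IsRealization

end SquareZeroExtension

/-! ### The field of a two-cochain -/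

namespace Grading

variable {W : Type*} [AddCommGroup W] [Module ℂ W] (G : Grading W)
  {X : Type*} [AddCommGroup X] [Module ℂ X]

/-- The linear map that agrees with `f n` on the subspace of degree `n`. -/
def assemble (f : ℤ → W →ₗ[ℂ] X) : W →ₗ[ℂ] X :=
  DirectSum.toModule ℂ ℤ X (fun n => f n ∘ₗ (G.gr n).subtype) ∘ₗ
    (LinearEquiv.ofBijective (DirectSum.coeLinearMap G.gr) G.internal).symm.toLinearMap

lemma assemble_of_mem (f : ℤ → W →ₗ[ℂ] X) {n : ℤ} {x : W} (hx : x ∈ G.gr n) :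
    G.assemble f x = f n x := by
  simp [assemble, G.symm_of_mem hx]

lemma linearMap_ext {f g : W →ₗ[ℂ] X} (h : ∀ n, ∀ x ∈ G.gr n, f x = g x) (x : W) : f x = g x := by
  refine G.induction (p := fun x => f x = g x) h (fun x y hx hy => ?_) x
  simp only [map_add, hx, hy]

end Grading

lemma Function.update_vec_fst {α : Type*} (a b c : α) : Function.update ![a, b] 0 c = ![c, b] := by
  funext i; fin_cases i <;> rfl

lemma Function.update_vec_snd {α : Type*} (a b c : α) : Function.update ![a, b] 1 c = ![a, c] := by
  funext i; fin_cases i <;> rfl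

namespace PreCochain

variable {V : Type*} [AddCommGroup V] [Module ℂ V] {A : GRVertexAlgebra V}
  {W : Type*} [AddCommGroup W] [Module ℂ W] {B : GRModule A W} (Φ : PreCochain B 2)

lemma val_add_left (u v x : V) (z : Fin 2 → ℂ) :
    Φ.val ![u + v, x] z = Φ.val ![u, x] z + Φ.val ![v, x] z := by
  unfold val
  split_ifs with h
  · simpa only [Function.update_vec_fst] using!
      congrFun (Φ.map_update_add ![u, x] 0 u v) ⟨z, h⟩
  · simp

lemma val_smul_left (c : ℂ) (u x : V) (z : Fin 2 → ℂ) :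
    Φ.val ![c • u, x] z = c • Φ.val ![u, x] z := by
  unfold val
  split_ifs with h
  · simpa only [Function.update_vec_fst] using!
      congrFun (Φ.map_update_smul ![u, x] 0 c u) ⟨z, h⟩
  · simp

lemma val_add_right (x u v : V) (z : Fin 2 → ℂ) :
    Φ.val ![x, u + v] z = Φ.val ![x, u] z + Φ.val ![x, v] z := by
  unfold val
  split_ifs with h
  · simpa only [Function.update_vec_snd] using!
      congrFun (Φ.map_update_add ![x, u] 1 u v) ⟨z, h⟩
  · simp

lemma val_smul_right (c : ℂ) (x u : V) (z : Fin 2 → ℂ) :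
    Φ.val ![x, c • u] z = c • Φ.val ![x, u] z := by
  unfold val
  split_ifs with h
  · simpa only [Function.update_vec_snd] using!
      congrFun (Φ.map_update_smul ![x, u] 1 c u) ⟨z, h⟩
  · simp

/-- The bilinear map `(u, v) ↦ P_r Φ(u, 1; v, 0)`. -/
def valOne (r : ℤ) : V →ₗ[ℂ] V →ₗ[ℂ] W :=
  LinearMap.mk₂ ℂ (fun u v => (Φ.val ![u, v] ![1, 0] r : W))
    (fun u v x => by simp [Φ.val_add_left]) (fun c u x => by simp [Φ.val_smul_left])
    (fun x u v => by simp [Φ.val_add_right]) (fun c x u => by simp [Φ.val_smul_right])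

/-- The coefficient of `z^{-n-1}` in `Φ(u, z; v, 0)`. -/
def psiMode (n : ℤ) : V →ₗ[ℂ] V →ₗ[ℂ] W :=
  A.assemble fun k => (A.assemble fun l => (Φ.valOne (k + l - n - 1)).flip).flip

lemma psiMode_of_mem (n : ℤ) {k l : ℤ} {u v : V} (hu : u ∈ A.gr k) (hv : v ∈ A.gr l) :
    Φ.psiMode n u v = (Φ.val ![u, v] ![1, 0] (k + l - n - 1) : W) := by
  rw [psiMode, Grading.assemble_of_mem _ _ hu, LinearMap.flip_apply,
    Grading.assemble_of_mem _ _ hv]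
  rfl

variable {Φ}

lemma injective_pair {a b : ℂ} (h : a ≠ b) : Function.Injective ![a, b] :=
  injective_two.2 (by simpa using h)

/-- Conjugation fixes the second point `0` and moves `1` to `t`, so each component of `Φ(u, z; v,
0)` is a single power of `z`. The values at `z = 1` therefore contain all modes. -/
lemma LConjugation.val_scale (hΦ : Φ.LConjugation) {k l : ℤ} {u v : V} (hu : u ∈ A.gr k)
    (hv : v ∈ A.gr l) {t : ℂ} (ht : t ≠ 0) (r : ℤ) :
    (Φ.val ![u, v] ![t, 0] r : W) = t ^ (r - k - l) • (Φ.val ![u, v] ![1, 0] r : W) := by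
  refine B.ext_gradedDual fun w' hw => ?_
  have h := hΦ ![k, l] ![u, v] (by intro i; fin_cases i <;> simpa) (w'.comp (B.proj r))
    (B.comp_proj_mem_gradedDual w' r) ![1, 0] (injective_pair one_ne_zero) t ht
  have e1 : (fun i => t ^ (![k, l] : Fin 2 → ℤ) i • (![u, v] : Fin 2 → V) i) =
      ![t ^ k • u, t ^ l • v] := by
    funext i; fin_cases i <;> rfl
  have e2 : (fun i => t * (![1, 0] : Fin 2 → ℂ) i) = ![t, 0] := by
    funext i; fin_cases i <;> simp
  rw [e1, e2, matEl, B.pairing_comp_proj, val_smul_left, val_smul_right] at h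
  rw [finsum_eq_single _ r] at h
  · have hp := B.proj_of_mem (Φ.val ![u, v] ![1, 0] r).2
    simp only [LinearMap.comp_apply, map_smul, hp, smul_eq_mul, Pi.smul_apply,
      Submodule.coe_smul] at h
    rw [map_smul, smul_eq_mul, zpow_sub₀ ht, zpow_sub₀ ht]
    field_simp
    linear_combination -h
  · intro m hm
    simp [B.proj_of_mem_ne (Φ.val ![u, v] ![1, 0] m).2 hm]

lemma matEl_comp_proj (w' : Module.Dual ℂ W) (r : ℤ) (v : Fin 2 → V) (z : Fin 2 → ℂ) :
    Φ.matEl (w'.comp (B.proj r)) v z = w' (Φ.val v z r) := B.pairing_comp_proj _ _ _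

/-- The monomial `t^(r-k-l)` is differentiated at `t = 1` and compared with the `L(-1)`-derivative
property. -/
lemma LDerivative.val_L_left (hΦ : Φ.LDerivative) (hc : Φ.LConjugation) {k l : ℤ} {u v : V}
    (hu : u ∈ A.gr k) (hv : v ∈ A.gr l) (r : ℤ) :
    (Φ.val ![A.Lm1 u, v] ![1, 0] r : W) = ((r : ℂ) - k - l) • (Φ.val ![u, v] ![1, 0] r : W) := by
  refine B.ext_gradedDual fun w' hw => ?_
  have h := (hΦ ![u, v] _ (B.comp_proj_mem_gradedDual w' r) ![1, 0]
    (injective_pair one_ne_zero)).1 0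
  simp only [matEl_comp_proj] at h
  have h1 : HasDerivAt (fun t : ℂ => t ^ (r - k - l) * w' (Φ.val ![u, v] ![1, 0] r : W))
      (((r : ℂ) - k - l) * w' (Φ.val ![u, v] ![1, 0] r : W)) 1 := by
    have := (hasDerivAt_zpow (r - k - l) (1 : ℂ) (Or.inl one_ne_zero)).mul_const
      (w' (Φ.val ![u, v] ![1, 0] r : W))
    simpa using this
  have h2 : HasDerivAt (fun t : ℂ => t ^ (r - k - l) * w' (Φ.val ![u, v] ![1, 0] r : W))
      (w' (Φ.val ![A.Lm1 u, v] ![1, 0] r : W)) 1 := by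
    have h' : HasDerivAt (fun t => w' (Φ.val ![u, v] (Function.update ![1, 0] 0 t) r : W))
        (w' (Φ.val ![A.Lm1 u, v] ![1, 0] r : W)) 1 := by
      simpa only [Function.update_vec_fst, Matrix.cons_val_zero] using h
    refine h'.congr_of_eventuallyEq ?_
    filter_upwards [isOpen_ne.mem_nhds (one_ne_zero : (1 : ℂ) ≠ 0)] with t ht
    rw [Function.update_vec_fst, hc.val_scale hu hv ht, map_smul, smul_eq_mul]
  rw [map_smul, smul_eq_mul, h1.unique h2]

lemma LDerivative.L_val (hΦ : Φ.LDerivative) {w' : Module.Dual ℂ W} (hw : w' ∈ B.gradedDual)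
    (u v : V) {z : Fin 2 → ℂ} (hz : Function.Injective z) :
    Φ.matEl (w'.comp B.Lm1) ![u, v] z =
      Φ.matEl w' ![A.Lm1 u, v] z + Φ.matEl w' ![u, A.Lm1 v] z := by
  obtain ⟨h1, h2⟩ := hΦ ![u, v] w' hw z hz
  rw [Fin.sum_univ_two, (h1 0).deriv, (h1 1).deriv] at h2
  refine Eq.trans ?_ (h2.symm.trans ?_)
  · rfl
  · simp [Function.update_vec_fst, Function.update_vec_snd]

/-- The operators `Ψ` with `Ψ(u, z)v = Φ(u, z; v, 0)`. -/
def psi (hd : Φ.LDerivative) (hc : Φ.LConjugation) : FieldMap A.tg A.tg B.tg where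
  mode := Φ.psiMode
  weight n k l u x hu hx := by
    rw [Φ.psiMode_of_mem n hu hx]
    exact (Φ.val ![u, x] ![1, 0] (k + l - n - 1)).2
  deriv_left n u x := by
    refine A.linearMap_ext (f := (Φ.psiMode n).flip x ∘ₗ A.Lm1)
      (g := (-(n : ℂ)) • (Φ.psiMode (n - 1)).flip x) (fun k u hu => ?_) u
    refine A.linearMap_ext (f := Φ.psiMode n (A.Lm1 u))
      (g := (-(n : ℂ)) • Φ.psiMode (n - 1) u) (fun l x hx => ?_) x
    rw [LinearMap.smul_apply, Φ.psiMode_of_mem n (A.Lm1_mem k u hu) hx,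
      Φ.psiMode_of_mem (n - 1) hu hx, hd.val_L_left hc hu hx]
    have e : k + 1 + l - n - 1 = k + l - (n - 1) - 1 := by ring
    rw [e]
    congr 1
    push_cast
    ring
  bracket n u x := by
    refine A.linearMap_ext (f := (B.Lm1 ∘ₗ (Φ.psiMode n).flip x) - (Φ.psiMode n).flip (A.Lm1 x))
      (g := (-(n : ℂ)) • (Φ.psiMode (n - 1)).flip x) (fun k u hu => ?_) u
    refine A.linearMap_ext (f := (B.Lm1 ∘ₗ Φ.psiMode n u) - Φ.psiMode n u ∘ₗ A.Lm1)
      (g := (-(n : ℂ)) • Φ.psiMode (n - 1) u) (fun l x hx => ?_) x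
    simp only [LinearMap.sub_apply, LinearMap.comp_apply, LinearMap.smul_apply]
    rw [Φ.psiMode_of_mem n hu (A.Lm1_mem l x hx), Φ.psiMode_of_mem n hu hx,
      Φ.psiMode_of_mem (n - 1) hu hx]
    have e0 : k + (l + 1) - n - 1 = k + l - n - 1 + 1 := by ring
    have e1 : k + l - (n - 1) - 1 = k + l - n - 1 + 1 := by ring
    rw [e0, e1]
    have h := hd.val_L_left hc hu hx (k + l - n - 1 + 1)
    have e2 : ((k + l - n - 1 + 1 : ℤ) : ℂ) - k - l = -(n : ℂ) := by push_cast; ring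
    rw [e2] at h
    rw [← h, sub_eq_iff_eq_add]
    set r := k + l - n - 1
    refine B.ext_gradedDual fun w' hw => ?_
    have h3 := hd.L_val (B.comp_proj_mem_gradedDual w' (r + 1)) u x
      (injective_pair (one_ne_zero : (1 : ℂ) ≠ 0))
    rw [matEl_comp_proj, matEl_comp_proj] at h3
    rw [map_add, ← h3, matEl, Grading.pairing, finsum_eq_single _ r]
    · simp [B.proj_of_mem (B.Lm1_weight r _ (Φ.val ![u, x] ![1, 0] r).2)]
    · intro m hm
      have hne : m + 1 ≠ r + 1 := fun h => hm (by lia)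
      simp [B.proj_of_mem_ne (B.Lm1_weight m _ (Φ.val ![u, x] ![1, 0] m).2) hne]

lemma psi_mode (hd : Φ.LDerivative) (hc : Φ.LConjugation) (n : ℤ) :
    (psi hd hc).mode n = Φ.psiMode n := rfl

lemma matEl_eq_lau (hd : Φ.LDerivative) (hc : Φ.LConjugation) {w' : Module.Dual ℂ W}
    (hw : w' ∈ B.gradedDual) (u v : V) {z : ℂ} (hz : z ≠ 0) :
    Φ.matEl w' ![u, v] ![z, 0] = (psi hd hc).lau w' u v z := by
  refine A.induction (p := fun u => Φ.matEl w' ![u, v] ![z, 0] = (psi hd hc).lau w' u v z)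
    (fun k u hu => ?_) (fun u u' h h' => ?_) u
  swap
  · rw [matEl, val_add_left, B.pairing_add hw, FieldMap.lau_add_left _ hw, ← h, ← h']; rfl
  refine A.induction (p := fun v => Φ.matEl w' ![u, v] ![z, 0] = (psi hd hc).lau w' u v z)
    (fun l v hv => ?_) (fun v v' h h' => ?_) v
  swap
  · rw [matEl, val_add_right, B.pairing_add hw, FieldMap.lau_add_right _ hw, ← h, ← h']; rfl
  refine (B.hasSum_pairing hw (Φ.val ![u, v] ![z, 0])).unique ?_
  have h := (psi hd hc).hasSum_lau hw u v z
  refine ((Equiv.subLeft (k + l - 1)).hasSum_iff.2 h).of_eq (fun r => ?_) rfl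
  simp only [Function.comp_apply, Equiv.subLeft_apply, psi_mode]
  rw [Φ.psiMode_of_mem _ hu hv, hc.val_scale hu hv hz, map_smul, smul_eq_mul, mul_comm]
  have e1 : k + l - (k + l - 1 - r) - 1 = r := by ring
  have e2 : -(k + l - 1 - r) - 1 = r - k - l := by ring
  rw [e1, e2]

/-- The derivative along the diagonal direction is the sum of both partial derivatives, which the
second half of the derivative property identifies with `L_W(-1)`. Rationality supplies the total
differentiability needed for the chain rule. -/
lemma hasDerivAt_matEl_diag (hr : Φ.IsRational) (hd : Φ.LDerivative) {w' : Module.Dual ℂ W}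
    (hw : w' ∈ B.gradedDual) (u v : V) {z : ℂ} (hz : z ≠ 0) (s : ℂ) :
    HasDerivAt (fun s => Φ.matEl w' ![u, v] ![z + s, s])
      (Φ.matEl (w'.comp B.Lm1) ![u, v] ![z + s, s]) s := by
  have hne : ∀ s : ℂ, z + s ≠ s := fun s => by simpa using hz
  obtain ⟨f, hf, hf'⟩ := isRational_iff.1 hr ![u, v] w' hw
  have hi := injective_pair (hne s)
  have hD := (hf.differentiableAt (eval_discAll_ne hi)).hasFDerivAt
  have hp : ∀ i : Fin 2, fderiv ℂ f ![z + s, s] (Pi.single i 1) =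
      Φ.matEl w' (Function.update ![u, v] i (A.Lm1 (![u, v] i))) ![z + s, s] := fun i => by
    have h1 := (hd ![u, v] w' hw _ hi).1 i
    have h2 := hD
    rw [← Function.update_eq_self i ![z + s, s]] at h2
    have h3 := h2.comp_hasDerivAt _ (hasDerivAt_update ![z + s, s] i (![z + s, s] i))
    rw [Function.update_eq_self] at h3
    refine h3.unique (h1.congr_of_eventuallyEq ?_)
    have hc : ContinuousAt (fun t => Function.update ![z + s, s] i t) (![z + s, s] i) :=
      (hasDerivAt_update ![z + s, s] i (![z + s, s] i)).continuousAt
    have ho : {x : Fin 2 → ℂ | x 0 ≠ x 1} ∈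
        𝓝 (Function.update ![z + s, s] i (![z + s, s] i)) := by
      rw [Function.update_eq_self]
      exact (isOpen_ne_fun (continuous_apply 0) (continuous_apply 1)).mem_nhds
        (injective_two.1 hi)
    filter_upwards [hc ho] with t ht
    exact (hf' _ (injective_two.2 ht)).symm
  have hl : HasDerivAt (fun s : ℂ => ![z + s, s]) (Pi.single 0 1 + Pi.single 1 1 : Fin 2 → ℂ) s := by
    rw [hasDerivAt_pi]
    intro i
    fin_cases i
    · simpa using (hasDerivAt_id s).const_add z
    · simpa using hasDerivAt_id' s
  have := hD.comp_hasDerivAt s hl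
  rw [map_add, hp, hp] at this
  rw [hd.L_val hw u v hi]
  have e : (fun s => Φ.matEl w' ![u, v] ![z + s, s]) = f ∘ fun s => ![z + s, s] := by
    funext t
    exact hf' _ (injective_pair (hne t))
  rw [e]
  simpa [Function.update_vec_fst, Function.update_vec_snd] using this

/-- A rational cochain is determined by its modes. -/
lemma eq_cochain_psi (hr : Φ.IsRational) (hd : Φ.LDerivative) (hc : Φ.LConjugation) :
    Φ = (psi hd hc).cochain := by
  refine ext_matEl fun v w' hw z hz => ?_
  have hz' := injective_two.1 hz
  rw [FieldMap.cochain_matEl _ hw _ hz']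
  have ev : v = ![v 0, v 1] := by funext i; fin_cases i <;> rfl
  have ez : z = ![z 0 - z 1 + z 1, z 1] := by funext i; fin_cases i <;> simp
  have h0 : z 0 - z 1 ≠ 0 := sub_ne_zero.2 hz'
  -- The two points `(z₁ - z₂ + s, s)` are moved from `s = 0`, where the cochain is given by its
  -- modes, to `s = z₂`.
  have hT := hasSum_taylor (h := fun k s =>
    Φ.matEl (w'.comp (B.Lm1 ^ k)) ![v 0, v 1] ![z 0 - z 1 + s, s]) (R := ‖z 1‖ + 1)
    (fun k s _ => by
      have := hasDerivAt_matEl_diag hr hd (B.tg.comp_pow_mem hw k) (v 0) (v 1) h0 s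
      rw [LinearMap.comp_assoc] at this
      exact this) (s := z 1) (by linarith)
  simp only [pow_zero, ← ez, ← ev] at hT
  refine hT.unique ?_
  obtain ⟨K, hK⟩ := B.tg.exists_comp_pow_eq_zero hw
  rw [FieldMap.e2_eq_sum _ hw hK]
  have hL : ∀ k, Φ.matEl (w'.comp (B.Lm1 ^ k)) v ![z 0 - z 1 + 0, 0] =
      (psi hd hc).lau (w'.comp (B.Lm1 ^ k)) (v 0) (v 1) (z 0 - z 1) := fun k => by
    rw [add_zero, ← matEl_eq_lau hd hc (B.tg.comp_pow_mem hw k) _ _ h0, ← ev]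
  have := hasSum_sum_of_ne_finset_zero (L := .unconditional ℕ) (s := Finset.range K) (f := fun k : ℕ =>
    z 1 ^ k / (k.factorial : ℂ) * Φ.matEl (w'.comp (B.Lm1 ^ k)) v ![z 0 - z 1 + 0, 0])
    (fun k hk => by
      have : w'.comp (B.Lm1 ^ k) = 0 := hK k (by simpa using hk)
      rw [this]
      simp [matEl, Grading.pairing])
  simpa only [hL] using this

lemma ShuffleSymmetric.isSymmetric (hd : Φ.LDerivative) (hc : Φ.LConjugation)
    (hr : Φ.IsRational) (hs : Φ.ShuffleSymmetric) : (psi hd hc).IsSymmetric := by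
  intro w' hw u v z₁ z₂ h
  have h1 := shuffleSymmetric_two.1 hs ![u, v] ![z₁, z₂] (injective_pair h)
  have h2 := eq_cochain_psi hr hd hc
  rw [h2, FieldMap.cochain_val _ _ (by simpa using h),
    FieldMap.cochain_val _ _ (by simpa using h.symm)] at h1
  have h3 := congrArg (B.pairing w') h1
  exact ((psi hd hc).pairing_e2elt hw u v z₁ z₂).symm.trans
    (h3.trans ((psi hd hc).pairing_e2elt hw v u z₂ z₁))

end PreCochain

/-! ### Three-point functions of a cocycle -/

section ThreePoints

open MvPolynomial

lemma ratOn_discThree (P : MvPolynomial (Fin 3) ℂ) (N : ℕ) : RatOn discThree fun z =>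
    eval z P / ∏ p ∈ (Finset.univ : Finset (Fin 3)).offDiag, (z p.1 - z p.2) ^ N := by
  refine ⟨C ((-1) ^ N) * P, 2 * N, fun z hz => ?_⟩
  obtain ⟨h1, h2, h3⟩ := (eval_discThree_ne z).1 hz
  have hu : (Finset.univ : Finset (Fin 3)).offDiag =
      {(0, 1), (0, 2), (1, 0), (1, 2), (2, 0), (2, 1)} := by decide
  -- Each difference occurs twice among ordered pairs, with opposite signs; for three points this
  -- gives three sign changes.
  have hp : ∏ p ∈ (Finset.univ : Finset (Fin 3)).offDiag, (z p.1 - z p.2) ^ N =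
      (-1) ^ N * eval z discThree ^ (2 * N) := by
    rw [hu]
    simp only [Finset.prod_pow]
    rw [pow_mul, ← mul_pow]
    congr 1
    simp [discThree]
    ring
  have hd := pow_ne_zero (2 * N) hz
  have h4 : ((-1 : ℂ) ^ N) ≠ 0 := pow_ne_zero _ (by norm_num)
  have h5 : ((-1 : ℂ) ^ N) * (-1) ^ N = 1 := by rw [← mul_pow]; simp
  beta_reduce
  rw [hp, map_mul, eval_C, div_eq_div_iff (mul_ne_zero h4 hd) hd]
  linear_combination (-eval z P * eval z discThree ^ (2 * N)) * h5

lemma ratOn_rotate {f : ℂ → ℂ → ℂ → ℂ} (hf : RatOn discThree fun z => f (z 0) (z 1) (z 2)) :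
    RatOn discThree fun z => f (z 2) (z 0) (z 1) := by
  have h := hf.comp (κ := Fin 3) ![X 2, X 0, X 1]
  refine (h.mono ⟨1, ?_⟩).congr fun z _ => by simp
  simp [discThree]
  ring

lemma ratOn_swap_right {f : ℂ → ℂ → ℂ → ℂ} (hf : RatOn discThree fun z => f (z 0) (z 1) (z 2)) :
    RatOn discThree fun z => f (z 0) (z 2) (z 1) := by
  have h := hf.comp (κ := Fin 3) ![X 0, X 2, X 1]
  refine (h.mono ⟨-1, ?_⟩).congr fun z _ => by simp
  simp [discThree]
  ring

end ThreePoints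

lemma hasSum_laurent_of_nat {A : ℤ → ℂ} {b : ℕ} (hA : ∀ n : ℤ, b ≤ n → A n = 0) {y s : ℂ}
    (hy : y ≠ 0) (h : HasSum (fun j : ℕ => A (b - 1 - j) * y ^ j) (y ^ b * s)) :
    HasSum (fun n : ℤ => A n * y ^ (-n - 1)) s := by
  have hinj : Function.Injective fun j : ℕ => (b : ℤ) - 1 - j := fun i j hij => by
    simpa using hij
  refine (hinj.hasSum_iff fun n hn => ?_).1 ?_
  · rw [hA n, zero_mul]
    by_contra hlt
    exact hn ⟨(b - 1 - n).toNat, by simp only; lia⟩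
  · refine (h.mul_left ((y ^ b)⁻¹)).of_eq (fun j => ?_) ?_
    · simp only [Function.comp_apply]
      rw [show -((b : ℤ) - 1 - j) - 1 = -(b : ℤ) + j by ring, zpow_add₀ hy, zpow_neg,
        zpow_natCast, zpow_natCast]
      ring
    · field_simp

namespace FieldMap

variable {V : Type*} [AddCommGroup V] [Module ℂ V] {A : GRVertexAlgebra V}
  {W : Type*} [AddCommGroup W] [Module ℂ W] {B : GRModule A W}

/-- `T` is a family of rational functions, symmetric in the pairs `(v_i, z_i)`, that extend the
sums `Y_W(v₁, z₁)Ψ(v₂; v₃) + Ψ(v₁; Y_V(v₂)v₃)`. -/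
structure HasTriple (ψ : FieldMap A.tg A.tg B.tg)
    (T : Module.Dual ℂ W → V → V → V → ℂ → ℂ → ℂ → ℂ) : Prop where
  symm : ψ.IsSymmetric
  ratOn : ∀ w' ∈ B.gradedDual, ∀ v₁ v₂ v₃,
    RatOn discThree fun z => T w' v₁ v₂ v₃ (z 0) (z 1) (z 2)
  hasSum : ∀ w' ∈ B.gradedDual, ∀ v₁ v₂ v₃ z ζ, z ∈ firstRegion ζ →
    HasSum (firstTerm ψ.cochain w' v₁ v₂ v₃ z ζ) (T w' v₁ v₂ v₃ (z 0) (z 1) (z 2))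
  rotate : ∀ w' ∈ B.gradedDual, ∀ v₁ v₂ v₃ z₁ z₂ z₃, z₁ ≠ z₃ → z₂ ≠ z₃ → z₁ ≠ z₂ →
    T w' v₃ v₁ v₂ z₃ z₁ z₂ = T w' v₁ v₂ v₃ z₁ z₂ z₃
  swap : ∀ w' ∈ B.gradedDual, ∀ v₁ v₂ v₃ z₁ z₂ z₃, z₁ ≠ z₃ → z₂ ≠ z₃ → z₁ ≠ z₂ →
    T w' v₁ v₃ v₂ z₁ z₃ z₂ = T w' v₁ v₂ v₃ z₁ z₂ z₃

lemma vec_three {α : Type*} (z : Fin 3 → α) : ![z 0, z 1, z 2] = z := by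
  funext i; fin_cases i <;> rfl

/-- `T` is the rational extension of `G₁`. Rotation invariance is the equation `δ²_ex Φ = 0`,
because `G₂` is a rotated `G₁`; exchange of the last two arguments leaves every term of `G₁`
unchanged by symmetry of `ψ` and skew-symmetry of `V`. Nonemptiness of `U` makes the coordinate
restrictions void. -/
lemma exists_hasTriple {M : Type*} [TopologicalSpace M] [ChartedSpace ℂ M]
    [IsManifold 𝓘(ℂ, ℂ) ω M] {F : CurveFoliation M} {𝒰 : Set (Set M)} {U : Set M} (hU : U ∈ 𝒰)
    (hne : U.Nonempty) {ψ : FieldMap A.tg A.tg B.tg} (hψ : ψ.IsSymmetric)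
    (h : ψ.cochain ∈ exCocycles F 𝒰 B) : ∃ T, ψ.HasTriple T := by
  have huniv : ∀ z : Fin 3 → ℂ, ∀ i, z i ∈ coordValues U := fun z i => by
    rw [coordValues_eq_univ hne]; trivial
  -- Membership of `w'` in the graded dual is placed inside the existential so that one function can
  -- be chosen for all functionals, with junk value `0` elsewhere.
  have h1 : ∀ w' v₁ v₂ v₃, ∃ f : (Fin 3 → ℂ) → ℂ, w' ∈ B.gradedDual → RatOn discThree f ∧
      ∀ z ζ, z ∈ firstRegion ζ → HasSum (firstTerm ψ.cochain w' v₁ v₂ v₃ z ζ) (f z) := by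
    intro w' v₁ v₂ v₃
    by_cases hw : w' ∈ B.gradedDual
    · obtain ⟨P, N, hP⟩ := (h.1.2 U hU v₁ v₂ v₃ w' hw).1
      exact ⟨_, fun _ => ⟨ratOn_discThree P N, fun z ζ hz => hP z (huniv z) ζ hz⟩⟩
    · exact ⟨0, fun h => absurd h hw⟩
  choose f hf using h1
  have h2 : ∀ w' ∈ B.gradedDual, ∀ v₁ v₂ v₃ z, Function.Injective z →
      f w' v₃ v₁ v₂ ![z 2, z 0, z 1] = f w' v₁ v₂ v₃ z := by
    intro w' hw v₁ v₂ v₃ z hz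
    obtain ⟨P, N, hP⟩ := (h.1.2 U hU v₁ v₂ v₃ w' hw).2
    have hg := ratOn_discThree P N
    have hd : ∀ {z : Fin 3 → ℂ}, Function.Injective z → MvPolynomial.eval z discThree ≠ 0 :=
      fun hz => (eval_discThree_ne _).2 (injective_three.1 hz)
    have hc := h.2 v₁ v₂ v₃ w' hw z hz
    rw [deltaEx, (hf w' v₁ v₂ v₃ hw).1.ratExt_eq firstRegion_mem_nhds
      (fun x hx => ⟨hd hx.1, ((hf w' v₁ v₂ v₃ hw).2 x 0 hx).tsum_eq⟩) (hd hz),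
      hg.ratExt_eq secondRegion_mem_nhds
      (fun x hx => ⟨hd hx.1, (hP x (huniv x) 0 hx).tsum_eq⟩) (hd hz), sub_eq_zero] at hc
    rw [hc]
    have hr := ratOn_rotate (f := fun a b c => f w' v₃ v₁ v₂ ![a, b, c])
      ((hf w' v₃ v₁ v₂ hw).1.congr fun z _ => by rw [vec_three])
    refine hr.eq_of_eventually hg (z₀ := ![2, 1, 3]) ?_ (hd hz)
    -- On the second region both sides are the sum of the same series, once `G₂` is read as a
    -- rotated `G₁`.
    filter_upwards [secondRegion_mem_nhds] with x hx
    refine ((hf w' v₃ v₁ v₂ hw).2 _ 0 (mem_firstRegion_of_second hx)).unique ?_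
    exact (hP x (huniv x) 0 hx).of_eq (fun r => (secondTerm_eq ψ hψ hw v₁ v₂ v₃ hx r).symm) rfl
  refine ⟨fun w' v₁ v₂ v₃ a b c => f w' v₁ v₂ v₃ ![a, b, c], hψ, fun w' hw v₁ v₂ v₃ => ?_,
    fun w' hw v₁ v₂ v₃ z ζ hz => ?_, fun w' hw v₁ v₂ v₃ z₁ z₂ z₃ h₁ h₂ h₃ => ?_,
    fun w' hw v₁ v₂ v₃ z₁ z₂ z₃ h₁ h₂ h₃ => ?_⟩
  · exact (hf w' v₁ v₂ v₃ hw).1.congr fun z _ => by rw [vec_three]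
  · simp only [vec_three]
    exact (hf w' v₁ v₂ v₃ hw).2 z ζ hz
  · exact h2 w' hw v₁ v₂ v₃ ![z₁, z₂, z₃] (injective_three.2 ⟨h₁, h₂, h₃⟩)
  · have hr := ratOn_swap_right (f := fun a b c => f w' v₁ v₃ v₂ ![a, b, c])
      ((hf w' v₁ v₃ v₂ hw).1.congr fun z _ => by rw [vec_three])
    refine hr.eq_of_eventually (hf w' v₁ v₂ v₃ hw).1 (z₀ := ![3, 2, 1]) ?_ (z := ![z₁, z₂, z₃])
      ((eval_discThree_ne _).2 ⟨h₁, h₂, h₃⟩)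
    filter_upwards [firstRegion_mem_nhds] with x hx
    obtain ⟨hi, a1, a2, a3, a4⟩ := hx
    obtain ⟨b1, b2, b3⟩ := injective_three.1 hi
    have hx' : ![x 0, x 2, x 1] ∈ firstRegion 0 :=
      ⟨injective_three.2 ⟨b3, b2.symm, b1⟩, a3, a4, a1, a2⟩
    have hx : x ∈ firstRegion 0 := ⟨hi, a1, a2, a3, a4⟩
    refine ((hf w' v₁ v₃ v₂ hw).2 _ 0 hx').unique
      (((hf w' v₁ v₂ v₃ hw).2 _ 0 hx).of_eq (fun r => ?_) rfl)
    have hne' : x 2 - 0 ≠ x 1 - 0 := by simpa using b2.symm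
    rw [firstTerm_cochain ψ hw _ _ _ hx', firstTerm_cochain ψ hw _ _ _ hx]
    change B.field.e2 w' v₁ (ψ.e2elt v₃ v₂ (x 2 - 0) (x 1 - 0) r : W) (x 0) 0 +
      ψ.e2 w' v₁ (A.field.e2elt v₃ v₂ (x 2 - 0) (x 1 - 0) r : V) (x 0) 0 = _
    rw [hψ.e2elt v₃ v₂ hne', A.e2elt_symm v₃ v₂ hne']

variable {ψ : FieldMap A.tg A.tg B.tg} {T : Module.Dual ℂ W → V → V → V → ℂ → ℂ → ℂ → ℂ}

lemma lau_e2elt_mul {X : Type*} [AddCommGroup X] [Module ℂ X] {G : TGrading X}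
    {Y : FieldMap A.tg A.tg G} {Z : FieldMap A.tg G B.tg}
    {w' : Module.Dual ℂ W} (hw : w' ∈ B.gradedDual) (v₁ : V) {v₂ v₃ : V} {k l : ℤ}
    (h₂ : v₂ ∈ A.gr k) (h₃ : v₃ ∈ A.gr l) {b : ℕ} (hb : ∀ n : ℤ, b ≤ n → Y.mode n v₂ v₃ = 0)
    {x y : ℂ} (hxy : x ≠ y) (z : ℂ) (i : ℕ) :
    (x - y) ^ b * Z.lau w' v₁ (Y.e2elt v₂ v₃ x y (k + l - b + i) : X) z =
      ∑ p ∈ Finset.HasAntidiagonal.antidiagonal i, (y ^ p.1 / (p.1.factorial : ℂ) *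
        (x - y) ^ p.2) * Z.lau w' v₁ ((G.L ^ p.1) (Y.mode (b - 1 - p.2) v₂ v₃)) z := by
  rw [← Z.lau_smul_right hw, Y.e2elt_hom h₂ h₃ hb hxy i, Z.lau_sum_right hw]
  exact Finset.sum_congr rfl fun p _ => Z.lau_smul_right hw _ _ _ _

/-- With `z₂ = ζ + x` and `z₃ = ζ + y`, the factor `(x - y)^b` clears the pole at `z₂ = z₃`; the
other poles stay outside the bidisc of radius `‖z₁ - ζ‖`. -/
lemma HasTriple.exists_hasDPS (hT : ψ.HasTriple T) {w' : Module.Dual ℂ W} (hw : w' ∈ B.gradedDual)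
    (v₁ v₂ v₃ : V) : ∃ N : ℕ, ∀ b ≥ N, ∀ z₁ ζ : ℂ, ∃ K : ℂ × ℂ → ℂ,
      HasDPS {p | ‖p.1‖ < ‖z₁ - ζ‖ ∧ ‖p.2‖ < ‖z₁ - ζ‖} K ∧
      ∀ x y, ‖x‖ < ‖z₁ - ζ‖ → ‖y‖ < ‖z₁ - ζ‖ → x ≠ y →
        K (x, y) = (x - y) ^ b * T w' v₁ v₂ v₃ z₁ (ζ + x) (ζ + y) := by
  obtain ⟨P, N, hP⟩ := hT.ratOn w' hw v₁ v₂ v₃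
  refine ⟨N, fun b hb z₁ ζ => ?_⟩
  rcases eq_or_ne (z₁ - ζ) 0 with h0 | h0
  · refine ⟨0, ⟨0, fun p hp => ?_⟩, fun x y hx => ?_⟩
    · rw [h0, norm_zero] at hp
      exact absurd hp.1 (norm_nonneg _).not_gt
    · rw [h0, norm_zero] at hx
      exact absurd hx (norm_nonneg _).not_gt
  refine ⟨fun p => (p.1 - p.2) ^ (b - N) * (MvPolynomial.eval ![z₁, ζ + p.1, ζ + p.2] P *
    ((z₁ - ζ - (1 * p.1 + 0 * p.2))⁻¹ ^ N * (z₁ - ζ - (0 * p.1 + 1 * p.2))⁻¹ ^ N)), ?_,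
    fun x y hx hy hxy => ?_⟩
  · refine ((HasDPS.fst.sub HasDPS.snd).pow _).mul (HasDPS.mul ?_
      (((HasDPS.inv_sub 1 0 h0 fun p hp => ?_).pow N).mul
        ((HasDPS.inv_sub 0 1 h0 fun p hp => ?_).pow N)))
    · exact HasDPS.eval (φ := fun i p => (![z₁, ζ + p.1, ζ + p.2] : Fin 3 → ℂ) i) (fun i => by
        fin_cases i
        · exact HasDPS.const z₁
        · exact (HasDPS.const ζ).add HasDPS.fst
        · exact (HasDPS.const ζ).add HasDPS.snd) P
    · simpa using hp.1
    · simpa using hp.2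
  · have h1 : z₁ - ζ ≠ x := by rintro h; rw [h] at hx; exact hx.false
    have h2 : z₁ - ζ ≠ y := by rintro h; rw [h] at hy; exact hy.false
    have hne : MvPolynomial.eval ![z₁, ζ + x, ζ + y] discThree ≠ 0 :=
      (eval_discThree_ne _).2 ⟨fun h => h2 (sub_eq_iff_eq_add'.2 h), by simpa using hxy,
        fun h => h1 (sub_eq_iff_eq_add'.2 h)⟩
    have hv := hP _ hne
    have hv' : T w' v₁ v₂ v₃ z₁ (ζ + x) (ζ + y) = _ := hv
    have e : MvPolynomial.eval ![z₁, ζ + x, ζ + y] discThree =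
        (z₁ - ζ - y) * (x - y) * (z₁ - ζ - x) := by
      simp [discThree]
      ring
    have h1' := sub_ne_zero.2 h1
    have h2' := sub_ne_zero.2 h2
    have h3' := sub_ne_zero.2 hxy
    rw [hv', e]
    obtain ⟨c, rfl⟩ := Nat.exists_eq_add_of_le hb
    simp only [one_mul, zero_mul, add_zero, zero_add, Nat.add_sub_cancel_left, inv_pow, mul_pow,
      pow_add]
    field_simp

/-- The expansion of the rational function `T(v₁, z₁; v₂, z₂; v₃, ζ)` around `z₂ = ζ`. -/
lemma HasTriple.hasSum_mode (hT : ψ.HasTriple T) {w' : Module.Dual ℂ W} (hw : w' ∈ B.gradedDual)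
    (v₁ : V) {v₂ v₃ : V} {k l : ℤ} (h₂ : v₂ ∈ A.gr k) (h₃ : v₃ ∈ A.gr l) {z₁ z₂ ζ : ℂ}
    (hz : z₂ ≠ ζ) (h : ‖z₂ - ζ‖ < ‖z₁ - ζ‖) :
    HasSum (fun n : ℤ => (B.field.e2 w' v₁ (ψ.mode n v₂ v₃) z₁ ζ +
      ψ.e2 w' v₁ (A.mode n v₂ v₃) z₁ ζ) * (z₂ - ζ) ^ (-n - 1)) (T w' v₁ v₂ v₃ z₁ z₂ ζ) := by
  obtain ⟨N, hN⟩ := hT.exists_hasDPS hw v₁ v₂ v₃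
  obtain ⟨b₁, hb₁⟩ := ψ.exists_trunc v₂ v₃
  obtain ⟨b₂, hb₂⟩ := A.field.exists_trunc v₂ v₃
  set b := max N (max b₁ b₂) with hbdef
  have hψ : ∀ n : ℤ, b ≤ n → ψ.mode n v₂ v₃ = 0 := fun n hn => hb₁ n (by lia)
  have hA : ∀ n : ℤ, b ≤ n → A.mode n v₂ v₃ = 0 := fun n hn => hb₂ n (by lia)
  obtain ⟨K, hK, hKT⟩ := hN b (le_max_left _ _) z₁ ζ
  have hw'' := B.tg.expDual_mem hw ζ
  set w'' := B.tg.expDual w' ζ with hw''def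
  -- `p i` is the part of degree `i` of `(x - y)^b G₁`. The defining sum is available only when both
  -- `x` and `y` are nonzero, whereas the claim concerns `y = 0`, where only the term `(0, i)`, that
  -- is the mode `b - 1 - i`, survives.
  set p : ℕ → ℂ × ℂ → ℂ := fun i q => ∑ j ∈ Finset.HasAntidiagonal.antidiagonal i,
    (q.2 ^ j.1 / (j.1.factorial : ℂ) * (q.1 - q.2) ^ j.2) *
      (B.field.lau w'' v₁ ((B.Lm1 ^ j.1) (ψ.mode (b - 1 - j.2) v₂ v₃)) (z₁ - ζ) +
        ψ.lau w'' v₁ ((A.Lm1 ^ j.1) (A.mode (b - 1 - j.2) v₂ v₃)) (z₁ - ζ)) with hp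
  have haxis := hasSum_on_axis hK (p := p) (fun i t x y => ?_) (fun i => ?_) ?_
    (x := z₂ - ζ) (norm_pos_iff.2 (sub_ne_zero.2 hz)) h
  · rw [hKT _ _ h (by simpa using (norm_nonneg _).trans_lt h) (sub_ne_zero.2 hz)] at haxis
    simp only [sub_zero, add_zero, add_sub_cancel] at haxis
    refine hasSum_laurent_of_nat (b := b) (fun n hn => ?_) (sub_ne_zero.2 hz)
      (haxis.of_eq (fun i => ?_) rfl)
    · rw [hψ n hn, hA n hn]
      simp [FieldMap.e2, FieldMap.lau]
    · simp only [hp]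
      rw [Finset.sum_eq_single_of_mem (0, i) (by simp)]
      · simp only [pow_zero, Nat.factorial_zero, Nat.cast_one, div_one, sub_zero, one_mul,
          Module.End.one_apply]
        rw [mul_comm]
        rfl
      · intro j hj hne
        have : j.1 ≠ 0 := fun h0 => hne (Prod.ext h0 (by
          have := Finset.HasAntidiagonal.mem_antidiagonal.1 hj
          simp only; lia))
        simp [zero_pow this]
  · simp only [hp, Finset.mul_sum]
    refine Finset.sum_congr rfl fun j hj => ?_
    rw [← Finset.HasAntidiagonal.mem_antidiagonal.1 hj, ← mul_sub, mul_pow, mul_pow, pow_add]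
    ring
  · simp only [hp]
    fun_prop
  · intro x y hx hxρ hy hyρ hxy
    rw [hKT x y hxρ hyρ hxy]
    have hmem : ![z₁, ζ + x, ζ + y] ∈ firstRegion ζ := by
      refine ⟨injective_three.2 ⟨?_, by simpa using hxy, ?_⟩, ?_⟩
      · rintro h; simp only [Matrix.cons_val_zero, Matrix.cons_val] at h
        rw [h, add_sub_cancel_left] at hyρ; exact hyρ.false
      · rintro h; simp only [Matrix.cons_val_zero, Matrix.cons_val_one] at h
        rw [h, add_sub_cancel_left] at hxρ; exact hxρ.false
      · simpa using ⟨norm_pos_iff.1 hx, hxρ, norm_pos_iff.1 hy, hyρ⟩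
    have hs := (hT.hasSum w' hw v₁ v₂ v₃ _ ζ hmem).mul_left ((x - y) ^ b)
    have hinj : Function.Injective fun i : ℕ => k + l - (b : ℤ) + i := fun a c h => by
      simpa using h
    have hx' : ζ + x - ζ = x := by ring
    have hy' : ζ + y - ζ = y := by ring
    have hterm : ∀ r, firstTerm ψ.cochain w' v₁ v₂ v₃ ![z₁, ζ + x, ζ + y] ζ r =
        B.field.lau w'' v₁ (ψ.e2elt v₂ v₃ x y r : W) (z₁ - ζ) +
        ψ.lau w'' v₁ (A.field.e2elt v₂ v₃ x y r : V) (z₁ - ζ) := fun r => by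
      rw [firstTerm_cochain ψ hw _ _ _ hmem]
      change B.field.e2 w' v₁ (ψ.e2elt v₂ v₃ (ζ + x - ζ) (ζ + y - ζ) r : W) z₁ ζ +
        ψ.e2 w' v₁ (A.field.e2elt v₂ v₃ (ζ + x - ζ) (ζ + y - ζ) r : V) z₁ ζ = _
      rw [hx', hy']
      rfl
    refine ((hinj.hasSum_iff fun r hr => ?_).2 hs).of_eq (fun i => ?_) rfl
    · have hlt : r < k + l - b := by
        by_contra hge
        exact hr ⟨(r - (k + l - b)).toNat, by simp only; lia⟩
      rw [hterm, ψ.e2elt_of_lt h₂ h₃ hψ x y hlt, A.field.e2elt_of_lt h₂ h₃ hA x y hlt]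
      simp [FieldMap.lau]
    · simp only [Function.comp_apply]
      rw [hterm, mul_add, lau_e2elt_mul hw'' v₁ h₂ h₃ hψ hxy, lau_e2elt_mul hw'' v₁ h₂ h₃ hA hxy,
        ← Finset.sum_add_distrib]
      exact Finset.sum_congr rfl fun j _ => mul_add _ _ _

end FieldMap

namespace FieldMap

variable {U : Type*} [AddCommGroup U] [Module ℂ U] {X : Type*} [AddCommGroup X] [Module ℂ X]
  {W : Type*} [AddCommGroup W] [Module ℂ W]
  {G₁ : TGrading U} {G₂ : TGrading X} {G₃ : TGrading W}

lemma lau_hom (Y : FieldMap G₁ G₂ G₃) {u : U} {x : X} {k l : ℤ} (hu : u ∈ G₁.gr k)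
    (hx : x ∈ G₂.gr l) {D : ℤ} {w' : Module.Dual ℂ W} (hw : ∀ m ≠ D, ∀ w ∈ G₃.gr m, w' w = 0)
    (z : ℂ) : Y.lau w' u x z = w' (Y.mode (k + l - D - 1) u x) * z ^ (D - k - l) := by
  rw [Y.lau_eq_sum (s := {k + l - D - 1}), Finset.sum_singleton]
  · congr 2
    ring
  · intro n hn
    refine hw _ (fun h => hn ?_) _ (Y.weight n k l u x hu hx)
    rw [Finset.mem_singleton]
    lia

/-- Fields with the same Laurent series have the same modes. -/
lemma mode_eq_of_lau (Y : FieldMap G₁ G₂ G₃) {U' X' : Type*} [AddCommGroup U'] [Module ℂ U']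
    [AddCommGroup X'] [Module ℂ X'] {H₁ : TGrading U'} {H₂ : TGrading X'}
    (Z : FieldMap H₁ H₂ G₃) {u : U} {x : X} {k l : ℤ} (hu : u ∈ G₁.gr k) (hx : x ∈ G₂.gr l)
    {u' : U'} {x' : X'} {k' l' : ℤ} (hu' : u' ∈ H₁.gr k') (hx' : x' ∈ H₂.gr l')
    (hkl : k + l = k' + l')
    (h : ∀ w' ∈ G₃.gradedDual, Y.lau w' u x 1 = Z.lau w' u' x' 1) (n : ℤ) :
    Y.mode n u x = Z.mode n u' x' := by
  refine G₃.ext_gradedDual fun w' _ => ?_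
  have hD : ∀ m ≠ k + l - n - 1, ∀ w ∈ G₃.gr m, (w'.comp (G₃.proj (k + l - n - 1))) w = 0 :=
    fun m hm w hw => by simp [G₃.proj_of_mem_ne hw hm]
  have h1 := h _ (G₃.comp_proj_mem_gradedDual w' (k + l - n - 1))
  rw [Y.lau_hom hu hx hD, Z.lau_hom hu' hx' hD, one_zpow, one_zpow, mul_one, mul_one] at h1
  have e1 : k + l - (k + l - n - 1) - 1 = n := by ring
  have e2 : k' + l' - (k + l - n - 1) - 1 = n := by rw [hkl]; ring
  have e3 : k' + l' - n - 1 = k + l - n - 1 := by rw [hkl]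
  rw [e1, e2, LinearMap.comp_apply, LinearMap.comp_apply, G₃.proj_of_mem (Y.weight n k l u x hu hx),
    G₃.proj_of_mem (e3 ▸ Z.weight n k' l' u' x' hu' hx')] at h1
  exact h1

end FieldMap

/-! ### The intertwining operator -/

section Intertwining

variable {V : Type*} [AddCommGroup V] [Module ℂ V] {A : GRVertexAlgebra V}
  {W : Type*} [AddCommGroup W] [Module ℂ W] (B : GRModule A W)

lemma intertwiningMode_eq_sum {n : ℤ} {w : W} {v : V} {K : ℕ}
    (hK : ∀ k : ℕ, K ≤ k → B.mode (n + k) v w = 0) :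
    intertwiningMode B n w v = ∑ k ∈ Finset.range K,
      ((-1 : ℂ) ^ (n + k + 1) / (k.factorial : ℂ)) • (B.Lm1 ^ k) (B.mode (n + k) v w) := by
  refine finsum_eq_sum_of_support_subset _ fun k hk => ?_
  simp only [Finset.coe_range, Set.mem_Iio]
  by_contra h
  exact hk (by simp [hK k (by lia)])

lemma exists_mode_add_eq_zero (n : ℤ) (w : W) (v : V) :
    ∃ K : ℕ, ∀ k : ℕ, K ≤ k → B.mode (n + k) v w = 0 := by
  obtain ⟨N, hN⟩ := B.lower_truncation v w
  exact ⟨(N - n).toNat, fun k hk => hN _ (by lia)⟩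

lemma intertwiningMode_add_left (n : ℤ) (w x : W) (v : V) :
    intertwiningMode B n (w + x) v = intertwiningMode B n w v + intertwiningMode B n x v := by
  obtain ⟨K, hK⟩ := exists_mode_add_eq_zero B n w v
  obtain ⟨K', hK'⟩ := exists_mode_add_eq_zero B n x v
  rw [intertwiningMode_eq_sum B (K := max K K') (fun k hk => hK k (by lia)),
    intertwiningMode_eq_sum B (K := max K K') (fun k hk => hK' k (by lia)),
    intertwiningMode_eq_sum B (K := max K K')
      (fun k hk => by rw [map_add, hK k (by lia), hK' k (by lia), add_zero]),
    ← Finset.sum_add_distrib]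
  simp

lemma intertwiningMode_add_right (n : ℤ) (w : W) (u v : V) :
    intertwiningMode B n w (u + v) = intertwiningMode B n w u + intertwiningMode B n w v := by
  obtain ⟨K, hK⟩ := exists_mode_add_eq_zero B n w u
  obtain ⟨K', hK'⟩ := exists_mode_add_eq_zero B n w v
  rw [intertwiningMode_eq_sum B (K := max K K') (fun k hk => hK k (by lia)),
    intertwiningMode_eq_sum B (K := max K K') (fun k hk => hK' k (by lia)),
    intertwiningMode_eq_sum B (K := max K K') (fun k hk => by
      rw [map_add, LinearMap.add_apply, hK k (by lia), hK' k (by lia), add_zero]),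
    ← Finset.sum_add_distrib]
  simp

lemma intertwiningMode_smul_left (n : ℤ) (c : ℂ) (w : W) (v : V) :
    intertwiningMode B n (c • w) v = c • intertwiningMode B n w v := by
  obtain ⟨K, hK⟩ := exists_mode_add_eq_zero B n w v
  rw [intertwiningMode_eq_sum B hK, intertwiningMode_eq_sum B (K := K)
    (fun k hk => by rw [map_smul, hK k hk, smul_zero]), Finset.smul_sum]
  exact Finset.sum_congr rfl fun k _ => by rw [map_smul, map_smul, smul_comm]

lemma intertwiningMode_smul_right (n : ℤ) (c : ℂ) (w : W) (v : V) :
    intertwiningMode B n w (c • v) = c • intertwiningMode B n w v := by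
  obtain ⟨K, hK⟩ := exists_mode_add_eq_zero B n w v
  rw [intertwiningMode_eq_sum B hK, intertwiningMode_eq_sum B (K := K)
    (fun k hk => by rw [map_smul, LinearMap.smul_apply, hK k hk, smul_zero]), Finset.smul_sum]
  exact Finset.sum_congr rfl fun k _ => by
    rw [map_smul, LinearMap.smul_apply, map_smul, smul_comm]

lemma Lm1_intertwiningMode {n : ℤ} {w : W} {v : V} {K : ℕ}
    (hK : ∀ k : ℕ, K ≤ k → B.mode (n + k) v w = 0) :
    B.Lm1 (intertwiningMode B n w v) = ∑ k ∈ Finset.range (K + 1),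
      (-(k : ℂ) * ((-1 : ℂ) ^ (n - 1 + k + 1 + 1) / (k.factorial : ℂ))) •
        (B.Lm1 ^ k) (B.mode (n - 1 + k) v w) := by
  rw [Finset.sum_range_succ', intertwiningMode_eq_sum B hK, map_sum]
  simp only [Nat.cast_zero, neg_zero, zero_mul, zero_smul, add_zero]
  refine Finset.sum_congr rfl fun k _ => ?_
  have e : n - 1 + ((k + 1 : ℕ) : ℤ) = n + k := by push_cast; ring
  rw [map_smul, e, B.tg.pow_succ_apply', zpow_add₀ (by norm_num : (-1 : ℂ) ≠ 0) (n + k + 1) 1,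
    Nat.factorial_succ]
  congr 1
  have h1 : (k.factorial : ℂ) ≠ 0 := by exact_mod_cast k.factorial_ne_zero
  have h2 : (k : ℂ) + 1 ≠ 0 := by exact_mod_cast k.succ_ne_zero
  push_cast
  field_simp

/-- The subtracted sum is `Y_{WV}^W(w)L(-1)v` written out, so this is the bracket formula; the
derivative property in the first argument reduces to the same termwise comparison. The range is
lengthened to `K + 1` because of the shift from `n` to `n - 1`. -/
lemma intertwiningMode_pred {n : ℤ} {w : W} {v : V} {K : ℕ}
    (hK : ∀ k : ℕ, K ≤ k → B.mode (n + k) v w = 0) :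
    (-(n : ℂ)) • intertwiningMode B (n - 1) w v = B.Lm1 (intertwiningMode B n w v) -
      ∑ k ∈ Finset.range (K + 1), (((n + k : ℤ) : ℂ) *
        ((-1 : ℂ) ^ (n + k) / (k.factorial : ℂ))) • (B.Lm1 ^ k) (B.mode (n - 1 + k) v w) := by
  rw [Lm1_intertwiningMode B hK, ← Finset.sum_sub_distrib,
    intertwiningMode_eq_sum B (K := K + 1) (fun k hk => ?_), Finset.smul_sum]
  · refine Finset.sum_congr rfl fun k _ => ?_
    rw [smul_smul, ← sub_smul]
    congr 1
    have e1 : n - 1 + (k : ℤ) + 1 = n + k := by ring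
    rw [e1, zpow_add₀ (by norm_num : (-1 : ℂ) ≠ 0) (n + k) 1]
    push_cast
    ring
  · obtain ⟨j, rfl⟩ := Nat.exists_eq_add_of_le' (show 1 ≤ k by lia)
    have := hK j (by lia)
    rwa [show n - 1 + ((j + 1 : ℕ) : ℤ) = n + j by push_cast; ring]

lemma mode_Lm1 (m : ℤ) (v : V) (w : W) :
    B.mode m v (B.Lm1 w) = B.Lm1 (B.mode m v w) + (m : ℂ) • B.mode (m - 1) v w := by
  have := B.Lm1_bracket m v w
  rw [sub_eq_iff_eq_add'] at this
  rw [this]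
  module

/-- The intertwining operator `Y_{WV}^W`. -/
def intertwining : FieldMap B.tg A.tg B.tg where
  mode n := LinearMap.mk₂ ℂ (intertwiningMode B n) (intertwiningMode_add_left B n)
    (intertwiningMode_smul_left B n) (intertwiningMode_add_right B n)
    (fun c w v => intertwiningMode_smul_right B n c w v)
  weight n k l w v hw hv := by
    obtain ⟨K, hK⟩ := exists_mode_add_eq_zero B n w v
    change intertwiningMode B n w v ∈ _
    rw [intertwiningMode_eq_sum B hK]
    refine Submodule.sum_mem _ fun j _ => Submodule.smul_mem _ _ ?_
    have := B.tg.pow_mem j (B.mode_weight (n + j) l k v w hv hw)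
    rwa [show l + k - (n + j) - 1 + j = k + l - n - 1 by ring] at this
  deriv_left n w v := by
    obtain ⟨K, hK⟩ := exists_mode_add_eq_zero B n w v
    have hsub : ∀ k : ℕ, K + 1 ≤ k → B.mode (n + k - 1) v w = 0 := fun k hk => by
      obtain ⟨j, rfl⟩ := Nat.exists_eq_add_of_le' (show 1 ≤ k by lia)
      have := hK j (by lia)
      rwa [show n + ((j + 1 : ℕ) : ℤ) - 1 = n + j by push_cast; ring]
    change intertwiningMode B n (B.Lm1 w) v = (-(n : ℂ)) • intertwiningMode B (n - 1) w v
    rw [intertwiningMode_pred B hK, intertwiningMode_eq_sum B (K := K + 1) (fun k hk => by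
      rw [mode_Lm1, hK k (by lia), hsub k hk, map_zero, smul_zero, add_zero]),
      intertwiningMode_eq_sum B (K := K + 1) (fun k hk => hK k (by lia)), map_sum,
      ← Finset.sum_sub_distrib]
    refine Finset.sum_congr rfl fun k _ => ?_
    rw [mode_Lm1, map_add, map_smul, smul_add, map_smul, ← B.tg.pow_succ_apply,
      B.tg.pow_succ_apply', smul_smul, show n - 1 + (k : ℤ) = n + k - 1 by ring,
      zpow_add₀ (by norm_num : (-1 : ℂ) ≠ 0) (n + k) 1, zpow_one]
    module
  bracket n w v := by
    obtain ⟨K, hK⟩ := exists_mode_add_eq_zero B n w v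
    have hsub : ∀ k : ℕ, K + 1 ≤ k → B.mode (n + k - 1) v w = 0 := fun k hk => by
      obtain ⟨j, rfl⟩ := Nat.exists_eq_add_of_le' (show 1 ≤ k by lia)
      have := hK j (by lia)
      rwa [show n + ((j + 1 : ℕ) : ℤ) - 1 = n + j by push_cast; ring]
    change B.Lm1 (intertwiningMode B n w v) - intertwiningMode B n w (A.Lm1 v) =
      (-(n : ℂ)) • intertwiningMode B (n - 1) w v
    rw [intertwiningMode_pred B hK]
    congr 1
    rw [intertwiningMode_eq_sum B (K := K + 1) (fun k hk => by
      rw [B.Lm1_derivative, hsub k hk, smul_zero])]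
    refine Finset.sum_congr rfl fun k _ => ?_
    rw [B.Lm1_derivative, map_smul, smul_smul, show n - 1 + (k : ℤ) = n + k - 1 by ring,
      zpow_add₀ (by norm_num : (-1 : ℂ) ≠ 0) (n + k) 1]
    congr 1
    push_cast
    ring

lemma intertwining_mode (n : ℤ) (w : W) (v : V) :
    (intertwining B).mode n w v = intertwiningMode B n w v := rfl

lemma lau_intertwining {w' : Module.Dual ℂ W} (hw : w' ∈ B.gradedDual) (w : W) (v : V) {z : ℂ}
    (hz : z ≠ 0) : (intertwining B).lau w' w v z = B.field.e2 w' v w 0 z := by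
  refine ((intertwining B).hasSum_lau hw w v z).unique ?_
  -- Terms with the same total power of `z` are collected: the power `k` of `L(-1)` accompanies the
  -- mode `n + k`.
  let e : ℕ × ℤ ≃ ℕ × ℤ :=
    { toFun := fun p => (p.1, p.2 + p.1)
      invFun := fun p => (p.1, p.2 - p.1)
      left_inv := fun p => by simp
      right_inv := fun p => by simp }
  have h := hasSum_columns (e.hasSum_iff.2 (B.field.hasSum_e2 hw v w 0 z))
  refine h.of_eq (fun n => ?_) rfl
  obtain ⟨K, hK⟩ := exists_mode_add_eq_zero B n w v
  rw [intertwining_mode, intertwiningMode_eq_sum B hK, map_sum, Finset.sum_mul,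
    tsum_eq_sum (s := Finset.range K)]
  · refine Finset.sum_congr rfl fun k _ => ?_
    change _ = w' ((B.Lm1 ^ k) (B.mode (n + k) v w)) * (z ^ k / (k.factorial : ℂ)) *
      (0 - z) ^ (-(n + k) - 1)
    have h1 : (-1 : ℂ) ^ (-(n + k) - 1) = (-1) ^ (n + k + 1) := by
      rw [show -(n + (k : ℤ)) - 1 = -(n + k + 1) by ring, zpow_neg]
      rcases Int.even_or_odd (n + k + 1) with h | h
      · rw [h.neg_one_zpow, inv_one]
      · rw [h.neg_one_zpow, inv_neg, inv_one]
    rw [map_smul, smul_eq_mul, zero_sub, neg_eq_neg_one_mul z, mul_zpow, h1,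
      show -(n + (k : ℤ)) - 1 = -n - 1 - k by ring, zpow_sub₀ hz (-n - 1) k, zpow_natCast]
    field_simp
  · intro k hk
    change w' ((B.Lm1 ^ k) (B.mode (n + k) v w)) * (z ^ k / (k.factorial : ℂ)) *
      (0 - z) ^ (-(n + k) - 1) = 0
    rw [hK k (by simpa using hk)]
    simp

/-- The components of `e^{zL(-1)}Y_W(v, -z)w` are the modes of the intertwining operator. Sums over
degrees in `hasSum_tri_e2elt` thereby become sums over modes. -/
lemma e2elt_zero_left {w : W} {v : V} {k l : ℤ} (hw : w ∈ B.gr k) (hv : v ∈ A.gr l) {z : ℂ}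
    (hz : z ≠ 0) (n : ℤ) : (B.field.e2elt v w 0 z (k + l - n - 1) : W) =
      z ^ (-n - 1) • intertwiningMode B n w v := by
  refine B.ext_gradedDual fun w' _ => ?_
  have hr := B.comp_proj_mem_gradedDual w' (k + l - n - 1)
  have hD : ∀ m ≠ k + l - n - 1, ∀ x ∈ B.gr m, (w'.comp (B.proj (k + l - n - 1))) x = 0 :=
    fun m hm x hx => by simp [B.proj_of_mem_ne hx hm]
  have h1 : w' (B.field.e2elt v w 0 z (k + l - n - 1) : W) = _ :=
    B.field.e2elt_apply w' (k + l - n - 1) v w 0 z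
  have h2 : B.field.e2 (w'.comp (B.proj (k + l - n - 1))) v w 0 z = _ :=
    (lau_intertwining B hr w v hz).symm
  rw [h1]
  refine h2.trans ?_
  rw [(intertwining B).lau_hom hw hv hD, show k + l - (k + l - n - 1) - 1 = n by ring,
    show k + l - n - 1 - k - l = -n - 1 by ring, map_smul, smul_eq_mul, LinearMap.comp_apply,
    B.proj_of_mem ((intertwining B).weight n k l w v hw hv), mul_comm, intertwining_mode]

lemma intertwiningMode_one (n : ℤ) (w : W) : intertwiningMode B n w A.one =
    if n < 0 then (((-n - 1).toNat.factorial : ℂ)⁻¹) • (B.Lm1 ^ (-n - 1).toNat) w else 0 := by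
  have hm : ∀ k : ℕ, n + k ≠ -1 → B.mode (n + k) A.one w = 0 := fun k hk => by
    rw [B.identity, if_neg hk]
  split_ifs with h
  · rw [intertwiningMode, finsum_eq_single _ (-n - 1).toNat]
    · have e : n + ((-n - 1).toNat : ℤ) = -1 := by lia
      rw [e, B.identity, if_pos rfl]
      simp
    · intro k hk
      rw [hm k (by lia), map_zero, smul_zero]
  · rw [intertwiningMode]
    refine finsum_eq_zero_of_forall_eq_zero fun k => ?_
    rw [hm k (by lia), map_zero, smul_zero]

end Intertwining

section PairSums

open MvPolynomial

/-- When only the indices with `m + n = s` contribute, the double series is supported on one line,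
and iterated summation is the same as absolute summation. -/
lemma hasSum_pair {S : ℤ → ℤ → ℂ} {s : ℤ} (hS : ∀ m n, m + n ≠ s → S m n = 0) {x y a : ℂ}
    {g : ℤ → ℂ} (hg : ∀ n, HasSum (fun m => S m n * x ^ (-m - 1)) (g n))
    (h : HasSum (fun n => g n * y ^ (-n - 1)) a) :
    HasSum (fun p : ℤ × ℤ => S p.1 p.2 * x ^ (-p.1 - 1) * y ^ (-p.2 - 1)) a := by
  have hinj : Function.Injective fun n : ℤ => (s - n, n) := fun a b h => by simpa using congrArg Prod.snd h
  refine (hinj.hasSum_iff fun p hp => ?_).1 (h.of_eq (fun n => ?_) rfl)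
  · rw [hS p.1 p.2 fun h => hp ⟨p.2, Prod.ext (by simp only; lia) rfl⟩, zero_mul, zero_mul]
  · rw [(hg n).unique (hasSum_single (s - n) fun m hm => by
      rw [hS m n (fun h => hm (by lia)), zero_mul])]
    rfl

lemma hasSum_pair_swap {S : ℤ → ℤ → ℂ} {s : ℤ} (hS : ∀ m n, m + n ≠ s → S m n = 0) {x y a : ℂ}
    {g : ℤ → ℂ} (hg : ∀ m, HasSum (fun n => S m n * y ^ (-n - 1)) (g m))
    (h : HasSum (fun m => g m * x ^ (-m - 1)) a) :
    HasSum (fun p : ℤ × ℤ => S p.1 p.2 * x ^ (-p.1 - 1) * y ^ (-p.2 - 1)) a := by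
  have := hasSum_pair (S := fun m n => S n m) (s := s) (fun m n hmn => hS n m (by lia)) hg h
  exact ((Equiv.prodComm ℤ ℤ).hasSum_iff.2 this).of_eq (fun _ => mul_right_comm _ _ _) rfl

lemma CommonRational.of_ratOn {S₁ S₂ S₃ : ℤ → ℤ → ℂ} {R : ℂ → ℂ → ℂ}
    (hR : RatOn discTwo fun z => R (z 0) (z 1)) (h : ConvergesTo S₁ S₂ S₃ R) :
    CommonRational S₁ S₂ S₃ := by
  obtain ⟨P, N, hP⟩ := hR
  refine ⟨P, N, N, N, ?_⟩
  refine h.congr fun z₁ z₂ h₁ h₂ h₁₂ => ?_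
  have := hP ![z₁, z₂] ((eval_discTwo_ne _).2 ⟨h₁, h₂, h₁₂⟩)
  simpa [discTwo, mul_pow] using this

lemma CommonRational.exists_ratOn {S₁ S₂ S₃ : ℤ → ℤ → ℂ} (h : CommonRational S₁ S₂ S₃) :
    ∃ R : ℂ → ℂ → ℂ, RatOn discTwo (fun z => R (z 0) (z 1)) ∧ ConvergesTo S₁ S₂ S₃ R := by
  obtain ⟨P, a, b, c, h⟩ := h
  exact ⟨_, GRModule.ratOn_of_poly, h⟩

lemma CommonRational.of_add {S₁ S₂ S₃ S₁' S₂' S₃' T₁ T₂ T₃ : ℤ → ℤ → ℂ}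
    (h : CommonRational S₁ S₂ S₃) (h' : CommonRational S₁' S₂' S₃')
    (e₁ : ∀ m n, T₁ m n = S₁ m n + S₁' m n) (e₂ : ∀ m n, T₂ m n = S₂ m n + S₂' m n)
    (e₃ : ∀ m n, T₃ m n = S₃ m n + S₃' m n) : CommonRational T₁ T₂ T₃ := by
  obtain ⟨R, hR, hc⟩ := h.exists_ratOn
  obtain ⟨R', hR', hc'⟩ := h'.exists_ratOn
  refine CommonRational.of_ratOn (R := fun z₁ z₂ => R z₁ z₂ + R' z₁ z₂) (hR.add hR') fun z₁ z₂ => ⟨fun h1 h2 => ?_, fun h1 h2 => ?_,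
    fun h1 h2 => ?_⟩
  · exact (((hc z₁ z₂).1 h1 h2).add ((hc' z₁ z₂).1 h1 h2)).of_eq
      (fun p => by rw [e₁]; ring) rfl
  · exact (((hc z₁ z₂).2.1 h1 h2).add ((hc' z₁ z₂).2.1 h1 h2)).of_eq
      (fun p => by rw [e₂]; ring) rfl
  · exact (((hc z₁ z₂).2.2 h1 h2).add ((hc' z₁ z₂).2.2 h1 h2)).of_eq
      (fun p => by rw [e₃]; ring) rfl

lemma hasSum_prod_swap {S₁ : ℤ → ℤ → ℂ} {R : ℂ → ℂ → ℂ}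
    {z₁ z₂ : ℂ} (h : HasSum (fun p : ℤ × ℤ => S₁ p.2 p.1 * z₂ ^ (-p.1 - 1) * z₁ ^ (-p.2 - 1))
      (R z₁ z₂)) : HasSum (fun p : ℤ × ℤ => S₁ p.1 p.2 * z₁ ^ (-p.1 - 1) * z₂ ^ (-p.2 - 1))
      (R z₁ z₂) :=
  ((Equiv.prodComm ℤ ℤ).hasSum_iff.2 h).of_eq (fun _ => mul_right_comm _ _ _) rfl

lemma ratOn_three_zero {f : ℂ → ℂ → ℂ → ℂ} (hf : RatOn discThree fun z => f (z 0) (z 1) (z 2)) :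
    RatOn discTwo fun z => f (z 0) (z 1) 0 := by
  have h := hf.comp (κ := Fin 2) ![X 0, X 1, 0]
  refine (h.mono ⟨1, ?_⟩).congr fun z _ => by simp
  simp [discThree, discTwo]

lemma ratOn_zero_mid {f : ℂ → ℂ → ℂ → ℂ} (hf : RatOn discThree fun z => f (z 0) (z 1) (z 2)) :
    RatOn discTwo fun z => f (z 0) 0 (z 1) := by
  have h := hf.comp (κ := Fin 2) ![X 0, 0, X 1]
  refine (h.mono ⟨-1, ?_⟩).congr fun z _ => by simp
  simp [discThree, discTwo]
  ring

lemma ratOn_zero_swap {f : ℂ → ℂ → ℂ → ℂ} (hf : RatOn discThree fun z => f (z 0) (z 1) (z 2)) :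
    RatOn discTwo fun z => f (z 1) 0 (z 0) := by
  have h := hf.comp (κ := Fin 2) ![X 1, 0, X 0]
  refine (h.mono ⟨1, ?_⟩).congr fun z _ => by simp
  simp [discThree, discTwo]
  ring

end PairSums

/-! ### Duality for the extension -/

section Duality

variable {V : Type*} [AddCommGroup V] [Module ℂ V] {A : GRVertexAlgebra V}
  {W : Type*} [AddCommGroup W] [Module ℂ W] {B : GRModule A W}

section Homogeneous

variable {w' : Module.Dual ℂ W} {D : ℤ}

/-- All three series expand `T(v₁, z₁; v₂, z₂; v₃, 0)`. The first expands around `z₂ = 0`. The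
second does so after exchanging `(v₁, z₁)` with `(v₂, z₂)`. The iterate expands around `z₁ = z₂`
with `v₃` rotated to the outer position; there the skew form of `Y_{WV}^W` and the symmetry of `ψ`
turn the summands into those of `G₁`. -/
lemma FieldMap.HasTriple.duality
    (hw : ∀ m ≠ D, ∀ w ∈ B.gr m, w' w = 0) {ψ : FieldMap A.tg A.tg B.tg}
    {T : Module.Dual ℂ W → V → V → V → ℂ → ℂ → ℂ → ℂ} (hT : ψ.HasTriple T) {k₁ k₂ k₃ : ℤ}
    {v₁ v₂ v₃ : V} (h₁ : v₁ ∈ A.gr k₁) (h₂ : v₂ ∈ A.gr k₂) (h₃ : v₃ ∈ A.gr k₃) :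
    CommonRational
      (fun m n => w' (B.mode m v₁ (ψ.mode n v₂ v₃)) + w' (ψ.mode m v₁ (A.mode n v₂ v₃)))
      (fun m n => w' (B.mode n v₂ (ψ.mode m v₁ v₃)) + w' (ψ.mode n v₂ (A.mode m v₁ v₃)))
      (fun m n => w' (intertwiningMode B n (ψ.mode m v₁ v₂) v₃) +
        w' (ψ.mode n (A.mode m v₁ v₂) v₃)) := by
  have hw' := B.mem_gradedDual_of_hom hw
  have hA : ∀ {k l : ℤ} {u v : V} (n : ℤ), u ∈ A.gr k → v ∈ A.gr l →
    A.mode n u v ∈ A.gr (k + l - n - 1) := fun n hu hv => A.mode_weight n _ _ _ _ hu hv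
  have hψ : ∀ {k l : ℤ} {u v : V} (n : ℤ), u ∈ A.gr k → v ∈ A.gr l →
    ψ.mode n u v ∈ B.gr (k + l - n - 1) := fun n hu hv => ψ.weight n _ _ _ _ hu hv
  refine CommonRational.of_ratOn (R := fun z₁ z₂ => T w' v₁ v₂ v₃ z₁ z₂ 0)
    (ratOn_three_zero (hT.ratOn w' hw' v₁ v₂ v₃))
    fun z₁ z₂ => ⟨fun ha hb => ?_, fun ha hb => ?_, fun ha hb => ?_⟩
  · refine hasSum_pair (S := fun m n => w' (B.mode m v₁ (ψ.mode n v₂ v₃)) +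
        w' (ψ.mode m v₁ (A.mode n v₂ v₃))) (s := k₁ + k₂ + k₃ - 2 - D) (fun m n hmn => ?_)
      (g := fun n => B.field.lau w' v₁ (ψ.mode n v₂ v₃) z₁ + ψ.lau w' v₁ (A.mode n v₂ v₃) z₁)
      (fun n => ?_) ?_
    · rw [hw _ (fun h => hmn (by lia)) _ (B.mode_weight m _ _ _ _ h₁ (hψ n h₂ h₃)),
        hw _ (fun h => hmn (by lia)) _ (hψ m h₁ (hA n h₂ h₃)), add_zero]
    · exact ((B.field.hasSum_lau hw' v₁ _ z₁).add (ψ.hasSum_lau hw' v₁ _ z₁)).of_eq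
        (fun m => add_mul _ _ _) rfl
    · have := hT.hasSum_mode hw' v₁ h₂ h₃ (z₁ := z₁) (z₂ := z₂) (ζ := 0) (norm_pos_iff.1 hb)
        (by simpa using ha)
      refine this.of_eq (fun n => ?_) rfl
      rw [B.field.e2_zero hw', ψ.e2_zero hw', sub_zero]
  · refine hasSum_pair_swap (S := fun m n => w' (B.mode n v₂ (ψ.mode m v₁ v₃)) +
        w' (ψ.mode n v₂ (A.mode m v₁ v₃))) (s := k₁ + k₂ + k₃ - 2 - D) (fun m n hmn => ?_)
      (g := fun m => B.field.lau w' v₂ (ψ.mode m v₁ v₃) z₂ + ψ.lau w' v₂ (A.mode m v₁ v₃) z₂)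
      (fun n => ?_) ?_
    · rw [hw _ (fun h => hmn (by lia)) _ (B.mode_weight n _ _ _ _ h₂ (hψ m h₁ h₃)),
        hw _ (fun h => hmn (by lia)) _ (hψ n h₂ (hA m h₁ h₃)), add_zero]
    · exact ((B.field.hasSum_lau hw' v₂ _ z₂).add (ψ.hasSum_lau hw' v₂ _ z₂)).of_eq
        (fun m => add_mul _ _ _) rfl
    · have h0 : z₁ ≠ 0 := norm_pos_iff.1 hb
      have h0' : z₂ ≠ 0 := norm_pos_iff.1 (hb.trans ha)
      have hne : z₁ ≠ z₂ := by rintro rfl; exact ha.false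
      have := hT.hasSum_mode hw' v₂ h₁ h₃ (z₁ := z₂) (z₂ := z₁) (ζ := 0) h0 (by simpa using ha)
      refine this.of_eq (fun n => ?_) ?_
      · rw [B.field.e2_zero hw', ψ.e2_zero hw', sub_zero]
      · rw [hT.rotate w' hw' v₁ v₃ v₂ z₁ 0 z₂ hne h0'.symm h0,
          hT.swap w' hw' v₁ v₂ v₃ z₁ z₂ 0 h0 h0' hne]
  · have h0' : z₂ ≠ 0 := norm_pos_iff.1 (hb.trans ha)
    have hne : z₁ ≠ z₂ := sub_ne_zero.1 (norm_pos_iff.1 hb)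
    have h0 : z₁ ≠ 0 := by rintro rfl; simp at ha
    refine hasSum_pair_swap (S := fun m n => w' (intertwiningMode B n (ψ.mode m v₁ v₂) v₃) +
        w' (ψ.mode n (A.mode m v₁ v₂) v₃)) (s := k₁ + k₂ + k₃ - 2 - D) (fun m n hmn => ?_)
      (g := fun m => B.field.e2 w' v₃ (ψ.mode m v₁ v₂) 0 z₂ + ψ.e2 w' v₃ (A.mode m v₁ v₂) 0 z₂)
      (fun m => ?_) ?_
    · rw [← intertwining_mode, hw _ (fun h => hmn (by lia)) _
          ((intertwining B).weight n _ _ _ _ (hψ m h₁ h₂) h₃),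
        hw _ (fun h => hmn (by lia)) _ (hψ n (hA m h₁ h₂) h₃), add_zero]
    · rw [← lau_intertwining B hw' _ _ h0', hT.symm w' hw' _ _ _ _ h0'.symm, ψ.e2_zero hw']
      exact (((intertwining B).hasSum_lau hw' _ _ z₂).add (ψ.hasSum_lau hw' _ _ z₂)).of_eq
        (fun m => add_mul _ _ _) rfl
    · have := hT.hasSum_mode hw' v₃ h₁ h₂ (z₁ := 0) (z₂ := z₁) (ζ := z₂) hne (by simpa using ha)
      exact this.of_eq (fun n => rfl) (hT.rotate w' hw' v₁ v₂ v₃ z₁ z₂ 0 h0 h0' hne).symm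

/-- `Y_W(v₁, z₁)Y_{WV}^W(w, z₂)v₃ = Y_W(v₁, z₁)e^{z₂L(-1)}Y_W(v₃, -z₂)w`, which expands the
three-point function with `v₃` at `0` and `w` at `z₂`. -/
lemma GRModule.hasSum_mode_intertwining
    (hw : ∀ m ≠ D, ∀ w ∈ B.gr m, w' w = 0)
    {k₁ k₂ k₃ : ℤ} {v₁ v₃ : V} {w : W} (h₁ : v₁ ∈ A.gr k₁)
    (h₂ : w ∈ B.gr k₂) (h₃ : v₃ ∈ A.gr k₃) {z₁ z₂ : ℂ} (ha : ‖z₂‖ < ‖z₁‖) (hb : 0 < ‖z₂‖) :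
    HasSum (fun p : ℤ × ℤ => w' (B.mode p.1 v₁ (intertwiningMode B p.2 w v₃)) *
      z₁ ^ (-p.1 - 1) * z₂ ^ (-p.2 - 1)) (B.tri w' v₁ v₃ w z₁ 0 z₂) := by
  have hw' := B.mem_gradedDual_of_hom hw
  have h0 : z₂ ≠ 0 := norm_pos_iff.1 hb
  refine hasSum_pair (S := fun m n => w' (B.mode m v₁ (intertwiningMode B n w v₃)))
    (s := k₁ + k₂ + k₃ - 2 - D) (fun m n hmn => ?_)
    (g := fun n => B.field.lau w' v₁ (intertwiningMode B n w v₃) z₁)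
    (fun n => B.field.hasSum_lau hw' v₁ _ z₁) ?_
  · exact hw _ (fun h => hmn (by lia)) _
      (B.mode_weight m _ _ _ _ h₁ ((intertwining B).weight n _ _ _ _ h₂ h₃))
  · have h := B.hasSum_tri_e2elt hw' v₁ v₃ w (z₁ := z₁) (z₂ := 0) (z₃ := z₂)
      (by simpa using hb.trans ha) ha h0.symm
    refine ((Equiv.subLeft (k₂ + k₃ - 1)).hasSum_iff.2 h).of_eq (fun n => ?_) rfl
    change _ = B.field.lau w' v₁ (B.field.e2elt v₃ w 0 z₂ (k₂ + k₃ - 1 - n) : W) z₁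
    rw [show k₂ + k₃ - 1 - n = k₂ + k₃ - n - 1 by ring, e2elt_zero_left B h₂ h₃ h0,
      B.field.lau_smul_right hw', mul_comm]

/-- `Y_{WV}^W(w, z₂)Y_V(v₁, z₁)v₃ = e^{z₂L(-1)}Y_W(Y_V(v₁, z₁)v₃, -z₂)w`, the iterate expansion of
the two-point function at `(z₁ - z₂, -z₂)`. -/
lemma GRModule.hasSum_intertwining_mode
    (hw : ∀ m ≠ D, ∀ w ∈ B.gr m, w' w = 0)
    {k₁ k₂ k₃ : ℤ} {v₁ v₃ : V} {w : W} (h₁ : v₁ ∈ A.gr k₁)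
    (h₂ : w ∈ B.gr k₂) (h₃ : v₃ ∈ A.gr k₃) {z₁ z₂ : ℂ} (ha : ‖z₁‖ < ‖z₂‖) (hb : 0 < ‖z₁‖) :
    HasSum (fun p : ℤ × ℤ => w' (intertwiningMode B p.2 w (A.mode p.1 v₁ v₃)) *
      z₁ ^ (-p.1 - 1) * z₂ ^ (-p.2 - 1)) (B.tri w' v₁ v₃ w z₁ 0 z₂) := by
  have hw' := B.mem_gradedDual_of_hom hw
  have h0 : z₂ ≠ 0 := norm_pos_iff.1 (hb.trans ha)
  refine hasSum_pair_swap (S := fun m n => w' (intertwiningMode B n w (A.mode m v₁ v₃)))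
    (s := k₁ + k₂ + k₃ - 2 - D) (fun m n hmn => ?_)
    (g := fun m => (intertwining B).lau w' w (A.mode m v₁ v₃) z₂)
    (fun m => (intertwining B).hasSum_lau hw' _ _ z₂) ?_
  · exact hw _ (fun h => hmn (by lia)) _
      ((intertwining B).weight n _ _ _ _ h₂ (A.mode_weight m _ _ _ _ h₁ h₃))
  · have hE := B.tg.expDual_mem hw' z₂
    have h := ((B.isCorr_corr hE v₁ v₃ w).2 (z₁ - z₂) (-z₂)).2.2 (by simpa using ha)
      (by simpa using hb)
    refine (hasSum_rows h).of_eq (fun m => ?_) (by rw [GRModule.tri, zero_sub])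
    rw [lau_intertwining B hw' _ _ h0, FieldMap.e2, zero_sub, FieldMap.lau, ← tsum_mul_right]
    refine tsum_congr fun n => ?_
    rw [show z₁ - z₂ - -z₂ = z₁ by ring]
    exact mul_right_comm _ _ _

/-- The two products are the preceding expansions. The iterate is `e^{z₂L(-1)}Y_W(v₃, -z₂)Y_W(v₁, z₁
- z₂)w`, the same function by commutativity. -/
lemma GRModule.duality_mid
    (hw : ∀ m ≠ D, ∀ w ∈ B.gr m, w' w = 0)
    {k₁ k₂ k₃ : ℤ} {v₁ v₃ : V} {w : W} (h₁ : v₁ ∈ A.gr k₁)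
    (h₂ : w ∈ B.gr k₂) (h₃ : v₃ ∈ A.gr k₃) :
    CommonRational (fun m n => w' (B.mode m v₁ (intertwiningMode B n w v₃)))
      (fun m n => w' (intertwiningMode B n w (A.mode m v₁ v₃)))
      (fun m n => w' (intertwiningMode B n (B.mode m v₁ w) v₃)) := by
  have hw' := B.mem_gradedDual_of_hom hw
  refine CommonRational.of_ratOn (R := fun z₁ z₂ => B.tri w' v₁ v₃ w z₁ 0 z₂)
    (ratOn_zero_mid (B.tri_ratOn hw' v₁ v₃ w))
    fun z₁ z₂ => ⟨fun ha hb => B.hasSum_mode_intertwining hw h₁ h₂ h₃ ha hb,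
      fun ha hb => B.hasSum_intertwining_mode hw h₁ h₂ h₃ ha hb, fun ha hb => ?_⟩
  have h0 : z₂ ≠ 0 := norm_pos_iff.1 (hb.trans ha)
  have h1 : z₁ - z₂ ≠ 0 := norm_pos_iff.1 hb
  refine hasSum_pair_swap (S := fun m n => w' (intertwiningMode B n (B.mode m v₁ w) v₃))
    (s := k₁ + k₂ + k₃ - 2 - D) (fun m n hmn => ?_)
    (g := fun m => (intertwining B).lau w' (B.mode m v₁ w) v₃ z₂)
    (fun m => (intertwining B).hasSum_lau hw' _ _ z₂) ?_
  · exact hw _ (fun h => hmn (by lia)) _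
      ((intertwining B).weight n _ _ _ _ (B.mode_weight m _ _ _ _ h₁ h₂) h₃)
  · have hE := B.tg.expDual_mem hw' z₂
    have h := B.hasSum_corr_snd hE v₃ v₁ w (x := -z₂) (y := z₁ - z₂) hb (by simpa using ha)
    refine h.of_eq (fun m => ?_) ?_
    · rw [lau_intertwining B hw' _ _ h0, FieldMap.e2, zero_sub]
    · have h2 : z₁ - z₂ ≠ -z₂ := fun h => by
        have : z₁ = 0 := by linear_combination h
        simp [this] at ha
      change B.tri w' v₁ v₃ w z₁ 0 z₂ = _
      rw [GRModule.tri, zero_sub, B.corr_symm hE v₁ v₃ w h1 (neg_ne_zero.2 h0) h2]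

/-- The products are those of the preceding case with the roles of `z₁` and `z₂` exchanged. The
iterate applies skew-symmetry twice and is the sum over degrees of `Y_W(v₃,
-z₂)e^{(z₁-z₂)L(-1)}Y_W(v₂, z₂ - z₁)w`, translated by `z₂`. -/
lemma GRModule.duality_left
    (hw : ∀ m ≠ D, ∀ w ∈ B.gr m, w' w = 0)
    {k₁ k₂ k₃ : ℤ} {v₂ v₃ : V} {w : W} (h₁ : w ∈ B.gr k₁)
    (h₂ : v₂ ∈ A.gr k₂) (h₃ : v₃ ∈ A.gr k₃) :
    CommonRational (fun m n => w' (intertwiningMode B m w (A.mode n v₂ v₃)))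
      (fun m n => w' (B.mode n v₂ (intertwiningMode B m w v₃)))
      (fun m n => w' (intertwiningMode B n (intertwiningMode B m w v₂) v₃)) := by
  have hw' := B.mem_gradedDual_of_hom hw
  refine CommonRational.of_ratOn (R := fun z₁ z₂ => B.tri w' v₂ v₃ w z₂ 0 z₁)
    (ratOn_zero_swap (B.tri_ratOn hw' v₂ v₃ w))
    fun z₁ z₂ => ⟨fun ha hb => ?_, fun ha hb => ?_, fun ha hb => ?_⟩
  · exact hasSum_prod_swap (S₁ := fun m n => w' (intertwiningMode B m w (A.mode n v₂ v₃)))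
      (R := fun z₁ z₂ => B.tri w' v₂ v₃ w z₂ 0 z₁) (B.hasSum_intertwining_mode hw h₂ h₁ h₃ ha hb)
  · exact hasSum_prod_swap (S₁ := fun m n => w' (B.mode n v₂ (intertwiningMode B m w v₃)))
      (R := fun z₁ z₂ => B.tri w' v₂ v₃ w z₂ 0 z₁) (B.hasSum_mode_intertwining hw h₂ h₁ h₃ ha hb)
  have h0 : z₂ ≠ 0 := norm_pos_iff.1 (hb.trans ha)
  have h1 : z₁ - z₂ ≠ 0 := norm_pos_iff.1 hb
  have h2 : z₁ ≠ 0 := by rintro rfl; simp at ha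
  refine hasSum_pair_swap (S := fun m n =>
      w' (intertwiningMode B n (intertwiningMode B m w v₂) v₃))
    (s := k₁ + k₂ + k₃ - 2 - D) (fun m n hmn => ?_)
    (g := fun m => (intertwining B).lau w' (intertwiningMode B m w v₂) v₃ z₂)
    (fun m => (intertwining B).hasSum_lau hw' _ _ z₂) ?_
  · exact hw _ (fun h => hmn (by lia)) _ ((intertwining B).weight n _ _ _ _
      ((intertwining B).weight m _ _ _ _ h₁ h₂) h₃)
  · have hE := B.tg.expDual_mem hw' z₂
    have h := B.hasSum_tri_e2elt hE v₃ v₂ w (z₁ := 0 - z₂) (z₂ := z₂ - z₂) (z₃ := z₁ - z₂)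
      (by simpa using h0) (by simpa using ha) (by simpa using h1.symm)
    rw [B.tri_expDual hw', B.tri_symm hw' _ _ _ h2.symm (sub_ne_zero.1 h1).symm h0.symm,
      sub_self] at h
    refine ((Equiv.subLeft (k₁ + k₂ - 1)).hasSum_iff.2 h).of_eq (fun n => ?_) rfl
    change _ = B.field.lau (B.tg.expDual w' z₂) v₃
      (B.field.e2elt v₂ w 0 (z₁ - z₂) (k₁ + k₂ - 1 - n) : W) (0 - z₂)
    rw [show k₁ + k₂ - 1 - n = k₁ + k₂ - n - 1 by ring, e2elt_zero_left B h₁ h₂ h1,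
      B.field.lau_smul_right hE, mul_comm, lau_intertwining B hw' _ _ h0, FieldMap.e2]

end Homogeneous

end Duality

/-! ### The extension defined by a cocycle -/

namespace Grading

variable {V : Type*} [AddCommGroup V] [Module ℂ V] {W : Type*} [AddCommGroup W] [Module ℂ W]

/-- The direct sum of graded spaces. -/
def prod (G : Grading V) (H : Grading W) : Grading (V × W) where
  gr n := (G.gr n).prod (H.gr n)
  internal := by
    constructor
    · rw [← AddMonoidHom.coe_coe, injective_iff_map_eq_zero]
      intro f hf
      have h : ∀ f : DirectSum ℤ fun n => (G.gr n).prod (H.gr n), ∀ n,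
          (LinearMap.prodMap (G.proj n) (H.proj n)) (DirectSum.coeLinearMap
            (fun n => (G.gr n).prod (H.gr n)) f) = (f n : V × W) := by
        intro f n
        induction f using DirectSum.induction_on with
        | zero => simp
        | of i x =>
          have hx : (x : V × W).1 ∈ G.gr i ∧ (x : V × W).2 ∈ H.gr i := x.2
          rw [DirectSum.coeLinearMap_of]
          rcases eq_or_ne i n with rfl | hne
          · rw [DirectSum.of_eq_same]
            exact Prod.ext (G.proj_of_mem hx.1) (H.proj_of_mem hx.2)
          · rw [DirectSum.of_eq_of_ne _ _ _ hne.symm]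
            exact Prod.ext (G.proj_of_mem_ne hx.1 hne) (H.proj_of_mem_ne hx.2 hne)
        | add f g hf hg => rw [map_add, map_add, hf, hg]; rfl
      refine DFinsupp.ext fun n => Subtype.ext ?_
      rw [← h f n]
      have hf' : DirectSum.coeLinearMap (fun n => (G.gr n).prod (H.gr n)) f = 0 := hf
      rw [hf', map_zero]
      rfl
    · have h : LinearMap.range (DirectSum.coeLinearMap fun n => (G.gr n).prod (H.gr n)) = ⊤ := by
        rw [eq_top_iff]
        rintro ⟨v, w⟩ -
        have hmem : ∀ n, ∀ x ∈ (G.gr n).prod (H.gr n),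
            x ∈ LinearMap.range (DirectSum.coeLinearMap fun n => (G.gr n).prod (H.gr n)) :=
          fun n x hx => ⟨DirectSum.of (fun n => (G.gr n).prod (H.gr n)) n ⟨x, hx⟩,
            DirectSum.coeLinearMap_of _ _ _⟩
        have hv : (v, (0 : W)) ∈
            LinearMap.range (DirectSum.coeLinearMap fun n => (G.gr n).prod (H.gr n)) :=
          G.induction (p := fun v => (v, (0 : W)) ∈ _) (fun n x hx => hmem n _ ⟨hx, zero_mem _⟩)
            (fun x y hx hy => by simpa using add_mem hx hy) v
        have hw : ((0 : V), w) ∈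
            LinearMap.range (DirectSum.coeLinearMap fun n => (G.gr n).prod (H.gr n)) :=
          H.induction (p := fun w => ((0 : V), w) ∈ _) (fun n x hx => hmem n _ ⟨zero_mem _, hx⟩)
            (fun x y hx hy => by simpa using add_mem hx hy) w
        simpa using add_mem hv hw
      exact LinearMap.range_eq_top.1 h
  finite n := by
    have h1 := G.finite n
    have h2 := H.finite n
    exact Module.Finite.iff_fg.2 ((Module.Finite.iff_fg.1 h1).prod (Module.Finite.iff_fg.1 h2))
  bounded := by
    obtain ⟨N, hN⟩ := G.bounded
    obtain ⟨N', hN'⟩ := H.bounded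
    refine ⟨min N N', fun n hn => ?_⟩
    rw [hN n (by lia), hN' n (by lia), Submodule.prod_bot]

lemma L0_bracket_of_weight (G : Grading V) {n : ℤ} {f : V →ₗ[ℂ] V →ₗ[ℂ] V}
    (hf : ∀ k l u v, u ∈ G.gr k → v ∈ G.gr l → f u v ∈ G.gr (k + l - n - 1)) (u v : V) :
    G.L0 (f u v) - f u (G.L0 v) = f (G.L0 u) v + (-(n : ℂ) - 1) • f u v := by
  refine G.linearMap_ext (f := G.L0 ∘ₗ f.flip v - f.flip (G.L0 v))
    (g := f.flip v ∘ₗ G.L0 + (-(n : ℂ) - 1) • f.flip v) (fun k u hu => ?_) u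
  refine G.linearMap_ext (f := G.L0 ∘ₗ f u - f u ∘ₗ G.L0)
    (g := f (G.L0 u) + (-(n : ℂ) - 1) • f u) (fun l v hv => ?_) v
  simp only [LinearMap.sub_apply, LinearMap.comp_apply, LinearMap.add_apply, LinearMap.smul_apply]
  rw [G.L0_of_mem (hf k l u v hu hv), G.L0_of_mem hu, G.L0_of_mem hv, map_smul, map_smul,
    LinearMap.smul_apply]
  push_cast
  module

end Grading

namespace FieldMap

variable {V : Type*} [AddCommGroup V] [Module ℂ V] {A : GRVertexAlgebra V}
  {W : Type*} [AddCommGroup W] [Module ℂ W] {B : GRModule A W} (ψ : FieldMap A.tg A.tg B.tg)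

/-- `L(-1)1 = 0`, so the derivative of `ψ(1, z)` vanishes and only the constant mode remains. -/
lemma mode_one_left {n : ℤ} (hn : n ≠ -1) (v : V) : ψ.mode n A.one v = 0 := by
  have h : ψ.mode (n + 1) (A.Lm1 A.one) v = _ := ψ.deriv_left (n + 1) A.one v
  rw [A.Lm1_one, map_zero, LinearMap.zero_apply, eq_comm, smul_eq_zero, add_sub_cancel_right] at h
  refine h.resolve_left fun h0 => hn ?_
  have : ((n + 1 : ℤ) : ℂ) = 0 := neg_eq_zero.1 h0
  have := Int.cast_eq_zero.1 this
  lia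

lemma mode_one_left_mem {k : ℤ} {v : V} (hv : v ∈ A.gr k) : ψ.mode (-1) A.one v ∈ B.gr k := by
  have := ψ.weight (-1) 0 k A.one v A.one_mem hv
  rwa [show (0 : ℤ) + k - -1 - 1 = k by ring] at this

lemma mode_one_Lm1 (v : V) : ψ.mode (-1) A.one (A.Lm1 v) = B.Lm1 (ψ.mode (-1) A.one v) := by
  have h : B.Lm1 (ψ.mode (-1) A.one v) - ψ.mode (-1) A.one (A.Lm1 v) = _ :=
    ψ.bracket (-1) A.one v
  rw [ψ.mode_one_left (n := -1 - 1) (by norm_num), smul_zero, sub_eq_zero] at h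
  exact h.symm

lemma lau_single {U X : Type*} [AddCommGroup U] [Module ℂ U] [AddCommGroup X] [Module ℂ X]
    {G₁ : TGrading U} {G₂ : TGrading X} {G₃ : TGrading W} (Y : FieldMap G₁ G₂ G₃) {u : U} {x : X}
    (h : ∀ n ≠ -1, Y.mode n u x = 0) (w' : Module.Dual ℂ W) (z : ℂ) :
    Y.lau w' u x z = w' (Y.mode (-1) u x) := by
  rw [Y.lau_eq_sum (s := {-1}) (fun n hn => by rw [h n (by simpa using hn), map_zero])]
  simp

lemma e2_one_left (w' : Module.Dual ℂ W) (v : V) (a b : ℂ) :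
    ψ.e2 w' A.one v a b = B.tg.expDual w' b (ψ.mode (-1) A.one v) :=
  ψ.lau_single (fun _ hn => ψ.mode_one_left hn v) _ _

lemma _root_.GRModule.e2_one_left (B : GRModule A W) (w' : Module.Dual ℂ W) (w : W) (a b : ℂ) :
    B.field.e2 w' A.one w a b = B.tg.expDual w' b w := by
  refine (B.field.lau_single (fun n hn => ?_) _ _).trans ?_
  · rw [B.identity, if_neg hn]
  · rw [B.identity, if_pos rfl]

variable {ψ} {T : Module.Dual ℂ W → V → V → V → ℂ → ℂ → ℂ → ℂ}

lemma HasTriple.hasSum_mode_one (hT : ψ.HasTriple T) {w' : Module.Dual ℂ W}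
    (hw : w' ∈ B.gradedDual) (u : V) {v : V} {k : ℤ} (hv : v ∈ A.gr k) {z₁ z₂ ζ : ℂ} (hz : z₂ ≠ ζ)
    (h : ‖z₂ - ζ‖ < ‖z₁ - ζ‖) : T w' u A.one v z₁ z₂ ζ =
      B.field.e2 w' u (ψ.mode (-1) A.one v) z₁ ζ + ψ.e2 w' u v z₁ ζ := by
  refine (hT.hasSum_mode hw u A.one_mem hv hz h).unique ?_
  refine (hasSum_single (-1 : ℤ) fun n hn => ?_).of_eq (fun _ => rfl) ?_
  · rw [ψ.mode_one_left hn, A.identity, if_neg hn]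
    simp [FieldMap.e2, FieldMap.lau]
  · rw [A.identity, if_pos rfl]
    simp

/-- Write `s = ψ_{-1}(1, ·)`. Three-point functions with two vacua can be expanded with the middle
vacuum near the other vacuum or near `v`. This gives `Y_W(v)s(1) + ψ(v)1 = 2e^{L(-1)}s(v)` at `z =
1`, and `ψ(v)1 = e^{L(-1)}s(v)` by symmetry. -/
lemma HasTriple.mode_section_one (hT : ψ.HasTriple T) (n : ℤ) (v : V) :
    B.mode n v (ψ.mode (-1) A.one A.one) = ψ.mode n v A.one := by
  refine A.linearMap_ext (f := (B.mode n).flip (ψ.mode (-1) A.one A.one))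
    (g := (ψ.mode n).flip A.one) (fun k v hv => ?_) v
  refine B.field.mode_eq_of_lau ψ hv (ψ.mode_one_left_mem A.one_mem) hv A.one_mem rfl
    (fun w' hw => ?_) n
  -- The points `1, -1/2, 0` satisfy both convergence conditions: `|-1/2| < 1` around `0`, and `|0 -
  -- 1| < |-1/2 - 1|` around `1`.
  have h1 := hT.hasSum_mode_one hw v A.one_mem (z₁ := 1) (z₂ := -1 / 2) (ζ := 0) (by norm_num)
    (by norm_num)
  have h2 := hT.hasSum_mode_one hw A.one hv (z₁ := -1 / 2) (z₂ := 0) (ζ := 1) (by norm_num)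
    (by norm_num)
  rw [hT.rotate w' hw A.one A.one v (-1 / 2) 0 1 (by norm_num) (by norm_num) (by norm_num), h2,
    B.e2_one_left, ψ.e2_one_left, hT.symm w' hw v A.one 1 0 one_ne_zero, ψ.e2_one_left,
    add_left_inj] at h1
  rw [← B.field.e2_zero hw, ← ψ.e2_zero hw, ← h1, hT.symm w' hw v A.one 1 0 one_ne_zero,
    ψ.e2_one_left]

lemma HasTriple.intertwining_section_one (hT : ψ.HasTriple T) (n : ℤ) (v : V) :
    (intertwining B).mode n (ψ.mode (-1) A.one A.one) v = ψ.mode n A.one v := by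
  refine A.linearMap_ext (fun k v hv => ?_) v
  refine (intertwining B).mode_eq_of_lau ψ (ψ.mode_one_left_mem A.one_mem) hv A.one_mem hv rfl
    (fun w' hw => ?_) n
  rw [lau_intertwining B hw _ _ one_ne_zero, ← ψ.e2_zero hw, hT.symm w' hw _ _ _ _ one_ne_zero]
  simp only [FieldMap.e2, FieldMap.lau, hT.mode_section_one]

/-- The vertex operators on `V ⊕ W` defined by `ψ`. -/
def extMode (ψ : FieldMap A.tg A.tg B.tg) (n : ℤ) : (V × W) →ₗ[ℂ] (V × W) →ₗ[ℂ] (V × W) :=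
  LinearMap.mk₂ ℂ (fun a b => (A.mode n a.1 b.1,
    B.mode n a.1 b.2 + (intertwining B).mode n a.2 b.1 + ψ.mode n a.1 b.1))
    (fun a a' b => Prod.ext (by simp) (by simp; abel))
    (fun c a b => Prod.ext (by simp) (by simp))
    (fun a b b' => Prod.ext (by simp) (by simp; abel))
    (fun c a b => Prod.ext (by simp) (by simp))

lemma extMode_apply (ψ : FieldMap A.tg A.tg B.tg) (n : ℤ) (a b : V × W) :
    ψ.extMode n a b = (A.mode n a.1 b.1,
      B.mode n a.1 b.2 + (intertwining B).mode n a.2 b.1 + ψ.mode n a.1 b.1) := rfl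

lemma extMode_weight (ψ : FieldMap A.tg A.tg B.tg) (n k l : ℤ) (a b : V × W)
    (ha : a ∈ (A.prod B.toGrading).gr k) (hb : b ∈ (A.prod B.toGrading).gr l) :
    ψ.extMode n a b ∈ (A.prod B.toGrading).gr (k + l - n - 1) :=
  ⟨A.mode_weight n k l _ _ ha.1 hb.1, add_mem (add_mem (B.mode_weight n k l _ _ ha.1 hb.2)
    ((intertwining B).weight n k l _ _ ha.2 hb.1)) (ψ.weight n k l _ _ ha.1 hb.1)⟩

/-- The correction `-s(1)` in the vacuum cancels `ψ(v, z)1`, which an arbitrary cocycle does not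
make zero; what is left is the creation property of `V` and of `Y_{WV}^W`. -/
lemma HasTriple.extMode_one (hT : ψ.HasTriple T) (n : ℤ) (a : V × W) :
    ψ.extMode n a (A.one, -ψ.mode (-1) A.one A.one) =
      (A.mode n a.1 A.one, intertwiningMode B n a.2 A.one) := by
  rw [extMode_apply]
  refine Prod.ext rfl ?_
  simp only [map_neg, hT.mode_section_one, intertwining_mode]
  abel

/-- By linearity the correlation functions decompose into five families: all vectors in `V` with
value in `V`, exactly one of the three vectors in `W`, and all vectors in `V` with value in `W`.
Contributions with two vectors from `W` are absent because `W` multiplies trivially with itself. -/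
lemma HasTriple.extMode_duality_hom (hT : ψ.HasTriple T) {k₁ k₂ k₃ D : ℤ} {u₁ u₂ u₃ : V × W}
    (h₁ : u₁ ∈ (A.prod B.toGrading).gr k₁) (h₂ : u₂ ∈ (A.prod B.toGrading).gr k₂)
    (h₃ : u₃ ∈ (A.prod B.toGrading).gr k₃) {φ : Module.Dual ℂ (V × W)}
    (hφ : ∀ m ≠ D, ∀ x ∈ (A.prod B.toGrading).gr m, φ x = 0) :
    CommonRational (fun m n => φ (ψ.extMode m u₁ (ψ.extMode n u₂ u₃)))
      (fun m n => φ (ψ.extMode n u₂ (ψ.extMode m u₁ u₃)))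
      (fun m n => φ (ψ.extMode n (ψ.extMode m u₁ u₂) u₃)) := by
  set v' : Module.Dual ℂ V := φ ∘ₗ LinearMap.inl ℂ V W with hv'
  set w' : Module.Dual ℂ W := φ ∘ₗ LinearMap.inr ℂ V W with hw'
  have hadd : ∀ a b, φ (a, b) = v' a + w' b := fun a b => by
    rw [hv', hw', LinearMap.comp_apply, LinearMap.comp_apply, ← map_add]
    simp
  have hvD : ∀ m ≠ D, ∀ x ∈ A.gr m, v' x = 0 := fun m hm x hx =>
    hφ m hm _ ⟨hx, zero_mem _⟩
  have hwD : ∀ m ≠ D, ∀ x ∈ B.gr m, w' x = 0 := fun m hm x hx =>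
    hφ m hm _ ⟨zero_mem _, hx⟩
  have c0 := A.duality u₁.1 u₂.1 u₃.1 v' (A.mem_gradedDual_of_hom hvD)
  have c1 := B.duality u₁.1 u₂.1 u₃.2 w' (B.mem_gradedDual_of_hom hwD)
  have c2 := B.duality_mid hwD h₁.1 h₂.2 h₃.1
  have c3 := B.duality_left hwD h₁.2 h₂.1 h₃.1
  have c4 := hT.duality hwD h₁.1 h₂.1 h₃.1
  refine (((c0.of_add c1 (fun _ _ => rfl) (fun _ _ => rfl) (fun _ _ => rfl)).of_add c2
    (fun _ _ => rfl) (fun _ _ => rfl) (fun _ _ => rfl)).of_add c3 (fun _ _ => rfl) (fun _ _ => rfl)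
    (fun _ _ => rfl)).of_add c4 (fun m n => ?_) (fun m n => ?_) (fun m n => ?_) <;>
  · rw [extMode_apply, extMode_apply, hadd]
    simp only [map_add, LinearMap.add_apply, intertwining_mode]
    ring

lemma HasTriple.extMode_duality (hT : ψ.HasTriple T) (u₁ u₂ u₃ : V × W)
    {φ : Module.Dual ℂ (V × W)} (hφ : φ ∈ (A.prod B.toGrading).gradedDual) :
    CommonRational (fun m n => φ (ψ.extMode m u₁ (ψ.extMode n u₂ u₃)))
      (fun m n => φ (ψ.extMode n u₂ (ψ.extMode m u₁ u₃)))
      (fun m n => φ (ψ.extMode n (ψ.extMode m u₁ u₂) u₃)) := by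
  induction u₁ using Grading.induction (G := A.prod B.toGrading) with
  | add x y hx hy =>
    refine hx.of_add hy (fun m n => ?_) (fun m n => ?_) (fun m n => ?_) <;>
      simp only [map_add, LinearMap.add_apply]
  | hom k₁ u₁ h₁ =>
  induction u₂ using Grading.induction (G := A.prod B.toGrading) with
  | add x y hx hy =>
    refine hx.of_add hy (fun m n => ?_) (fun m n => ?_) (fun m n => ?_) <;>
      simp only [map_add, LinearMap.add_apply]
  | hom k₂ u₂ h₂ =>
  induction u₃ using Grading.induction (G := A.prod B.toGrading) with
  | add x y hx hy =>
    refine hx.of_add hy (fun m n => ?_) (fun m n => ?_) (fun m n => ?_) <;>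
      simp only [map_add]
  | hom k₃ u₃ h₃ =>
  refine Grading.gradedDual_induction (G := A.prod B.toGrading) (p := fun φ =>
    CommonRational (fun m n => φ (ψ.extMode m u₁ (ψ.extMode n u₂ u₃)))
      (fun m n => φ (ψ.extMode n u₂ (ψ.extMode m u₁ u₃)))
      (fun m n => φ (ψ.extMode n (ψ.extMode m u₁ u₂) u₃)))
    (fun D φ hD => hT.extMode_duality_hom h₁ h₂ h₃ hD) (fun a b _ _ ha hb => ?_) hφ
  exact ha.of_add hb (fun m n => rfl) (fun m n => rfl) (fun m n => rfl)

/-- The vertex algebra `V ⊕ W` defined by a cocycle. -/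
def HasTriple.extension (hT : ψ.HasTriple T) : GRVertexAlgebra (V × W) :=
  have hL : ∀ a : V × W, ψ.extMode (-2) a (A.one, -ψ.mode (-1) A.one A.one) =
      (A.Lm1 a.1, B.Lm1 a.2) := fun a => by
    rw [hT.extMode_one, intertwiningMode_one, if_pos (by norm_num)]
    simp [GRVertexAlgebra.Lm1]
  { A.prod B.toGrading with
    mode := ψ.extMode
    one := (A.one, -ψ.mode (-1) A.one A.one)
    lower_truncation := fun a b => by
      obtain ⟨N₁, h₁⟩ := A.lower_truncation a.1 b.1
      obtain ⟨N₂, h₂⟩ := B.lower_truncation a.1 b.2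
      obtain ⟨N₃, h₃⟩ := (intertwining B).exists_trunc a.2 b.1
      obtain ⟨N₄, h₄⟩ := ψ.exists_trunc a.1 b.1
      refine ⟨max (max N₁ N₂) (max N₃ N₄), fun n hn => ?_⟩
      rw [extMode_apply, h₁ n (by lia), h₂ n (by lia), h₃ n (by lia), h₄ n (by lia)]
      simp
    identity := fun n a => by
      rw [extMode_apply]
      simp only [map_neg, LinearMap.neg_apply, hT.intertwining_section_one, A.identity, B.identity]
      split_ifs <;> simp
    creation := fun a => by
      refine ⟨fun n hn => ?_, ?_⟩
      · rw [hT.extMode_one, (A.creation a.1).1 n hn, intertwiningMode_one, if_neg (by lia)]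
        rfl
      · rw [hT.extMode_one, (A.creation a.1).2, intertwiningMode_one, if_pos (by norm_num)]
        simp
    duality := fun u₁ u₂ u₃ φ hφ => hT.extMode_duality u₁ u₂ u₃ hφ
    L0_bracket := fun n => (A.prod B.toGrading).L0_bracket_of_weight (ψ.extMode_weight n)
    Lm1_derivative := fun n a b => by
      rw [hL, extMode_apply, extMode_apply]
      refine Prod.ext (A.Lm1_derivative n a.1 b.1) ?_
      have h1 := B.Lm1_derivative n a.1 b.2
      have h2 : (intertwining B).mode n (B.Lm1 a.2) b.1 = _ := (intertwining B).deriv_left n a.2 b.1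
      have h3 : ψ.mode n (A.Lm1 a.1) b.1 = _ := ψ.deriv_left n a.1 b.1
      simp only [h1, h2, h3, Prod.smul_mk, smul_add]
    Lm1_bracket := fun n a b => by
      rw [hL, hL, extMode_apply, extMode_apply, extMode_apply]
      refine Prod.ext (A.Lm1_bracket n a.1 b.1) ?_
      have h1 := B.Lm1_bracket n a.1 b.2
      have h2 : B.Lm1 ((intertwining B).mode n a.2 b.1) -
        (intertwining B).mode n a.2 (A.Lm1 b.1) = _ := (intertwining B).bracket n a.2 b.1
      have h3 : B.Lm1 (ψ.mode n a.1 b.1) - ψ.mode n a.1 (A.Lm1 b.1) = _ := ψ.bracket n a.1 b.1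
      simp only [Prod.smul_mk, smul_add, ← h1, ← h2, ← h3, map_add, Prod.mk_sub_mk]
      abel }

lemma HasTriple.extension_Lm1 (hT : ψ.HasTriple T) (a : V × W) :
    hT.extension.Lm1 a = (A.Lm1 a.1, B.Lm1 a.2) := by
  have h : hT.extension.Lm1 a = ψ.extMode (-2) a (A.one, -ψ.mode (-1) A.one A.one) := rfl
  rw [h, hT.extMode_one, intertwiningMode_one, if_pos (by norm_num)]
  simp [GRVertexAlgebra.Lm1]

lemma HasTriple.isExtensionOf (hT : ψ.HasTriple T) : IsExtensionOf ψ.cochain hT.extension := by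
  refine ⟨fun n => rfl, fun n u v => ψ.mode n u v, fun v₁ v₂ w' hw z hz => ?_,
    fun n v₁ w₁ v₂ w₂ => rfl⟩
  rw [ψ.cochain_matEl hw _ (by simpa using hz)]
  have h := ψ.hasSum_lau hw v₁ v₂ z
  rw [← ψ.e2_zero hw] at h
  exact h

end FieldMap

/-! ### The model on `V ⊕ W` as a realizable square-zero extension -/

section FromExtension

variable {V : Type u} [AddCommGroup V] [Module ℂ V] {A : GRVertexAlgebra V}
  {W : Type v} [AddCommGroup W] [Module ℂ W] {B : GRModule A W} {ψ : FieldMap A.tg A.tg B.tg}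
  {T : Module.Dual ℂ W → V → V → V → ℂ → ℂ → ℂ → ℂ}

lemma FieldMap.HasTriple.isSquareZeroExtension (hT : ψ.HasTriple T) :
    IsSquareZeroExtension B hT.extension (LinearMap.fst ℂ V W) (LinearMap.inr ℂ V W) where
  hom := ⟨fun n x hx => hx.1, rfl, fun n x y => rfl⟩
  surjective := LinearMap.fst_surjective
  square_zero n x y hx hy := by
    have hx : x.1 = 0 := hx
    have hy : y.1 = 0 := hy
    change ψ.extMode n x y = 0
    rw [ψ.extMode_apply, hx, hy]
    simp
  injective := LinearMap.inr_injective
  range_eq := LinearMap.range_inr ℂ V W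
  map_gr n w hw := ⟨zero_mem _, hw⟩
  map_mode n e w := by
    change (0, B.mode n e.1 w) = ψ.extMode n e (0, w)
    rw [ψ.extMode_apply]
    simp
  map_Lm1 w := by
    rw [hT.extension_Lm1]
    simp

/-- The section is `v ↦ (v, -s(v))` with `s = ψ_{-1}(1, ·)`. It sends `1` to the vacuum, and the
normalization holds because `s` commutes with `L(-1)` while the vertex operators applied to the
vacuum are given by `e^{zL(-1)}`. -/
lemma FieldMap.HasTriple.realizable (hT : ψ.HasTriple T) :
    (SquareZeroExtension.ofSum hT.extension hT.isSquareZeroExtension).Realizable := by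
  refine ⟨(LinearMap.id.prod (-ψ.mode (-1) A.one) : V →ₗ[ℂ] V × W), fun v => rfl,
    fun n v hv => ⟨hv, neg_mem (ψ.mode_one_left_mem hv)⟩, rfl, fun n v => ?_⟩
  change ψ.extMode n (v, -ψ.mode (-1) A.one v) (A.one, -ψ.mode (-1) A.one A.one) =
    (A.mode n v A.one, -ψ.mode (-1) A.one (A.mode n v A.one))
  rw [hT.extMode_one, intertwiningMode_one]
  refine Prod.ext rfl ?_
  simp only
  have hpow : ∀ k : ℕ, ψ.mode (-1) A.one ((A.Lm1 ^ k) v) = (B.Lm1 ^ k) (ψ.mode (-1) A.one v) := by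
    intro k
    induction k with
    | zero => simp
    | succ k ih =>
      rw [pow_succ', pow_succ', Module.End.mul_apply, Module.End.mul_apply, ψ.mode_one_Lm1, ih]
  split_ifs with h
  · have e : n = -((-n - 1).toNat : ℤ) - 1 := by lia
    conv_rhs => rw [e, A.mode_one, map_smul, hpow]
    simp
  · rw [(A.creation v).1 n (by lia), map_zero, neg_zero]

end FromExtension

/-! ### One-cochains and coboundaries -/

section OneCochains

lemma Function.update_vec_one {α : Type*} (a b : α) : Function.update ![a] 0 b = ![b] := by
  funext i
  obtain rfl : i = 0 := Subsingleton.elim _ _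
  rfl

variable {V : Type*} [AddCommGroup V] [Module ℂ V] {A : GRVertexAlgebra V}
  {W : Type*} [AddCommGroup W] [Module ℂ W] {B : GRModule A W}

/-- A grading-preserving linear map that commutes with `L(-1)`. -/
structure IsGradedMap (B : GRModule A W) (f : V →ₗ[ℂ] W) : Prop where
  map_gr : ∀ n, ∀ v ∈ A.gr n, f v ∈ B.gr n
  map_Lm1 : ∀ v, f (A.Lm1 v) = B.Lm1 (f v)

/-- The cochain `χ(v, z) = e^{zL(-1)} f(v)`. -/
def oneCochain (B : GRModule A W) (f : V →ₗ[ℂ] W) : PreCochain B 1 where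
  toFun v z := B.tg.expElt (f (v 0)) (z.1 0)
  map_update_add' v i x y := by
    obtain rfl : i = 0 := Subsingleton.elim _ _
    funext z
    simp [B.tg.expElt_add]
  map_update_smul' v i c x := by
    obtain rfl : i = 0 := Subsingleton.elim _ _
    funext z
    simp [B.tg.expElt_smul]

lemma oneCochain_val (f : V →ₗ[ℂ] W) (v : Fin 1 → V) (z : Fin 1 → ℂ) :
    (oneCochain B f).val v z = B.tg.expElt (f (v 0)) (z 0) :=
  PreCochain.val_of_injective _ _ (Function.injective_of_subsingleton z)

lemma oneCochain_matEl {f : V →ₗ[ℂ] W} {w' : Module.Dual ℂ W} (hw : w' ∈ B.gradedDual)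
    (v : Fin 1 → V) (z : Fin 1 → ℂ) :
    (oneCochain B f).matEl w' v z = B.tg.expDual w' (z 0) (f (v 0)) := by
  rw [PreCochain.matEl, oneCochain_val]
  exact B.tg.pairing_expElt hw _ _

namespace PreCochain

variable {χ : PreCochain B 1}

lemma LDerivative.hasDerivAt_one (hχ : χ.LDerivative) {w' : Module.Dual ℂ W}
    (hw : w' ∈ B.gradedDual) (v : V) (z : ℂ) :
    HasDerivAt (fun t => χ.matEl w' ![v] ![t]) (χ.matEl w' ![A.Lm1 v] ![z]) z ∧
      χ.matEl w' ![A.Lm1 v] ![z] = χ.matEl (w'.comp B.Lm1) ![v] ![z] := by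
  obtain ⟨h1, h2⟩ := hχ ![v] w' hw ![z] (Function.injective_of_subsingleton _)
  have h3 : HasDerivAt (fun t => χ.matEl w' ![v] ![t]) (χ.matEl w' ![A.Lm1 v] ![z]) z := by
    simpa only [Function.update_vec_one, Matrix.cons_val_zero] using h1 0
  refine ⟨h3, ?_⟩
  rw [Fin.sum_univ_one] at h2
  simp only [Function.update_vec_one, Matrix.cons_val_zero] at h2
  rw [h3.deriv] at h2
  exact h2

/-- Scaling fixes the point `0`, so the component of degree `r` is multiplied both by `2^r` and by
`2^k`. -/
lemma LConjugation.val_zero (hχ : χ.LConjugation) {k : ℤ} {v : V} (hv : v ∈ A.gr k) {r : ℤ}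
    (hr : r ≠ k) : (χ.val ![v] ![0] r : W) = 0 := by
  refine B.ext_gradedDual fun w' hw => ?_
  have h := hχ (fun _ => k) ![v] (by intro i; fin_cases i; exact hv) (w'.comp (B.proj r))
    (B.comp_proj_mem_gradedDual w' r) ![0] (Function.injective_of_subsingleton _) 2 (by norm_num)
  have e1 : (fun i => (2 : ℂ) ^ k • (![v] : Fin 1 → V) i) = (2 : ℂ) ^ k • ![v] := rfl
  have e2 : (fun i => 2 * (![0] : Fin 1 → ℂ) i) = ![0] := by
    funext i; fin_cases i; simp
  have hs : χ.val ((2 : ℂ) ^ k • ![v]) ![0] = (2 : ℂ) ^ k • χ.val ![v] ![0] := by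
    rw [val_of_injective _ _ (Function.injective_of_subsingleton _),
      val_of_injective _ _ (Function.injective_of_subsingleton _)]
    have := χ.map_smul_univ (fun _ => (2 : ℂ) ^ k) ![v]
    rw [Fin.prod_univ_one] at this
    exact congrFun this _
  rw [e1, e2, matEl, B.pairing_comp_proj, hs, finsum_eq_single _ r] at h
  · have hp := B.proj_of_mem (χ.val ![v] ![0] r).2
    simp only [LinearMap.comp_apply, map_smul, hp, smul_eq_mul, Pi.smul_apply,
      Submodule.coe_smul] at h
    have hne : (2 : ℂ) ^ r ≠ 2 ^ k := fun h => hr <| by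
      have h' : ((2 : ℝ) ^ r) = 2 ^ k := by simpa using congrArg norm h
      exact zpow_right_injective₀ (by norm_num) (by norm_num) h'
    rw [map_zero]
    have : ((2 : ℂ) ^ r - 2 ^ k) * w' (χ.val ![v] ![0] r : W) = 0 := by linear_combination h
    exact (mul_eq_zero.1 this).resolve_left (sub_ne_zero.2 hne)
  · intro m hm
    simp [B.proj_of_mem_ne (χ.val ![v] ![0] m).2 hm]

/-- A one-cochain is of the form `e^{zL(-1)} f(v)`. -/
lemma exists_eq_oneCochain (hd : χ.LDerivative) (hc : χ.LConjugation) :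
    ∃ f, IsGradedMap B f ∧ χ = oneCochain B f := by
  have hadd : ∀ u v z, χ.val ![u + v] ![z] = χ.val ![u] ![z] + χ.val ![v] ![z] := fun u v z => by
    simp only [val_of_injective _ _ (Function.injective_of_subsingleton _)]
    have := χ.map_update_add ![u] 0 u v
    simp only [Function.update_vec_one] at this
    exact congrFun this _
  have hsmul : ∀ (c : ℂ) v z, χ.val ![c • v] ![z] = c • χ.val ![v] ![z] := fun c v z => by
    simp only [val_of_injective _ _ (Function.injective_of_subsingleton _)]
    have := χ.map_update_smul ![v] 0 c v
    simp only [Function.update_vec_one] at this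
    exact congrFun this _
  -- The map `f` is read off at `z = 0`, where a vector of degree `k` has only a component of degree
  -- `k`.
  let F : ℤ → V →ₗ[ℂ] W := fun k =>
    { toFun := fun v => (χ.val ![v] ![0] k : W)
      map_add' := fun u v => by rw [hadd]; rfl
      map_smul' := fun c v => by rw [hsmul]; rfl }
  have hf0 : ∀ w' ∈ B.gradedDual, ∀ v, χ.matEl w' ![v] ![0] = w' (A.assemble F v) := by
    intro w' hw v
    induction v using Grading.induction (G := A.toGrading) with
    | add x y hx hy => rw [map_add, map_add, ← hx, ← hy, matEl, hadd, B.pairing_add hw]; rfl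
    | hom k v hv =>
      rw [A.assemble_of_mem F hv, matEl, Grading.pairing, finsum_eq_single _ k]
      · rfl
      · intro r hr
        rw [hc.val_zero hv hr, map_zero]
  refine ⟨A.assemble F, ⟨fun n v hv => ?_, fun v => ?_⟩, ?_⟩
  · rw [A.assemble_of_mem F hv]
    exact (χ.val ![v] ![0] n).2
  · refine B.ext_gradedDual fun w' hw => ?_
    rw [← hf0 w' hw, (hd.hasDerivAt_one hw v 0).2, hf0 _ (B.tg.comp_L_mem hw)]
    rfl
  · refine ext_matEl fun v w' hw z _ => ?_
    rw [oneCochain_matEl hw]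
    have ev : v = ![v 0] := by funext i; fin_cases i; rfl
    have ez : z = ![z 0] := by funext i; fin_cases i; rfl
    have hT := hasSum_taylor (h := fun k s => χ.matEl (w'.comp (B.Lm1 ^ k)) ![v 0] ![s])
      (R := ‖z 0‖ + 1) (fun k s _ => by
        have := hd.hasDerivAt_one (B.tg.comp_pow_mem hw k) (v 0) s
        have h2 := this.1
        rw [this.2, LinearMap.comp_assoc] at h2
        exact h2) (s := z 0) (by linarith)
    simp only [pow_zero, ← ez, ← ev] at hT
    refine hT.unique ((B.tg.hasSum_expDual hw (z 0) (A.assemble F (v 0))).of_eq (fun k => ?_) rfl)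
    rw [ev, hf0 _ (B.tg.comp_pow_mem hw k)]
    rfl

end PreCochain

variable {f : V →ₗ[ℂ] W}

lemma IsGradedMap.dual_mem (hf : IsGradedMap B f) {w' : Module.Dual ℂ W}
    (hw : w' ∈ B.gradedDual) : w'.comp f ∈ A.gradedDual :=
  Grading.comp_mem_gradedDual hw f 0 fun n v hv => by simpa using hf.map_gr n v hv

lemma IsGradedMap.expDual (hf : IsGradedMap B f) {w' : Module.Dual ℂ W}
    (hw : w' ∈ B.gradedDual) (z : ℂ) :
    (B.tg.expDual w' z).comp f = A.tg.expDual (w'.comp f) z :=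
  B.tg.expDual_comp (H := A.tg) hw f hf.map_gr hf.map_Lm1 z

lemma IsGradedMap.oneCochain_isRational : (oneCochain B f).IsRational := by
  rw [PreCochain.isRational_iff]
  intro v w' hw
  obtain ⟨K, hK⟩ := B.tg.exists_comp_pow_eq_zero hw
  refine ⟨fun z => ∑ k ∈ Finset.range K, z 0 ^ k * ((k.factorial : ℂ)⁻¹ *
    w' ((B.Lm1 ^ k) (f (v 0)))), RatOn.sum _ fun k _ =>
      ((RatOn.coord 0).pow k).mul (RatOn.const _), fun z _ => ?_⟩
  rw [oneCochain_matEl hw, B.tg.expDual_eq_sum hK, LinearMap.sum_apply]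
  refine Finset.sum_congr rfl fun k _ => ?_
  simp only [LinearMap.smul_apply, LinearMap.comp_apply, smul_eq_mul]
  ring

lemma IsGradedMap.oneCochain_lDerivative (hf : IsGradedMap B f) :
    (oneCochain B f).LDerivative := by
  intro v w' hw z _
  have h : ∀ i : Fin 1, HasDerivAt (fun t => (oneCochain B f).matEl w' v (Function.update z i t))
      ((oneCochain B f).matEl w' (Function.update v i (A.Lm1 (v i))) z) (z i) := fun i => by
    obtain rfl : i = 0 := Subsingleton.elim _ _
    simp only [oneCochain_matEl hw, Function.update_self, hf.map_Lm1]
    exact B.tg.hasDerivAt_expDual hw (z 0) (f (v 0))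
  refine ⟨h, ?_⟩
  rw [Fin.sum_univ_one, (h 0).deriv, oneCochain_matEl hw, Function.update_self, hf.map_Lm1]
  have h2 := oneCochain_matEl (f := f) (B.tg.comp_L_mem hw) v z
  exact (B.tg.expDual_comp_L hw (z 0) (f (v 0))).symm.trans h2.symm

lemma IsGradedMap.oneCochain_lConjugation (hf : IsGradedMap B f) :
    (oneCochain B f).LConjugation := by
  intro k v hv w' hw z _ t ht
  have hm := hf.map_gr (k 0) (v 0) (hv 0)
  rw [oneCochain_matEl hw, oneCochain_val]
  have h1 := B.tg.hasSum_expDual hw (t * z 0) (f (t ^ k 0 • v 0))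
  have hfin : (Function.support fun r : ℤ =>
      w' (t ^ r • (B.tg.expElt (f (v 0)) (z 0) r : W))).Finite := by
    refine Set.Finite.subset hw fun r hr => ⟨_, Submodule.smul_mem _ _ (Subtype.mem _), hr⟩
  rw [finsum_eq_sum _ hfin]
  refine HasSum.unique (hasSum_sum_of_ne_finset_zero (L := .unconditional ℤ) (s := hfin.toFinset)
    (f := fun r : ℤ => w' (t ^ r • (B.tg.expElt (f (v 0)) (z 0) r : W)))
    fun r hr => by simpa only [Set.Finite.mem_toFinset, Function.mem_support, not_not] using hr) ?_
  have hinj : Function.Injective fun j : ℕ => k 0 + (j : ℤ) := fun a b h => by simpa using h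
  refine (hinj.hasSum_iff fun r hr => ?_).1 (h1.of_eq (fun j => ?_) rfl)
  · rw [B.tg.expElt_of_lt hm _ (by
      by_contra hge
      exact hr ⟨(r - k 0).toNat, by simp only; lia⟩), smul_zero, map_zero]
  · simp only [Function.comp_apply]
    rw [B.tg.expElt_hom hm, map_smul, map_smul, map_smul, map_smul, map_smul, zpow_add₀ ht,
      zpow_natCast, mul_pow]
    simp only [smul_eq_mul]
    ring

end OneCochains

/-! ### Composability of one-cochains, and coboundaries as fields -/

section OneCochains

variable {V : Type*} [AddCommGroup V] [Module ℂ V] {A : GRVertexAlgebra V}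
  {W : Type*} [AddCommGroup W] [Module ℂ W] {B : GRModule A W}

lemma GRModule.tri_offDiag (B : GRModule A W) {w' : Module.Dual ℂ W} (hw : w' ∈ B.gradedDual)
    {ι : Type*} [Fintype ι] [DecidableEq ι] {i j k : ι} (hik : i ≠ k) (hjk : j ≠ k) (hij : i ≠ j)
    {N : ι × ι → ℕ} {u₁ u₂ : V} {w : W} (h₁ : ∀ n : ℤ, N (i, k) ≤ n → B.mode n u₁ w = 0)
    (h₂ : ∀ n : ℤ, N (j, k) ≤ n → B.mode n u₂ w = 0)
    (h₃ : ∀ n : ℤ, N (i, j) ≤ n → A.mode n u₁ u₂ = 0) :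
    ∃ P : MvPolynomial ι ℂ, ∀ z : ι → ℂ, Function.Injective z →
      B.tri w' u₁ u₂ w (z i) (z j) (z k) = MvPolynomial.eval z P /
        ∏ p ∈ (Finset.univ : Finset ι).offDiag, (z p.1 - z p.2) ^ N p := by
  obtain ⟨Q, hQ⟩ := B.tri_poly hw h₁ h₂ h₃
  obtain ⟨P, hP⟩ := exists_offDiag_poles (MvPolynomial.rename ![i, j, k] Q)
    (S := {(i, k), (j, k), (i, j)}) (M := N) (N := N)
    (by intro p; simp only [Finset.mem_insert, Finset.mem_singleton, Finset.mem_offDiag]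
        rintro (rfl | rfl | rfl) <;> simp [hik, hjk, hij]) (fun _ _ => le_rfl)
  refine ⟨P, fun z hz => ?_⟩
  have hc : z ∘ ![i, j, k] = ![z i, z j, z k] := by funext a; fin_cases a <;> rfl
  rw [hQ _ _ _ (hz.ne hik) (hz.ne hjk) (hz.ne hij), ← hP z hz, MvPolynomial.eval_rename, hc,
    Finset.prod_insert (by simp [hij, hjk.symm]), Finset.prod_insert (by simp [hjk.symm]),
    Finset.prod_singleton, mul_assoc]

variable {f : V →ₗ[ℂ] W}

lemma GRModule.hasSum_corr_expElt (B : GRModule A W) {w' : Module.Dual ℂ W}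
    (hw : w' ∈ B.gradedDual) (u₁ u₂ : V) (w : W) {z₁ z₂ z₃ : ℂ} (h₁ : ‖z₃‖ < ‖z₁‖)
    (h₂ : ‖z₃‖ < ‖z₂‖) (h₁₂ : z₁ ≠ z₂) (h₃ : 0 < ‖z₃‖) :
    HasSum (fun q : ℤ => B.corr w' u₁ u₂ (B.tg.expElt w z₃ q : W) z₁ z₂)
      (B.tri w' u₁ u₂ w z₁ z₂ z₃) := by
  have n1 : z₁ ≠ 0 := norm_pos_iff.1 (h₃.trans h₁)
  have n2 : z₂ ≠ 0 := norm_pos_iff.1 (h₃.trans h₂)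
  have n13 : z₁ ≠ z₃ := fun h => by simp [h] at h₁
  have n23 : z₂ ≠ z₃ := fun h => by simp [h] at h₂
  refine B.tg.hasSum_expElt (φ := fun w => B.corr w' u₁ u₂ w z₁ z₂)
    (Q := fun w => B.tri w' u₁ u₂ w z₁ z₂ z₃) (fun x y => B.corr_add_vec hw u₁ u₂ x y n1 n2 h₁₂)
    (fun c x => ?_) (fun x y => B.tri_add_vec hw u₁ u₂ x y n13 n23 h₁₂)
    (fun x => B.hasSum_tri_vec hw u₁ u₂ x h₁ h₂ h₁₂)
  refine B.corr_eq hw (R := fun a b => c * B.corr w' u₁ u₂ x a b)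
    ((RatOn.const c).mul (B.isCorr_corr hw u₁ u₂ x).1) (fun a b hb hab => ?_) n1 n2 h₁₂
  refine ((B.hasSum_corr hw u₁ u₂ x hb hab).mul_left c).of_eq (fun p => ?_) rfl
  simp only [map_smul, smul_eq_mul]
  ring

/-- Inner sum: there is one block of three vectors, and `w' ∘ f` lies in the graded dual of `V`, so
only finitely many degrees contribute to a three-point function of `V`. Outer sum:
`Y_W(v₁)Y_W(v₂)e^{z₃L(-1)}f(v₃)` is a three-point function of `W`. The outer pole bound for `(u, v)`
is the larger of the truncation orders of `Y_V(u)v` and `Y_W(u)f(v)`. -/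
lemma IsGradedMap.oneCochain_composable (hf : IsGradedMap B f) (S₀ : Set ℂ) (S : Fin 2 → Set ℂ) :
    (oneCochain B f).Composable 2 S₀ S where
  inner := by
    choose N hN using A.field.exists_trunc
    refine ⟨N, fun l hl hsum v w' hw => ?_⟩
    obtain rfl : l = fun _ => 3 := by
      rw [Fin.sum_univ_one] at hsum
      funext i
      obtain rfl : i = 0 := Subsingleton.elim _ _
      exact hsum
    obtain ⟨P, hP⟩ := A.adjoint.tri_offDiag (hf.dual_mem hw) (ι := Σ _ : Fin 1, Fin 3)
      (i := ⟨0, 0⟩) (j := ⟨0, 1⟩) (k := ⟨0, 2⟩) (by decide) (by decide) (by decide)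
      (N := fun p => N (v p.1) (v p.2)) (hN _ _) (hN _ _) (hN _ _)
    refine ⟨P, fun z _ hz ζ _ _ => ?_⟩
    have hne : ∀ a b : Fin 3, a ≠ b → z ⟨0, a⟩ - ζ 0 ≠ z ⟨0, b⟩ - ζ 0 := fun a b hab h =>
      hab (by simpa using hz (sub_left_injective h))
    have h := A.hasSum_pairing (A.tg.expDual_mem (hf.dual_mem hw) (ζ 0))
      (elementE A.toGrading A.mode 3 (fun p => v ⟨0, p⟩) A.one (fun p => z ⟨0, p⟩ - ζ 0))
    rw [A.pairing_elementE_three _ (hne 0 2 (by decide)) (hne 1 2 (by decide))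
      (hne 0 1 (by decide)) (A.tg.expDual_mem (hf.dual_mem hw) (ζ 0))] at h
    rw [← hP z hz, ← (Equiv.funUnique (Fin 1) ℤ).symm.hasSum_iff]
    refine h.of_eq (fun r => ?_) (A.adjoint.tri_expDual (hf.dual_mem hw) _ _ _ _ _ _ (ζ 0)).symm
    simp only [Function.comp_apply]
    rw [oneCochain_matEl hw, ← hf.expDual hw]
    rfl
  outer := by
    choose N hN using A.field.exists_trunc
    choose N' hN' using B.field.exists_trunc
    refine ⟨fun u v => max (N u v) (N' u (f v)), fun v w' hw => ?_⟩
    obtain ⟨P, hP⟩ := B.tri_offDiag hw (ι := Fin 2 ⊕ Fin 1)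
      (i := Sum.inl 0) (j := Sum.inl 1) (k := Sum.inr 0) (by decide) (by decide) (by decide)
      (u₁ := v (Sum.inl 0)) (u₂ := v (Sum.inl 1)) (w := f (v (Sum.inr 0)))
      (N := fun p => max (N (v p.1) (v p.2)) (N' (v p.1) (f (v p.2))))
      (fun n hn => hN' _ _ n (by push_cast at hn; exact (le_max_right _ _).trans hn))
      (fun n hn => hN' _ _ n (by push_cast at hn; exact (le_max_right _ _).trans hn))
      (fun n hn => hN _ _ n (by push_cast at hn; exact (le_max_left _ _).trans hn))
    refine ⟨P, fun z _ _ hz h0 hlt => ?_⟩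
    have hn : ∀ i, z (Sum.inl i) ≠ 0 := fun i => norm_pos_iff.1 ((h0 0).trans (hlt i 0))
    have h01 : z (Sum.inl 0) ≠ z (Sum.inl 1) := hz.ne (by decide)
    rw [← hP z hz]
    refine (B.hasSum_corr_expElt hw _ _ _ (hlt 0 0) (hlt 1 0) h01 (h0 0)).of_eq (fun q => ?_) rfl
    rw [B.pairing_elementE_two _ _ (hn 0) (hn 1) h01 hw, oneCochain_val]
    rfl

lemma IsGradedMap.oneCochain_mem {M : Type*} [TopologicalSpace M] [ChartedSpace ℂ M]
    (F : CurveFoliation M) (𝒰 : Set (Set M)) (hf : IsGradedMap B f) :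
    oneCochain B f ∈ cochains F 𝒰 B 1 2 :=
  ⟨oneCochain_isRational, hf.oneCochain_lDerivative, hf.oneCochain_lConjugation,
    fun s h1 h2 => absurd h2 (by lia), fun _ _ _ _ _ _ => hf.oneCochain_composable _ _⟩

/-- The coboundary `u, v ↦ Y_W(u, z)f(v) - f(Y_V(u, z)v) + Y_{WV}^W(f(u), z)v`. -/
def IsGradedMap.deltaOne (hf : IsGradedMap B f) : FieldMap A.tg A.tg B.tg where
  mode n := (B.mode n).compl₂ f - (A.mode n).compr₂ f + ((intertwining B).mode n).comp f
  weight n k l u x hu hx :=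
    Submodule.add_mem _ (Submodule.sub_mem _
      (B.mode_weight n k l u _ hu (hf.map_gr l x hx))
      (hf.map_gr _ _ (A.mode_weight n k l u x hu hx)))
      ((intertwining B).weight n k l _ x (hf.map_gr k u hu) hx)
  deriv_left n u x := by
    have h1 := B.Lm1_derivative n u (f x)
    have h2 := congrArg f (A.field.deriv_left n u x)
    have h3 := (intertwining B).deriv_left n (f u) x
    simp only [LinearMap.add_apply, LinearMap.sub_apply, LinearMap.compl₂_apply,
      LinearMap.compr₂_apply, LinearMap.comp_apply, hf.map_Lm1] at *
    rw [h1, h2, h3, map_smul, smul_add, smul_sub]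
  bracket n u x := by
    have h1 := B.Lm1_bracket n u (f x)
    have h2 := congrArg f (A.field.bracket n u x)
    have h3 := (intertwining B).bracket n (f u) x
    simp only [LinearMap.add_apply, LinearMap.sub_apply, LinearMap.compl₂_apply,
      LinearMap.compr₂_apply, LinearMap.comp_apply, hf.map_Lm1, map_sub, map_add,
      map_smul] at *
    rw [smul_add, smul_sub, ← h1, ← h2, ← h3]
    abel

lemma IsGradedMap.deltaOne_mode (hf : IsGradedMap B f) (n : ℤ) (u v : V) :
    hf.deltaOne.mode n u v =
      B.mode n u (f v) - f (A.mode n u v) + intertwiningMode B n (f u) v :=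
  rfl

lemma IsGradedMap.deltaOne_lau (hf : IsGradedMap B f) {w' : Module.Dual ℂ W}
    (hw : w' ∈ B.gradedDual) (u v : V) {z : ℂ} (hz : z ≠ 0) :
    hf.deltaOne.lau w' u v z = B.field.lau w' u (f v) z - A.field.lau (w'.comp f) u v z +
      B.field.e2 w' v (f u) 0 z := by
  rw [← lau_intertwining B hw _ _ hz]
  refine (hf.deltaOne.hasSum_lau hw u v z).unique
    ((((B.field.hasSum_lau hw u (f v) z).sub (A.field.hasSum_lau (hf.dual_mem hw) u v z)).add
      ((intertwining B).hasSum_lau hw (f u) v z)).of_eq (fun n => ?_) rfl)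
  rw [hf.deltaOne_mode, map_add, map_sub, add_mul, sub_mul]
  rfl

lemma IsGradedMap.deltaOne_e2 (hf : IsGradedMap B f) {w' : Module.Dual ℂ W}
    (hw : w' ∈ B.gradedDual) (u v : V) {z₁ z₂ : ℂ} (hz : z₁ ≠ z₂) :
    hf.deltaOne.e2 w' u v z₁ z₂ = B.field.e2 w' u (f v) z₁ z₂ -
      A.field.e2 (w'.comp f) u v z₁ z₂ + B.field.e2 w' v (f u) z₂ z₁ := by
  have h := B.field.e2_expDual hw v (f u) z₂ z₁ z₂
  rw [FieldMap.e2, hf.deltaOne_lau (B.tg.expDual_mem hw z₂) u v (sub_ne_zero.2 hz),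
    hf.expDual hw, ← h, sub_self]
  rfl

lemma hasSum_lau_expElt {w' : Module.Dual ℂ W} (hw : w' ∈ B.gradedDual) (u : V) (w : W)
    {z s : ℂ} (h : ‖s‖ < ‖z‖) :
    HasSum (fun q : ℤ => B.field.lau w' u (B.tg.expElt w s q : W) z) (B.field.e2 w' u w z s) :=
  B.tg.hasSum_expElt (φ := fun w => B.field.lau w' u w z) (Q := fun w => B.field.e2 w' u w z s)
    (fun x y => B.field.lau_add_right hw u x y z) (fun c x => B.field.lau_smul_right hw c u x z)
    (fun x y => B.field.lau_add_right (B.tg.expDual_mem hw s) u x y (z - s))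
    (fun x => B.field.hasSum_lau_exp hw u x h)

lemma tsum_actAt_oneCochain {w' : Module.Dual ℂ W} (hw : w' ∈ B.gradedDual) (u v : V)
    {z s : ℂ} (h : ‖s‖ < ‖z‖) :
    ∑' q : ℤ, actAt B w' u z 0 ((oneCochain B f).val ![v] ![s] q : W) =
      B.field.e2 w' u (f v) z s := by
  refine HasSum.tsum_eq ((hasSum_lau_expElt hw u (f v) h).of_eq (fun q => ?_) rfl)
  rw [actAt_eq B hw, B.field.e2_zero hw, oneCochain_val]
  rfl

/-- Each of the three rational extensions is a translated field matrix element with poles only at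
`z₁ = z₂`, computed from its expansion in one region. Their signed sum is the cochain of `deltaOne`,
and a cochain is determined by its matrix elements. -/
lemma IsGradedMap.isDeltaOne_iff (hf : IsGradedMap B f) {Θ : PreCochain B 2} :
    IsDeltaOne (oneCochain B f) Θ ↔ Θ = hf.deltaOne.cochain := by
  have key : ∀ v₁ v₂ : V, ∀ w' ∈ B.gradedDual, ∀ z : Fin 2 → ℂ, Function.Injective z →
      ratExt {x | 0 < ‖x 1‖ ∧ ‖x 1‖ < ‖x 0‖}
        (fun x => ∑' q : ℤ, actAt B w' v₁ (x 0) 0 ((oneCochain B f).val ![v₂] ![x 1] q : W)) z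
      - ratExt {x | x 0 ≠ x 1} (fun x => ∑' n : ℤ,
          (oneCochain B f).matEl w' ![A.mode n v₁ v₂] ![x 1] * (x 0 - x 1) ^ (-n - 1)) z
      + ratExt {x | 0 < ‖x 0‖ ∧ ‖x 0‖ < ‖x 1‖}
        (fun x => ∑' q : ℤ, actAt B w' v₂ (x 1) 0 ((oneCochain B f).val ![v₁] ![x 0] q : W)) z
      = hf.deltaOne.cochain.matEl w' ![v₁, v₂] z := by
    intro v₁ v₂ w' hw z hz
    have h01 := injective_two.1 hz
    have hd : ∀ x : Fin 2 → ℂ, x 0 ≠ x 1 →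
        MvPolynomial.eval x (MvPolynomial.X 0 - MvPolynomial.X 1) ≠ 0 := fun x hx => by
      simpa [sub_ne_zero] using hx
    have hlt : ∀ {a b : ℂ}, ‖a‖ < ‖b‖ → b ≠ a := fun h e => by simp [e] at h
    rw [hf.deltaOne.cochain_matEl hw _ h01]
    simp only [Matrix.cons_val_zero, Matrix.cons_val_one]
    rw [hf.deltaOne_e2 hw _ _ h01]
    congr 1
    congr 1
    · exact (B.field.e2_ratOn hw v₁ (f v₂)).ratExt_eq (z₀ := ![2, 1]) eventually_norm_lt
        (fun x hx => ⟨hd x (hlt hx.2), tsum_actAt_oneCochain hw v₁ v₂ hx.2⟩) (hd z h01)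
    · refine (A.field.e2_ratOn (hf.dual_mem hw) v₁ v₂).ratExt_eq (z₀ := ![2, 1])
        (Filter.mem_of_superset eventually_norm_lt fun x hx => hlt hx.2)
        (fun x hx => ⟨hd x hx, ?_⟩) (hd z h01)
      rw [FieldMap.e2, ← hf.expDual hw]
      refine HasSum.tsum_eq ((A.field.hasSum_lau (hf.dual_mem (B.tg.expDual_mem hw (x 1)))
        v₁ v₂ (x 0 - x 1)).of_eq (fun n => ?_) rfl)
      rw [oneCochain_matEl hw]
      rfl
    · have h2 : RatOn (MvPolynomial.X 0 - MvPolynomial.X 1 : MvPolynomial (Fin 2) ℂ)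
          fun z => B.field.e2 w' v₂ (f v₁) (z 1) (z 0) := by
        refine ((B.field.e2_ratOn hw v₂ (f v₁)).comp
          ![MvPolynomial.X 1, MvPolynomial.X 0]).mono ?_ |>.congr fun z _ => ?_
        · exact ⟨-1, by simp⟩
        · simp
      refine h2.ratExt_eq (z₀ := ![1, 2]) ?_
        (fun x hx => ⟨hd x (hlt hx.2).symm, tsum_actAt_oneCochain hw v₂ v₁ hx.2⟩) (hd z h01)
      have hc : ∀ i : Fin 2, Continuous fun x : Fin 2 → ℂ => ‖x i‖ := fun i => by fun_prop
      exact ((isOpen_lt continuous_const (hc 0)).inter (isOpen_lt (hc 0) (hc 1))).mem_nhds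
        (by constructor <;> simp)
  have hv : ∀ v : Fin 2 → V, v = ![v 0, v 1] := fun v => by funext i; fin_cases i <;> rfl
  constructor
  · intro h
    refine PreCochain.ext_matEl fun v w' hw z hz => ?_
    rw [hv v, h _ _ w' hw z hz, key _ _ w' hw z hz]
  · rintro rfl v₁ v₂ w' hw z hz
    exact (key v₁ v₂ w' hw z hz).symm

lemma FieldMap.cochain_sub_eq_iff {ψ₁ ψ₂ ψ : FieldMap A.tg A.tg B.tg} :
    ψ₁.cochain - ψ₂.cochain = ψ.cochain ↔
      ∀ n u v, ψ₁.mode n u v = ψ₂.mode n u v + ψ.mode n u v := by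
  -- The sum of the two fields is itself a field, so equality of modes follows from equality of
  -- Laurent series at `z = 1`.
  let σ : FieldMap A.tg A.tg B.tg :=
    { mode := fun n => ψ₂.mode n + ψ.mode n
      weight := fun n k l u x hu hx =>
        Submodule.add_mem _ (ψ₂.weight n k l u x hu hx) (ψ.weight n k l u x hu hx)
      deriv_left := fun n u x => by
        simp only [LinearMap.add_apply, ψ₂.deriv_left, ψ.deriv_left, smul_add]
      bracket := fun n u x => by
        simp only [LinearMap.add_apply, map_add, smul_add, ← ψ₂.bracket, ← ψ.bracket]
        abel }
  have hσ : ∀ w' ∈ B.gradedDual, ∀ u v z, σ.lau w' u v z = ψ₂.lau w' u v z + ψ.lau w' u v z :=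
    fun w' hw u v z => (σ.hasSum_lau hw u v z).unique
      (((ψ₂.hasSum_lau hw u v z).add (ψ.hasSum_lau hw u v z)).of_eq
        (fun n => by rw [← add_mul, ← map_add]; rfl) rfl)
  constructor
  · intro h n u v
    suffices hs : ∀ u v, ψ₁.mode n u v = σ.mode n u v from hs u v
    refine fun u v => LinearMap.congr_fun (A.linearMap_ext (fun k u hu =>
      LinearMap.ext (A.linearMap_ext fun l v hv => ?_)) u) v
    refine FieldMap.mode_eq_of_lau ψ₁ σ hu hv hu hv rfl (fun w' hw => ?_) n
    have h01 : Function.Injective ![(1 : ℂ), 0] := injective_two.2 (by simp)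
    have h1 := congrArg (fun Φ => Φ.matEl w' ![u, v] ![1, 0]) h
    rw [PreCochain.matEl_sub _ _ hw _ h01, ψ₁.cochain_matEl hw _ (by simp),
      ψ₂.cochain_matEl hw _ (by simp), ψ.cochain_matEl hw _ (by simp)] at h1
    simp only [Matrix.cons_val_zero, Matrix.cons_val_one, ψ₁.e2_zero hw, ψ₂.e2_zero hw,
      ψ.e2_zero hw] at h1
    rw [hσ w' hw]
    linear_combination h1
  · intro h
    refine PreCochain.ext_matEl fun v w' hw z hz => ?_
    have h01 := injective_two.1 hz
    have h1 : ψ₁.e2 w' (v 0) (v 1) (z 0) (z 1) = σ.e2 w' (v 0) (v 1) (z 0) (z 1) :=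
      tsum_congr fun n => by rw [h]; rfl
    have h2 := hσ _ (B.tg.expDual_mem hw (z 1)) (v 0) (v 1) (z 0 - z 1)
    rw [PreCochain.matEl_sub _ _ hw _ hz, ψ₁.cochain_matEl hw _ h01,
      ψ₂.cochain_matEl hw _ h01, ψ.cochain_matEl hw _ h01, h1]
    exact sub_eq_iff_eq_add'.2 h2

lemma FieldMap.cohomologous_iff {M : Type*} [TopologicalSpace M] [ChartedSpace ℂ M]
    (F : CurveFoliation M) (𝒰 : Set (Set M)) {ψ₁ ψ₂ : FieldMap A.tg A.tg B.tg} :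
    Cohomologous F 𝒰 B ψ₁.cochain ψ₂.cochain ↔ ∃ f : V →ₗ[ℂ] W, IsGradedMap B f ∧
      ∀ n u v, ψ₁.mode n u v = ψ₂.mode n u v +
        (B.mode n u (f v) - f (A.mode n u v) + intertwiningMode B n (f u) v) := by
  constructor
  · rintro ⟨χ, hχ, h⟩
    obtain ⟨f, hf, rfl⟩ := PreCochain.exists_eq_oneCochain hχ.2.1 hχ.2.2.1
    exact ⟨f, hf, cochain_sub_eq_iff.1 (hf.isDeltaOne_iff.1 h)⟩
  · rintro ⟨f, hf, h⟩
    exact ⟨oneCochain B f, hf.oneCochain_mem F 𝒰,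
      hf.isDeltaOne_iff.2 (cochain_sub_eq_iff (ψ := hf.deltaOne).2 h)⟩

end OneCochains

/-! ### Equivalence of extensions -/

namespace GRVertexAlgebra

variable {V : Type*} [AddCommGroup V] [Module ℂ V]

/-- The vacuum is determined by the modes: the product `1(-1)1'` of the two vacua is `1'` by the
identity property of one and `1` by the creation property of the other. -/
lemma eq_of_mode {A A' : GRVertexAlgebra V} (hg : ∀ n, A.gr n = A'.gr n)
    (hm : ∀ n x y, A.mode n x y = A'.mode n x y) : A = A' := by
  have h1 : A.one = A'.one := by
    rw [← (A'.creation A.one).2, ← hm, A.identity, if_pos rfl]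
  replace hg : A.gr = A'.gr := funext hg
  replace hm : A.mode = A'.mode := by ext; apply hm
  obtain ⟨⟨g, _, _, _⟩, m, o⟩ := A
  obtain ⟨⟨g', _, _, _⟩, m', o'⟩ := A'
  simp only at h1 hg hm
  subst h1 hg hm
  rfl

/-- The image of the vacuum acts as the identity on the image of `f`, which is everything; applied
to the vacuum of the target it gives `f(1) = 1`. -/
lemma isHom_of_surjective {V' : Type*} [AddCommGroup V'] [Module ℂ V'] {A : GRVertexAlgebra V}
    {A' : GRVertexAlgebra V'} {f : V →ₗ[ℂ] V'} (hg : ∀ n, ∀ x ∈ A.gr n, f x ∈ A'.gr n)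
    (hm : ∀ n x y, f (A.mode n x y) = A'.mode n (f x) (f y)) (hf : Function.Surjective f) :
    A.IsHom A' f := by
  refine ⟨hg, ?_, hm⟩
  obtain ⟨x, hx⟩ := hf A'.one
  have h := hm (-1) A.one x
  rwa [A.identity, if_pos rfl, hx, (A'.creation _).2, eq_comm] at h

lemma IsHom.symm {V' : Type*} [AddCommGroup V'] [Module ℂ V'] {A : GRVertexAlgebra V}
    {A' : GRVertexAlgebra V'} {f : V ≃ₗ[ℂ] V'} (h : A.IsHom A' f.toLinearMap) :
    A'.IsHom A f.symm.toLinearMap := by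
  have hL : ∀ x, f (A.L0 x) = A'.L0 (f x) :=
    A.linearMap_ext (f := f.toLinearMap ∘ₗ A.L0) (g := A'.L0 ∘ₗ f.toLinearMap) fun n x hx => by
      rw [LinearMap.comp_apply, LinearMap.comp_apply, A.L0_of_mem hx,
        A'.L0_of_mem (h.map_gr n x hx), map_smul]
  refine isHom_of_surjective (fun n x hx => A.mem_gr_of_L0 (f.injective ?_)) (fun n x y => ?_)
    f.symm.surjective
  · simp [hL, A'.L0_of_mem hx]
  · have := h.map_mode n (f.symm x) (f.symm y)
    simp only [LinearEquiv.coe_coe, LinearEquiv.apply_symm_apply] at this ⊢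
    rw [← this, LinearEquiv.symm_apply_apply]

end GRVertexAlgebra

section Equivalences

variable {V : Type u} [AddCommGroup V] [Module ℂ V] {A : GRVertexAlgebra V}
  {W : Type v} [AddCommGroup W] [Module ℂ W] {B : GRModule A W}

lemma SquareZeroExtension.equivalence_equivalent :
    Equivalence (SquareZeroExtension.Equivalent (B := B)) where
  refl X := ⟨LinearEquiv.refl ℂ X.E, ⟨fun _ _ h => h, rfl, fun _ _ _ => rfl⟩, fun _ => rfl,
    fun _ => rfl⟩
  symm := by
    rintro X Y ⟨h, hh, hα, hγ⟩
    refine ⟨h.symm, hh.symm, fun w => ?_, fun x => ?_⟩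
    · rw [← hα, h.symm_apply_apply]
    · rw [← hγ, h.apply_symm_apply]
  trans := by
    rintro X Y Z ⟨h, hh, hα, hγ⟩ ⟨k, hk, kα, kγ⟩
    refine ⟨h.trans k, ⟨fun n x hx => hk.map_gr n _ (hh.map_gr n x hx), ?_, fun n x y => ?_⟩,
      fun w => ?_, fun x => ?_⟩
    · exact (congrArg k hh.map_one).trans hk.map_one
    · exact (congrArg k (hh.map_mode n x y)).trans (hk.map_mode n _ _)
    · simp [hα, kα]
    · simp [hγ, kγ]

namespace FieldMap

variable {ψ ψ₁ ψ₂ : FieldMap A.tg A.tg B.tg} {T T₁ T₂ : Module.Dual ℂ W → V → V → V → ℂ → ℂ → ℂ → ℂ}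

/-- Convergence of a Laurent series over `ℤ` does not bound its pole. The truncation axiom of `C`
does, and then uniqueness of power series identifies the modes. The model is thus unique, and the
statements about it do not depend on a choice. -/
lemma HasTriple.eq_extension (hT : ψ.HasTriple T) {C : GRVertexAlgebra (V × W)}
    (h : IsExtensionOf ψ.cochain C) : C = hT.extension := by
  obtain ⟨hg, φ, hφ, hm⟩ := h
  refine GRVertexAlgebra.eq_of_mode hg fun n x y => ?_
  obtain ⟨v₁, w₁⟩ := x
  obtain ⟨v₂, w₂⟩ := y
  suffices hs : φ n v₁ v₂ = ψ.mode n v₁ v₂ by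
    rw [hm, hs]
    rfl
  refine B.ext_gradedDual fun w' hw => ?_
  obtain ⟨N, hN⟩ := ψ.exists_trunc v₁ v₂
  obtain ⟨K, hK⟩ := C.lower_truncation (v₁, 0) (v₂, 0)
  have hφ0 : ∀ n ≥ K, φ n v₁ v₂ = 0 := fun n hn => by
    have h1 := congrArg Prod.snd ((hm n v₁ 0 v₂ 0).symm.trans (hK n hn))
    have h2 : intertwiningMode B n 0 v₂ = 0 := by
      rw [← intertwining_mode, map_zero, LinearMap.zero_apply]
    simpa [h2] using h1
  set b : ℕ := max N K.toNat with hb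
  have hne : ∀ᶠ t in 𝓝[≠] (0 : ℂ), t ≠ 0 := eventually_mem_nhdsWithin
  have h1 : ∀ᶠ t in 𝓝[≠] (0 : ℂ), HasSum (fun j : ℕ => w' (φ (b - 1 - j) v₁ v₂) * t ^ j)
      (t ^ b * ψ.lau w' v₁ v₂ t) := by
    filter_upwards [hne] with t ht
    refine hasSum_nat_of_laurent (A := fun n => w' (φ n v₁ v₂))
      (fun n hn => by rw [hφ0 n (by lia), map_zero]) ht ?_
    have := hφ v₁ v₂ w' hw t ht
    rw [ψ.cochain_matEl hw _ (by simpa using ht)] at this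
    exact this.of_eq (fun _ => rfl) (ψ.e2_zero hw v₁ v₂ t).symm
  have h2 : ∀ᶠ t in 𝓝[≠] (0 : ℂ), HasSum (fun j : ℕ => w' (ψ.mode (b - 1 - j) v₁ v₂) * t ^ j)
      (t ^ b * ψ.lau w' v₁ v₂ t) := by
    filter_upwards [hne] with t ht
    exact hasSum_nat_of_laurent (A := fun n => w' (ψ.mode n v₁ v₂))
      (fun n hn => by rw [hN n (by lia), map_zero]) ht (ψ.hasSum_lau hw v₁ v₂ t)
  rcases le_or_gt (b : ℤ) n with hn | hn
  · rw [hφ0 n (by lia), hN n (by lia)]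
  · have := congrFun (hasSum_pow_unique h1 h2) (b - 1 - n).toNat
    rwa [show (b : ℤ) - 1 - ((b - 1 - n).toNat : ℤ) = n by lia] at this

/-- A map compatible with the projection and the inclusion is `(v, w) ↦ (v, f(v) + w)`. Comparing
products of `(u, 0)` and `(v, 0)` gives the coboundary equation, and conversely that equation is the
only condition on products. Preservation of the vacuum makes `f` commute with `L(-1)`. -/
lemma HasTriple.equivalent_iff (hT₁ : ψ₁.HasTriple T₁) (hT₂ : ψ₂.HasTriple T₂) :
    (SquareZeroExtension.ofSum hT₁.extension hT₁.isSquareZeroExtension).Equivalent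
      (SquareZeroExtension.ofSum hT₂.extension hT₂.isSquareZeroExtension) ↔
    ∃ f : V →ₗ[ℂ] W, IsGradedMap B f ∧ ∀ n u v, ψ₁.mode n u v = ψ₂.mode n u v +
      (B.mode n u (f v) - f (A.mode n u v) + intertwiningMode B n (f u) v) := by
  constructor
  · rintro ⟨h, hh, hα, hγ⟩
    change (V × W) ≃ₗ[ℂ] (V × W) at h
    replace hα : ∀ w, h (0, w) = (0, w) := hα
    replace hγ : ∀ x, (h x).1 = x.1 := hγ
    let f : V →ₗ[ℂ] W := LinearMap.snd ℂ V W ∘ₗ h.toLinearMap ∘ₗ LinearMap.inl ℂ V W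
    have hf : ∀ x, h x = (x.1, f x.1 + x.2) := fun x => by
      have e : x = (x.1, 0) + (0, x.2) := by simp
      refine Prod.ext (hγ x) ?_
      conv_lhs => rw [e, map_add, hα]
      rfl
    have hmode : ∀ n x y, h (ψ₁.extMode n x y) = ψ₂.extMode n (h x) (h y) := hh.map_mode
    refine ⟨f, ⟨fun n v hv => (hh.map_gr n (v, 0) ⟨hv, zero_mem _⟩).2, fun v => ?_⟩,
      fun n u v => ?_⟩
    · have hone : h hT₁.extension.one = hT₂.extension.one := hh.map_one
      have h2 : h (hT₁.extension.Lm1 (v, 0)) = hT₂.extension.Lm1 (h (v, 0)) := by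
        have := hmode (-2) (v, 0) hT₁.extension.one
        rw [hone] at this
        exact this
      rw [hT₁.extension_Lm1, hT₂.extension_Lm1, hf, hf] at h2
      simpa using congrArg Prod.snd h2
    · have := congrArg Prod.snd (hmode n (u, 0) (v, 0))
      rw [hf, hf, hf, ψ₁.extMode_apply, ψ₂.extMode_apply] at this
      simp only [map_zero, LinearMap.zero_apply, add_zero, zero_add] at this
      rw [intertwining_mode] at this
      rw [← sub_eq_zero, ← sub_eq_zero.2 this]
      abel
  · rintro ⟨f, hf, hψ⟩
    let h : (V × W) ≃ₗ[ℂ] (V × W) := LinearEquiv.ofLinearMap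
      ((LinearMap.fst ℂ V W).prod (f ∘ₗ LinearMap.fst ℂ V W + LinearMap.snd ℂ V W))
      ((LinearMap.fst ℂ V W).prod (LinearMap.snd ℂ V W - f ∘ₗ LinearMap.fst ℂ V W))
      (LinearMap.ext fun x => Prod.ext rfl (by simp))
      (LinearMap.ext fun x => Prod.ext rfl (by simp))
    have hh : ∀ x, h x = (x.1, f x.1 + x.2) := fun x => rfl
    have hmode : ∀ n x y, h (ψ₁.extMode n x y) = ψ₂.extMode n (h x) (h y) := fun n x y => by
      rw [hh, hh, hh, ψ₁.extMode_apply, ψ₂.extMode_apply]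
      refine Prod.ext rfl ?_
      simp only [hψ, map_add, LinearMap.add_apply, intertwining_mode]
      abel
    refine ⟨h, GRVertexAlgebra.isHom_of_surjective (fun n x hx => ?_) hmode h.surjective,
      fun w => ?_, fun x => rfl⟩
    · exact ⟨hx.1, add_mem (hf.map_gr n _ hx.1) hx.2⟩
    · change h (0, w) = (0, w)
      simp [hh]

end FieldMap

/-! ### Comparison of an extension with its model on `V ⊕ W` -/

namespace SquareZeroExtension.IsRealization

variable {X : SquareZeroExtension B} {Γ : V →ₗ[ℂ] X.E} (hΓ : X.IsRealization Γ)

/-- The component `w, v ↦ Y_E(α w, z)Γ v` of the vertex operators of an extension. -/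
def alphaField : FieldMap B.tg A.tg B.tg where
  mode n := ((X.alg.mode n).compl₁₂ X.α Γ).compr₂ hΓ.ret
  weight n k l u x hu hx :=
    hΓ.ret_mem (X.alg.mode_weight n k l _ _ (X.isExt.map_gr k u hu) (hΓ.map_gr l x hx))
  deriv_left n u x := by
    change hΓ.ret (X.alg.mode n (X.α (B.Lm1 u)) (Γ x)) =
      (-(n : ℂ)) • hΓ.ret (X.alg.mode (n - 1) (X.α u) (Γ x))
    rw [X.isExt.map_Lm1, ← map_smul]
    exact congrArg _ (X.alg.Lm1_derivative n (X.α u) (Γ x))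
  bracket n u x := by
    change B.Lm1 (hΓ.ret (X.alg.mode n (X.α u) (Γ x))) -
      hΓ.ret (X.alg.mode n (X.α u) (Γ (A.Lm1 x))) =
      (-(n : ℂ)) • hΓ.ret (X.alg.mode (n - 1) (X.α u) (Γ x))
    rw [← hΓ.Lm1_section, ← hΓ.ret_Lm1, ← map_smul, ← map_sub]
    exact congrArg _ (X.alg.Lm1_bracket n (X.α u) (Γ x))

lemma mode_section_alpha (hΓ : X.IsRealization Γ) (n : ℤ) (v : V) (w : W) :
    X.alg.mode n (Γ v) (X.α w) = X.α (B.mode n v w) := by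
  rw [← X.isExt.map_mode, hΓ.isSection]

/-- Skew-symmetry in `E` rewrites `Y_E(αw, z)Γv` as `e^{zL(-1)}Y_E(Γv, -z)αw`, and there `Y_E(Γv)α`
is the module action. Hence the left action of the ideal is forced to be `Y_{WV}^W`. -/
lemma alphaField_mode (n : ℤ) (w : W) (v : V) :
    hΓ.alphaField.mode n w v = intertwiningMode B n w v := by
  rw [← intertwining_mode]
  refine LinearMap.congr_fun (B.linearMap_ext (fun k w hw =>
    LinearMap.ext (A.linearMap_ext fun l v hv => ?_)) w) v
  refine FieldMap.mode_eq_of_lau _ _ hw hv hw hv rfl (fun w' hw' => ?_) n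
  rw [lau_intertwining B hw' _ _ one_ne_zero]
  have h1 : hΓ.alphaField.lau w' w v 1 =
      X.alg.field.e2 (w'.comp hΓ.ret) (X.α w) (Γ v) 1 0 := by
    rw [X.alg.field.e2_zero (hΓ.ret_dual hw')]
    rfl
  rw [h1, X.alg.e2_symm (hΓ.ret_dual hw') _ _ one_ne_zero, FieldMap.e2, FieldMap.e2,
    hΓ.expDual_ret hw']
  refine tsum_congr fun m => ?_
  rw [LinearMap.comp_apply]
  change B.tg.expDual w' 1 (hΓ.ret (X.alg.mode m (Γ v) (X.α w))) * _ =
    B.tg.expDual w' 1 (B.mode m v w) * _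
  rw [hΓ.mode_section_alpha, hΓ.ret_alpha]

lemma mode_alpha_section (hΓ : X.IsRealization Γ) (n : ℤ) (w : W) (v : V) :
    X.alg.mode n (X.α w) (Γ v) = X.α (intertwiningMode B n w v) := by
  have h := hΓ.eq_add (X.alg.mode n (X.α w) (Γ v))
  rw [X.isExt.hom.map_mode, gamma_alpha, map_zero, LinearMap.zero_apply, map_zero, zero_add] at h
  rw [h, ← hΓ.alphaField_mode]
  rfl

/-- The comparison map is `(v, w) ↦ Γv + αw`, with inverse given by `γ` and the retraction. The four
products of parts are the defining one of `ψ`, the module action, its skew form, and zero. -/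
lemma equivalent {T : Module.Dual ℂ W → V → V → V → ℂ → ℂ → ℂ → ℂ} (hT : hΓ.psi.HasTriple T) :
    (ofSum hT.extension hT.isSquareZeroExtension).Equivalent X := by
  let h : (V × W) ≃ₗ[ℂ] X.E := LinearEquiv.ofLinearMap (Γ.coprod X.α) (X.γ.prod hΓ.ret)
    (LinearMap.ext fun e => (hΓ.eq_add e).symm)
    (LinearMap.ext fun x => Prod.ext
      (by simp [hΓ.isSection, gamma_alpha]) (by simp [hΓ.ret_section, hΓ.ret_alpha]))
  have hh : ∀ x, h x = Γ x.1 + X.α x.2 := fun x => rfl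
  have hmode : ∀ n x y, h (hΓ.psi.extMode n x y) = X.alg.mode n (h x) (h y) := fun n x y => by
    rw [hh, hh, hh, FieldMap.extMode_apply]
    simp only [map_add, LinearMap.add_apply]
    rw [hΓ.mode_section, hΓ.mode_section_alpha, hΓ.mode_alpha_section, intertwining_mode,
      X.isExt.square_zero n _ _ (gamma_alpha X x.2) (gamma_alpha X y.2)]
    abel
  have hγ : ∀ x, X.γ (h x) = x.1 := fun x => by simp [hh, hΓ.isSection, gamma_alpha]
  refine ⟨h, GRVertexAlgebra.isHom_of_surjective (fun n x hx => ?_) hmode h.surjective,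
    fun w => ?_, hγ⟩
  · exact add_mem (hΓ.map_gr n _ hx.1) (X.isExt.map_gr n _ hx.2)
  · change h (0, w) = X.α w
    simp [hh]

end SquareZeroExtension.IsRealization

/-! ### The bijection between extension classes and cohomology -/

variable {M : Type*} [TopologicalSpace M] [ChartedSpace ℂ M] [IsManifold 𝓘(ℂ, ℂ) ω M] [Nonempty M]
  {F : CurveFoliation M} {𝒰 : Set (Set M)}

lemma exists_hasTriple_of_mem (h𝒰 : F.IsTransversalBasis 𝒰) {Φ : PreCochain B 2}
    (hΦ : Φ ∈ exCocycles F 𝒰 B) : ∃ (ψ : FieldMap A.tg A.tg B.tg)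
      (T : Module.Dual ℂ W → V → V → V → ℂ → ℂ → ℂ → ℂ), ψ.HasTriple T ∧ Φ = ψ.cochain := by
  obtain ⟨hr, hd, hc, hs, -⟩ := hΦ.1.1
  obtain ⟨U, hU, hne⟩ := h𝒰.exists_nonempty
  have h := PreCochain.eq_cochain_psi hr hd hc
  have hsym := hs.isSymmetric hd hc hr
  rw [h] at hΦ
  obtain ⟨T, hT⟩ := FieldMap.exists_hasTriple hU hne hsym hΦ
  exact ⟨_, T, hT, h⟩

lemma cohomologous_iff_equivalent (h𝒰 : F.IsTransversalBasis 𝒰) {Φ₁ Φ₂ : PreCochain B 2}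
    (hΦ₁ : Φ₁ ∈ exCocycles F 𝒰 B) (hΦ₂ : Φ₂ ∈ exCocycles F 𝒰 B) {C₁ C₂ : GRVertexAlgebra (V × W)}
    (hC₁ : IsExtensionOf Φ₁ C₁) (hC₂ : IsExtensionOf Φ₂ C₂)
    (h₁ : IsSquareZeroExtension B C₁ (LinearMap.fst ℂ V W) (LinearMap.inr ℂ V W))
    (h₂ : IsSquareZeroExtension B C₂ (LinearMap.fst ℂ V W) (LinearMap.inr ℂ V W)) :
    Cohomologous F 𝒰 B Φ₁ Φ₂ ↔
      (SquareZeroExtension.ofSum C₁ h₁).Equivalent (SquareZeroExtension.ofSum C₂ h₂) := by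
  obtain ⟨ψ₁, T₁, hT₁, rfl⟩ := exists_hasTriple_of_mem h𝒰 hΦ₁
  obtain ⟨ψ₂, T₂, hT₂, rfl⟩ := exists_hasTriple_of_mem h𝒰 hΦ₂
  obtain rfl := hT₁.eq_extension hC₁
  obtain rfl := hT₂.eq_extension hC₂
  rw [FieldMap.cohomologous_iff, ← hT₁.equivalent_iff hT₂]

lemma exists_extension (h𝒰 : F.IsTransversalBasis 𝒰) {Φ : PreCochain B 2}
    (hΦ : Φ ∈ exCocycles F 𝒰 B) : ∃ C : GRVertexAlgebra (V × W), IsExtensionOf Φ C ∧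
      ∃ h : IsSquareZeroExtension B C (LinearMap.fst ℂ V W) (LinearMap.inr ℂ V W),
        (SquareZeroExtension.ofSum C h).Realizable := by
  obtain ⟨ψ, T, hT, rfl⟩ := exists_hasTriple_of_mem h𝒰 hΦ
  exact ⟨hT.extension, hT.isExtensionOf, hT.isSquareZeroExtension, hT.realizable⟩

lemma SquareZeroExtension.IsRealization.equivalent_ofSum (h𝒰 : F.IsTransversalBasis 𝒰)
    {X : SquareZeroExtension B} {Γ : V →ₗ[ℂ] X.E} (hΓ : X.IsRealization Γ)
    {C : GRVertexAlgebra (V × W)} (hC : IsExtensionOf hΓ.psi.cochain C)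
    (h : IsSquareZeroExtension B C (LinearMap.fst ℂ V W) (LinearMap.inr ℂ V W)) :
    (ofSum C h).Equivalent X := by
  obtain ⟨U, hU, hne⟩ := h𝒰.exists_nonempty
  obtain ⟨T, hT⟩ := FieldMap.exists_hasTriple hU hne hΓ.isSymmetric_psi (hΓ.cochain_mem F 𝒰)
  obtain rfl := hT.eq_extension hC
  exact hΓ.equivalent hT

/-- The map `[Φ] ↦ [V ⊕ W]` is well defined and injective because cohomologous cocycles are exactly
those with equivalent models. Reading equality of classes as equivalence uses that equivalence of
extensions is an equivalence relation; the corresponding fact for cocycles is not needed.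
Surjectivity holds because a realizable extension is equivalent to the model of its cocycle. -/
lemma exists_extensionClasses_equiv (h𝒰 : F.IsTransversalBasis 𝒰) :
    ∃ e : ExtensionClasses B ≃ ExCohomology F 𝒰 B,
      ∀ (Φ : exCocycles F 𝒰 B) (C : GRVertexAlgebra (V × W)), IsExtensionOf Φ.1 C →
        ∀ (h : IsSquareZeroExtension B C (LinearMap.fst ℂ V W) (LinearMap.inr ℂ V W))
          (hr : (SquareZeroExtension.ofSum C h).Realizable),
          e (Quot.mk _ ⟨SquareZeroExtension.ofSum C h, hr⟩) = Quot.mk _ Φ := by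
  choose C hC h hr using fun Φ : exCocycles F 𝒰 B => exists_extension h𝒰 Φ.2
  have hE : Equivalence fun X₁ X₂ : {X : SquareZeroExtension B // X.Realizable} =>
      X₁.1.Equivalent X₂.1 := SquareZeroExtension.equivalence_equivalent.comap Subtype.val
  let G : ExCohomology F 𝒰 B → ExtensionClasses B :=
    Quot.lift (fun Φ => Quot.mk _ ⟨SquareZeroExtension.ofSum (C Φ) (h Φ), hr Φ⟩)
      fun Φ₁ Φ₂ hc => Quot.sound
        ((cohomologous_iff_equivalent h𝒰 Φ₁.2 Φ₂.2 (hC Φ₁) (hC Φ₂) (h Φ₁) (h Φ₂)).1 hc)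
  have hG : Function.Bijective G := by
    refine ⟨?_, ?_⟩
    · rintro ⟨Φ₁⟩ ⟨Φ₂⟩ he
      exact Quot.sound ((cohomologous_iff_equivalent h𝒰 Φ₁.2 Φ₂.2 (hC Φ₁) (hC Φ₂) (h Φ₁)
        (h Φ₂)).2 ((hE.quot_mk_eq_iff _ _).1 he))
    · rintro ⟨X, Γ, hΓ⟩
      exact ⟨Quot.mk _ ⟨_, hΓ.cochain_mem F 𝒰⟩,
        Quot.sound (hΓ.equivalent_ofSum h𝒰 (hC ⟨_, hΓ.cochain_mem F 𝒰⟩) (h _))⟩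
  refine ⟨(Equiv.ofBijective G hG).symm, fun Φ C' hC' h' hr' => ?_⟩
  refine (Equiv.symm_apply_eq _).2 ?_
  -- Uniqueness of the vertex algebra defined by `Φ` removes the dependence on the chosen models.
  obtain ⟨ψ, T, hT, hψ⟩ := exists_hasTriple_of_mem h𝒰 Φ.2
  have e1 := hT.eq_extension (hψ ▸ hC')
  have e2 := hT.eq_extension (hψ ▸ hC Φ)
  obtain rfl : C' = C Φ := e1.trans e2.symm
  rfl

end Equivalences

end

theorem mainTheorem2 {M : Type*} [TopologicalSpace M] [ChartedSpace ℂ M]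
    [IsManifold 𝓘(ℂ, ℂ) ω M] [Nonempty M]
    (F : CurveFoliation M) (𝒰 : Set (Set M)) (h𝒰 : F.IsTransversalBasis 𝒰)
    {V : Type u} [AddCommGroup V] [Module ℂ V] (A : GRVertexAlgebra V)
    {W : Type v} [AddCommGroup W] [Module ℂ W] (B : GRModule A W) :
    (∀ (X : SquareZeroExtension B) (Γ : V →ₗ[ℂ] X.E), X.IsRealization Γ →
      ∃! Φ : PreCochain B 2, Φ ∈ exCocycles F 𝒰 B ∧ X.IsInvariant Γ Φ) ∧
    (∀ Φ ∈ exCocycles F 𝒰 B, ∃ C : GRVertexAlgebra (V × W), IsExtensionOf Φ C ∧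
      ∃ h : IsSquareZeroExtension B C (LinearMap.fst ℂ V W) (LinearMap.inr ℂ V W),
        (SquareZeroExtension.ofSum C h).Realizable) ∧
    (∃ e : ExtensionClasses B ≃ ExCohomology F 𝒰 B,
      (∀ (X : SquareZeroExtension B) (Γ : V →ₗ[ℂ] X.E) (hΓ : X.IsRealization Γ)
        (Φ : exCocycles F 𝒰 B), X.IsInvariant Γ Φ.1 →
          e (Quot.mk _ ⟨X, Γ, hΓ⟩) = Quot.mk _ Φ) ∧
      (∀ (Φ : exCocycles F 𝒰 B) (C : GRVertexAlgebra (V × W)), IsExtensionOf Φ.1 C →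
        ∀ (h : IsSquareZeroExtension B C (LinearMap.fst ℂ V W) (LinearMap.inr ℂ V W))
          (hr : (SquareZeroExtension.ofSum C h).Realizable),
          e (Quot.mk _ ⟨SquareZeroExtension.ofSum C h, hr⟩) = Quot.mk _ Φ)) ∧
    (∀ Φ₁ ∈ exCocycles F 𝒰 B, ∀ Φ₂ ∈ exCocycles F 𝒰 B,
      ∀ C₁ C₂ : GRVertexAlgebra (V × W), IsExtensionOf Φ₁ C₁ → IsExtensionOf Φ₂ C₂ →
      ∀ (h₁ : IsSquareZeroExtension B C₁ (LinearMap.fst ℂ V W) (LinearMap.inr ℂ V W))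
        (h₂ : IsSquareZeroExtension B C₂ (LinearMap.fst ℂ V W) (LinearMap.inr ℂ V W)),
        Cohomologous F 𝒰 B Φ₁ Φ₂ ↔
          (SquareZeroExtension.ofSum C₁ h₁).Equivalent (SquareZeroExtension.ofSum C₂ h₂)) := by
  refine ⟨fun X Γ hΓ => ?_, fun Φ hΦ => exists_extension h𝒰 hΦ, ?_,
    fun Φ₁ h₁ Φ₂ h₂ C₁ C₂ hC₁ hC₂ => cohomologous_iff_equivalent h𝒰 h₁ h₂ hC₁ hC₂⟩
  · exact ⟨hΓ.psi.cochain, ⟨hΓ.cochain_mem F 𝒰, hΓ.isInvariant⟩,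
      fun Φ hΦ => hΓ.eq_cochain hΦ.1.1.1.1 hΦ.2⟩
  · obtain ⟨e, he⟩ := exists_extensionClasses_equiv (B := B) h𝒰
    refine ⟨e, fun X Γ hΓ Φ hΦ => ?_, he⟩
    obtain ⟨C, hC, h, hr⟩ := exists_extension h𝒰 Φ.2
    -- The bijection is known on models, so it suffices that the given extension is equivalent to
    -- the model of its invariant; that invariant equals the cochain of the realization.
    rw [← he Φ C hC h hr]
    refine congrArg e (Quot.sound (SquareZeroExtension.equivalence_equivalent.symm ?_))
    exact hΓ.equivalent_ofSum h𝒰 (hΓ.eq_cochain Φ.2.1.1.1 hΦ ▸ hC) h
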